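/- For a finite family $\mathcal H$ of finite digraphs, $\mathcal H$-SCC Deletion is the following decision problem: given a finite digraph $D$ and an integer $k\ge 0$, does there exist a set $S$ of at most $k$ vertices of $D$ such that no strong component of $D-S$ contains a graph of $\mathcal H$ as a (not necessarily induced) subgraph, up to isomorphism? Write $n=|V(D)|$ and $h=\max_{H\in\mathcal H}|V(H)|$. An arborescence with root $r$ is a rooted directed tree in which $r$ has in-degree $0$ and every other vertex has in-degree exactly $1$. Theorem. If $\mathcal H$ is a fixed finite family of digraphs each of which contains a spanning arborescence, then $\mathcal H$-SCC Deletion can be solved in time $2^{O(k^3\log k)}\cdot n^{O(h)}$. Precisely: there is an absolute constant $c$ such that for every finite family $\mathcal H$ of digraphs each containing a spanning arborescence there are a constant $B=B(\mathcal H)$ and a random-access machine program (with addition and truncated subtraction of natural numbers, tests, and indirect addressing at unit cost) which, given $k$ and the adjacency matrix of a digraph $D$ on $n$ vertices, halts after at most $B\cdot 2^{c\,k^3\log_2 k}\cdot \max(n,1)^{c\,h}$ steps and correctly decides whether $(D,k)$ is a yes-instance. (Here $k^3\log_2 k$ is read as $0$ for $k=0$, and $h$ as $0$ for the empty family.) 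-/

import Mathlib

/-! ### A random-access machine with step count

Programs of a random-access machine, written in structured form.  The machine has registers
`var 0, var 1, …` and memory blocks `arr 0, arr 1, …`, each an unbounded sequence of cells that
hold natural numbers; cells are addressed indirectly.  The only arithmetic operations are
addition and truncated subtraction, each at unit cost.  (There is no multiplication, so that in
`t` steps numbers grow by at most `t` bits, and the unit cost measure is polynomially
equivalent to the running time of Turing machines.) -/

namespace RAM

/-- The contents of the registers and of the memory blocks. -/
structure State where
  var : ℕ → ℕ
  arr : ℕ → ℕ → ℕ

/-- Expressions: constants, registers, indirect reads, addition, truncated subtraction. -/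
inductive Expr where
  | const (m : ℕ)
  | var (x : ℕ)
  | load (a : ℕ) (i : Expr)
  | add (e₁ e₂ : Expr)
  | sub (e₁ e₂ : Expr)

/-- The value of an expression. -/
def Expr.eval (s : State) : Expr → ℕ
  | .const m => m
  | .var x => s.var x
  | .load a i => s.arr a (i.eval s)
  | .add e₁ e₂ => e₁.eval s + e₂.eval s
  | .sub e₁ e₂ => e₁.eval s - e₂.eval s

/-- The number of steps needed to evaluate an expression: one for each operation. -/
def Expr.cost : Expr → ℕ
  | .const _ => 1
  | .var _ => 1
  | .load _ i => i.cost + 1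
  | .add e₁ e₂ => e₁.cost + e₂.cost + 1
  | .sub e₁ e₂ => e₁.cost + e₂.cost + 1

/-- Programs.  In tests, an expression counts as true if its value is not zero. -/
inductive Prog where
  | skip
  | assign (x : ℕ) (e : Expr)
  | store (a : ℕ) (i e : Expr)
  | seq (p q : Prog)
  | ite (e : Expr) (p q : Prog)
  | loop (e : Expr) (p : Prog)

/-- Write a value into a register. -/
def State.setVar (s : State) (x v : ℕ) : State where
  var := Function.update s.var x v
  arr := s.arr

/-- Write a value into a memory cell. -/
def State.setArr (s : State) (a i v : ℕ) : State where
  var := s.var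
  arr := Function.update s.arr a (Function.update (s.arr a) i v)

/-- `Exec p s s' t`: the program `p`, started in the state `s`, halts in the state `s'`
after exactly `t` steps. -/
inductive Exec : Prog → State → State → ℕ → Prop
  | skip (s : State) : Exec .skip s s 1
  | assign (s : State) (x : ℕ) (e : Expr) :
      Exec (.assign x e) s (s.setVar x (e.eval s)) (e.cost + 1)
  | store (s : State) (a : ℕ) (i e : Expr) :
      Exec (.store a i e) s (s.setArr a (i.eval s) (e.eval s)) (i.cost + e.cost + 1)
  | seq {p q : Prog} {s s' s'' : State} {t t' : ℕ} :
      Exec p s s' t → Exec q s' s'' t' → Exec (.seq p q) s s'' (t + t')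
  | iteTrue {e : Expr} {p q : Prog} {s s' : State} {t : ℕ} :
      e.eval s ≠ 0 → Exec p s s' t → Exec (.ite e p q) s s' (e.cost + 1 + t)
  | iteFalse {e : Expr} {p q : Prog} {s s' : State} {t : ℕ} :
      e.eval s = 0 → Exec q s s' t → Exec (.ite e p q) s s' (e.cost + 1 + t)
  | loopEnd {e : Expr} {p : Prog} {s : State} :
      e.eval s = 0 → Exec (.loop e p) s s (e.cost + 1)
  | loopStep {e : Expr} {p : Prog} {s s' s'' : State} {t t' : ℕ} :
      e.eval s ≠ 0 → Exec p s s' t → Exec (.loop e p) s' s'' t' →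
        Exec (.loop e p) s s'' (e.cost + 1 + t + t')

end RAM

/-! ### Strong components, arborescences and the deletion problem -/

namespace SCCDeletion

/-- There is a directed path (possibly of length zero) from `u` to `v` in `D`. -/
def Reach {V : Type} (D : Digraph V) (u v : V) : Prop :=
  Relation.ReflTransGen D.Adj u v

/-- A strong component: a maximal set of vertices any two of which are joined by directed
paths in both directions. -/
def IsStrongComponent {V : Type} (D : Digraph V) (C : Set V) : Prop :=
  Maximal (fun C : Set V => ∀ u ∈ C, ∀ v ∈ C, Reach D u v ∧ Reach D v u) C

/-- The subdigraph of `D` induced by the set `X`. -/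
def induced {V : Type} (D : Digraph V) (X : Set V) : Digraph X where
  Adj u v := D.Adj u v

/-- `D` contains `H` as a (not necessarily induced) subgraph, up to isomorphism. -/
def ContainsSubgraph {V W : Type} (D : Digraph V) (H : Digraph W) : Prop :=
  ∃ f : W → V, Function.Injective f ∧ ∀ i j, H.Adj i j → D.Adj (f i) (f j)

/-- `T` is an arborescence with root `r` that spans the whole vertex set: the root has
in-degree zero, every other vertex has in-degree one, and every vertex is reached from the
root. -/
def IsArborescence {V : Type} (T : Digraph V) (r : V) : Prop :=
  (∀ u, ¬ T.Adj u r) ∧ (∀ v, v ≠ r → ∃! u, T.Adj u v) ∧ ∀ v, Reach T r v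

/-- `H` contains a spanning arborescence. -/
def IsRooted {V : Type} (H : Digraph V) : Prop :=
  ∃ (T : Digraph V) (r : V), T ≤ H ∧ IsArborescence T r

/-- Finite digraphs, with vertices numbered from zero. -/
abbrev FinDigraph : Type := Σ m : ℕ, Digraph (Fin m)

/-- The maximal number of vertices of a graph in the family. -/
def maxOrder (F : Finset FinDigraph) : ℕ := F.sup fun H => H.1

/-- No strong component of `D - S` contains a graph of the family as a subgraph. -/
def IsDeletionSet {V : Type} (F : Finset FinDigraph) (D : Digraph V) (S : Finset V) : Prop :=
  ∀ C : Set ((↑S : Set V)ᶜ : Set V), IsStrongComponent (induced D (↑S : Set V)ᶜ) C →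
    ∀ H ∈ F, ¬ ContainsSubgraph (induced (induced D (↑S : Set V)ᶜ) C) H.2

/-- `(D, k)` is a yes-instance: there is a deletion set of at most `k` vertices. -/
def IsYes {V : Type} (F : Finset FinDigraph) (D : Digraph V) (k : ℕ) : Prop :=
  ∃ S : Finset V, S.card ≤ k ∧ IsDeletionSet F D S

open Classical in
/-- The initial state on the input `(D, k)`: the number `n` of vertices in register `0`, the
number `k` in register `1`, the adjacency matrix, row by row, in memory block `0`, and zeros
everywhere else. -/
noncomputable def input {n : ℕ} (D : Digraph (Fin n)) (k : ℕ) : RAM.State where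
  var x := if x = 0 then n else if x = 1 then k else 0
  arr a p :=
    if a = 0 ∧ ∃ u v : Fin n, p = (u : ℕ) * n + v ∧ D.Adj u v then 1 else 0

end SCCDeletion

/-!
The algorithm is iterative compression combined with a search whose choices are guessed.

*Patterns.*  A copy of a graph `H` of the family is treated as a pattern: the root of a spanning
arborescence of `H` together with the vertex set of the copy.  Since the root reaches the whole
copy inside the copy, the copy lies in one strong component of the digraph induced by `G` if and
only if each of its vertices reaches the root in `G` (`RootedPatterns`, `Bad`).  So to destroy a
copy means to cut one of its vertices off from the root, and this is what makes cuts the right tool.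

*Compression.*  The vertices are added one at a time.  A solution for the preceding vertices
together with the new vertex is a set `W` of at most `k + 1` vertices whose deletion leaves no
pattern in a strong component.  A solution of the whole digraph restricts to every prefix
(`IsSolution.inter_range`), so if some prefix has none, the answer is no (`prefixBody_spec`).

*The search.*  Let `S` be a solution and let some bad pattern be left in the digraph on `G`.  If `S`
meets `W`, guess a vertex of the intersection and delete it.  Otherwise the strong component of the
pattern meets `W`; among the vertices of `W` in it let `w` be one that reaches as little as possible
by arcs inside strong components that avoid `S`, and let `D` be what it reaches.  There are two
cases (`Implements.exists_delete`).

If `D` contains no root of a bad pattern, then `D` may be enlarged to a maximal set `Z` that avoids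
the roots and whose boundary is no larger, and every boundary vertex of `Z` lies in a solution no
larger than `S` (`exists_important`; this is the exchange argument for important separators).  By
submodularity, the minimum cut of maximal source side between `w` and the roots either meets the
boundary of `Z` or lies inside `Z`; in the second case it becomes the new set of sources, and the
size of the minimum cut grows.  So after at most `k + 1` moves a boundary vertex of `Z` is deleted
(`Implements.chase`).

If `D` contains a root, only the part of the minimum cut that lies in `D` is kept as the new set of
sources.  This improves the size of the cut relative to the number of the vertices of `S` that are
still present, so that after at most `k + 1` moves the flow exceeds that number and one of its ends
lies in `D` (`Implements.find_root`).  This end is the root of a bad pattern.  Either the pattern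
meets `S`, and a common vertex is deleted, or the pattern avoids `S` and hence all of it is reached
from `w`.  Then some vertex `u` of the pattern reaches no vertex of `W` outside of `S`: otherwise
each vertex of the pattern would reach such a vertex, which by the choice of `w` reaches `w` in turn
and thereby the root, and the pattern would survive the deletion of `S`.  Now the argument of the
first case applies to `u` and `W`.

Each deletion takes at most `2 * k + 4` moves, so at most `k * (2 * k + 4)` moves lead to a solution
(`Implements.exists_good`).

*Guessing.*  A move chooses among at most `k + 1` vertices, or among the vertices of a copy with a
given root, or among the subsets of a cut of at most `k` vertices.  It is coded by `k + 4` digits in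
base `k + h + 5`.  The program enumerates all tapes of `(k + 1) * (2 * k + 6)` such commands and
verifies every outcome (`check_spec`).  Hence soundness is clear, and the argument above is needed
only for completeness (`exists_tape`).  There are `(k + h + 5) ^ O(k ^ 3)` tapes, which is
`k ^ O(k ^ 3)` up to a factor that depends only on `h`, since the cases `k ≤ h + 1` contribute a
constant (`tapes_le`).

*The machine.*  The algorithm is written in a language with bounded loops (`LProg`), whose meaning
is a function on states.  If a program does not change its loop bounds, the machine halts in the
state that this function gives, within a number of steps that can be read off the nesting of the
loops (`LProg.WF.exec`, `LProg.timeBound_le`).  Minimum cuts come from `k + 1` augmentations of a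
flow in the digraph in which every vertex is split into two nodes (`isFlowOutput_of_isFlow`,
`flow_spec`), and copies from trying all maps of the at most `h` vertices (`copies_spec`).  So one
run along a tape takes a number of steps polynomial in `n` with exponent `O(h)`.
-/

namespace SCCDeletion

open Relation

variable {V : Type}

/-! ### Bad copies in an induced subdigraph -/

/-- There is a directed path from `u` to `v` all of whose arcs have both ends in `G`. -/
def Conn (adj : V → V → Prop) (G : Finset V) (u v : V) : Prop :=
  ReflTransGen (fun x y => adj x y ∧ x ∈ G ∧ y ∈ G) u v

/-- A family of patterns, each a root together with a vertex set, is rooted if in every pattern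
the root reaches all vertices inside the pattern. -/
def RootedPatterns (adj : V → V → Prop) (𝓒 : Set (V × Finset V)) : Prop :=
  ∀ p ∈ 𝓒, p.1 ∈ p.2 ∧ ∀ u ∈ p.2, Conn adj p.2 p.1 u

/-- The pattern `p` lies in `G` and all its vertices reach the root within `G`.  For rooted
patterns this says that `p` lies in one strong component of the digraph induced by `G`. -/
def Bad (adj : V → V → Prop) (G : Finset V) (p : V × Finset V) : Prop :=
  p.2 ⊆ G ∧ ∀ u ∈ p.2, Conn adj G u p.1

/-- No pattern lies in a strong component of the digraph induced by `G`. -/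
def Good (adj : V → V → Prop) (𝓒 : Set (V × Finset V)) (G : Finset V) : Prop :=
  ∀ p ∈ 𝓒, ¬ Bad adj G p

open Classical in
/-- The roots of the patterns that lie in strong components of the digraph induced by `G`. -/
noncomputable def roots (adj : V → V → Prop) (𝓒 : Set (V × Finset V)) (G : Finset V) :
    Finset V :=
  G.filter fun b => ∃ U, (b, U) ∈ 𝓒 ∧ Bad adj G (b, U)

/-- The arcs of the digraph induced by `G` that lie inside a strong component. -/
def SccArc (adj : V → V → Prop) (G : Finset V) (u v : V) : Prop :=
  adj u v ∧ u ∈ G ∧ v ∈ G ∧ Conn adj G v u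

open Classical in
/-- The out-neighbours of the set `Y` in the set `X`. -/
noncomputable def nb (E : V → V → Prop) (X Y : Finset V) : Finset V :=
  X.filter fun v => v ∉ Y ∧ ∃ u ∈ Y, E u v

theorem mem_nb {E : V → V → Prop} {X Y : Finset V} {v : V} :
    v ∈ nb E X Y ↔ v ∈ X ∧ v ∉ Y ∧ ∃ u ∈ Y, E u v := by
  classical
  simp [nb]

theorem mem_roots {adj : V → V → Prop} {𝓒 : Set (V × Finset V)} {G : Finset V} {b : V} :
    b ∈ roots adj 𝓒 G ↔ b ∈ G ∧ ∃ U, (b, U) ∈ 𝓒 ∧ Bad adj G (b, U) := by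
  classical
  simp [roots]

section

variable {adj : V → V → Prop} {𝓒 : Set (V × Finset V)}

theorem Conn.mono {G H : Finset V} (h : G ⊆ H) {u v : V} (huv : Conn adj G u v) :
    Conn adj H u v :=
  Relation.ReflTransGen.mono (fun _ _ hxy => ⟨hxy.1, h hxy.2.1, h hxy.2.2⟩) u v huv

/-- A path between two vertices of a strong component stays inside that component. -/
theorem Conn.restrict {H H' : Finset V} {u v : V} (huv : Conn adj H u v) (hvu : Conn adj H v u)
    (hJ : ∀ z ∈ H, Conn adj H u z → Conn adj H z u → z ∈ H') : Conn adj H' u v := by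
  induction huv with
  | refl => exact .refl
  | @tail y z huy hyz ih =>
    have hyu : Conn adj H y u := .head hyz hvu
    exact .tail (ih hyu) ⟨hyz.1, hJ y hyz.2.1 huy hyu,
      hJ z hyz.2.2 (.tail huy hyz) hvu⟩

/-- A set that is closed under the arcs inside strong components contains, together with a
vertex, the whole strong component of that vertex. -/
theorem Conn.mem_of_closed {G H R : Finset V} (hHG : H ⊆ G) {u v : V} (huv : Conn adj H u v)
    (hvu : Conn adj H v u) (hR : ∀ x ∈ R, ∀ y ∈ H, SccArc adj G x y → y ∈ R) (hu : u ∈ R) :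
    v ∈ R := by
  induction huv with
  | refl => exact hu
  | @tail y z huy hyz ih =>
    have hyu : Conn adj H y u := .head hyz hvu
    exact hR y (ih hyu) z hyz.2.2 ⟨hyz.1, hHG hyz.2.1, hHG hyz.2.2,
      Conn.mono hHG (ReflTransGen.trans hvu huy)⟩

theorem Bad.conn_root (hroot : RootedPatterns adj 𝓒) {G : Finset V} {p : V × Finset V}
    (hp : p ∈ 𝓒) (hb : Bad adj G p) {u : V} (hu : u ∈ p.2) : Conn adj G p.1 u :=
  Conn.mono hb.1 ((hroot p hp).2 u hu)

theorem good_iff_roots_eq_empty (hroot : RootedPatterns adj 𝓒) (G : Finset V) :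
    Good adj 𝓒 G ↔ roots adj 𝓒 G = ∅ := by
  constructor
  · intro h
    refine Finset.eq_empty_of_forall_notMem fun b hb => ?_
    obtain ⟨-, U, hU, hbad⟩ := mem_roots.1 hb
    exact h _ hU hbad
  · intro h p hp hb
    have : p.1 ∈ roots adj 𝓒 G := mem_roots.2 ⟨hb.1 (hroot p hp).1, p.2, hp, hb⟩
    simp [h] at this

theorem Good.mono {G H : Finset V} (h : H ⊆ G) (hG : Good adj 𝓒 G) : Good adj 𝓒 H :=
  fun p hp hb => hG p hp ⟨hb.1.trans h, fun u hu => Conn.mono h (hb.2 u hu)⟩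

variable [DecidableEq V]

/-- If every pattern in `G \ T` is harmless, the strong component of a bad pattern meets `T`. -/
theorem Bad.exists_mem (hroot : RootedPatterns adj 𝓒) {G T : Finset V}
    (hT : Good adj 𝓒 (G \ T)) {p : V × Finset V} (hp : p ∈ 𝓒) (hb : Bad adj G p) :
    ∃ t ∈ T, t ∈ G ∧ Conn adj G p.1 t ∧ Conn adj G t p.1 := by
  by_contra! hcon
  refine hT p hp ⟨fun u hu => ?_, fun u hu => ?_⟩
  · exact Finset.mem_sdiff.2 ⟨hb.1 hu, fun hut =>
      hcon u hut (hb.1 hu) (hb.conn_root hroot hp hu) (hb.2 u hu)⟩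
  · refine Conn.restrict (hb.2 u hu) (hb.conn_root hroot hp hu) fun z hz huz hzu => ?_
    exact Finset.mem_sdiff.2 ⟨hz, fun hzt => hcon z hzt hz
      ((hb.conn_root hroot hp hu).trans huz) (hzu.trans (hb.2 u hu))⟩

theorem good_sdiff_roots (hroot : RootedPatterns adj 𝓒) (G : Finset V) :
    Good adj 𝓒 (G \ roots adj 𝓒 G) := by
  intro p hp hb
  have hmem := hb.1 (hroot p hp).1
  rw [Finset.mem_sdiff, mem_roots] at hmem
  refine hmem.2 ⟨hmem.1, p.2, hp, ?_⟩
  exact ⟨hb.1.trans Finset.sdiff_subset, fun u hu => Conn.mono Finset.sdiff_subset (hb.2 u hu)⟩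

/-! ### Neighbourhoods and important separators -/

theorem nb_union_inter (E : V → V → Prop) (X Y Z : Finset V) :
    (nb E X (Y ∪ Z)).card + (nb E X (Y ∩ Z)).card ≤ (nb E X Y).card + (nb E X Z).card := by
  rw [← Finset.card_union_add_card_inter, ← Finset.card_union_add_card_inter (nb E X Y)]
  refine add_le_add (Finset.card_le_card fun v => ?_) (Finset.card_le_card fun v => ?_)
  · simp only [Finset.mem_union, Finset.mem_inter, mem_nb]
    grind
  · simp only [Finset.mem_union, Finset.mem_inter, mem_nb]
    grind

/-- The part of a solution `S` that bounds a set `R` avoiding `T` may be replaced by the boundary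
of a maximal set `R'` with the same properties: a bad pattern of `G` that survives the exchange
lies in a strong component inside `R'`, where it would avoid `T`, or disjoint from `R'`, where
it would avoid `S`. -/
theorem exists_important (hroot : RootedPatterns adj 𝓒) {G S R T : Finset V}
    (hT : Good adj 𝓒 (G \ T)) (hSG : S ⊆ G) (hS : Good adj 𝓒 (G \ S)) (hRG : R ⊆ G)
    (hRS : nb (SccArc adj G) G R ⊆ S) (hRT : Disjoint R T) :
    ∃ R', R ⊆ R' ∧ R' ⊆ G ∧ Disjoint R' T ∧
      (nb (SccArc adj G) G R').card ≤ (nb (SccArc adj G) G R).card ∧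
      (∀ Y, R' ⊆ Y → Y ⊆ G → Disjoint Y T →
        (nb (SccArc adj G) G Y).card ≤ (nb (SccArc adj G) G R').card → Y ⊆ R') ∧
      ∀ x ∈ nb (SccArc adj G) G R',
        ∃ S', S' ⊆ G.erase x ∧ S'.card + 1 ≤ S.card ∧ Good adj 𝓒 (G.erase x \ S') := by
  classical
  set E := SccArc adj G with hE
  obtain ⟨R', hle, hmax⟩ := (G.powerset.filter fun Y => R ⊆ Y ∧ Disjoint Y T ∧
    (nb E G Y).card ≤ (nb E G R).card).exists_le_maximal (a := R) (by simp [hRG, hRT])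
  have hR' := hmax.prop
  simp only [Finset.mem_filter, Finset.mem_powerset] at hR'
  obtain ⟨hR'G, hRR', hR'T, hcard⟩ := hR'
  refine ⟨R', hRR', hR'G, hR'T, hcard, fun Y hY hYG hYT hYc => ?_, fun x hx => ?_⟩
  · refine hmax.2 ?_ hY
    simp only [Finset.mem_filter, Finset.mem_powerset]
    exact ⟨hYG, hRR'.trans hY, hYT, hYc.trans hcard⟩
  set S'' := (S \ nb E G R) ∪ nb E G R' with hS''
  have hxS : x ∈ S'' := Finset.mem_union_right _ hx
  have hS''G : S'' ⊆ G := by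
    refine Finset.union_subset (Finset.sdiff_subset.trans hSG) fun v hv => (mem_nb.1 hv).1
  have hc : S''.card ≤ S.card := by
    have h1 := Finset.card_union_le (S \ nb E G R) (nb E G R')
    rw [← hS''] at h1
    have h2 := Finset.card_sdiff_add_card_eq_card hRS
    omega
  refine ⟨S''.erase x, Finset.erase_subset_erase _ hS''G, ?_, ?_⟩
  · rw [Finset.card_erase_add_one hxS]; exact hc
  have hEq : G.erase x \ S''.erase x = G \ S'' := by
    ext v
    simp only [Finset.mem_sdiff, Finset.mem_erase]
    grind
  rw [hEq]
  intro p hp hb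
  have hclosed : ∀ x ∈ R', ∀ y ∈ G \ S'', SccArc adj G x y → y ∈ R' := by
    intro x hx y hy hxy
    by_contra hyR
    refine (Finset.mem_sdiff.1 hy).2 (Finset.mem_union_right _ (mem_nb.2 ⟨?_, hyR, x, hx, hxy⟩))
    exact (Finset.mem_sdiff.1 hy).1
  have hto : ∀ u ∈ p.2, Conn adj (G \ S'') p.1 u := fun u hu => hb.conn_root hroot hp hu
  -- the strong component of the pattern lies in `R'` as soon as it meets `R'`
  by_cases hJ : ∃ v ∈ R', Conn adj (G \ S'') v p.1 ∧ Conn adj (G \ S'') p.1 v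
  · obtain ⟨v, hv, hvp, hpv⟩ := hJ
    have hp1 : p.1 ∈ R' := Conn.mem_of_closed Finset.sdiff_subset hvp hpv hclosed hv
    have hall : ∀ z, Conn adj (G \ S'') p.1 z → Conn adj (G \ S'') z p.1 → z ∈ G \ T := by
      intro z h1 h2
      have hz := Conn.mem_of_closed Finset.sdiff_subset h1 h2 hclosed hp1
      exact Finset.mem_sdiff.2 ⟨hR'G hz, Finset.disjoint_left.1 hR'T hz⟩
    refine hT p hp ⟨fun u hu => hall u (hto u hu) (hb.2 u hu), fun u hu => ?_⟩
    exact Conn.restrict (hb.2 u hu) (hto u hu) fun z _ h1 h2 =>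
      hall z ((hto u hu).trans h1) (h2.trans (hb.2 u hu))
  · push Not at hJ
    have hall : ∀ z ∈ G \ S'', Conn adj (G \ S'') p.1 z → Conn adj (G \ S'') z p.1 →
        z ∈ G \ S := by
      intro z hz h1 h2
      have hzR : z ∉ R' := fun h => hJ z h h2 h1
      obtain ⟨hzG, hzS⟩ := Finset.mem_sdiff.1 hz
      refine Finset.mem_sdiff.2 ⟨hzG, fun hzS' => hzS ?_⟩
      by_cases hzn : z ∈ nb E G R
      · obtain ⟨-, -, u, hu, huz⟩ := mem_nb.1 hzn
        exact Finset.mem_union_right _ (mem_nb.2 ⟨hzG, hzR, u, hRR' hu, huz⟩)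
      · exact Finset.mem_union_left _ (Finset.mem_sdiff.2 ⟨hzS', hzn⟩)
    refine hS p hp ⟨fun u hu => hall u (hb.1 hu) (hto u hu) (hb.2 u hu), fun u hu => ?_⟩
    exact Conn.restrict (hb.2 u hu) (hto u hu) fun z hz h1 h2 =>
      hall z hz ((hto u hu).trans h1) (h2.trans (hb.2 u hu))

/-! ### Minimum cuts of maximal source side -/

/-- `Y` is a set with `A ⊆ Y ⊆ X` that avoids `T`; its boundary separates `A` from `T`. -/
def IsCut (X A T Y : Finset V) : Prop := A ⊆ Y ∧ Y ⊆ X ∧ Disjoint Y T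

/-- What a computation of a maximum flow from `A` to `T`, cut off at the value `k + 1`, gives:
its value `val`, the set `P` of the vertices of `T` where it ends, and, unless the flow has the
value `k + 1`, the maximal source side `Y` of a minimum vertex cut and the cut `C` itself. -/
structure IsFlowOutput (E : V → V → Prop) (X A T : Finset V) (k : ℕ) (C Y P : Finset V)
    (val : ℕ) : Prop where
  ends_subset : P ⊆ T ∩ X
  card_ends : P.card ≤ k + 1
  val_le : ∀ Z, IsCut X A P Z → val ≤ (nb E X Z).card
  cut : val ≤ k → IsCut X A T Y ∧ C = nb E X Y ∧ C.card = val
  maximal : val ≤ k → ∀ Z, IsCut X A T Z → (nb E X Z).card ≤ val → Z ⊆ Y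

theorem IsFlowOutput.val_le_of_isCut {E : V → V → Prop} {X A T C Y P : Finset V} {k val : ℕ}
    (h : IsFlowOutput E X A T k C Y P val) {Z : Finset V} (hZ : IsCut X A T Z) :
    val ≤ (nb E X Z).card :=
  h.val_le Z ⟨hZ.1, hZ.2.1, Finset.disjoint_of_subset_right
    (h.ends_subset.trans Finset.inter_subset_left) hZ.2.2⟩

/-- A cut beyond the cut `nb E X Y`, together with `Y`, is a cut again. -/
theorem nb_union_subset {E : V → V → Prop} {X Y Z C' : Finset V} (hC' : C' ⊆ Z) :
    nb E X (Z ∪ Y) ⊆ (nb E X Y \ C') ∪ nb E ((X \ Y) \ (nb E X Y \ C')) Z := by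
  intro v hv
  simp only [mem_nb, Finset.mem_union, Finset.mem_sdiff] at hv ⊢
  grind

theorem isCut_union {E : V → V → Prop} {X A T Y Z C' : Finset V} (hY : IsCut X A T Y)
    (hZ : IsCut ((X \ Y) \ (nb E X Y \ C')) C' T Z) : IsCut X A T (Z ∪ Y) :=
  ⟨hY.1.trans Finset.subset_union_right, Finset.union_subset
    (hZ.2.1.trans (Finset.sdiff_subset.trans Finset.sdiff_subset)) hY.2.1,
    Finset.disjoint_union_left.2 ⟨hZ.2.2, hY.2.2⟩⟩

/-- Beyond a minimum cut of maximal source side, a nonempty part `C'` of the cut is separated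
from `T` only by more than `|C'|` vertices. -/
theorem IsFlowOutput.card_lt {E : V → V → Prop} {X A T C Y P : Finset V} {k val : ℕ}
    (h : IsFlowOutput E X A T k C Y P val) (hk : val ≤ k) {C' Z : Finset V} (hC' : C' ⊆ C)
    (hne : C'.Nonempty) (hZ : IsCut ((X \ Y) \ (C \ C')) C' T Z) :
    C'.card + 1 ≤ (nb E ((X \ Y) \ (C \ C')) Z).card := by
  obtain ⟨hY, rfl, hval⟩ := h.cut hk
  have hU := isCut_union hY hZ
  have hnot : ¬ (nb E X (Z ∪ Y)).card ≤ val := by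
    intro hle
    obtain ⟨c, hc⟩ := hne
    exact (mem_nb.1 (hC' hc)).2.1 (h.maximal hk _ hU hle (Finset.mem_union_left _ (hZ.1 hc)))
  have h1 := (Finset.card_le_card (nb_union_subset (E := E) (X := X) (Y := Y) hZ.1)).trans
    (Finset.card_union_le _ _)
  have h2 := Finset.card_sdiff_add_card_eq_card hC'
  omega

/-! ### The moves of the search -/

/-- The state of the search: the vertices `G` not yet deleted, and the sources `A`, the vertex
set `X` and the targets `T` of the cuts that are searched for. -/
structure CutState (V : Type) where
  G : Finset V
  A : Finset V
  X : Finset V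
  T : Finset V

/-- From `σ`, some state with the property `Q` can be reached in at most `m` moves. -/
def Within {St : Type} (R : St → St → Prop) : ℕ → St → (St → Prop) → Prop
  | 0, σ, Q => Q σ
  | m + 1, σ, Q => Q σ ∨ ∃ σ', R σ σ' ∧ Within R m σ' Q

theorem Within.of_self {St : Type} {R : St → St → Prop} {m : ℕ} {σ : St} {Q : St → Prop}
    (h : Q σ) : Within R m σ Q := by
  cases m with
  | zero => exact h
  | succ m => exact .inl h

theorem Within.step {St : Type} {R : St → St → Prop} {m : ℕ} {σ σ' : St} {Q : St → Prop}
    (h : R σ σ') (h' : Within R m σ' Q) : Within R (m + 1) σ Q := .inr ⟨σ', h, h'⟩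

theorem Within.succ {St : Type} {R : St → St → Prop} {m : ℕ} {σ : St} {Q : St → Prop}
    (h : Within R m σ Q) : Within R (m + 1) σ Q := by
  induction m generalizing σ with
  | zero => exact .inl h
  | succ m ih =>
    rcases h with h | ⟨σ', h1, h2⟩
    · exact .inl h
    · exact .inr ⟨σ', h1, ih h2⟩

theorem Within.mono {St : Type} {R : St → St → Prop} {m m' : ℕ} {σ : St} {Q : St → Prop}
    (h : Within R m σ Q) (hm : m ≤ m') : Within R m' σ Q := by
  induction m', hm using Nat.le_induction with
  | base => exact h
  | succ m' _ ih => exact ih.succ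

theorem Within.bind {St : Type} {R : St → St → Prop} {m m' : ℕ} {σ : St} {Q Q' : St → Prop}
    (h : Within R m σ Q) (h' : ∀ σ', Q σ' → Within R m' σ' Q') : Within R (m + m') σ Q' := by
  induction m generalizing σ with
  | zero => exact (h' σ h).mono (by omega)
  | succ m ih =>
    rcases h with h | ⟨σ', hR, h⟩
    · exact (h' σ h).mono (by omega)
    · rw [Nat.add_right_comm]
      exact .inr ⟨σ', hR, ih h⟩

/-- What the search offers in the state `σ`: the data `C`, `Y`, `P`, `val` of a flow, a bad
pattern `U b` for each root `b`, and the moves that delete a vertex or change the sources. -/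
structure MoveOptions (adj : V → V → Prop) (𝓒 : Set (V × Finset V)) (W : Finset V) (k : ℕ)
    {St : Type} (st : St → CutState V) (R : St → St → Prop) (σ : St) (C Y P : Finset V) (val : ℕ)
    (U : V → Finset V) : Prop where
  flow : (st σ).A ⊆ (st σ).X → (st σ).X ⊆ (st σ).G →
    IsFlowOutput (SccArc adj (st σ).G) (st σ).X (st σ).A (st σ).T k C Y P val
  pattern : ∀ b ∈ roots adj 𝓒 (st σ).G, (b, U b) ∈ 𝓒 ∧ Bad adj (st σ).G (b, U b)
  start : ∀ w ∈ W, w ∈ (st σ).G →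
    ∃ σ', R σ σ' ∧ st σ' = ⟨(st σ).G, {w}, (st σ).G, roots adj 𝓒 (st σ).G⟩
  deleteTarget : ∀ w ∈ W, w ∈ (st σ).G → ∃ σ', R σ σ' ∧ (st σ').G = (st σ).G.erase w
  deleteCut : C.card ≤ k → ∀ x ∈ C, ∃ σ', R σ σ' ∧ (st σ').G = (st σ).G.erase x
  shrink : C.card ≤ k → ∀ C' ⊆ C,
    ∃ σ', R σ σ' ∧ st σ' = ⟨(st σ).G, C', ((st σ).X \ Y) \ (C \ C'), (st σ).T⟩
  deletePattern : P.card ≤ k + 1 → ∀ b ∈ P, b ∈ roots adj 𝓒 (st σ).G → ∀ u ∈ U b,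
    ∃ σ', R σ σ' ∧ (st σ').G = (st σ).G.erase u
  startPattern : P.card ≤ k + 1 → ∀ b ∈ P, b ∈ roots adj 𝓒 (st σ).G → ∀ u ∈ U b,
    ∃ σ', R σ σ' ∧ st σ' = ⟨(st σ).G, {u}, (st σ).G, W⟩

/-- The search offers its moves in every state. -/
def Implements (adj : V → V → Prop) (𝓒 : Set (V × Finset V)) (W : Finset V) (k : ℕ)
    {St : Type} (st : St → CutState V) (R : St → St → Prop) : Prop :=
  ∀ σ, ∃ C Y P val U, MoveOptions adj 𝓒 W k st R σ C Y P val U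

variable {W : Finset V} {k : ℕ} {St : Type} {st : St → CutState V} {R : St → St → Prop}

/-- The boundary of a maximal set `Z` is met after few moves, since it meets the minimum cut of
maximal source side or lies beyond it, and the size of the minimum cut grows. -/
theorem Implements.chase (himp : Implements adj 𝓒 W k st R) {G T : Finset V} (m : ℕ) :
    ∀ (σ : St) (A X Z : Finset V) (j : ℕ), st σ = ⟨G, A, X, T⟩ → X ⊆ G → IsCut X A T Z →
      (∀ Y, Z ⊆ Y → Y ⊆ X → Disjoint Y T →
        (nb (SccArc adj G) X Y).card ≤ (nb (SccArc adj G) X Z).card → Y ⊆ Z) →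
      (nb (SccArc adj G) X Z).card ≤ k → 1 ≤ j →
      (∀ Y, IsCut X A T Y → j ≤ (nb (SccArc adj G) X Y).card) →
      (nb (SccArc adj G) X Z).card ≤ j + m →
      Within R (m + 1) σ fun σ' => ∃ x ∈ nb (SccArc adj G) X Z, (st σ').G = G.erase x := by
  set E := SccArc adj G with hE
  induction m using Nat.strong_induction_on with | _ m ih => ?_
  intro σ A X Z j hσ hXG hZ hmax hk hj hlow hm
  obtain ⟨C, Y, P, val, U, hopt⟩ := himp σ
  have hflow := hopt.flow
  have hdel := hopt.deleteCut
  have hshrink := hopt.shrink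
  rw [hσ] at hflow hdel hshrink
  have hflow : IsFlowOutput E X A T k C Y P val := hflow (hZ.1.trans hZ.2.1) hXG
  have hval : val ≤ k := (hflow.val_le_of_isCut hZ).trans hk
  obtain ⟨hY, hC, hCval⟩ := hflow.cut hval
  -- by submodularity, joining `Y` to `Z` does not enlarge the boundary of `Z`
  have hYZ : Y ⊆ Z := by
    refine Finset.subset_union_right.trans (hmax (Z ∪ Y) Finset.subset_union_left
      (Finset.union_subset hZ.2.1 hY.2.1) (Finset.disjoint_union_left.2 ⟨hZ.2.2, hY.2.2⟩) ?_)
    have h1 := nb_union_inter E X Z Y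
    have h2 := hflow.val_le_of_isCut (Z := Z ∩ Y) ⟨Finset.subset_inter hZ.1 hY.1,
      Finset.inter_subset_left.trans hZ.2.1,
      Finset.disjoint_of_subset_left Finset.inter_subset_left hZ.2.2⟩
    rw [← hC] at h1
    omega
  -- either the cut meets the boundary of `Z`, or it lies inside `Z` and becomes the set of sources
  by_cases hmeet : ∃ x ∈ C, x ∈ nb E X Z
  · obtain ⟨x, hxC, hxZ⟩ := hmeet
    obtain ⟨σ', hR, hσ'⟩ := hdel (hCval ▸ hval) x hxC
    exact .step hR (.of_self ⟨x, hxZ, hσ'⟩)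
  have hCZ : C ⊆ Z := by
    intro c hc
    by_contra hcZ
    rw [hC] at hc
    obtain ⟨hcX, -, u, hu, huc⟩ := mem_nb.1 hc
    exact hmeet ⟨c, hC ▸ hc, mem_nb.2 ⟨hcX, hcZ, u, hYZ hu, huc⟩⟩
  have hCX : C ⊆ X \ Y := by
    intro c hc
    rw [hC] at hc
    exact Finset.mem_sdiff.2 ⟨(mem_nb.1 hc).1, (mem_nb.1 hc).2.1⟩
  have hX' : (X \ Y) \ (C \ C) = X \ Y := by simp
  have hne : C.Nonempty := by
    rw [← Finset.card_pos, hC]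
    exact hj.trans (hlow Y hY)
  have hZ' : IsCut (X \ Y) C T (Z \ Y) :=
    ⟨fun c hc => Finset.mem_sdiff.2 ⟨hCZ hc, (Finset.mem_sdiff.1 (hCX hc)).2⟩,
      Finset.sdiff_subset_sdiff hZ.2.1 le_rfl,
      Finset.disjoint_of_subset_left Finset.sdiff_subset hZ.2.2⟩
  -- a boundary vertex of `Z` cannot be adjacent to `Y`, as it would belong to the cut `C ⊆ Z`
  have hnb : nb E (X \ Y) (Z \ Y) = nb E X Z := by
    ext v
    simp only [mem_nb, Finset.mem_sdiff]
    constructor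
    · rintro ⟨⟨h1, h2⟩, h3, u, ⟨h4, -⟩, h5⟩
      exact ⟨h1, fun h => h3 ⟨h, h2⟩, u, h4, h5⟩
    · rintro ⟨h1, h2, u, h3, h4⟩
      refine ⟨⟨h1, fun h => h2 (hYZ h)⟩, fun h => h2 h.1, u, ⟨h3, fun h => h2 (hCZ ?_)⟩, h4⟩
      rw [hC]
      exact mem_nb.2 ⟨h1, fun h' => h2 (hYZ h'), u, h, h4⟩
  have hlow' : ∀ Z', IsCut (X \ Y) C T Z' → j + 1 ≤ (nb E (X \ Y) Z').card := by
    intro Z' hZ'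
    have := hflow.card_lt hval subset_rfl hne (hX'.symm ▸ hZ')
    rw [hX'] at this
    have h1 := hlow Y hY
    rw [← hC] at h1
    omega
  obtain _ | m := m
  · have := hlow' _ hZ'
    rw [hnb] at this
    omega
  obtain ⟨σ', hR, hσ'⟩ := hshrink (hCval ▸ hval) C subset_rfl
  rw [hX'] at hσ'
  refine .step hR ?_
  rw [← hnb]
  refine ih m (Nat.lt_succ_self m) σ' C (X \ Y) (Z \ Y) (j + 1) hσ'
    (Finset.sdiff_subset.trans hXG) hZ' ?_
    (hnb ▸ hk) (by omega) hlow' (by rw [hnb]; omega)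
  intro Z' hle hZ'X hZ'T hcard
  have hsub : Z' ∪ Y ⊆ Z := by
    refine hmax _ ?_ (Finset.union_subset (hZ'X.trans Finset.sdiff_subset) hY.2.1)
      (Finset.disjoint_union_left.2 ⟨hZ'T, hY.2.2⟩) ?_
    · intro z hz
      by_cases hzY : z ∈ Y
      · exact Finset.mem_union_right _ hzY
      · exact Finset.mem_union_left _ (hle (Finset.mem_sdiff.2 ⟨hz, hzY⟩))
    · rw [← hnb]
      refine (Finset.card_le_card ?_).trans hcard
      have := nb_union_subset (E := E) (X := X) (Y := Y) (C' := C) (Z := Z')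
        (hZ'.1.trans hle)
      rwa [← hC, hX', Finset.sdiff_self, Finset.empty_union] at this
  exact fun z hz => Finset.mem_sdiff.2 ⟨hsub (Finset.mem_union_left _ hz),
    (Finset.mem_sdiff.1 (hZ'X hz)).2⟩

/-- If every set that contains the sources and is closed outside of `S` meets `T`, then after few
moves the flow ends in a vertex that is reached outside of `S`. Each move keeps the reached part
of the minimum cut of maximal source side, whereby the number of the vertices of `S` that are
still present decreases relative to the size of the minimum cut. -/
theorem Implements.find_root (himp : Implements adj 𝓒 W k st R) {G S T D : Finset V}
    (hSk : S.card ≤ k)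
    (hD : ∀ x ∈ D, ∀ y ∈ G, y ∉ S → SccArc adj G x y → y ∈ D) (m : ℕ) :
    ∀ (σ : St) (A X : Finset V), st σ = ⟨G, A, X, T⟩ → X ⊆ G → A ⊆ X → A ⊆ D →
      (∀ Z, A ⊆ Z → Z ⊆ X → (∀ x ∈ Z, ∀ y ∈ X, y ∉ S → SccArc adj G x y → y ∈ Z) →
        ∃ t ∈ T, t ∈ Z) →
      (∀ Z, IsCut X A T Z → (S ∩ X).card + 1 ≤ (nb (SccArc adj G) X Z).card + m) →
      Within R m σ fun σ' => (st σ').G = G ∧ ∃ C Y P val U,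
        MoveOptions adj 𝓒 W k st R σ' C Y P val U ∧ P ⊆ T ∧ P.card ≤ k + 1 ∧ ∃ b ∈ P, b ∈ D := by
  set E := SccArc adj G with hE
  induction m using Nat.strong_induction_on with | _ m ih => ?_
  intro σ A X hσ hXG hAX hAD hpath hmeas
  obtain ⟨C, Y, P, val, U, hopt⟩ := himp σ
  have hflow := hopt.flow
  have hshrink := hopt.shrink
  rw [hσ] at hflow hshrink
  have hflow : IsFlowOutput E X A T k C Y P val := hflow hAX hXG
  -- a flow that ends outside of `D` passes through the boundary of `D`, which is part of `S`; so a
  -- flow of value more than `|S ∩ X|` ends somewhere in `D`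
  by_cases hval : (S ∩ X).card < val
  · refine .of_self ⟨by rw [hσ], C, Y, P, val, U, hopt,
      hflow.ends_subset.trans Finset.inter_subset_left, hflow.card_ends, ?_⟩
    by_contra! hcon
    have h1 := hflow.val_le (D ∩ X) ⟨Finset.subset_inter hAD hAX, Finset.inter_subset_right,
      Finset.disjoint_left.2 fun b hb hbP => hcon b hbP (Finset.mem_inter.1 hb).1⟩
    have h2 : nb E X (D ∩ X) ⊆ S ∩ X := by
      intro v hv
      obtain ⟨hvX, hvD, u, hu, huv⟩ := mem_nb.1 hv
      refine Finset.mem_inter.2 ⟨?_, hvX⟩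
      by_contra hvS
      exact hvD (Finset.mem_inter.2 ⟨hD u (Finset.mem_inter.1 hu).1 v (hXG hvX) hvS huv, hvX⟩)
    have := Finset.card_le_card h2
    omega
  have hvalk : val ≤ k := by
    have := Finset.card_le_card (Finset.inter_subset_left (s₁ := S) (s₂ := X))
    omega
  obtain ⟨hY, hC, hCval⟩ := hflow.cut hvalk
  obtain _ | m := m
  · have := hmeas Y hY
    rw [← hC] at this
    omega
  -- otherwise pass to the part of the cut that is reached outside of `S`
  set C' := C ∩ D with hC'
  obtain ⟨σ', hR, hσ'⟩ := hshrink (hCval ▸ hvalk) C' Finset.inter_subset_left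
  simp only at hσ'
  set X' := (X \ Y) \ (C \ C') with hX'
  have hX'X : X' ⊆ X := Finset.sdiff_subset.trans Finset.sdiff_subset
  have hC'X : C' ⊆ X' := by
    intro c hc
    have hcC := (Finset.mem_inter.1 hc).1
    rw [hC] at hcC
    refine Finset.mem_sdiff.2 ⟨Finset.mem_sdiff.2 ⟨(mem_nb.1 hcC).1, (mem_nb.1 hcC).2.1⟩,
      fun h => (Finset.mem_sdiff.1 h).2 hc⟩
  have hpath' : ∀ Z, C' ⊆ Z → Z ⊆ X' → (∀ x ∈ Z, ∀ y ∈ X', y ∉ S → E x y → y ∈ Z) →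
      ∃ t ∈ T, t ∈ Z := by
    intro Z hCZ hZX hZ
    have hcl : ∀ x ∈ (Y ∩ D) ∪ (Z ∩ D), ∀ y ∈ X, y ∉ S → E x y → y ∈ (Y ∩ D) ∪ (Z ∩ D) := by
      intro x hx y hyX hyS hxy
      have hxD : x ∈ D := by
        rcases Finset.mem_union.1 hx with h | h <;> exact (Finset.mem_inter.1 h).2
      have hyD := hD x hxD y (hXG hyX) hyS hxy
      by_cases hyY : y ∈ Y
      · exact Finset.mem_union_left _ (Finset.mem_inter.2 ⟨hyY, hyD⟩)
      refine Finset.mem_union_right _ (Finset.mem_inter.2 ⟨?_, hyD⟩)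
      rcases Finset.mem_union.1 hx with h | h
      · refine hCZ (Finset.mem_inter.2 ⟨?_, hyD⟩)
        rw [hC]
        exact mem_nb.2 ⟨hyX, hyY, x, (Finset.mem_inter.1 h).1, hxy⟩
      · refine hZ x (Finset.mem_inter.1 h).1 y (Finset.mem_sdiff.2
          ⟨Finset.mem_sdiff.2 ⟨hyX, hyY⟩, fun h' => ?_⟩) hyS hxy
        exact (Finset.mem_sdiff.1 h').2 (Finset.mem_inter.2 ⟨(Finset.mem_sdiff.1 h').1, hyD⟩)
    obtain ⟨t, htT, ht⟩ := hpath ((Y ∩ D) ∪ (Z ∩ D))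
      (fun a ha => Finset.mem_union_left _ (Finset.mem_inter.2 ⟨hY.1 ha, hAD ha⟩))
      (Finset.union_subset (Finset.inter_subset_left.trans hY.2.1)
        (Finset.inter_subset_left.trans (hZX.trans hX'X))) hcl
    refine ⟨t, htT, ?_⟩
    rcases Finset.mem_union.1 ht with h | h
    · exact absurd htT (Finset.disjoint_left.1 hY.2.2 (Finset.mem_inter.1 h).1)
    · exact (Finset.mem_inter.1 h).1
  have hne : C'.Nonempty := by
    by_contra hne
    rw [Finset.not_nonempty_iff_eq_empty] at hne
    obtain ⟨t, -, ht⟩ := hpath' ∅ (by rw [hne]) (Finset.empty_subset _) (by simp)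
    simp at ht
  refine .step hR (ih m (Nat.lt_succ_self m) σ' C' X' hσ' (hX'X.trans hXG) hC'X
    Finset.inter_subset_right hpath' fun Z hZ => ?_)
  have h1 := hflow.card_lt hvalk Finset.inter_subset_left hne hZ
  -- at least `|C \ C'|` vertices of `S` lie in `Y ∪ (C \ C')`
  have h2 := hflow.val_le_of_isCut (Z := D ∩ Y) ⟨Finset.subset_inter hAD hY.1,
    Finset.inter_subset_right.trans hY.2.1,
    Finset.disjoint_of_subset_left Finset.inter_subset_right hY.2.2⟩
  have h3 : nb E X (D ∩ Y) ⊆ ((S ∩ X) \ (S ∩ X')) ∪ C' := by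
    intro v hv
    obtain ⟨hvX, hvDY, u, hu, huv⟩ := mem_nb.1 hv
    obtain ⟨huD, huY⟩ := Finset.mem_inter.1 hu
    by_cases hvD : v ∈ D
    · refine Finset.mem_union_right _ (Finset.mem_inter.2 ⟨?_, hvD⟩)
      rw [hC]
      exact mem_nb.2 ⟨hvX, fun h => hvDY (Finset.mem_inter.2 ⟨hvD, h⟩), u, huY, huv⟩
    · have hvS : v ∈ S := by
        by_contra hvS
        exact hvD (hD u huD v (hXG hvX) hvS huv)
      refine Finset.mem_union_left _ (Finset.mem_sdiff.2 ⟨Finset.mem_inter.2 ⟨hvS, hvX⟩,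
        fun h => ?_⟩)
      obtain ⟨h4, h5⟩ := Finset.mem_sdiff.1 (Finset.mem_inter.1 h).2
      refine h5 (Finset.mem_sdiff.2 ⟨?_, fun h => hvD (Finset.mem_inter.1 h).2⟩)
      rw [hC]
      exact mem_nb.2 ⟨hvX, (Finset.mem_sdiff.1 h4).2, u, huY, huv⟩
  have h4 := (Finset.card_le_card h3).trans (Finset.card_union_le _ _)
  have h5 := Finset.card_sdiff_add_card_eq_card
    (Finset.inter_subset_inter (le_refl S) hX'X)
  have h6 := hmeas Y hY
  rw [← hC] at h6
  have h7 : C'.card + 1 ≤ (nb E X' Z).card := h1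
  have h8 := Finset.card_sdiff_add_card_eq_card (Finset.inter_subset_left : C' ⊆ C)
  omega

/-- If `S` is a solution, then few moves lead to the deletion of a vertex after which a solution
of smaller size remains. -/
theorem Implements.exists_delete (hroot : RootedPatterns adj 𝓒)
    (himp : Implements adj 𝓒 W k st R) {S : Finset V} (σ : St) (hSG : S ⊆ (st σ).G)
    (hSk : S.card ≤ k) (hS : Good adj 𝓒 ((st σ).G \ S)) (hW : Good adj 𝓒 ((st σ).G \ W))
    (hbad : ¬ Good adj 𝓒 (st σ).G) :
    Within R (2 * k + 4) σ fun σ' => ∃ x ∈ (st σ).G, (st σ').G = (st σ).G.erase x ∧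
      ∃ S', S' ⊆ (st σ).G.erase x ∧ S'.card + 1 ≤ S.card ∧
        Good adj 𝓒 ((st σ).G.erase x \ S') := by
  classical
  obtain ⟨C, Y, P, val, U, hopt⟩ := himp σ
  set G := (st σ).G with hG
  set E := SccArc adj G with hE
  have hdel : ∀ x ∈ S, x ∈ G ∧ ∃ S', S' ⊆ G.erase x ∧ S'.card + 1 ≤ S.card ∧
      Good adj 𝓒 (G.erase x \ S') := by
    intro x hx
    refine ⟨hSG hx, S.erase x, Finset.erase_subset_erase _ hSG,
      (Finset.card_erase_add_one hx).le, ?_⟩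
    convert hS using 1
    ext v
    simp only [Finset.mem_sdiff, Finset.mem_erase]
    grind
  by_cases hSW : ∃ x ∈ S, x ∈ W
  · obtain ⟨x, hxS, hxW⟩ := hSW
    obtain ⟨hxG, hx⟩ := hdel x hxS
    obtain ⟨σ', hR, hσ'⟩ := hopt.deleteTarget x hxW hxG
    exact (Within.step hR (.of_self ⟨x, hxG, hσ', hx⟩)).mono (m := 1) (by omega)
  have hWS : ∀ x ∈ W, x ∉ S := fun x hx hxS => hSW ⟨x, hxS, hx⟩
  -- reachability outside of `S` by arcs inside strong components
  set r : V → V → Prop := ReflTransGen fun x y => E x y ∧ x ∉ S ∧ y ∉ S with hr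
  have hrConn : ∀ {u v}, r u v → Conn adj G u v ∧ Conn adj G v u := by
    intro u v h
    induction h with
    | refl => exact ⟨.refl, .refl⟩
    | tail _ h2 ih =>
      exact ⟨ih.1.tail ⟨h2.1.1, h2.1.2.1, h2.1.2.2.1⟩, h2.1.2.2.2.trans ih.2⟩
  have hrS : ∀ {u v}, u ∈ G → u ∉ S → r u v → Conn adj (G \ S) u v := by
    intro u v _ _ h
    refine Relation.ReflTransGen.mono (fun x y hxy => ?_) u v h
    exact ⟨hxy.1.1, Finset.mem_sdiff.2 ⟨hxy.1.2.1, hxy.2.1⟩,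
      Finset.mem_sdiff.2 ⟨hxy.1.2.2.1, hxy.2.2⟩⟩
  have hclosed : ∀ u, ∀ x ∈ G.filter (r u ·), ∀ y ∈ G, y ∉ S → u ∉ S → E x y →
      y ∈ G.filter (r u ·) := by
    intro u x hx y hy hyS huS hxy
    rw [Finset.mem_filter] at hx ⊢
    have hxS : x ∉ S := by
      rcases ReflTransGen.cases_tail hx.2 with h | ⟨z, -, -, -, h⟩
      · rwa [h]
      · exact h
    exact ⟨hy, hx.2.tail ⟨hxy, hxS, hyS⟩⟩
  have hreachnb : ∀ u, u ∉ S → nb E G (G.filter (r u ·)) ⊆ S := by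
    intro u huS v hv
    obtain ⟨hvG, hvn, x, hx, hxv⟩ := mem_nb.1 hv
    by_contra hvS
    exact hvn (hclosed u x hx v hvG hvS huS hxv)
  -- a set without boundary contains the strong component of each of its vertices
  have hnbpos : ∀ {p} (_ : p ∈ 𝓒) (_ : Bad adj G p) {T Z : Finset V} {z : V},
      Good adj 𝓒 (G \ T) → Z ⊆ G → Disjoint Z T → z ∈ Z → Conn adj G z p.1 →
      Conn adj G p.1 z → 1 ≤ (nb (SccArc adj G) G Z).card := by
    intro p hp hb T Z z hT hZG hZT hz hzp hpz
    by_contra hlt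
    have hemp : nb E G Z = ∅ := Finset.card_eq_zero.1 (Nat.lt_one_iff.1 (not_le.1 hlt))
    obtain ⟨t, htT, htG, hpt, htp⟩ := hb.exists_mem hroot hT hp
    refine Finset.disjoint_left.1 hZT
      (Conn.mem_of_closed le_rfl (hzp.trans hpt) (htp.trans hpz) ?_ hz) htT
    intro x hx y hy hxy
    by_contra hyZ
    have : y ∈ nb E G Z := mem_nb.2 ⟨hy, hyZ, x, hx, hxy⟩
    simp [hemp] at this
  -- the vertices of `W` in a bad strong component, and among them one that reaches least
  unfold Good at hbad
  push Not at hbad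
  obtain ⟨p, hp, hb⟩ := hbad
  set Wp := G.filter (fun z => z ∈ W ∧ Conn adj G p.1 z ∧ Conn adj G z p.1) with hWp
  have hWpne : Wp.Nonempty := by
    obtain ⟨t, htW, htG, h1, h2⟩ := hb.exists_mem hroot hW hp
    exact ⟨t, by simp [hWp, htW, htG, h1, h2]⟩
  obtain ⟨w, hw, hmin⟩ := Wp.exists_min_image (fun z => (G.filter (r z ·)).card) hWpne
  obtain ⟨hwG, hwW, hpw, hwp⟩ := Finset.mem_filter.1 hw
  -- by minimality, a vertex of `W` reached from `w` reaches `w`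
  have hback : ∀ w' ∈ W, w' ∈ G → r w w' → r w' w := by
    intro w' hw' hw'G hww'
    have hsub : G.filter (r w' ·) ⊆ G.filter (r w ·) := fun v hv => by
      rw [Finset.mem_filter] at hv ⊢
      exact ⟨hv.1, hww'.trans hv.2⟩
    have heq := Finset.eq_of_subset_of_card_le hsub (hmin w' (Finset.mem_filter.2
      ⟨hw'G, hw', hpw.trans (hrConn hww').1, (hrConn hww').2.trans hwp⟩))
    have : w ∈ G.filter (r w ·) := Finset.mem_filter.2 ⟨hwG, .refl⟩
    rw [← heq] at this
    exact (Finset.mem_filter.1 this).2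
  have hwS := hWS w hwW
  set D := G.filter (r w ·) with hD
  have hwD : w ∈ D := Finset.mem_filter.2 ⟨hwG, .refl⟩
  have hDG : D ⊆ G := Finset.filter_subset _ _
  obtain ⟨σ₁, hR₁, hσ₁⟩ := hopt.start w hwW hwG
  -- either the roots are cut off from `w` by `S`, or a root is reached from `w`
  by_cases hDT : Disjoint D (roots adj 𝓒 G)
  · obtain ⟨Z, hDZ, hZG, hZT, hZcard, hZmax, hZ⟩ := exists_important hroot
      (good_sdiff_roots hroot G) hSG hS hDG (hreachnb w hwS) hDT
    have hZk := (hZcard.trans (Finset.card_le_card (hreachnb w hwS))).trans hSk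
    have := himp.chase k σ₁ {w} G Z 1 hσ₁ le_rfl
      ⟨Finset.singleton_subset_iff.2 (hDZ hwD), hZG, hZT⟩ hZmax hZk le_rfl
      (fun Y hY => hnbpos hp hb (good_sdiff_roots hroot G) hY.2.1 hY.2.2
        (Finset.singleton_subset_iff.1 hY.1) hwp hpw) (hZk.trans (by omega))
    refine Within.mono (m := k + 2) (.step hR₁ (this.bind (m' := 0) fun σ' h => ?_)) (by omega)
    obtain ⟨x, hx, hσ'⟩ := h
    exact ⟨x, (mem_nb.1 hx).1, hσ', hZ x hx⟩
  · obtain ⟨t, htD, htT⟩ := Finset.not_disjoint_iff.1 hDT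
    have := himp.find_root hSk (fun x hx y hy hyS hxy => hclosed w x hx y hy hyS hwS hxy)
      (k + 1) σ₁ {w} G hσ₁ le_rfl (Finset.singleton_subset_iff.2 hwG)
      (Finset.singleton_subset_iff.2 hwD) ?_ ?_
    · refine Within.mono (.step hR₁ (this.bind (m' := k + 2) fun σ₂ h => ?_)) (by omega)
      clear this
      obtain ⟨hσ₂, C₂, Y₂, P₂, val₂, U₂, hopt₂, hPT, hPk, b, hbP, hbD⟩ := h
      have hbroot := hPT hbP
      have hpat := hopt₂.pattern b (by rwa [hσ₂])
      rw [hσ₂] at hpat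
      obtain ⟨hbC, hbU⟩ := hpat
      by_cases hUS : ∃ u ∈ U₂ b, u ∈ S
      · obtain ⟨u, huU, huS⟩ := hUS
        obtain ⟨σ', hR, hσ'⟩ := hopt₂.deletePattern hPk b hbP (by rwa [hσ₂]) u huU
        rw [hσ₂] at hσ'
        exact (Within.step hR (.of_self ⟨u, hSG huS, hσ', (hdel u huS).2⟩)).mono (m := 1)
          (by omega)
      push Not at hUS
      have hrbU : ∀ u ∈ U₂ b, r b u := by
        intro u hu
        have h1 := (hroot _ hbC).2 u hu
        induction h1 with
        | refl => exact .refl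
        | @tail y z h2 h3 ih =>
          refine (ih h3.2.1).tail ⟨⟨h3.1, hbU.1 h3.2.1, hbU.1 h3.2.2, ?_⟩, hUS y h3.2.1,
            hUS z h3.2.2⟩
          exact (hbU.2 z h3.2.2).trans (hbU.conn_root hroot hbC h3.2.1)
      have hrwb := (Finset.mem_filter.1 hbD).2
      -- some vertex of the pattern no longer reaches `W` outside of `S`
      have hex : ∃ u ∈ U₂ b, Disjoint (G.filter (r u ·)) W := by
        by_contra! hcon
        have hreach : ∀ u ∈ U₂ b, r u w := by
          intro u hu
          obtain ⟨w', hw', hw'W⟩ := Finset.not_disjoint_iff.1 (hcon u hu)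
          obtain ⟨hw'G, huw'⟩ := Finset.mem_filter.1 hw'
          exact huw'.trans (hback w' hw'W hw'G ((hrwb.trans (hrbU u hu)).trans huw'))
        refine hS _ hbC ⟨fun u hu => Finset.mem_sdiff.2 ⟨hbU.1 hu, hUS u hu⟩, fun u hu => ?_⟩
        exact hrS (hbU.1 hu) (hUS u hu) ((hreach u hu).trans hrwb)
      obtain ⟨u, huU, huW⟩ := hex
      have huG := hbU.1 huU
      have huS := hUS u huU
      obtain ⟨σ₃, hR₃, hσ₃⟩ := hopt₂.startPattern hPk b hbP (by rwa [hσ₂]) u huU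
      rw [hσ₂] at hσ₃
      obtain ⟨Z, hDZ, hZG, hZT, hZcard, hZmax, hZ⟩ := exists_important hroot hW hSG hS
        (Finset.filter_subset _ _) (hreachnb u huS) huW
      have hZk := (hZcard.trans (Finset.card_le_card (hreachnb u huS))).trans hSk
      have huZ : u ∈ Z := hDZ (Finset.mem_filter.2 ⟨huG, .refl⟩)
      have := himp.chase k σ₃ {u} G Z 1 hσ₃ le_rfl
        ⟨Finset.singleton_subset_iff.2 huZ, hZG, hZT⟩ hZmax hZk le_rfl
        (fun Y hY => hnbpos hbC hbU hW hY.2.1 hY.2.2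
          (Finset.singleton_subset_iff.1 hY.1) (hbU.2 u huU)
          (hbU.conn_root hroot hbC huU)) (hZk.trans (by omega))
      refine Within.step hR₃ (Within.mono (this.bind (m' := 0) fun σ' h => ?_) (by omega))
      obtain ⟨x, hx, hσ'⟩ := h
      exact ⟨x, (mem_nb.1 hx).1, hσ', hZ x hx⟩
    · intro Z hwZ hZG hZ
      refine ⟨t, htT, ?_⟩
      have hall : ∀ v, r w v → v ∈ Z := by
        intro v hv
        induction hv with
        | refl => exact Finset.singleton_subset_iff.1 hwZ
        | tail _ h2 ih => exact hZ _ ih _ h2.1.2.2.1 h2.2.2 h2.1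
      exact hall t (Finset.mem_filter.1 htD).2
    · intro Z _
      have := Finset.card_le_card (Finset.inter_subset_left (s₁ := S) (s₂ := G))
      omega

/-- A solution of size at most `s ≤ k` is found within `s * (2 * k + 4)` moves. -/
theorem Implements.exists_good (hroot : RootedPatterns adj 𝓒)
    (himp : Implements adj 𝓒 W k st R) (s : ℕ) (hsk : s ≤ k) :
    ∀ (σ : St) (S : Finset V), S ⊆ (st σ).G → S.card ≤ s → Good adj 𝓒 ((st σ).G \ S) →
      Good adj 𝓒 ((st σ).G \ W) →
      Within R (s * (2 * k + 4)) σ fun σ' => Good adj 𝓒 (st σ').G ∧ (st σ').G ⊆ (st σ).G ∧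
        (st σ).G.card ≤ (st σ').G.card + s := by
  induction s with
  | zero =>
    intro σ S _ hS hgood _
    rw [Finset.card_eq_zero.1 (Nat.le_zero.1 hS), Finset.sdiff_empty] at hgood
    exact .of_self ⟨hgood, le_rfl, by omega⟩
  | succ s ih =>
    intro σ S hSG hS hgood hW
    by_cases hb : Good adj 𝓒 (st σ).G
    · exact .of_self ⟨hb, le_rfl, by omega⟩
    have := himp.exists_delete hroot σ hSG (hS.trans hsk) hgood hW hb
    rw [Nat.succ_mul, Nat.add_comm]
    refine this.bind fun σ' h => ?_
    obtain ⟨x, hx, hσ', S', hS'G, hS'c, hS'⟩ := h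
    rw [← hσ'] at hS'G hS'
    have hsub : (st σ').G ⊆ (st σ).G := by
      rw [hσ']
      exact Finset.erase_subset _ _
    refine ((ih (by omega) σ' S' hS'G (by omega) hS'
      (hW.mono (Finset.sdiff_subset_sdiff hsub le_rfl))).bind (m' := 0) fun σ'' h => ?_)
    have := Finset.card_erase_add_one hx
    rw [← hσ'] at this
    exact ⟨h.1, h.2.1.trans hsub, by omega⟩

end

end SCCDeletion

namespace SCCDeletion

/-! ### Flows in residual form -/

/-- `res` gives the residual capacities of a flow of value `val` with the sources `src` and the
sink `t` in the network with node set `{0, …, N - 1}` and capacities `cap`; the flow along `x y`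
is `cap x y - res x y`. -/
structure IsFlow (N : ℕ) (cap : ℕ → ℕ → ℕ) (src : ℕ → Prop) (t : ℕ) (res : ℕ → ℕ → ℕ)
    (val : ℕ) : Prop where
  skew : ∀ x < N, ∀ y < N, res x y + res y x = cap x y + cap y x
  conserve : ∀ x < N, ¬ src x → x ≠ t → ∑ y ∈ Finset.range N, ((cap x y : ℤ) - res x y) = 0
  value : ∑ y ∈ Finset.range N, ((cap t y : ℤ) - res t y) = -val

/-- Like `IsFlow`, except that one more unit of flow has already arrived at the node `c`. -/
structure IsFlowAt (N : ℕ) (cap : ℕ → ℕ → ℕ) (src : ℕ → Prop) (t : ℕ) (res : ℕ → ℕ → ℕ)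
    (val c : ℕ) : Prop where
  skew : ∀ x < N, ∀ y < N, res x y + res y x = cap x y + cap y x
  conserve : ∀ x < N, ¬ src x → x ≠ t →
    ∑ y ∈ Finset.range N, ((cap x y : ℤ) - res x y) = if x = c then -1 else 0
  value : ∑ y ∈ Finset.range N, ((cap t y : ℤ) - res t y) = -val - if t = c then 1 else 0

/-- The residual capacities after sending one unit of flow along the arc `c y`. -/
def pushRes (res : ℕ → ℕ → ℕ) (c y : ℕ) : ℕ → ℕ → ℕ := fun a b =>
  if a = c ∧ b = y then res a b - 1 else if a = y ∧ b = c then res a b + 1 else res a b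

section

variable {N t val c : ℕ} {cap res : ℕ → ℕ → ℕ} {src : ℕ → Prop}

theorem IsFlow.init (t : ℕ) : IsFlow N cap src t cap 0 where
  skew _ _ _ _ := rfl
  conserve _ _ _ _ := by simp
  value := by simp

theorem IsFlow.isFlowAt (h : IsFlow N cap src t res val) (hc : src c) (hct : c ≠ t) :
    IsFlowAt N cap src t res val c where
  skew := h.skew
  conserve x hx hsx hxt := by
    rw [h.conserve x hx hsx hxt, if_neg]
    rintro rfl
    exact hsx hc
  value := by rw [h.value, if_neg (Ne.symm hct), sub_zero]

theorem IsFlowAt.isFlow (h : IsFlowAt N cap src t res val t) :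
    IsFlow N cap src t res (val + 1) where
  skew := h.skew
  conserve x hx hsx hxt := by rw [h.conserve x hx hsx hxt, if_neg hxt]
  value := by
    rw [h.value, if_pos rfl]
    push_cast
    ring

theorem sum_pushRes {y : ℕ} (hc : c < N) (hy : y < N) (hcy : c ≠ y) (hres : res c y ≠ 0) (x : ℕ) :
    ∑ b ∈ Finset.range N, ((cap x b : ℤ) - pushRes res c y x b) =
      ∑ b ∈ Finset.range N, ((cap x b : ℤ) - res x b) + (if x = c then 1 else 0) -
        (if x = y then 1 else 0) := by
  have h1 : ∀ b, ((cap x b : ℤ) - pushRes res c y x b) = ((cap x b : ℤ) - res x b) +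
      (if x = c then (if b = y then 1 else 0) else 0) -
        (if x = y then (if b = c then 1 else 0) else 0) := by
    intro b
    unfold pushRes
    split_ifs <;> first | omega | (subst_vars; push_cast [Nat.one_le_iff_ne_zero.2 hres]; ring)
  simp_rw [h1]
  rw [Finset.sum_sub_distrib, Finset.sum_add_distrib]
  congr 1
  · congr 1
    split_ifs with h <;> simp [hy]
  · split_ifs with h <;> simp [hc]

theorem IsFlowAt.push (h : IsFlowAt N cap src t res val c) {y : ℕ} (hc : c < N) (hy : y < N)
    (hcy : c ≠ y) (hct : c ≠ t) (hres : res c y ≠ 0) :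
    IsFlowAt N cap src t (pushRes res c y) val y where
  skew a ha b hb := by
    rw [← h.skew a ha b hb]
    unfold pushRes
    split_ifs <;> first | omega | (obtain ⟨rfl, rfl⟩ := ‹_ ∧ _›; omega)
  conserve x hx hsx hxt := by
    rw [sum_pushRes hc hy hcy hres, h.conserve x hx hsx hxt]
    split_ifs <;> omega
  value := by
    rw [sum_pushRes hc hy hcy hres, h.value]
    split_ifs <;> omega

/-- The value of a flow across a cut with the sink side `Q`. -/
theorem IsFlow.value_eq (h : IsFlow N cap src t res val) {Q : Finset ℕ}
    (hQ : Q ⊆ Finset.range N) (ht : t ∈ Q) (hsrc : ∀ x ∈ Q, ¬ src x) :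
    (val : ℤ) = ∑ x ∈ Finset.range N \ Q, ∑ y ∈ Q, ((cap x y : ℤ) - res x y) := by
  set f : ℕ → ℕ → ℤ := fun x y => (cap x y : ℤ) - res x y with hf
  have hskew : ∀ x ∈ Finset.range N, ∀ y ∈ Finset.range N, f x y = - f y x := by
    intro x hx y hy
    have := h.skew x (Finset.mem_range.1 hx) y (Finset.mem_range.1 hy)
    simp only [hf]
    omega
  have h1 : ∑ y ∈ Q, ∑ x ∈ Finset.range N, f y x = -val := by
    rw [Finset.sum_eq_single_of_mem t ht]
    · exact h.value
    · intro y hy hyt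
      exact h.conserve y (Finset.mem_range.1 (hQ hy)) (hsrc y hy) hyt
  have h2 : ∑ y ∈ Q, ∑ x ∈ Q, f y x = 0 := by
    have : ∑ y ∈ Q, ∑ x ∈ Q, f y x = - ∑ y ∈ Q, ∑ x ∈ Q, f y x := by
      conv_lhs => rw [Finset.sum_comm]
      rw [← Finset.sum_neg_distrib]
      refine Finset.sum_congr rfl fun y hy => ?_
      rw [← Finset.sum_neg_distrib]
      exact Finset.sum_congr rfl fun x hx => hskew x (hQ hx) y (hQ hy)
    omega
  have h3 : ∑ y ∈ Q, ∑ x ∈ Finset.range N, f y x =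
      ∑ y ∈ Q, ∑ x ∈ Finset.range N \ Q, f y x + ∑ y ∈ Q, ∑ x ∈ Q, f y x := by
    rw [← Finset.sum_add_distrib]
    exact Finset.sum_congr rfl fun y _ => (Finset.sum_sdiff hQ).symm
  have h4 : ∑ y ∈ Q, ∑ x ∈ Finset.range N \ Q, f y x =
      - ∑ x ∈ Finset.range N \ Q, ∑ y ∈ Q, f x y := by
    rw [Finset.sum_comm, ← Finset.sum_neg_distrib]
    refine Finset.sum_congr rfl fun x hx => ?_
    rw [← Finset.sum_neg_distrib]
    exact Finset.sum_congr rfl fun y hy => hskew y (hQ hy) x (Finset.mem_sdiff.1 hx).1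
  linarith

/-! ### Labels of a backward search -/

/-- The result of a backward search from `t` along the arcs with `res x y ≠ 0`: the nodes that
reach `t` have nonzero labels, and `nxt` leads from each of them to a node of smaller label. -/
structure IsMarking (N : ℕ) (res : ℕ → ℕ → ℕ) (t : ℕ) (lev nxt : ℕ → ℕ) : Prop where
  target : lev t = 1
  le : ∀ x < N, lev x ≤ N + 1
  next : ∀ x < N, lev x ≠ 0 → x ≠ t →
    nxt x < N ∧ res x (nxt x) ≠ 0 ∧ lev (nxt x) ≠ 0 ∧ lev (nxt x) < lev x
  closed : ∀ x < N, ∀ y < N, res x y ≠ 0 → lev y ≠ 0 → lev x ≠ 0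

theorem IsMarking.lev_ne_zero_iff {lev nxt : ℕ → ℕ} (h : IsMarking N res t lev nxt) {x : ℕ}
    (hx : x < N) : lev x ≠ 0 ↔
      Relation.ReflTransGen (fun x y => x < N ∧ y < N ∧ res x y ≠ 0) x t := by
  constructor
  · induction hl : lev x using Nat.strong_induction_on generalizing x with | _ l ih
    intro hl0
    by_cases hxt : x = t
    · rw [hxt]
    · obtain ⟨h1, h2, h3, h4⟩ := h.next x hx (hl ▸ hl0) hxt
      exact .head ⟨hx, h1, h2⟩ (ih _ (hl ▸ h4) h1 rfl h3)
  · intro hr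
    induction hr using Relation.ReflTransGen.head_induction_on with
    | refl => rw [h.target]; exact one_ne_zero
    | head h1 _ ih => exact h.closed _ h1.1 _ h1.2.1 h1.2.2 (ih h1.2.1)

end

/-! ### Vertex cuts from flows in the split digraph -/

open Classical in
/-- The capacities of the split digraph: a vertex `v < n` becomes an arc from `v` to `n + v` of
capacity one (unless `v` is a source), an arc `u v` becomes an arc from `n + u` to `v` of capacity
`K`, and each `v ∈ T` has an arc of capacity `K` from `n + v` to the sink `2 * n`. -/
noncomputable def splitCap (n : ℕ) (E : ℕ → ℕ → Prop) (X A T : Finset ℕ) (K x y : ℕ) : ℕ :=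
  if x < n then (if y = n + x ∧ x ∈ X ∧ x ∉ A then 1 else 0)
  else if x < 2 * n then
    if y < n then (if x - n ∈ X ∧ y ∈ X ∧ E (x - n) y then K else 0)
    else if y = 2 * n then (if x - n ∈ X ∧ x - n ∈ T then K else 0) else 0
  else 0

theorem sum_lt_of_exists {s u : Finset ℕ} {f g : ℕ → ℕ → ℤ} (h : ∀ x ∈ s, ∀ y ∈ u, f x y ≤ g x y)
    (h' : ∃ x ∈ s, ∃ y ∈ u, f x y < g x y) :
    ∑ x ∈ s, ∑ y ∈ u, f x y < ∑ x ∈ s, ∑ y ∈ u, g x y := by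
  obtain ⟨x, hx, y, hy, hxy⟩ := h'
  exact Finset.sum_lt_sum (fun x hx => Finset.sum_le_sum (h x hx))
    ⟨x, hx, Finset.sum_lt_sum (h x hx) ⟨y, hy, hxy⟩⟩

section

variable {n k val : ℕ} {E : ℕ → ℕ → Prop} {X A T : Finset ℕ} {res : ℕ → ℕ → ℕ} {lev nxt : ℕ → ℕ}

/-- A maximum flow in the split digraph, cut off at the value `k + 1`, and the labels of a
backward search in its residual digraph give the minimum cut of maximal source side. -/
theorem isFlowOutput_of_isFlow (hX : X ⊆ Finset.range n) (hAX : A ⊆ X)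
    (hflow : IsFlow (2 * n + 1) (splitCap n E X A T (k + 1)) (fun x => ∃ a ∈ A, x = n + a)
      (2 * n) res val)
    (hmark : IsMarking (2 * n + 1) res (2 * n) lev nxt) (hval : val ≤ k + 1)
    (hmax : val ≤ k → ∀ a ∈ A, lev (n + a) = 0) :
    IsFlowOutput E X A T k (X.filter fun v => lev v = 0 ∧ lev (n + v) ≠ 0)
      (X.filter fun v => lev (n + v) = 0)
      ((Finset.range n).filter fun v => res (2 * n) (n + v) ≠ 0) val := by
  classical
  set cap := splitCap n E X A T (k + 1) with hcap
  set N := 2 * n + 1 with hN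
  have hXn : ∀ v ∈ X, v < n := fun v hv => Finset.mem_range.1 (hX hv)
  have hcapt : ∀ y, cap (2 * n) y = 0 := by
    intro y
    simp only [hcap, splitCap]
    rw [if_neg (by omega), if_neg (by omega)]
  set P := (Finset.range n).filter fun v => res (2 * n) (n + v) ≠ 0 with hP
  have hPTX : P ⊆ T ∩ X := by
    intro v hv
    obtain ⟨hvn, hv⟩ := Finset.mem_filter.1 hv
    have hvn := Finset.mem_range.1 hvn
    have h1 := hflow.skew (2 * n) (by omega) (n + v) (by omega)
    have h2 : cap (n + v) (2 * n) ≠ 0 := by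
      rw [hcapt] at h1
      omega
    simp only [hcap, splitCap] at h2
    rw [if_neg (by omega), if_pos (by omega), if_neg (by omega), if_pos trivial,
      Nat.add_sub_cancel_left] at h2
    simp only [ne_eq, ite_eq_right_iff, not_forall] at h2
    exact Finset.mem_inter.2 ⟨h2.1.2, h2.1.1⟩
  -- across the cut given by `Z`, the flow is at most the size of the boundary of `Z`
  have key : ∀ Z, A ⊆ Z → Z ⊆ X → ∃ Q : Finset ℕ, Q ⊆ Finset.range N ∧ 2 * n ∈ Q ∧
      (∀ x ∈ Q, ¬ ∃ a ∈ A, x = n + a) ∧ (∀ v ∈ Z, n + v ∈ Finset.range N \ Q) ∧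
      (∀ x ∈ Finset.range N \ Q, ∀ y ∈ Q,
        cap x y ≤ (if x ∈ nb E X Z ∧ y = n + x then 1 else 0) ∨
          ∃ u ∈ Z, u ∈ T ∧ x = n + u ∧ y = 2 * n) ∧
      ∑ x ∈ Finset.range N \ Q, ∑ y ∈ Q, (if x ∈ nb E X Z ∧ y = n + x then (1 : ℤ) else 0) ≤
        (nb E X Z).card := by
    intro Z hAZ hZX
    refine ⟨(Finset.range N).filter fun x =>
      ¬ ((x < n ∧ x ∈ Z ∪ nb E X Z) ∨ (n ≤ x ∧ x - n ∈ Z)), Finset.filter_subset _ _, ?_, ?_, ?_,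
      ?_, ?_⟩
    · refine Finset.mem_filter.2 ⟨Finset.mem_range.2 (by omega), ?_⟩
      rintro (⟨h, -⟩ | ⟨-, h⟩)
      · omega
      · have := hXn _ (hZX h)
        omega
    · rintro x hx ⟨a, ha, rfl⟩
      refine (Finset.mem_filter.1 hx).2 (.inr ⟨by omega, ?_⟩)
      rw [Nat.add_sub_cancel_left]
      exact hAZ ha
    · intro v hv
      have := hXn _ (hZX hv)
      refine Finset.mem_sdiff.2 ⟨Finset.mem_range.2 (by omega), fun h => ?_⟩
      refine (Finset.mem_filter.1 h).2 (.inr ⟨by omega, ?_⟩)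
      rw [Nat.add_sub_cancel_left]
      exact hv
    · intro x hx y hy
      obtain ⟨hxN, hx⟩ := Finset.mem_sdiff.1 hx
      obtain ⟨hyN, hy⟩ := Finset.mem_filter.1 hy
      have hx : (x < n ∧ x ∈ Z ∪ nb E X Z) ∨ (n ≤ x ∧ x - n ∈ Z) := by
        by_contra h
        exact hx (Finset.mem_filter.2 ⟨hxN, h⟩)
      simp only [hcap, splitCap]
      by_cases hxn : x < n
      · left
        rw [if_pos hxn]
        by_cases hyx : y = n + x ∧ x ∈ X ∧ x ∉ A
        · rw [if_pos hyx, if_pos]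
          refine ⟨?_, hyx.1⟩
          rcases hx with ⟨-, h⟩ | ⟨h, -⟩
          · rcases Finset.mem_union.1 h with h | h
            · refine absurd (Or.inr ⟨by omega, ?_⟩) hy
              rw [hyx.1, Nat.add_sub_cancel_left]
              exact h
            · exact h
          · omega
        · rw [if_neg hyx]
          exact Nat.zero_le _
      · have hxZ : x - n ∈ Z := by
          rcases hx with ⟨h, -⟩ | ⟨-, h⟩
          · omega
          · exact h
        rw [if_neg hxn]
        by_cases hx2 : x < 2 * n
        · rw [if_pos hx2]
          by_cases hyn : y < n
          · left
            rw [if_pos hyn, if_neg]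
            · exact Nat.zero_le _
            · rintro ⟨-, hyX, hxy⟩
              refine hy (.inl ⟨hyn, ?_⟩)
              by_cases hyZ : y ∈ Z
              · exact Finset.mem_union_left _ hyZ
              · exact Finset.mem_union_right _ (mem_nb.2 ⟨hyX, hyZ, _, hxZ, hxy⟩)
          · rw [if_neg hyn]
            by_cases hy2 : y = 2 * n
            · rw [if_pos hy2]
              by_cases hT : x - n ∈ T
              · exact .inr ⟨x - n, hxZ, hT, by omega, hy2⟩
              · left
                rw [if_neg (fun h => hT h.2)]
                exact Nat.zero_le _
            · left
              rw [if_neg hy2]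
              exact Nat.zero_le _
        · left
          rw [if_neg hx2]
          exact Nat.zero_le _
    · set Q := (Finset.range N).filter fun x =>
        ¬ ((x < n ∧ x ∈ Z ∪ nb E X Z) ∨ (n ≤ x ∧ x - n ∈ Z))
      calc ∑ x ∈ Finset.range N \ Q, ∑ y ∈ Q, (if x ∈ nb E X Z ∧ y = n + x then (1 : ℤ) else 0)
          ≤ ∑ x ∈ Finset.range N \ Q, if x ∈ nb E X Z then (1 : ℤ) else 0 := by
            refine Finset.sum_le_sum fun x _ => ?_
            by_cases hx : x ∈ nb E X Z
            · simp only [hx, true_and, if_true]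
              rw [Finset.sum_ite_eq']
              split_ifs <;> simp
            · simp [hx]
        _ ≤ ∑ x ∈ nb E X Z, (1 : ℤ) := by
            rw [← Finset.sum_filter]
            refine Finset.sum_le_sum_of_subset_of_nonneg (fun x hx => (Finset.mem_filter.1 hx).2)
              fun _ _ _ => zero_le_one
        _ = (nb E X Z).card := by simp
  have hvalle : ∀ Z, IsCut X A P Z → val ≤ (nb E X Z).card := by
    rintro Z ⟨hAZ, hZX, hZP⟩
    obtain ⟨Q, hQ, htQ, hsrc, -, hb, hsum⟩ := key Z hAZ hZX
    have := hflow.value_eq hQ htQ hsrc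
    have h2 : (val : ℤ) ≤ (nb E X Z).card := by
      rw [this]
      refine le_trans (Finset.sum_le_sum fun x hx => Finset.sum_le_sum fun y hy => ?_) hsum
      rcases hb x hx y hy with h | ⟨u, huZ, huT, rfl, rfl⟩
      · have h' : (cap x y : ℤ) ≤ if x ∈ nb E X Z ∧ y = n + x then (1 : ℤ) else 0 := by
          split_ifs at h ⊢ <;> exact_mod_cast h
        omega
      · have hun := hXn u (hZX huZ)
        have h3 : res (2 * n) (n + u) = 0 := by
          by_contra h
          exact Finset.disjoint_left.1 hZP huZ
            (Finset.mem_filter.2 ⟨Finset.mem_range.2 hun, h⟩)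
        have h4 := hflow.skew (2 * n) (by omega) (n + u) (by omega)
        have h5 : (0 : ℤ) ≤ if n + u ∈ nb E X Z ∧ 2 * n = n + (n + u) then (1 : ℤ) else 0 := by
          split_ifs <;> simp
        omega
    exact_mod_cast h2
  refine ⟨hPTX, ?_, hvalle, fun hvk => ?_, fun hvk Z hZ hZc => ?_⟩
  · have h1 := hflow.value
    simp only [hcapt] at h1
    have h2 : ∑ y ∈ Finset.range N, res (2 * n) y = val := by
      zify
      simpa using h1
    have h3 : P.card ≤ ∑ v ∈ P, res (2 * n) (n + v) := by
      rw [Finset.card_eq_sum_ones]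
      exact Finset.sum_le_sum fun v hv =>
        Nat.one_le_iff_ne_zero.2 (Finset.mem_filter.1 hv).2
    have h4 : ∑ v ∈ P, res (2 * n) (n + v) = ∑ y ∈ P.map (addLeftEmbedding n), res (2 * n) y := by
      rw [Finset.sum_map]
      rfl
    have h5 : ∑ y ∈ P.map (addLeftEmbedding n), res (2 * n) y ≤
        ∑ y ∈ Finset.range N, res (2 * n) y := by
      refine Finset.sum_le_sum_of_subset fun y hy => ?_
      obtain ⟨v, hv, rfl⟩ := Finset.mem_map.1 hy
      have := Finset.mem_range.1 (Finset.mem_filter.1 hv).1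
      simp only [addLeftEmbedding_apply, Finset.mem_range]
      omega
    omega
  · have hA0 := hmax hvk
    set Q := (Finset.range N).filter fun x => lev x ≠ 0 with hQ
    have hcross : ∀ x ∈ Finset.range N \ Q, ∀ y ∈ Q, res x y = 0 := by
      intro x hx y hy
      by_contra hres
      obtain ⟨hxN, hxQ⟩ := Finset.mem_sdiff.1 hx
      obtain ⟨hyN, hyl⟩ := Finset.mem_filter.1 hy
      exact hxQ (Finset.mem_filter.2 ⟨hxN, hmark.closed x (Finset.mem_range.1 hxN) y
        (Finset.mem_range.1 hyN) hres hyl⟩)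
    have hv := hflow.value_eq (Q := Q) (Finset.filter_subset _ _)
      (Finset.mem_filter.2 ⟨Finset.mem_range.2 (by omega), by rw [hmark.target]; simp⟩)
      (by
        rintro x hx ⟨a, ha, rfl⟩
        exact (Finset.mem_filter.1 hx).2 (hA0 a ha))
    have hv' : val = ∑ x ∈ Finset.range N \ Q, ∑ y ∈ Q, cap x y := by
      zify
      rw [hv]
      refine Finset.sum_congr rfl fun x hx => Finset.sum_congr rfl fun y hy => ?_
      rw [hcross x hx y hy]
      simp
    have hsingle : ∀ x < N, ∀ y < N, lev x = 0 → lev y ≠ 0 → cap x y ≤ val := by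
      intro x hx y hy hlx hly
      have hxQ : x ∈ Finset.range N \ Q := Finset.mem_sdiff.2 ⟨Finset.mem_range.2 hx,
        fun h => (Finset.mem_filter.1 h).2 hlx⟩
      have hyQ : y ∈ Q := Finset.mem_filter.2 ⟨Finset.mem_range.2 hy, hly⟩
      rw [hv']
      exact (Finset.single_le_sum (f := fun y => cap x y) (fun _ _ => Nat.zero_le _) hyQ).trans
        (Finset.single_le_sum (f := fun x => ∑ y ∈ Q, cap x y) (fun _ _ => Nat.zero_le _) hxQ)
    set Y := X.filter fun v => lev (n + v) = 0 with hY
    set C := X.filter fun v => lev v = 0 ∧ lev (n + v) ≠ 0 with hC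
    have hAY : A ⊆ Y := fun a ha => Finset.mem_filter.2 ⟨hAX ha, hA0 a ha⟩
    have hYT : Disjoint Y T := by
      refine Finset.disjoint_left.2 fun v hvY hvT => ?_
      obtain ⟨hvX, hvl⟩ := Finset.mem_filter.1 hvY
      have hvn := hXn v hvX
      have := hsingle (n + v) (by omega) (2 * n) (by omega) hvl (by rw [hmark.target]; simp)
      simp only [hcap, splitCap] at this
      rw [if_neg (by omega), if_pos (by omega), if_neg (by omega), if_pos trivial,
        Nat.add_sub_cancel_left, if_pos ⟨hvX, hvT⟩] at this
      omega
    have hYcut : IsCut X A T Y := ⟨hAY, Finset.filter_subset _ _, hYT⟩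
    have hnbC : nb E X Y ⊆ C := by
      intro v hv
      obtain ⟨hvX, hvY, u, hu, huv⟩ := mem_nb.1 hv
      obtain ⟨huX, hul⟩ := Finset.mem_filter.1 hu
      have hvn := hXn v hvX
      have hun := hXn u huX
      refine Finset.mem_filter.2 ⟨hvX, ?_, fun h => hvY (Finset.mem_filter.2 ⟨hvX, h⟩)⟩
      by_contra hvl
      have := hsingle (n + u) (by omega) v (by omega) hul hvl
      simp only [hcap, splitCap] at this
      rw [if_neg (by omega), if_pos (by omega), if_pos hvn, Nat.add_sub_cancel_left,
        if_pos ⟨huX, hvX, huv⟩] at this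
      omega
    have hCval : C.card ≤ val := by
      rw [hv']
      calc C.card = ∑ v ∈ C, 1 := by simp
        _ ≤ ∑ v ∈ C, ∑ y ∈ Q, cap v y := by
            refine Finset.sum_le_sum fun v hv => ?_
            obtain ⟨hvX, hvl, hvl'⟩ := Finset.mem_filter.1 hv
            have hvn := hXn v hvX
            have hvQ : n + v ∈ Q := Finset.mem_filter.2 ⟨Finset.mem_range.2 (by omega), hvl'⟩
            refine le_trans ?_ (Finset.single_le_sum (f := fun y => cap v y)
              (fun _ _ => Nat.zero_le _) hvQ)
            simp only [hcap, splitCap]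
            rw [if_pos hvn, if_pos ⟨trivial, hvX, fun hvA => hvl' (hA0 v hvA)⟩]
        _ ≤ ∑ x ∈ Finset.range N \ Q, ∑ y ∈ Q, cap x y := by
            refine Finset.sum_le_sum_of_subset fun v hv => ?_
            obtain ⟨hvX, hvl, hvl'⟩ := Finset.mem_filter.1 hv
            have hvn := hXn v hvX
            exact Finset.mem_sdiff.2 ⟨Finset.mem_range.2 (by omega),
              fun h => (Finset.mem_filter.1 h).2 hvl⟩
    have hle := hvalle Y ⟨hAY, Finset.filter_subset _ _,
      Finset.disjoint_of_subset_right (hPTX.trans Finset.inter_subset_left) hYT⟩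
    have heq := Finset.eq_of_subset_of_card_le hnbC (hCval.trans hle)
    refine ⟨hYcut, heq.symm, le_antisymm hCval ?_⟩
    rw [← heq]
    exact hle
  · obtain ⟨hAZ, hZX, hZT⟩ := hZ
    obtain ⟨Q, hQ, htQ, hsrc, hZQ, hb, hsum⟩ := key Z hAZ hZX
    have hv := hflow.value_eq hQ htQ hsrc
    have hcapb : ∀ x ∈ Finset.range N \ Q, ∀ y ∈ Q,
        (cap x y : ℤ) ≤ if x ∈ nb E X Z ∧ y = n + x then (1 : ℤ) else 0 := by
      intro x hx y hy
      rcases hb x hx y hy with h | ⟨u, huZ, huT, -⟩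
      · split_ifs at h ⊢ <;> exact_mod_cast h
      · exact absurd huT (Finset.disjoint_left.1 hZT huZ)
    have hres : ∀ x ∈ Finset.range N \ Q, ∀ y ∈ Q, res x y = 0 := by
      by_contra! hcon
      obtain ⟨x, hx, y, hy, hxy⟩ := hcon
      have := sum_lt_of_exists (s := Finset.range N \ Q) (u := Q)
        (f := fun x y => (cap x y : ℤ) - res x y)
        (g := fun x y => if x ∈ nb E X Z ∧ y = n + x then (1 : ℤ) else 0)
        (fun x hx y hy => by have := hcapb x hx y hy; omega)
        ⟨x, hx, y, hy, by have := hcapb x hx y hy; omega⟩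
      omega
    have hlev : ∀ l x, x ∈ Finset.range N \ Q → lev x = l → l = 0 := by
      intro l
      induction l using Nat.strong_induction_on with | _ l ih
      intro x hx hl
      by_contra hl0
      obtain ⟨hxN, hxQ⟩ := Finset.mem_sdiff.1 hx
      obtain ⟨h1, h2, h3, h4⟩ := hmark.next x (Finset.mem_range.1 hxN) (hl ▸ hl0)
        (fun h => hxQ (h ▸ htQ))
      refine h3 (ih _ (hl ▸ h4) (nxt x) (Finset.mem_sdiff.2 ⟨Finset.mem_range.2 h1, fun h => ?_⟩)
        rfl)
      exact h2 (hres x hx _ h)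
    exact fun v hvZ => Finset.mem_filter.2 ⟨hZX hvZ, hlev _ _ (hZQ v hvZ) rfl⟩

end

end SCCDeletion

namespace RAM

/-! ### Programs with bounded loops -/

/-- Programs all of whose loops run over the numbers below the value of a register.  They are
compiled to programs of the machine by `LProg.compile`, where a store is guarded: it is executed
only if the address is less than the value of register `9`. -/
inductive LProg where
  | skip
  | assign (x : ℕ) (e : Expr)
  | store (a : ℕ) (i e : Expr)
  | seq (p q : LProg)
  | ite (e : Expr) (p q : LProg)
  | loop (x b : ℕ) (p : LProg)

namespace LProg

/-- The machine program for a program with bounded loops. -/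
def compile : LProg → Prog
  | skip => .skip
  | assign x e => .assign x e
  | store a i e => .ite (.sub (.var 9) i) (.store a i e) .skip
  | seq p q => .seq p.compile q.compile
  | ite e p q => .ite e p.compile q.compile
  | .loop x b p => .seq (.assign x (.const 0)) (Prog.loop (.sub (.var b) (.var x))
      (.seq p.compile (.assign x (.add (.var x) (.const 1)))))

/-- The state in which a program halts.  For loops this agrees with the machine program only if
the loop body changes neither the loop variable nor the bound, see `LProg.WF`. -/
def den : LProg → State → State
  | skip, s => s
  | assign x e, s => s.setVar x (e.eval s)
  | store a i e, s => if i.eval s < s.var 9 then s.setArr a (i.eval s) (e.eval s) else s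
  | seq p q, s => q.den (p.den s)
  | ite e p q, s => if e.eval s ≠ 0 then p.den s else q.den s
  | .loop x b p, s =>
      (fun s' => (p.den s').setVar x ((p.den s').var x + 1))^[s.var b] (s.setVar x 0)

/-- The program writes into register `y`. -/
def WritesVar : LProg → ℕ → Prop
  | skip, _ => False
  | assign x _, y => y = x
  | store _ _ _, _ => False
  | seq p q, y => p.WritesVar y ∨ q.WritesVar y
  | ite _ p q, y => p.WritesVar y ∨ q.WritesVar y
  | .loop x _ p, y => y = x ∨ p.WritesVar y

/-- The program writes into memory block `a`. -/
def WritesArr : LProg → ℕ → Prop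
  | skip, _ => False
  | assign _ _, _ => False
  | store a _ _, b => b = a
  | seq p q, b => p.WritesArr b ∨ q.WritesArr b
  | ite _ p q, b => p.WritesArr b ∨ q.WritesArr b
  | .loop _ _ p, b => p.WritesArr b

/-- The registers below `θ` are constant, they contain all loop bounds, and no loop variable is
changed inside its loop. -/
def WF (θ : ℕ) : LProg → Prop
  | skip => True
  | assign x _ => θ ≤ x
  | store _ _ _ => True
  | seq p q => p.WF θ ∧ q.WF θ
  | ite _ p q => p.WF θ ∧ q.WF θ
  | .loop x b p => θ ≤ x ∧ b < θ ∧ ¬ p.WritesVar x ∧ p.WF θ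

/-- The register `b` is the bound of some loop. -/
def IsBound : LProg → ℕ → Prop
  | skip, _ => False
  | assign _ _, _ => False
  | store _ _ _, _ => False
  | seq p q, b => p.IsBound b ∨ q.IsBound b
  | ite _ p q, b => p.IsBound b ∨ q.IsBound b
  | .loop _ c p, b => b = c ∨ p.IsBound b

/-- A bound on the number of steps, given bounds `β` on the values of the loop bounds. -/
def timeBound (β : ℕ → ℕ) : LProg → ℕ
  | skip => 1
  | assign _ e => e.cost + 1
  | store _ i e => 2 * i.cost + e.cost + 5
  | seq p q => p.timeBound β + q.timeBound β
  | ite e p q => e.cost + 1 + p.timeBound β + q.timeBound β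
  | .loop _ b p => β b * (p.timeBound β + 8) + 6

/-- A bound on the number of steps if each loop is executed once. -/
def size : LProg → ℕ
  | skip => 1
  | assign _ e => e.cost + 1
  | store _ i e => 2 * i.cost + e.cost + 5
  | seq p q => p.size + q.size
  | ite e p q => e.cost + 1 + p.size + q.size
  | .loop _ _ p => p.size + 14

/-- The nesting depth of the loops. -/
def depth : LProg → ℕ
  | skip => 0
  | assign _ _ => 0
  | store _ _ _ => 0
  | seq p q => max p.depth q.depth
  | ite _ p q => max p.depth q.depth
  | .loop _ _ p => p.depth + 1

end LProg

section

variable {x y a b i v : ℕ} {s : State}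

@[simp] theorem State.setVar_var : (s.setVar x v).var y = if y = x then v else s.var y := by
  simp [State.setVar, Function.update_apply]

@[simp] theorem State.setVar_arr : (s.setVar x v).arr = s.arr := rfl

@[simp] theorem State.setArr_var : (s.setArr a i v).var = s.var := rfl

theorem State.setArr_arr {j : ℕ} :
    (s.setArr a i v).arr b j = if b = a ∧ j = i then v else s.arr b j := by
  simp only [State.setArr, Function.update_apply]
  split_ifs with h1 h2 h3 <;> grind

end

theorem State.ext' {s s' : State} (h1 : ∀ x, s.var x = s'.var x)
    (h2 : ∀ a i, s.arr a i = s'.arr a i) : s = s' := by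
  cases s
  cases s'
  congr
  · exact funext h1
  · exact funext fun a => funext (h2 a)

namespace LProg

theorem den_loop_of_forall {x b : ℕ} {p : LProg} (Q : State → Prop) {s : State}
    (h0 : Q (s.setVar x 0)) (h : ∀ s, Q s → Q ((p.den s).setVar x ((p.den s).var x + 1))) :
    Q ((loop x b p).den s) :=
  Function.Iterate.rec Q h0 h _

theorem den_var {p : LProg} {y : ℕ} (h : ¬ p.WritesVar y) (s : State) :
    (p.den s).var y = s.var y := by
  induction p generalizing s with
  | skip => rfl
  | assign x e => simp only [den, State.setVar_var]; exact if_neg h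
  | store a i e =>
    simp only [den]
    split_ifs <;> rfl
  | seq p q ihp ihq =>
    simp only [WritesVar, not_or] at h
    rw [den, ihq h.2, ihp h.1]
  | ite e p q ihp ihq =>
    simp only [WritesVar, not_or] at h
    rw [den]
    split_ifs
    · exact ihp h.1 s
    · exact ihq h.2 s
  | loop x b p ih =>
    simp only [WritesVar, not_or] at h
    exact den_loop_of_forall (fun s' => s'.var y = s.var y) (by simp [h.1])
      fun s' hs' => by simp [h.1, ih h.2, hs']

theorem den_arr {p : LProg} {a : ℕ} (h : ¬ p.WritesArr a) (s : State) :
    (p.den s).arr a = s.arr a := by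
  induction p generalizing s with
  | skip => rfl
  | assign x e => rfl
  | store b i e =>
    simp only [den]
    split_ifs
    · funext j
      rw [State.setArr_arr, if_neg (fun h' => h h'.1)]
    · rfl
  | seq p q ihp ihq =>
    simp only [WritesArr, not_or] at h
    rw [den, ihq h.2, ihp h.1]
  | ite e p q ihp ihq =>
    simp only [WritesArr, not_or] at h
    rw [den]
    split_ifs
    · exact ihp h.1 s
    · exact ihq h.2 s
  | loop x b p ih =>
    exact den_loop_of_forall (fun s' => s'.arr a = s.arr a) rfl
      fun s' hs' => by rw [State.setVar_arr, ih h, hs']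

/-- Cells beyond the guard are never changed. -/
theorem den_arr_of_le {p : LProg} (h : ¬ p.WritesVar 9) (s : State) (a : ℕ) {i : ℕ}
    (hi : s.var 9 ≤ i) : (p.den s).arr a i = s.arr a i := by
  induction p generalizing s with
  | skip => rfl
  | assign x e => rfl
  | store b j e =>
    simp only [den]
    split_ifs
    · rw [State.setArr_arr, if_neg]
      omega
    · rfl
  | seq p q ihp ihq =>
    simp only [WritesVar, not_or] at h
    rw [den, ihq h.2, ihp h.1 s hi]
    rwa [den_var h.1]
  | ite e p q ihp ihq =>
    simp only [WritesVar, not_or] at h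
    rw [den]
    split_ifs
    · exact ihp h.1 s hi
    · exact ihq h.2 s hi
  | loop x b p ih =>
    simp only [WritesVar, not_or] at h
    refine (den_loop_of_forall (fun s' => s'.var 9 = s.var 9 ∧ s'.arr a i = s.arr a i) ?_
      fun s' hs' => ?_).2
    · simp [h.1]
    · simp only [State.setVar_var, if_neg h.1, den_var h.2, State.setVar_arr]
      exact ⟨hs'.1, by rw [ih h.2 s' (hs'.1 ▸ hi), hs'.2]⟩

/-- The two states agree except on the registers and blocks that `p` writes, and on register
`x`. -/
structure Frame (p : LProg) (x : ℕ) (s s' : State) : Prop where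
  var : ∀ y, y ≠ x → ¬ p.WritesVar y → s'.var y = s.var y
  arr : ∀ a, ¬ p.WritesArr a → s'.arr a = s.arr a

/-- The rule for loops: `P i` holds when the loop body has been executed `i` times. -/
theorem den_loop {x b m : ℕ} {p : LProg} {s : State} (P : ℕ → State → Prop) (hm : s.var b = m)
    (hx : ¬ p.WritesVar x) (h0 : P 0 (s.setVar x 0))
    (hs : ∀ i < m, ∀ s', s'.var x = i → Frame p x s s' → P i s' →
      P (i + 1) ((p.den s').setVar x (i + 1))) :
    P m ((loop x b p).den s) := by
  subst hm
  rw [den]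
  have key : ∀ m ≤ s.var b, ∀ s'', s'' =
      (fun s' => (p.den s').setVar x ((p.den s').var x + 1))^[m] (s.setVar x 0) →
      s''.var x = m ∧ Frame p x s s'' ∧ P m s'' := by
    intro m
    induction m with
    | zero =>
      rintro - s'' rfl
      exact ⟨by simp, ⟨fun y hy _ => by simp [hy], fun _ _ => rfl⟩, h0⟩
    | succ m ih =>
      rintro hm s'' rfl
      obtain ⟨h1, h2, h3⟩ := ih (by omega) _ rfl
      rw [Function.iterate_succ_apply']
      generalize (fun s' => (p.den s').setVar x ((p.den s').var x + 1))^[m] (s.setVar x 0) = s'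
        at h1 h2 h3
      have h4 : (p.den s').var x = m := by rw [den_var hx, h1]
      rw [h4]
      refine ⟨by simp, ⟨fun y hy hy' => ?_, fun a ha => ?_⟩, hs m (by omega) s' h1 h2 h3⟩
      · simp [hy, den_var hy', h2.var y hy hy']
      · rw [State.setVar_arr, den_arr ha, h2.arr a ha]
  exact (key _ le_rfl _ rfl).2.2

/-! ### Running time -/

theorem WF.not_writesVar {θ : ℕ} {p : LProg} (h : p.WF θ) {y : ℕ} (hy : y < θ) :
    ¬ p.WritesVar y := by
  induction p with
  | skip => exact id
  | assign x e =>
    simp only [WF, WritesVar] at *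
    omega
  | store a i e => exact id
  | seq p q ihp ihq =>
    rintro (h' | h')
    · exact ihp h.1 h'
    · exact ihq h.2 h'
  | ite e p q ihp ihq =>
    rintro (h' | h')
    · exact ihp h.1 h'
    · exact ihq h.2 h'
  | loop x b p ih =>
    obtain ⟨h1, -, -, h4⟩ := h
    rintro (h' | h')
    · omega
    · exact ih h4 h'

/-- The machine program halts in the state that `den` gives, within `timeBound` steps.
Well-formedness guarantees that the loop bounds keep the values on which `timeBound` is based. -/
theorem WF.exec {θ : ℕ} {β : ℕ → ℕ} {p : LProg} (h : p.WF θ) (s : State)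
    (hβ : ∀ b < θ, s.var b ≤ β b) :
    ∃ t ≤ p.timeBound β, Exec p.compile s (p.den s) t := by
  induction p generalizing s with
  | skip => exact ⟨1, le_rfl, .skip s⟩
  | assign x e => exact ⟨_, le_rfl, .assign s x e⟩
  | store a i e =>
    simp only [compile, den, timeBound]
    split_ifs with hi
    · refine ⟨_, ?_, .iteTrue ?_ (.store s a i e)⟩
      · simp only [Expr.cost]
        omega
      · simp only [Expr.eval]
        omega
    · refine ⟨_, ?_, .iteFalse ?_ (.skip s)⟩
      · simp only [Expr.cost]
        omega
      · simp only [Expr.eval]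
        omega
  | seq p q ihp ihq =>
    obtain ⟨t, ht, h1⟩ := ihp h.1 s hβ
    obtain ⟨t', ht', h2⟩ := ihq h.2 (p.den s) fun b hb => by
      rw [den_var (h.1.not_writesVar hb)]
      exact hβ b hb
    exact ⟨_, add_le_add ht ht', .seq h1 h2⟩
  | ite e p q ihp ihq =>
    simp only [compile, den, timeBound]
    split_ifs with he
    · obtain ⟨t, ht, h1⟩ := ihp h.1 s hβ
      exact ⟨_, by omega, .iteTrue he h1⟩
    · obtain ⟨t, ht, h1⟩ := ihq h.2 s hβ
      exact ⟨_, by omega, .iteFalse (not_not.1 he) h1⟩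
  | loop x b p ih =>
    obtain ⟨hx, hb, hpx, hp⟩ := h
    simp only [compile, timeBound]
    set f : State → State := fun s' => (p.den s').setVar x ((p.den s').var x + 1) with hf
    set q : Prog := Prog.loop (.sub (.var b) (.var x))
      (.seq p.compile (.assign x (.add (.var x) (.const 1)))) with hq
    have key : ∀ m, ∀ s' : State, (∀ y < θ, s'.var y = s.var y) → s'.var x + m = s.var b →
        ∃ t ≤ m * (p.timeBound β + 8) + 4, Exec q s' (f^[m] s') t := by
      intro m
      induction m with
      | zero =>
        intro s' h1 h2
        refine ⟨_, ?_, .loopEnd ?_⟩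
        · simp [Expr.cost]
        · simp only [Expr.eval]
          rw [h1 b hb]
          omega
      | succ m ihm =>
        intro s' h1 h2
        obtain ⟨t, ht, hex⟩ := ih hp s' fun c hc => by
          rw [h1 c hc]
          exact hβ c hc
        have h3 : ∀ y < θ, (f s').var y = s.var y := by
          intro y hy
          simp only [hf, State.setVar_var]
          rw [if_neg (by omega), den_var (hp.not_writesVar hy), h1 y hy]
        obtain ⟨t', ht', hex'⟩ := ihm (f s') h3 (by
          simp only [hf, State.setVar_var, if_true, den_var hpx]
          omega)
        refine ⟨_, ?_, .loopStep ?_ (.seq hex (.assign _ x (.add (.var x) (.const 1)))) hex'⟩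
        · simp only [Expr.cost]
          rw [Nat.succ_mul]
          omega
        · simp only [Expr.eval]
          rw [h1 b hb]
          omega
    obtain ⟨t, ht, hex⟩ := key (s.var b) (s.setVar x 0) (fun y hy => by
      simp only [State.setVar_var]
      rw [if_neg (by omega)]) (by simp)
    refine ⟨_, ?_, .seq (.assign s x (.const 0)) hex⟩
    have := Nat.mul_le_mul_right (p.timeBound β + 8) (hβ b hb)
    simp only [Expr.cost]
    omega

/-- A program whose loop bounds are at most `m` takes `O(m ^ d)` steps, where `d` is the nesting
depth of its loops. -/
theorem timeBound_le {β : ℕ → ℕ} {p : LProg} {m : ℕ} (hm : 1 ≤ m)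
    (h : ∀ b, p.IsBound b → β b ≤ m) : p.timeBound β ≤ p.size * m ^ p.depth := by
  have hpow : ∀ {d d' c : ℕ}, d ≤ d' → c * m ^ d ≤ c * m ^ d' := fun hd =>
    Nat.mul_le_mul_left _ (Nat.pow_le_pow_right hm hd)
  induction p with
  | skip => simp [timeBound, size, depth]
  | assign x e => simp [timeBound, size, depth]
  | store a i e => simp [timeBound, size, depth]
  | seq p q ihp ihq =>
    have h1 := (ihp fun b hb => h b (.inl hb)).trans (hpow (le_max_left _ q.depth))
    have h2 := (ihq fun b hb => h b (.inr hb)).trans (hpow (le_max_right p.depth _))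
    simp only [timeBound, size, depth]
    rw [Nat.add_mul]
    omega
  | ite e p q ihp ihq =>
    have h1 := (ihp fun b hb => h b (.inl hb)).trans (hpow (le_max_left _ q.depth))
    have h2 := (ihq fun b hb => h b (.inr hb)).trans (hpow (le_max_right p.depth _))
    have h3 : e.cost + 1 ≤ (e.cost + 1) * m ^ max p.depth q.depth :=
      Nat.le_mul_of_pos_right _ (Nat.pow_pos hm)
    simp only [timeBound, size, depth]
    rw [Nat.add_mul, Nat.add_mul (e.cost + 1)]
    omega
  | loop x b p ih =>
    have h1 := ih fun b hb => h b (.inr hb)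
    have h2 := h b (.inl rfl)
    simp only [timeBound, size, depth]
    have h3 : 1 ≤ m ^ p.depth := Nat.pow_pos hm
    calc β b * (p.timeBound β + 8) + 6 ≤ m * (p.size * m ^ p.depth + 8) + 6 := by gcongr
      _ ≤ (p.size + 14) * m ^ (p.depth + 1) := by
        rw [pow_succ]
        nlinarith [Nat.mul_le_mul hm h3, Nat.mul_le_mul_left m h3]

theorem den_skip {s : State} : skip.den s = s := rfl

theorem den_assign {x : ℕ} {e : Expr} {s : State} :
    (assign x e).den s = s.setVar x (e.eval s) := rfl

theorem den_store {a : ℕ} {i e : Expr} {s : State} (h : i.eval s < s.var 9) :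
    (store a i e).den s = s.setArr a (i.eval s) (e.eval s) := if_pos h

theorem den_seq {p q : LProg} {s : State} : (seq p q).den s = q.den (p.den s) := rfl

theorem den_ite {e : Expr} {p q : LProg} {s : State} :
    (ite e p q).den s = if e.eval s ≠ 0 then p.den s else q.den s := rfl

end LProg

/-! ### Parts of the state that do not matter -/

/-- The state with the registers in `Iv` and the blocks in `Ia` cleared. -/
def State.erase (Iv Ia : Finset ℕ) (s : State) : State where
  var x := if x ∈ Iv then 0 else s.var x
  arr a i := if a ∈ Ia then 0 else s.arr a i

/-- The expression does not read the registers in `Iv` and the blocks in `Ia`. -/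
def Expr.Avoids (Iv Ia : Finset ℕ) : Expr → Prop
  | .const _ => True
  | .var x => x ∉ Iv
  | .load a i => a ∉ Ia ∧ i.Avoids Iv Ia
  | .add e₁ e₂ => e₁.Avoids Iv Ia ∧ e₂.Avoids Iv Ia
  | .sub e₁ e₂ => e₁.Avoids Iv Ia ∧ e₂.Avoids Iv Ia

theorem Expr.Avoids.eval_erase {Iv Ia : Finset ℕ} {e : Expr} (h : e.Avoids Iv Ia) (s : State) :
    e.eval (s.erase Iv Ia) = e.eval s := by
  induction e with
  | const m => rfl
  | var x => simp only [eval, State.erase]; rw [if_neg h]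
  | load a i ih => simp only [eval, State.erase]; rw [if_neg h.1]; congr 1; exact ih h.2
  | add e₁ e₂ ih₁ ih₂ => simp only [eval]; rw [ih₁ h.1, ih₂ h.2]
  | sub e₁ e₂ ih₁ ih₂ => simp only [eval]; rw [ih₁ h.1, ih₂ h.2]

namespace LProg

/-- The program neither reads nor writes the registers in `Iv` and the blocks in `Ia`. -/
def Avoids (Iv Ia : Finset ℕ) : LProg → Prop
  | skip => True
  | assign x e => x ∉ Iv ∧ e.Avoids Iv Ia
  | store a i e => 9 ∉ Iv ∧ a ∉ Ia ∧ i.Avoids Iv Ia ∧ e.Avoids Iv Ia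
  | seq p q => p.Avoids Iv Ia ∧ q.Avoids Iv Ia
  | ite e p q => e.Avoids Iv Ia ∧ p.Avoids Iv Ia ∧ q.Avoids Iv Ia
  | .loop x b p => x ∉ Iv ∧ b ∉ Iv ∧ p.Avoids Iv Ia

theorem setVar_erase {Iv Ia : Finset ℕ} {x v : ℕ} (h : x ∉ Iv) (s : State) :
    (s.erase Iv Ia).setVar x v = (s.setVar x v).erase Iv Ia := by
  refine State.ext' (fun y => ?_) fun _ _ => rfl
  simp only [State.erase, State.setVar_var]
  split_ifs <;> simp_all

theorem Avoids.den_erase {Iv Ia : Finset ℕ} {p : LProg} (h : p.Avoids Iv Ia) (s : State) :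
    p.den (s.erase Iv Ia) = (p.den s).erase Iv Ia := by
  induction p generalizing s with
  | skip => rfl
  | assign x e => simp only [den]; rw [h.2.eval_erase, setVar_erase h.1]
  | store a i e =>
    simp only [den]
    rw [h.2.2.1.eval_erase, h.2.2.2.eval_erase]
    have h9 : (s.erase Iv Ia).var 9 = s.var 9 := if_neg h.1
    rw [h9]
    split_ifs
    · refine State.ext' (fun y => rfl) fun b j => ?_
      simp only [State.erase, State.setArr_arr]
      have := h.2.1
      split_ifs <;> simp_all
    · rfl
  | seq p q ihp ihq => rw [den, ihp h.1, ihq h.2, den]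
  | ite e p q ihp ihq =>
    simp only [den]
    rw [h.1.eval_erase]
    split_ifs
    · exact ihp h.2.1 s
    · exact ihq h.2.2 s
  | loop x b p ih =>
    obtain ⟨hx, hb, hp⟩ := h
    rw [den, den]
    have h9 : (s.erase Iv Ia).var b = s.var b := if_neg hb
    rw [h9, setVar_erase hx]
    generalize s.var b = m
    generalize s.setVar x 0 = s'
    induction m generalizing s' with
    | zero => rfl
    | succ m ihm =>
      rw [Function.iterate_succ_apply, Function.iterate_succ_apply, ← ihm, ih hp, setVar_erase hx]
      congr 3
      exact congrArg (· + 1) (if_neg hx)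

end LProg

/-! ### Boolean expressions -/

/-- The expression that is nonzero if `e` is zero. -/
def Expr.not (e : Expr) : Expr := .sub (.const 1) e

/-- The expression that is nonzero if both `e` and `e'` are nonzero. -/
def Expr.and (e e' : Expr) : Expr := .not (.add (.not e) (.not e'))

/-- The expression that is nonzero if `e` and `e'` have the same value. -/
def Expr.eq (e e' : Expr) : Expr := .not (.add (.sub e e') (.sub e' e))

/-- The expression that is nonzero if the value of `e` is less than that of `e'`. -/
def Expr.lt (e e' : Expr) : Expr := .sub e' e

@[simp] theorem Expr.eval_not_eq_zero {e : Expr} {s : State} :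
    e.not.eval s = 0 ↔ e.eval s ≠ 0 := by
  simp only [Expr.not, eval]
  omega

@[simp] theorem Expr.eval_and_eq_zero {e e' : Expr} {s : State} :
    (e.and e').eval s = 0 ↔ ¬ (e.eval s ≠ 0 ∧ e'.eval s ≠ 0) := by
  simp only [Expr.and, Expr.not, eval]
  omega

@[simp] theorem Expr.eval_eq_eq_zero {e e' : Expr} {s : State} :
    (e.eq e').eval s = 0 ↔ e.eval s ≠ e'.eval s := by
  simp only [Expr.eq, Expr.not, eval]
  omega

@[simp] theorem Expr.eval_lt_eq_zero {e e' : Expr} {s : State} :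
    (e.lt e').eval s = 0 ↔ ¬ e.eval s < e'.eval s := by
  simp only [Expr.lt, eval]
  omega

/-- The programs of a list one after the other. -/
def LProg.seqs : List LProg → LProg
  | [] => .skip
  | p :: l => .seq p (seqs l)

theorem LProg.den_seqs_nil {s : State} : (LProg.seqs []).den s = s := rfl

theorem LProg.den_seqs_cons {p : LProg} {l : List LProg} {s : State} :
    (LProg.seqs (p :: l)).den s = (LProg.seqs l).den (p.den s) := rfl

attribute [irreducible] LProg.den

end RAM

namespace RAM

open SCCDeletion

/-! ### Searching the residual digraph -/

/-- The cell of block `a` whose address is in register `x`. -/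
abbrev Expr.ld (a x : ℕ) : Expr := .load a (.var x)

/-- The entry in row `x` and column `y` (both registers) of the matrix in block `a`; block `b`
holds the addresses of the rows. -/
abbrev Expr.ld2 (a b x y : ℕ) : Expr := .load a (.add (.load b (.var x)) (.var y))

/-- The data that the program computes in advance: registers `0` to `3` hold `n`, `k`,
`2 * n + 1` and `k + 1`, register `9` holds a bound on all addresses, and blocks `0`, `1`, `2`
hold the adjacency matrix and the row addresses of matrices of width `n` and `2 * n + 1`. -/
structure Base (adj : ℕ → ℕ → Prop) (n k : ℕ) (s : State) : Prop where
  var_zero : s.var 0 = n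
  var_one : s.var 1 = k
  var_two : s.var 2 = 2 * n + 1
  var_three : s.var 3 = k + 1
  var_nine : (2 * n + 1) * (2 * n + 1) ≤ s.var 9
  adj_iff : ∀ u < n, ∀ v < n, s.arr 0 (u * n + v) ≠ 0 ↔ adj u v
  row : ∀ u < n, s.arr 1 u = u * n
  row' : ∀ x < 2 * n + 1, s.arr 2 x = x * (2 * n + 1)

section

variable {adj : ℕ → ℕ → Prop} {n k : ℕ} {s s' : State}

theorem Base.congr (h : Base adj n k s) (hv : ∀ y < 10, s'.var y = s.var y)
    (ha : ∀ a < 3, s'.arr a = s.arr a) : Base adj n k s' where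
  var_zero := by rw [hv 0 (by omega), h.var_zero]
  var_one := by rw [hv 1 (by omega), h.var_one]
  var_two := by rw [hv 2 (by omega), h.var_two]
  var_three := by rw [hv 3 (by omega), h.var_three]
  var_nine := by rw [hv 9 (by omega)]; exact h.var_nine
  adj_iff := by rw [ha 0 (by omega)]; exact h.adj_iff
  row := by rw [ha 1 (by omega)]; exact h.row
  row' := by rw [ha 2 (by omega)]; exact h.row'

theorem Base.den (h : Base adj n k s) {p : LProg} (hp : p.WF 10)
    (ha : ∀ a < 3, ¬ p.WritesArr a) : Base adj n k (p.den s) :=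
  h.congr (fun _ hy => LProg.den_var (hp.not_writesVar hy) s) fun a h' => LProg.den_arr (ha a h') s

theorem Base.frame (h : Base adj n k s) {p : LProg} {x : ℕ} (hF : LProg.Frame p x s s')
    (hx : 10 ≤ x) (hp : p.WF 10) (ha : ∀ a < 3, ¬ p.WritesArr a) : Base adj n k s' :=
  h.congr (fun _ hy => hF.var _ (by omega) (hp.not_writesVar hy)) fun a h' => hF.arr a (ha a h')

theorem Base.lt_nine (h : Base adj n k s) {x : ℕ} (hx : x < 2 * n + 1) : x < s.var 9 := by
  have := h.var_nine
  nlinarith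

theorem lt_mul_of_lt {m x y : ℕ} (hx : x < m) (hy : y < m) : x * m + y < m * m := by
  nlinarith [Nat.mul_le_mul_right m hx]

end

/-- Backward search from the node in register `23` in the digraph whose matrix of width
`2 * n + 1` is in block `5`: labels in block `6`, pointers towards the target in block `7`. -/
def mark : LProg := .seqs [
  .loop 20 2 (.store 6 (.var 20) (.const 0)),
  .store 6 (.var 23) (.const 1),
  .loop 22 2 (.loop 20 2 (.loop 21 2
    (.ite (.and (.not (.ld 6 20)) (.and (.ld 6 21)
        (.and (.lt (.ld 6 21) (.add (.var 22) (.const 2))) (.ld2 5 2 20 21))))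
      (.seq (.store 6 (.var 20) (.add (.var 22) (.const 2))) (.store 7 (.var 20) (.var 21)))
      .skip)))]

theorem mark_wf : mark.WF 10 := by
  simp [mark, LProg.seqs, LProg.WF, LProg.WritesVar]

theorem mark_writesVar {y : ℕ} : mark.WritesVar y ↔ y = 20 ∨ y = 21 ∨ y = 22 := by
  simp [mark, LProg.seqs, LProg.WritesVar]
  tauto

theorem mark_writesArr {a : ℕ} : mark.WritesArr a ↔ a = 6 ∨ a = 7 := by
  simp [mark, LProg.seqs, LProg.WritesArr]

/-- What holds during round `r` of the backward search, where `lev₀` are the labels before the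
round: new labels are `r + 2`. -/
structure RoundInv (N : ℕ) (res : ℕ → ℕ → ℕ) (t r : ℕ) (lev₀ lev nxt : ℕ → ℕ) : Prop where
  target : lev t = 1
  le : ∀ x < N, lev x ≤ r + 2
  next : ∀ x < N, lev x ≠ 0 → x ≠ t →
    nxt x < N ∧ res x (nxt x) ≠ 0 ∧ lev (nxt x) ≠ 0 ∧ lev (nxt x) < lev x
  old : ∀ x < N, lev₀ x ≠ 0 → lev x = lev₀ x
  new : ∀ x < N, lev₀ x = 0 → lev x ≠ 0 → lev x = r + 2

/-- The backward search labels the nodes that reach the target. Labels increase along the rounds, so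
the pointers lead to the target; each round labels at least one new node or the search is complete,
whence as many rounds as there are nodes suffice. -/
theorem mark_spec {adj : ℕ → ℕ → Prop} {n k : ℕ} {s : State} (hs : Base adj n k s) {N : ℕ}
    (hN : N = 2 * n + 1) (ht : s.var 23 < N) :
    IsMarking N (fun x y => s.arr 5 (x * N + y)) (s.var 23) ((mark.den s).arr 6)
      ((mark.den s).arr 7) := by
  subst hN
  set N := 2 * n + 1 with hN
  set t := s.var 23 with htdef
  set res : ℕ → ℕ → ℕ := fun x y => s.arr 5 (x * N + y) with hres
  simp only [mark, LProg.den_seqs_cons, LProg.den_seqs_nil]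
  -- the initialization
  set s₁ := (LProg.loop 20 2 (.store 6 (.var 20) (.const 0))).den s with hs₁
  have h1 : ∀ x < N, s₁.arr 6 x = 0 := by
    refine LProg.den_loop (fun i s' => ∀ x < i, s'.arr 6 x = 0) hs.var_two
      (by simp [LProg.WritesVar])
      (by simp) fun i hi s' hx hF hP x hxi => ?_
    have h9 : i < s'.var 9 := by
      rw [hF.var 9 (by decide) (by simp [LProg.WritesVar])]
      exact hs.lt_nine hi
    rw [LProg.den_store (by simpa [Expr.eval, hx] using h9)]
    simp only [Expr.eval, hx, State.setVar_arr, State.setArr_arr]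
    split_ifs with h
    · rfl
    · exact hP x (by have : x ≠ i := fun e => h (by simp [e]); omega)
  have hb₁ : Base adj n k s₁ := hs.den (by simp [LProg.WF, LProg.WritesVar])
    (by simp [LProg.WritesArr]; omega)
  have h23 : s₁.var 23 = t := LProg.den_var (by simp [LProg.WritesVar]) s
  have h5₁ : s₁.arr 5 = s.arr 5 := LProg.den_arr (by simp [LProg.WritesArr]) s
  clear_value s₁
  rw [LProg.den_store (by simpa [Expr.eval, h23] using hb₁.lt_nine ht)]
  simp only [Expr.eval, h23]
  set s₂ := s₁.setArr 6 t 1 with hs₂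
  have hb₂ : Base adj n k s₂ := hb₁.congr (fun _ _ => rfl) fun a ha => by
    funext i
    simp only [hs₂, State.setArr_arr]
    rw [if_neg (by omega)]
  have h5₂ : s₂.arr 5 = s.arr 5 := by
    rw [← h5₁]
    funext i
    simp [hs₂, State.setArr_arr]
  have h2t : s₂.arr 6 t = 1 := by simp [hs₂, State.setArr_arr]
  have h2 : ∀ x < N, x ≠ t → s₂.arr 6 x = 0 := by
    intro x hx hxt
    simp only [hs₂, State.setArr_arr]
    rw [if_neg (by tauto), h1 x hx]
  clear_value s₂
  clear hs₁ h1 hb₁ h23 h5₁ hs₂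
  set inner : LProg := .ite (.and (.not (.ld 6 20)) (.and (.ld 6 21)
        (.and (.lt (.ld 6 21) (.add (.var 22) (.const 2))) (.ld2 5 2 20 21))))
      (.seq (.store 6 (.var 20) (.add (.var 22) (.const 2))) (.store 7 (.var 20) (.var 21)))
      .skip with hinner
  have hwv : ∀ y, ¬ inner.WritesVar y := by simp [hinner, LProg.WritesVar]
  have hwa : ∀ a, inner.WritesArr a ↔ a = 6 ∨ a = 7 := by simp [hinner, LProg.WritesArr]
  have hwf : inner.WF 10 := by simp [hinner, LProg.WF]
  -- one round
  have hround : ∀ (s' : State) (r : ℕ), Base adj n k s' → s'.arr 5 = s.arr 5 → s'.var 22 = r →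
      s'.arr 6 t = 1 → (∀ x < N, s'.arr 6 x ≤ r + 1) →
      (∀ x < N, s'.arr 6 x ≠ 0 → x ≠ t → s'.arr 7 x < N ∧ res x (s'.arr 7 x) ≠ 0 ∧
        s'.arr 6 (s'.arr 7 x) ≠ 0 ∧ s'.arr 6 (s'.arr 7 x) < s'.arr 6 x) →
      RoundInv N res t r (s'.arr 6) (((LProg.loop 20 2 (.loop 21 2 inner)).den s').arr 6)
        (((LProg.loop 20 2 (.loop 21 2 inner)).den s').arr 7) ∧
      ∀ x < N, ∀ y < N, res x y ≠ 0 → s'.arr 6 y ≠ 0 →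
        ((LProg.loop 20 2 (.loop 21 2 inner)).den s').arr 6 x ≠ 0 := by
    intro sr r hbr h5r h22r htr hler hnextr
    refine LProg.den_loop (b := 2) (fun i s' => RoundInv N res t r (sr.arr 6) (s'.arr 6) (s'.arr 7)
      ∧ ∀ x < i, ∀ y < N, res x y ≠ 0 → sr.arr 6 y ≠ 0 → s'.arr 6 x ≠ 0) hbr.var_two ?_ ?_ ?_
    · simp [LProg.WritesVar, hwv]
    · refine ⟨⟨htr, fun x hx => (hler x hx).trans (by omega), hnextr, fun _ _ _ => rfl,
        fun _ _ h1 h2 => absurd h1 h2⟩, by simp⟩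
    · intro i hi s' hx hF hP
      have hb' : Base adj n k s' := hbr.frame hF (by omega)
        (by simp [LProg.WF, hwv, hwf]) (by simp [LProg.WritesArr, hwa]; omega)
      have h5' : s'.arr 5 = s.arr 5 := by
        rw [hF.arr 5 (by simp [LProg.WritesArr, hwa]), h5r]
      have h22' : s'.var 22 = r := by
        rw [hF.var 22 (by decide) (by simp [LProg.WritesVar, hwv]), h22r]
      rw [State.setVar_arr]
      have := LProg.den_loop (x := 21) (b := 2) (p := inner) (s := s')
        (fun j s'' => RoundInv N res t r (sr.arr 6) (s''.arr 6) (s''.arr 7) ∧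
          (∀ x < i, ∀ y < N, res x y ≠ 0 → sr.arr 6 y ≠ 0 → s''.arr 6 x ≠ 0) ∧
          ∀ y < j, res i y ≠ 0 → sr.arr 6 y ≠ 0 → s''.arr 6 i ≠ 0) hb'.var_two (hwv _)
        ⟨hP.1, hP.2, by simp⟩ ?_
      · refine ⟨this.1, fun x hxi y hy h3 h4 => ?_⟩
        rcases Nat.lt_succ_iff_lt_or_eq.1 hxi with h | rfl
        · exact this.2.1 x h y hy h3 h4
        · exact this.2.2 y hy h3 h4
      · intro j hj s'' hx'' hF'' hP''
        have hb'' : Base adj n k s'' := hb'.frame hF'' (by omega) hwf (by simp [hwa]; omega)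
        have h20 : s''.var 20 = i := by rw [hF''.var 20 (by decide) (hwv _), hx]
        have h22 : s''.var 22 = r := by rw [hF''.var 22 (by decide) (hwv _), h22']
        have h5'' : s''.arr 5 = s.arr 5 := by rw [hF''.arr 5 (by simp [hwa]), h5']
        have hi9 := hb''.lt_nine hi
        rw [State.setVar_arr]
        obtain ⟨hinv, hd1, hd2⟩ := hP''
        simp only [hinner, LProg.den_ite, Expr.eval, h20, hx'', h22, ne_eq,
          Expr.eval_and_eq_zero, Expr.eval_not_eq_zero, Expr.eval_lt_eq_zero, not_not,
          hb''.row' i hi, h5'']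
        split_ifs with hcond
        · obtain ⟨hc1, hc2, hc3, hc4⟩ := hcond
          rw [LProg.den_seq, LProg.den_store (a := 6) (by simpa [Expr.eval, h20] using hi9),
            LProg.den_store (by simpa [Expr.eval, h20] using hi9)]
          simp only [Expr.eval, h20, hx'', h22, State.setArr_var]
          have e6 : ((s''.setArr 6 i (r + 2)).setArr 7 i j).arr 6 =
              Function.update (s''.arr 6) i (r + 2) := by
            funext z
            simp [State.setArr_arr, Function.update_apply]
          have e7 : ((s''.setArr 6 i (r + 2)).setArr 7 i j).arr 7 =
              Function.update (s''.arr 7) i j := by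
            funext z
            simp [State.setArr_arr, Function.update_apply]
          rw [e6, e7]
          have hit : i ≠ t := by
            rintro rfl
            rw [hinv.target] at hc1
            omega
          have hij : j ≠ i := by
            rintro rfl
            exact hc2 hc1
          refine ⟨⟨?_, ?_, ?_, ?_, ?_⟩, ?_, ?_⟩
          · rw [Function.update_of_ne hit.symm, hinv.target]
          · intro x hxN
            rw [Function.update_apply]
            split_ifs
            · exact le_rfl
            · exact hinv.le x hxN
          · intro x hxN hx0 hxt
            by_cases hxi : x = i
            · subst hxi
              rw [Function.update_self, Function.update_of_ne hij, Function.update_self]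
              exact ⟨hj, hc4, hc2, hc3⟩
            · rw [Function.update_of_ne hxi] at hx0
              obtain ⟨h3, h4, h5, h6⟩ := hinv.next x hxN hx0 hxt
              rw [Function.update_of_ne hxi, Function.update_of_ne hxi,
                Function.update_of_ne (fun h : s''.arr 7 x = i => h5 (by rw [h]; exact hc1))]
              exact ⟨h3, h4, h5, h6⟩
          · intro x hxN hx0
            rw [Function.update_of_ne, hinv.old x hxN hx0]
            rintro rfl
            rw [hinv.old x hxN hx0] at hc1
            exact hx0 hc1
          · intro x hxN hx0 hx1
            by_cases hxi : x = i
            · rw [hxi, Function.update_self]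
            · rw [Function.update_of_ne hxi] at hx1 ⊢
              exact hinv.new x hxN hx0 hx1
          · intro x hxi y hy h3 h4
            rw [Function.update_of_ne (by omega)]
            exact hd1 x hxi y hy h3 h4
          · intro y hy h3 h4
            rw [Function.update_self]
            omega
        · rw [LProg.den_skip]
          refine ⟨hinv, hd1, fun y hy h3 h4 => ?_⟩
          rcases Nat.lt_succ_iff_lt_or_eq.1 hy with h | rfl
          · exact hd2 y h h3 h4
          · intro h0
            refine hcond ⟨h0, ?_, ?_, h3⟩
            · rw [hinv.old y hj h4]
              exact h4
            · rw [hinv.old y hj h4]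
              have := hler y hj
              omega
  -- all rounds
  have hall := LProg.den_loop (x := 22) (b := 2) (p := .loop 20 2 (.loop 21 2 inner)) (s := s₂)
    (fun r s' => s'.arr 6 t = 1 ∧ (∀ x < N, s'.arr 6 x ≤ r + 1) ∧
      (∀ x < N, s'.arr 6 x ≠ 0 → x ≠ t → s'.arr 7 x < N ∧ res x (s'.arr 7 x) ≠ 0 ∧
        s'.arr 6 (s'.arr 7 x) ≠ 0 ∧ s'.arr 6 (s'.arr 7 x) < s'.arr 6 x) ∧
      ((∀ x < N, ∀ y < N, res x y ≠ 0 → s'.arr 6 y ≠ 0 → s'.arr 6 x ≠ 0) ∨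
        r + 1 ≤ ((Finset.range N).filter fun x => s'.arr 6 x ≠ 0).card)) hb₂.var_two ?_ ?_ ?_
  · obtain ⟨h3, h4, h5, h6⟩ := hall
    refine ⟨h3, h4, h5, h6.resolve_right fun h => ?_⟩
    have := (Finset.card_filter_le (Finset.range N) fun x =>
      ((LProg.loop 22 2 (.loop 20 2 (.loop 21 2 inner))).den s₂).arr 6 x ≠ 0)
    rw [Finset.card_range] at this
    omega
  · simp [LProg.WritesVar, hwv]
  · simp only [State.setVar_arr]
    refine ⟨h2t, fun x hx => ?_, fun x hx h0 hxt => absurd (h2 x hx hxt) h0, .inr ?_⟩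
    · by_cases hxt : x = t
      · rw [hxt, h2t]
      · rw [h2 x hx hxt]
        omega
    · rw [Nat.zero_add, Nat.one_le_iff_ne_zero, ← Nat.pos_iff_ne_zero, Finset.card_pos]
      exact ⟨t, Finset.mem_filter.2 ⟨Finset.mem_range.2 ht, by rw [h2t]; omega⟩⟩
  · intro r hr s' hx hF ⟨hP1, hP2, hP3, hP4⟩
    have hb' : Base adj n k s' := hb₂.frame hF (by omega)
      (by simp [LProg.WF, hwv, hwf, LProg.WritesVar]) (by simp [LProg.WritesArr, hwa]; omega)
    have h5' : s'.arr 5 = s.arr 5 := by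
      rw [hF.arr 5 (by simp [LProg.WritesArr, hwa]), h5₂]
    obtain ⟨hinv, hdone⟩ := hround s' r hb' h5' hx hP1 hP2 hP3
    rw [State.setVar_arr]
    set lev := ((LProg.loop 20 2 (.loop 21 2 inner)).den s').arr 6 with hlev
    refine ⟨hinv.target, hinv.le, hinv.next, ?_⟩
    by_cases hcl : ∀ x < N, ∀ y < N, res x y ≠ 0 → s'.arr 6 y ≠ 0 → s'.arr 6 x ≠ 0
    · left
      have hsame : ∀ x < N, lev x ≠ 0 → s'.arr 6 x ≠ 0 := by
        intro x hxN hx0 h0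
        obtain ⟨h3, h4, h5, h6⟩ := hinv.next x hxN hx0 (by rintro rfl; omega)
        refine hcl x hxN _ h3 h4 (fun h7 => ?_) h0
        rw [hinv.new _ h3 h7 h5, hinv.new x hxN h0 hx0] at h6
        omega
      exact fun x hxN y hyN h3 h4 => hdone x hxN y hyN h3 (hsame y hyN h4)
    · right
      have hcard := hP4.resolve_left hcl
      push Not at hcl
      obtain ⟨x, hxN, y, hyN, h3, h4, h5⟩ := hcl
      refine hcard.trans_lt (Finset.card_lt_card ⟨fun z hz => ?_, fun hsub => ?_⟩)
      · obtain ⟨hzN, hz0⟩ := Finset.mem_filter.1 hz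
        refine Finset.mem_filter.2 ⟨hzN, ?_⟩
        rw [hinv.old z (Finset.mem_range.1 hzN) hz0]
        exact hz0
      · exact (Finset.mem_filter.1 (hsub (Finset.mem_filter.2
          ⟨Finset.mem_range.2 hxN, hdone x hxN y hyN h3 h4⟩))).2 h5

end RAM

namespace RAM

open SCCDeletion Relation

/-! ### Filling arrays and matrices -/

namespace LProg

/-- A loop whose body writes the cell `i` of block `a` in its `i`-th round. -/
theorem den_fill {x b a m : ℕ} {q : LProg} {s : State} (f : ℕ → ℕ) (hb : s.var b = m)
    (hx : ¬ q.WritesVar x) (ha : ∀ c, q.WritesArr c → c = a)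
    (hq : ∀ i < m, ∀ s', s'.var x = i → (∀ z, z ≠ x → ¬ q.WritesVar z → s'.var z = s.var z) →
      (∀ c, c ≠ a → s'.arr c = s.arr c) →
      (q.den s').arr a = Function.update (s'.arr a) i (f i)) :
    ((loop x b q).den s).arr a = fun p => if p < m then f p else s.arr a p := by
  refine den_loop (fun i s' => s'.arr a = fun p => if p < i then f p else s.arr a p) hb hx ?_ ?_
  · simp
  · intro i hi s' h1 hF hP
    rw [State.setVar_arr, hq i hi s' h1 hF.var (fun c hc => hF.arr c fun h => hc (ha c h)), hP]
    funext p
    rw [Function.update_apply]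
    rcases lt_trichotomy p i with h | rfl | h
    · rw [if_neg (by omega), if_pos h, if_pos (by omega)]
    · rw [if_pos rfl, if_pos (by omega)]
    · rw [if_neg (by omega), if_neg (by omega), if_neg (by omega)]

/-- Two nested loops whose body writes the cell `i * w + j` of block `a` in round `i`, `j`. -/
theorem den_fill₂ {x y b a m w : ℕ} {q : LProg} {s : State} (f : ℕ → ℕ → ℕ) (hb : s.var b = m)
    (hx : ¬ q.WritesVar x) (hy : ¬ q.WritesVar y) (hxy : x ≠ y) (hbx : b ≠ x) (hby : b ≠ y)
    (hbq : ¬ q.WritesVar b) (ha : ∀ c, q.WritesArr c → c = a) (hmw : m ≤ w)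
    (hq : ∀ i < m, ∀ j < m, ∀ s', s'.var x = i → s'.var y = j →
      (∀ z, z ≠ x → z ≠ y → ¬ q.WritesVar z → s'.var z = s.var z) →
      (∀ c, c ≠ a → s'.arr c = s.arr c) →
      (q.den s').arr a = Function.update (s'.arr a) (i * w + j) (f i j)) :
    ∀ i < m, ∀ j < m, ((loop x b (loop y b q)).den s).arr a (i * w + j) = f i j := by
  refine den_loop (fun i s' => ∀ i' < i, ∀ j < m, s'.arr a (i' * w + j) = f i' j) hb ?_ ?_ ?_
  · simp [WritesVar, hx, hxy]
  · simp
  · intro i hi s' h1 hF hP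
    rw [State.setVar_arr]
    have := den_loop (x := y) (b := b) (p := q) (s := s') (m := m)
      (fun j s'' => (∀ i' < i, ∀ j < m, s''.arr a (i' * w + j) = f i' j) ∧
        ∀ j' < j, s''.arr a (i * w + j') = f i j')
      (by rw [hF.var b hbx (by simp [WritesVar, hby, hbq]), hb]) hy ⟨hP, by simp⟩ ?_
    · intro i' hi' j hj
      rcases Nat.lt_succ_iff_lt_or_eq.1 hi' with h | rfl
      · exact this.1 i' h j hj
      · exact this.2 j hj
    · intro j hj s'' h2 hF' hP'
      rw [State.setVar_arr, hq i hi j hj s'' (by rw [hF'.var x hxy hx, h1]) h2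
        (fun z hzx hzy hz => by
          rw [hF'.var z hzy hz, hF.var z hzx (by simp [WritesVar, hzy, hz])])
        (fun c hc => by
          rw [hF'.arr c fun h => hc (ha c h), hF.arr c fun h => hc (ha c h)])]
      refine ⟨fun i' hi' j' hj' => ?_, fun j' hj' => ?_⟩
      · rw [Function.update_of_ne, hP'.1 i' hi' j' hj']
        have := Nat.mul_le_mul_right w (Nat.succ_le_of_lt hi')
        rw [Nat.succ_mul] at this
        omega
      · rcases Nat.lt_succ_iff_lt_or_eq.1 hj' with h | rfl
        · rw [Function.update_of_ne (by omega), hP'.2 j' h]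
        · rw [Function.update_self]

/-- Cells that the nested loops of `den_fill₂` do not reach keep their values. -/
theorem den_fill₂_of_ne {x y b a m w p : ℕ} {q : LProg} {s : State} (f : ℕ → ℕ → ℕ)
    (hb : s.var b = m) (hx : ¬ q.WritesVar x) (hy : ¬ q.WritesVar y) (hxy : x ≠ y) (hbx : b ≠ x)
    (hby : b ≠ y) (hbq : ¬ q.WritesVar b) (ha : ∀ c, q.WritesArr c → c = a)
    (hq : ∀ i < m, ∀ j < m, ∀ s', s'.var x = i → s'.var y = j →
      (∀ z, z ≠ x → z ≠ y → ¬ q.WritesVar z → s'.var z = s.var z) →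
      (∀ c, c ≠ a → s'.arr c = s.arr c) →
      (q.den s').arr a = Function.update (s'.arr a) (i * w + j) (f i j))
    (hp : ∀ i < m, ∀ j < m, p ≠ i * w + j) :
    ((loop x b (loop y b q)).den s).arr a p = s.arr a p := by
  refine den_loop (fun _ s' => s'.arr a p = s.arr a p) hb ?_ rfl ?_
  · simp [WritesVar, hx, hxy]
  · intro i hi s' h1 hF hP
    rw [State.setVar_arr]
    refine den_loop (x := y) (b := b) (p := q) (s := s') (m := m)
      (fun _ s'' => s''.arr a p = s.arr a p)
      (by rw [hF.var b hbx (by simp [WritesVar, hby, hbq]), hb]) hy hP ?_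
    intro j hj s'' h2 hF' hP'
    rw [State.setVar_arr, hq i hi j hj s'' (by rw [hF'.var x hxy hx, h1]) h2
      (fun z hzx hzy hz => by
        rw [hF'.var z hzy hz, hF.var z hzx (by simp [WritesVar, hzy, hz])])
      (fun c hc => by
        rw [hF'.arr c fun h => hc (ha c h), hF.arr c fun h => hc (ha c h)]),
      Function.update_of_ne (hp i hi j hj), hP']

theorem den_store_arr {a : ℕ} {i e : Expr} {s : State} (h : i.eval s < s.var 9) :
    ((store a i e).den s).arr a = Function.update (s.arr a) (i.eval s) (e.eval s) := by
  rw [den_store h]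
  funext j
  simp [State.setArr_arr, Function.update_apply]

end LProg

/-- The set of the numbers `v < n` whose cell in block `a` is not zero. -/
def mask (n : ℕ) (s : State) (a : ℕ) : Finset ℕ := (Finset.range n).filter fun v => s.arr a v ≠ 0

theorem mem_mask {n a v : ℕ} {s : State} : v ∈ mask n s a ↔ v < n ∧ s.arr a v ≠ 0 := by
  simp [mask]

theorem mask_congr {n a a' : ℕ} {s s' : State}
    (h : ∀ v < n, s.arr a v ≠ 0 ↔ s'.arr a' v ≠ 0) : mask n s a = mask n s' a' := by
  ext v
  simp only [mem_mask]
  exact and_congr_right fun hv => h v hv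

/-! ### The reachability matrix -/

/-- Computes in block `3` the reachability matrix of the digraph induced by the set in
block `8`: row `u` marks the vertices that reach `u`. -/
def closure : LProg := .seqs [
  .loop 20 2 (.loop 21 2 (.store 5 (.add (.ld 2 20) (.var 21)) (.const 0))),
  .loop 25 0 (.loop 26 0 (.store 5 (.add (.ld 2 25) (.var 26))
    (.and (.ld 8 25) (.and (.ld 8 26) (.ld2 0 1 25 26))))),
  .loop 24 0 (.seqs [.assign 23 (.var 24), mark,
    .loop 25 0 (.store 3 (.add (.ld 1 24) (.var 25)) (.ld 6 25))])]

theorem closure_wf : closure.WF 10 := by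
  simp [closure, LProg.seqs, LProg.WF, LProg.WritesVar, mark_wf, mark_writesVar]

theorem closure_writesVar {y : ℕ} (h : closure.WritesVar y) : 20 ≤ y ∧ y ≤ 26 := by
  simp [closure, LProg.seqs, LProg.WritesVar, mark_writesVar] at h
  omega

theorem closure_writesArr {a : ℕ} :
    closure.WritesArr a ↔ a = 3 ∨ a = 5 ∨ a = 6 ∨ a = 7 := by
  simp [closure, LProg.seqs, LProg.WritesArr, mark_writesArr]
  tauto

/-- The matrix that `closure` computes is the reachability relation of the induced digraph. -/
theorem closure_spec {adj : ℕ → ℕ → Prop} {n k : ℕ} {s : State} (hs : Base adj n k s) :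
    ∀ u < n, ∀ v < n, (closure.den s).arr 3 (u * n + v) ≠ 0 ↔ Conn adj (mask n s 8) v u := by
  set G := mask n s 8 with hG
  set N := 2 * n + 1 with hN
  simp only [closure, LProg.den_seqs_cons, LProg.den_seqs_nil]
  set p₁ : LProg := .loop 20 2 (.loop 21 2 (.store 5 (.add (.ld 2 20) (.var 21)) (.const 0)))
  set s₁ := p₁.den s with hs₁
  have hb₁ : Base adj n k s₁ := hs.den (by simp [p₁, LProg.WF, LProg.WritesVar])
    (by simp [p₁, LProg.WritesArr]; omega)
  have h8₁ : s₁.arr 8 = s.arr 8 := LProg.den_arr (by simp [p₁, LProg.WritesArr]) s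
  have h5₁ : ∀ i < N, ∀ j < N, s₁.arr 5 (i * N + j) = 0 := by
    refine LProg.den_fill₂ (fun _ _ => 0) hs.var_two (by simp [LProg.WritesVar])
      (by simp [LProg.WritesVar]) (by decide) (by decide) (by decide) (by simp [LProg.WritesVar])
      (by simp [LProg.WritesArr]) le_rfl ?_
    intro i hi j hj s' h1 h2 h3 h4
    rw [LProg.den_store_arr]
    · simp only [Expr.eval, h1, h2, h4 2 (by decide), hs.row' i hi]
      rfl
    · simp only [Expr.eval, h1, h2, h4 2 (by decide), hs.row' i hi,
        h3 9 (by decide) (by decide) (by simp [LProg.WritesVar])]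
      exact (lt_mul_of_lt hi hj).trans_le hs.var_nine
  clear_value s₁
  set p₂ : LProg := .loop 25 0 (.loop 26 0 (.store 5 (.add (.ld 2 25) (.var 26))
    (.and (.ld 8 25) (.and (.ld 8 26) (.ld2 0 1 25 26)))))
  set s₂ := p₂.den s₁ with hs₂
  have hb₂ : Base adj n k s₂ := hb₁.den (by simp [p₂, LProg.WF, LProg.WritesVar])
    (by simp [p₂, LProg.WritesArr]; omega)
  have hq : ∀ i < n, ∀ j < n, ∀ s' : State, s'.var 25 = i → s'.var 26 = j →
      (∀ z, z ≠ 25 → z ≠ 26 → ¬ (LProg.store 5 (.add (.ld 2 25) (.var 26))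
        (.and (.ld 8 25) (.and (.ld 8 26) (.ld2 0 1 25 26)))).WritesVar z → s'.var z = s₁.var z) →
      (∀ c, c ≠ 5 → s'.arr c = s₁.arr c) →
      ((LProg.store 5 (.add (.ld 2 25) (.var 26))
        (.and (.ld 8 25) (.and (.ld 8 26) (.ld2 0 1 25 26)))).den s').arr 5 =
      Function.update (s'.arr 5) (i * N + j)
        ((fun i j => (Expr.and (.ld 8 25) (.and (.ld 8 26) (.ld2 0 1 25 26))).eval
          ((s₁.setVar 25 i).setVar 26 j)) i j) := by
    intro i hi j hj s' h1 h2 h3 h4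
    rw [LProg.den_store_arr]
    · simp only [Expr.and, Expr.not, Expr.eval, h1, h2, h4 2 (by decide), hb₁.row' i (by omega),
        h4 8 (by decide), h4 1 (by decide), h4 0 (by decide), State.setVar_arr, State.setVar_var]
      simp [hN]
    · simp only [Expr.eval, h1, h2, h4 2 (by decide), hb₁.row' i (by omega),
        h3 9 (by decide) (by decide) (by simp [LProg.WritesVar])]
      exact (lt_mul_of_lt (by omega) (by omega)).trans_le hb₁.var_nine
  have h5₂ : ∀ i < N, ∀ j < N, s₂.arr 5 (i * N + j) ≠ 0 ↔ adj i j ∧ i ∈ G ∧ j ∈ G := by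
    intro i hi j hj
    by_cases hij : i < n ∧ j < n
    · rw [LProg.den_fill₂ _ hb₁.var_zero (by simp [LProg.WritesVar])
        (by simp [LProg.WritesVar]) (by decide) (by decide) (by decide)
        (by simp [LProg.WritesVar]) (by simp [LProg.WritesArr]) (by omega) hq i hij.1 j hij.2]
      have hrow := hb₁.row i hij.1
      have hadj := hb₁.adj_iff i hij.1 j hij.2
      simp only [hG, mem_mask]
      simp [Expr.eval, h8₁, hrow, hij]
      rw [← hadj]
      tauto
    · rw [LProg.den_fill₂_of_ne _ hb₁.var_zero (by simp [LProg.WritesVar])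
        (by simp [LProg.WritesVar]) (by decide) (by decide) (by decide)
        (by simp [LProg.WritesVar]) (by simp [LProg.WritesArr]) hq, h5₁ i hi j hj]
      · simp only [ne_eq, not_true_eq_false, false_iff, not_and, hG, mem_mask]
        tauto
      · intro i' hi' j' hj' heq
        have h1 : i = i' := by
          have := congrArg (· / N) heq
          simpa [Nat.add_comm (_ * N), Nat.add_mul_div_right _ _ (show 0 < N by omega),
            Nat.div_eq_of_lt hj, Nat.div_eq_of_lt (show j' < N by omega)] using this
        subst h1
        exact hij ⟨hi', by omega⟩
  clear_value s₂
  clear hq hs₁ hs₂ h5₁ h8₁ hb₁ p₁ p₂ s₁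
  -- the loop over the targets
  refine LProg.den_loop (fun c s' => ∀ u < c, ∀ v < n, s'.arr 3 (u * n + v) ≠ 0 ↔ Conn adj G v u)
    hb₂.var_zero (by simp [LProg.seqs, LProg.WritesVar, mark_writesVar]) (by simp) ?_
  intro c hc s' hx hF hP
  have hb' : Base adj n k s' := hb₂.frame hF (by omega)
    (by simp [LProg.seqs, LProg.WF, LProg.WritesVar, mark_wf])
    (by simp [LProg.seqs, LProg.WritesArr, mark_writesArr]; omega)
  have h5' : s'.arr 5 = s₂.arr 5 :=
    hF.arr 5 (by simp [LProg.seqs, LProg.WritesArr, mark_writesArr])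
  simp only [State.setVar_arr, LProg.den_seqs_cons, LProg.den_seqs_nil, LProg.den_assign,
    Expr.eval, hx]
  set s₃ := s'.setVar 23 c with hs₃
  have hb₃ : Base adj n k s₃ := hb'.congr
    (fun y hy => by simp only [hs₃, State.setVar_var]; rw [if_neg (by omega)]) fun _ _ => rfl
  have h23 : s₃.var 23 = c := by simp [hs₃]
  have hmark := mark_spec hb₃ rfl (show s₃.var 23 < 2 * n + 1 by rw [h23]; omega)
  have hb₄ : Base adj n k (mark.den s₃) := hb₃.den mark_wf (by simp [mark_writesArr]; omega)
  have h24 : (mark.den s₃).var 24 = c := by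
    rw [LProg.den_var (by simp [mark_writesVar])]
    simp [hs₃, hx]
  have h3 : (mark.den s₃).arr 3 = s'.arr 3 := LProg.den_arr (by simp [mark_writesArr]) s₃
  rw [h23] at hmark
  have hlev : ∀ v < n, (mark.den s₃).arr 6 v ≠ 0 ↔ Conn adj G v c := by
    intro v hv
    rw [hmark.lev_ne_zero_iff (show v < 2 * n + 1 by omega)]
    have hrel : (fun x y => x < 2 * n + 1 ∧ y < 2 * n + 1 ∧ s₃.arr 5 (x * (2 * n + 1) + y) ≠ 0) =
        fun x y => adj x y ∧ x ∈ G ∧ y ∈ G := by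
      funext x y
      rw [hs₃, State.setVar_arr, h5']
      refine propext ⟨fun ⟨h1, h2, h3⟩ => (h5₂ x h1 y h2).1 h3, fun h => ?_⟩
      have h1 := (mem_mask.1 h.2.1).1
      have h2 := (mem_mask.1 h.2.2).1
      exact ⟨by omega, by omega, (h5₂ x (by omega) y (by omega)).2 h⟩
    rw [hrel]
    rfl
  generalize mark.den s₃ = s₄ at hmark hb₄ h24 h3 hlev
  have := LProg.den_loop (x := 25) (b := 0) (m := n)
    (p := .store 3 (.add (.ld 1 24) (.var 25)) (.ld 6 25)) (s := s₄)
    (fun j s'' => (∀ u < c, ∀ v < n, s''.arr 3 (u * n + v) ≠ 0 ↔ Conn adj G v u) ∧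
      ∀ v < j, s''.arr 3 (c * n + v) ≠ 0 ↔ Conn adj G v c) hb₄.var_zero
    (by simp [LProg.WritesVar]) ⟨by rw [State.setVar_arr, h3]; exact hP, by simp⟩ ?_
  · intro u hu v hv
    rcases Nat.lt_succ_iff_lt_or_eq.1 hu with h | rfl
    · exact this.1 u h v hv
    · exact this.2 v hv
  · intro j hj s₅ hx₅ hF₅ hP₅
    have hb₅ : Base adj n k s₅ := hb₄.frame hF₅ (by omega) (by simp [LProg.WF])
      (by simp [LProg.WritesArr]; omega)
    have h24₅ : s₅.var 24 = c := by
      rw [hF₅.var 24 (by decide) (by simp [LProg.WritesVar]), h24]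
    rw [State.setVar_arr, LProg.den_store_arr]
    · simp only [Expr.eval, h24₅, hx₅, hb₅.row c hc, hF₅.arr 6 (by simp [LProg.WritesArr])]
      refine ⟨fun u hu v hv => ?_, fun v hv => ?_⟩
      · rw [Function.update_of_ne]
        · exact hP₅.1 u hu v hv
        · have := Nat.mul_le_mul_right n (Nat.succ_le_of_lt hu)
          rw [Nat.succ_mul] at this
          omega
      · rcases Nat.lt_succ_iff_lt_or_eq.1 hv with h | rfl
        · rw [Function.update_of_ne (by omega)]
          exact hP₅.2 v h
        · rw [Function.update_self]
          exact hlev v hj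
    · simp only [Expr.eval, h24₅, hx₅, hb₅.row c hc]
      refine (lt_mul_of_lt hc hj).trans_le (le_trans ?_ hb₅.var_nine)
      exact Nat.mul_le_mul (by omega) (by omega)

end RAM

namespace SCCDeletion

/-! ### Copies of the graphs of the family -/

/-- A root of `H`, that is, a vertex that reaches all vertices (if there is one). -/
noncomputable def rootOf (H : FinDigraph) : ℕ := by
  classical
  exact if h : ∃ r : Fin H.1, ∀ v, Reach H.2 r v then h.choose else 0

theorem rootOf_spec {H : FinDigraph} (h : IsRooted H.2) :
    ∃ r : Fin H.1, rootOf H = r ∧ ∀ v, Reach H.2 r v := by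
  obtain ⟨T, r, hT, -, -, hr⟩ := h
  have h : ∃ r : Fin H.1, ∀ v, Reach H.2 r v :=
    ⟨r, fun v => Relation.ReflTransGen.mono (fun _ _ => @hT _ _) _ _ (hr v)⟩
  exact ⟨h.choose, by rw [rootOf, dif_pos h], h.choose_spec⟩

/-- The map `f`, restricted to the numbers below `H.1`, is an embedding of `H` into the digraph
`adj` on the numbers below `n`. -/
structure IsCopy (adj : ℕ → ℕ → Prop) (n : ℕ) (H : FinDigraph) (f : ℕ → ℕ) : Prop where
  lt : ∀ i < H.1, f i < n
  inj : ∀ i < H.1, ∀ j < H.1, i ≠ j → f i ≠ f j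
  arc : ∀ i j : Fin H.1, H.2.Adj i j → adj (f i) (f j)

/-- The copies of the graphs of the family, as patterns. -/
def copyPatterns (F : Finset FinDigraph) (adj : ℕ → ℕ → Prop) (n : ℕ) : Set (ℕ × Finset ℕ) :=
  {p | ∃ H ∈ F, ∃ f, IsCopy adj n H f ∧ p = (f (rootOf H), (Finset.range H.1).image f)}

theorem rootedPatterns_copyPatterns {F : Finset FinDigraph} (hF : ∀ H ∈ F, IsRooted H.2)
    (adj : ℕ → ℕ → Prop) (n : ℕ) : RootedPatterns adj (copyPatterns F adj n) := by
  rintro p ⟨H, hH, f, hf, rfl⟩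
  obtain ⟨r, hr, hreach⟩ := rootOf_spec (hF H hH)
  have hmem : ∀ i : Fin H.1, f i ∈ (Finset.range H.1).image f := fun i =>
    Finset.mem_image_of_mem f (Finset.mem_range.2 i.2)
  refine ⟨by rw [hr]; exact hmem r, fun u hu => ?_⟩
  obtain ⟨i, hi, rfl⟩ := Finset.mem_image.1 hu
  have := hreach ⟨i, Finset.mem_range.1 hi⟩
  rw [hr]
  exact Relation.ReflTransGen.lift (fun i : Fin H.1 => f i)
    (fun x y hxy => ⟨hf.arc x y hxy, hmem x, hmem y⟩) _ _ this

end SCCDeletion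

namespace RAM

open SCCDeletion

/-- The expression that is nonzero if all expressions of the list are nonzero. -/
def Expr.all : List Expr → Expr
  | [] => .const 1
  | e :: l => .and e (all l)

theorem Expr.eval_all_ne_zero {l : List Expr} {s : State} :
    (Expr.all l).eval s ≠ 0 ↔ ∀ e ∈ l, e.eval s ≠ 0 := by
  induction l with
  | nil => simp [all, eval]
  | cons e l ih =>
    rw [all, ne_eq, eval_and_eq_zero, not_not, ih]
    simp

theorem Expr.avoids_not {Iv Ia : Finset ℕ} {e : Expr} :
    e.not.Avoids Iv Ia ↔ e.Avoids Iv Ia := by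
  simp [Expr.not, Avoids]

theorem Expr.avoids_and {Iv Ia : Finset ℕ} {e e' : Expr} :
    (e.and e').Avoids Iv Ia ↔ e.Avoids Iv Ia ∧ e'.Avoids Iv Ia := by
  simp [Expr.and, Expr.not, Avoids]

theorem Expr.avoids_eq {Iv Ia : Finset ℕ} {e e' : Expr} :
    (e.eq e').Avoids Iv Ia ↔ e.Avoids Iv Ia ∧ e'.Avoids Iv Ia := by
  simp only [Expr.eq, Expr.not, Avoids]
  tauto

theorem Expr.avoids_lt {Iv Ia : Finset ℕ} {e e' : Expr} :
    (e.lt e').Avoids Iv Ia ↔ e'.Avoids Iv Ia ∧ e.Avoids Iv Ia := Iff.rfl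

theorem Expr.avoids_all {Iv Ia : Finset ℕ} {l : List Expr} :
    (Expr.all l).Avoids Iv Ia ↔ ∀ e ∈ l, e.Avoids Iv Ia := by
  induction l with
  | nil => simp [all, Avoids]
  | cons e l ih => simp [all, avoids_and, ih]

namespace LProg

/-! ### Sequences and nested loops -/

section

variable {l : List LProg}

theorem writesVar_seqs {y : ℕ} : (seqs l).WritesVar y ↔ ∃ p ∈ l, p.WritesVar y := by
  induction l with
  | nil => simp [seqs, WritesVar]
  | cons p l ih => simp [seqs, WritesVar, ih]

theorem writesArr_seqs {a : ℕ} : (seqs l).WritesArr a ↔ ∃ p ∈ l, p.WritesArr a := by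
  induction l with
  | nil => simp [seqs, WritesArr]
  | cons p l ih => simp [seqs, WritesArr, ih]

theorem wf_seqs {θ : ℕ} : (seqs l).WF θ ↔ ∀ p ∈ l, p.WF θ := by
  induction l with
  | nil => simp [seqs, WF]
  | cons p l ih => simp [seqs, WF, ih]

theorem isBound_seqs {b : ℕ} : (seqs l).IsBound b ↔ ∃ p ∈ l, p.IsBound b := by
  induction l with
  | nil => simp [seqs, IsBound]
  | cons p l ih => simp [seqs, IsBound, ih]

theorem avoids_seqs {Iv Ia : Finset ℕ} : (seqs l).Avoids Iv Ia ↔ ∀ p ∈ l, p.Avoids Iv Ia := by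
  induction l with
  | nil => simp [seqs, Avoids]
  | cons p l ih => simp [seqs, Avoids, ih]

theorem depth_seqs_le {d : ℕ} : (seqs l).depth ≤ d ↔ ∀ p ∈ l, p.depth ≤ d := by
  induction l with
  | nil => simp [seqs, depth]
  | cons p l ih => simp [seqs, depth, ih]

theorem den_seqs_of_forall (I : State → Prop) (h : ∀ p ∈ l, ∀ s, I s → I (p.den s)) {s : State}
    (hs : I s) : I ((seqs l).den s) := by
  induction l generalizing s with
  | nil => rwa [den_seqs_nil]
  | cons p l ih =>
    rw [den_seqs_cons]
    exact ih (fun q hq => h q (List.mem_cons_of_mem _ hq)) (h p List.mem_cons_self s hs)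

/-- If one program of a list establishes `Q` and all keep it, `Q` holds in the end. -/
theorem den_seqs_of_mem (I Q : State → Prop) (h : ∀ p ∈ l, ∀ s, I s → I (p.den s))
    (h' : ∀ p ∈ l, ∀ s, I s → Q s → Q (p.den s)) {p : LProg} (hp : p ∈ l)
    (hQ : ∀ s, I s → Q (p.den s)) {s : State} (hs : I s) : Q ((seqs l).den s) := by
  induction l generalizing s with
  | nil => cases hp
  | cons q l ih =>
    rw [den_seqs_cons]
    have hI : I (q.den s) := h q List.mem_cons_self s hs
    rcases List.mem_cons.1 hp with rfl | hp
    · exact (den_seqs_of_forall (fun s => I s ∧ Q s) (fun p hp s hs =>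
        ⟨h p (List.mem_cons_of_mem _ hp) s hs.1, h' p (List.mem_cons_of_mem _ hp) s hs.1 hs.2⟩)
        ⟨hI, hQ s hs⟩).2
    · exact ih (fun q hq => h q (List.mem_cons_of_mem _ hq))
        (fun q hq => h' q (List.mem_cons_of_mem _ hq)) hp hI

end

/-- Nested loops over the numbers below the value of register `0`, one loop for each variable
of the list. -/
def nest : List ℕ → LProg → LProg
  | [], p => p
  | x :: l, p => .loop x 0 (nest l p)

section

variable {l : List ℕ} {p : LProg}

theorem writesVar_nest {y : ℕ} : (nest l p).WritesVar y ↔ y ∈ l ∨ p.WritesVar y := by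
  induction l with
  | nil => simp [nest]
  | cons x l ih => simp [nest, WritesVar, ih, or_assoc]

theorem writesArr_nest {a : ℕ} : (nest l p).WritesArr a ↔ p.WritesArr a := by
  induction l with
  | nil => simp [nest]
  | cons x l ih => simp [nest, WritesArr, ih]

theorem wf_nest {θ : ℕ} (hθ : 0 < θ) (hl : ∀ x ∈ l, θ ≤ x) (hnd : l.Nodup)
    (hp : p.WF θ) (hlp : ∀ x ∈ l, ¬ p.WritesVar x) : (nest l p).WF θ := by
  induction l with
  | nil => exact hp
  | cons x l ih =>
    rw [List.nodup_cons] at hnd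
    refine ⟨hl x List.mem_cons_self, hθ, ?_,
      ih (fun y hy => hl y (List.mem_cons_of_mem _ hy)) hnd.2
        fun y hy => hlp y (List.mem_cons_of_mem _ hy)⟩
    rw [writesVar_nest, not_or]
    exact ⟨hnd.1, hlp x List.mem_cons_self⟩

theorem isBound_nest {b : ℕ} (h : (nest l p).IsBound b) : b = 0 ∨ p.IsBound b := by
  induction l with
  | nil => exact .inr h
  | cons x l ih => exact h.elim .inl ih

theorem avoids_nest {Iv Ia : Finset ℕ} (h0 : 0 ∉ Iv) (hl : ∀ x ∈ l, x ∉ Iv)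
    (hp : p.Avoids Iv Ia) : (nest l p).Avoids Iv Ia := by
  induction l with
  | nil => exact hp
  | cons x l ih =>
    exact ⟨hl x List.mem_cons_self, h0, ih fun y hy => hl y (List.mem_cons_of_mem _ hy)⟩

theorem depth_nest : (nest l p).depth = p.depth + l.length := by
  induction l with
  | nil => rfl
  | cons x l ih => simp only [nest, depth, ih, List.length_cons]; omega

theorem den_nest_of_forall (I : State → Prop) (hI : ∀ s, ∀ x ∈ l, ∀ v, I s → I (s.setVar x v))
    (hp : ∀ s, I s → I (p.den s)) {s : State} (hs : I s) : I ((nest l p).den s) := by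
  induction l generalizing s with
  | nil => exact hp s hs
  | cons x l ih =>
    exact den_loop_of_forall I (hI s x List.mem_cons_self 0 hs) fun s' hs' =>
      hI _ x List.mem_cons_self _ (ih (fun s y hy => hI s y (List.mem_cons_of_mem _ hy)) hs')

/-- If the body establishes `Q` for the values `f` of the loop variables, and keeps it for all
other values, then `Q` holds in the end. -/
theorem den_nest_of_eq {n : ℕ} (I Q : State → Prop) (l₀ : List ℕ) (f : ℕ → ℕ)
    (hI : ∀ s, ∀ x ∈ l, ∀ v, I s → I (s.setVar x v)) (hp : ∀ s, I s → I (p.den s))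
    (hIQ : ∀ s, ∀ x ∈ l, ∀ v, Q s → Q (s.setVar x v)) (hpQ : ∀ s, I s → Q s → Q (p.den s))
    (hn : ∀ s, I s → s.var 0 = n) (hf : ∀ x ∈ l, f x < n) (hnd : l.Nodup)
    (hlp : ∀ x, ¬ p.WritesVar x)
    (hit : ∀ s, I s → (∀ x ∈ l₀, s.var x = f x) → Q (p.den s)) {s : State} (hs : I s)
    (hl₀ : ∀ x ∈ l₀, x ∈ l ∨ s.var x = f x) : Q ((nest l p).den s) := by
  induction l generalizing s with
  | nil => exact hit s hs fun x hx => (hl₀ x hx).resolve_left (by simp)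
  | cons x l ih =>
    rw [List.nodup_cons] at hnd
    have hwx : ¬ (nest l p).WritesVar x := by
      rw [writesVar_nest, not_or]
      exact ⟨hnd.1, hlp x⟩
    have hI' := fun s y (hy : y ∈ l) => hI s y (List.mem_cons_of_mem _ hy)
    have hIQ' := fun s y (hy : y ∈ l) => hIQ s y (List.mem_cons_of_mem _ hy)
    refine (den_loop (m := n) (fun i s' => I s' ∧ (f x < i → Q s')) (hn s hs) hwx
      ⟨hI s x List.mem_cons_self 0 hs, by simp⟩ fun i hi s' hx hF hP => ?_).2
      (hf x List.mem_cons_self)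
    refine ⟨hI _ x List.mem_cons_self _ (den_nest_of_forall I hI' hp hP.1), fun hfi => ?_⟩
    refine hIQ _ x List.mem_cons_self _ ?_
    rcases Nat.lt_succ_iff_lt_or_eq.1 hfi with h | h
    · exact (den_nest_of_forall (fun s => I s ∧ Q s)
        (fun s y hy v hs => ⟨hI' s y hy v hs.1, hIQ' s y hy v hs.2⟩)
        (fun s hs => ⟨hp s hs.1, hpQ s hs.1 hs.2⟩) ⟨hP.1, hP.2 h⟩).2
    · refine ih hI' hIQ' (fun y hy => hf y (List.mem_cons_of_mem _ hy)) hnd.2 hP.1 fun y hy => ?_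
      by_cases hyx : y = x
      · right
        rw [hyx, hx, h]
      · rcases hl₀ y hy with h1 | h1
        · left
          exact (List.mem_cons.1 h1).resolve_left hyx
        · by_cases hyl : y ∈ l
          · exact .inl hyl
          · right
            rw [hF.var y hyx (by rw [writesVar_nest, not_or]; exact ⟨hyl, hlp y⟩), h1]

end

end LProg

/-! ### Searching for copies -/

/-- The registers `100`, …, `100 + m - 1`. -/
def copyRegs (m : ℕ) : List ℕ := (List.range m).map (100 + ·)

theorem mem_copyRegs {m x : ℕ} : x ∈ copyRegs m ↔ 100 ≤ x ∧ x < 100 + m := by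
  simp only [copyRegs, List.mem_map, List.mem_range]
  exact ⟨by rintro ⟨i, hi, rfl⟩; omega, fun h => ⟨x - 100, by omega, by omega⟩⟩

open Classical in
/-- The conditions that the numbers in the registers `100`, `101`, … form a copy of `H` in a
strong component: the vertices are alive, they reach the root, they are distinct, and there are
the arcs of `H` between them. -/
noncomputable def copyTests (H : FinDigraph) : List Expr :=
  (List.range H.1).map (fun j => .and (.lt (.var (100 + j)) (.var 0)) (.ld 8 (100 + j))) ++
  (List.range H.1).map (fun j =>
    .load 3 (.add (.ld 1 (100 + rootOf H)) (.var (100 + j)))) ++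
  ((Finset.range H.1 ×ˢ Finset.range H.1).toList.filter fun p => p.1 ≠ p.2).map (fun p =>
    .not (.eq (.var (100 + p.1)) (.var (100 + p.2)))) ++
  ((Finset.univ : Finset (Fin H.1 × Fin H.1)).toList.filter fun p => H.2.Adj p.1 p.2).map
    (fun p => .load 0 (.add (.ld 1 (100 + p.1)) (.var (100 + p.2))))

/-- Marks in block `4` the vertex in register `100 + rootOf H` and records the vertices of the
copy in the blocks `100`, `101`, … -/
noncomputable def recordCopy (H : FinDigraph) : LProg :=
  .seq (.store 4 (.var (100 + rootOf H)) (.const 1))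
    (.seqs ((List.range H.1).map fun j =>
      .store (100 + j) (.var (100 + rootOf H)) (.var (100 + j))))

/-- Searches for the copies of `H`. -/
noncomputable def copiesOf (H : FinDigraph) : LProg :=
  .nest (copyRegs H.1) (.ite (.all (copyTests H)) (recordCopy H) .skip)

/-- Searches for the copies of the graphs of the family in strong components of the digraph
induced by the set in block `8`; their roots are marked in block `4`. -/
noncomputable def copies (F : Finset FinDigraph) : LProg :=
  .seq (.loop 20 0 (.store 4 (.var 20) (.const 0))) (.seqs (F.toList.map copiesOf))

theorem recordCopy_writesVar {H : FinDigraph} (y : ℕ) : ¬ (recordCopy H).WritesVar y := by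
  simp [recordCopy, LProg.WritesVar, LProg.writesVar_seqs]

theorem recordCopy_writesArr {H : FinDigraph} {a : ℕ} :
    (recordCopy H).WritesArr a ↔ a = 4 ∨ 100 ≤ a ∧ a < 100 + H.1 := by
  rw [← mem_copyRegs]
  simp [recordCopy, LProg.WritesArr, LProg.writesArr_seqs, copyRegs, eq_comm]

theorem recordCopy_arr {H : FinDigraph} {s : State} (hb : s.var (100 + rootOf H) < s.var 9)
    (a i : ℕ) : ((recordCopy H).den s).arr a i =
      if i = s.var (100 + rootOf H) then
        if a = 4 then 1 else if 100 ≤ a ∧ a < 100 + H.1 then s.var a else s.arr a i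
      else s.arr a i := by
  have key : ∀ l : List ℕ, ∀ s : State, s.var (100 + rootOf H) < s.var 9 →
      ((LProg.seqs (l.map fun j =>
        .store (100 + j) (.var (100 + rootOf H)) (.var (100 + j)))).den s).arr a i =
      if i = s.var (100 + rootOf H) ∧ ∃ j ∈ l, a = 100 + j then s.var a else s.arr a i := by
    intro l
    induction l with
    | nil => intro s _; simp [LProg.den_seqs_nil]
    | cons j l ih =>
      intro s hs
      rw [List.map_cons, LProg.den_seqs_cons, LProg.den_store (by simpa [Expr.eval] using hs),
        ih _ (by simpa using hs)]
      simp only [Expr.eval, State.setArr_var, State.setArr_arr, List.mem_cons, exists_eq_or_imp]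
      by_cases h1 : i = s.var (100 + rootOf H)
      · by_cases h2 : a = 100 + j
        · simp [h1, h2]
        · simp [h1, h2]
      · simp [h1]
  rw [recordCopy, LProg.den_seq, LProg.den_store (by simpa [Expr.eval] using hb),
    key _ _ (by simpa using hb)]
  have hex : (∃ j ∈ List.range H.1, a = 100 + j) ↔ 100 ≤ a ∧ a < 100 + H.1 := by
    rw [← mem_copyRegs]
    simp [copyRegs, eq_comm]
  simp only [Expr.eval, State.setArr_var, State.setArr_arr, hex]
  by_cases h1 : i = s.var (100 + rootOf H)
  · by_cases h2 : a = 4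
    · simp [h1, h2]
    · simp [h1, h2]
  · simp [h1]

theorem le_maxOrder {F : Finset FinDigraph} {H : FinDigraph} (hH : H ∈ F) : H.1 ≤ maxOrder F :=
  Finset.le_sup (f := fun H : FinDigraph => H.1) hH

theorem copiesOf_writesVar {H : FinDigraph} {y : ℕ} :
    (copiesOf H).WritesVar y ↔ 100 ≤ y ∧ y < 100 + H.1 := by
  simp [copiesOf, LProg.writesVar_nest, LProg.WritesVar, recordCopy_writesVar, mem_copyRegs]

theorem copiesOf_writesArr {H : FinDigraph} {a : ℕ} :
    (copiesOf H).WritesArr a ↔ a = 4 ∨ 100 ≤ a ∧ a < 100 + H.1 := by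
  simp [copiesOf, LProg.writesArr_nest, LProg.WritesArr, recordCopy_writesArr]

theorem copies_writesVar {F : Finset FinDigraph} {y : ℕ} (h : (copies F).WritesVar y) :
    y = 20 ∨ 100 ≤ y ∧ y < 100 + maxOrder F := by
  simp only [copies, LProg.WritesVar, LProg.writesVar_seqs, List.mem_map, Finset.mem_toList] at h
  rcases h with (h | h) | ⟨p, ⟨H, hH, rfl⟩, h⟩
  · exact .inl h
  · exact h.elim
  · have := copiesOf_writesVar.1 h
    have := le_maxOrder hH
    omega

theorem copies_writesArr {F : Finset FinDigraph} {a : ℕ} (h : (copies F).WritesArr a) :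
    a = 4 ∨ 100 ≤ a ∧ a < 100 + maxOrder F := by
  simp only [copies, LProg.WritesArr, LProg.writesArr_seqs, List.mem_map, Finset.mem_toList] at h
  rcases h with h | ⟨p, ⟨H, hH, rfl⟩, h⟩
  · exact .inl h
  · have := copiesOf_writesArr.1 h
    have := le_maxOrder hH
    omega

theorem copyRegs_nodup (m : ℕ) : (copyRegs m).Nodup :=
  List.nodup_range.map fun _ _ h => by simpa using h

theorem copiesOf_wf {H : FinDigraph} : (copiesOf H).WF 10 := by
  refine LProg.wf_nest (by omega) (fun x hx => by have := mem_copyRegs.1 hx; omega)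
    (copyRegs_nodup _) ?_ fun x _ => ?_
  · simp [LProg.WF, recordCopy, LProg.wf_seqs]
  · simp [LProg.WritesVar, recordCopy_writesVar]

theorem copies_wf {F : Finset FinDigraph} : (copies F).WF 10 := by
  refine ⟨by simp [LProg.WF, LProg.WritesVar], LProg.wf_seqs.2 fun p hp => ?_⟩
  obtain ⟨H, -, rfl⟩ := List.mem_map.1 hp
  exact copiesOf_wf

theorem copies_isBound {F : Finset FinDigraph} {b : ℕ} (h : (copies F).IsBound b) : b = 0 := by
  simp only [copies, LProg.IsBound, LProg.isBound_seqs, List.mem_map, or_false] at h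
  rcases h with h | ⟨p, ⟨H, -, rfl⟩, h⟩
  · exact h
  · refine (LProg.isBound_nest h).resolve_right ?_
    simp [LProg.IsBound, recordCopy, LProg.isBound_seqs]

theorem copies_depth {F : Finset FinDigraph} : (copies F).depth ≤ maxOrder F + 1 := by
  simp only [copies, LProg.depth, max_le_iff, LProg.depth_seqs_le, List.mem_map,
    Finset.mem_toList]
  refine ⟨by omega, ?_⟩
  rintro p ⟨H, hH, rfl⟩
  have h0 : (recordCopy H).depth = 0 := by
    simp only [recordCopy, LProg.depth, Nat.max_eq_zero_iff, true_and]
    exact Nat.le_zero.1 (LProg.depth_seqs_le.2 (by simp [LProg.depth]))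
  have := le_maxOrder hH
  simp [copiesOf, LProg.depth_nest, LProg.depth, copyRegs, h0]
  omega

theorem copies_avoids {F : Finset FinDigraph} {Iv Ia : Finset ℕ}
    (hIv : ∀ x ∈ Iv, 10 ≤ x ∧ x < 20 ∨ x = 39)
    (hIa : ∀ a ∈ Ia, 14 ≤ a ∧ a < 20) : (copies F).Avoids Iv Ia := by
  have h1 : ∀ x, x < 10 ∨ x = 20 ∨ 100 ≤ x → x ∉ Iv := fun x hx h => by
    have := hIv x h
    omega
  have h2 : ∀ a, a < 14 ∨ 20 ≤ a → a ∉ Ia := fun a ha h => by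
    have := hIa a h
    omega
  refine ⟨⟨h1 _ (by omega), h1 _ (by omega), h1 _ (by omega), h2 _ (by omega),
    h1 _ (by omega), trivial⟩, LProg.avoids_seqs.2 ?_⟩
  rintro p hp
  obtain ⟨H, -, rfl⟩ := List.mem_map.1 hp
  refine LProg.avoids_nest (h1 _ (by omega)) (fun x hx => h1 _ ?_) ⟨?_, ⟨?_, ?_⟩, trivial⟩
  · have := mem_copyRegs.1 hx
    omega
  · rw [Expr.avoids_all]
    intro e he
    simp only [copyTests, List.mem_append, List.mem_map] at he
    rcases he with ((⟨j, -, rfl⟩ | ⟨j, -, rfl⟩) | ⟨j, -, rfl⟩) | ⟨j, -, rfl⟩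
    · rw [Expr.avoids_and, Expr.avoids_lt]
      exact ⟨⟨h1 _ (by omega), h1 _ (by omega)⟩, h2 _ (by omega), h1 _ (by omega)⟩
    · exact ⟨h2 _ (by omega), ⟨h2 _ (by omega), h1 _ (by omega)⟩, h1 _ (by omega)⟩
    · rw [Expr.avoids_not, Expr.avoids_eq]
      exact ⟨h1 _ (by omega), h1 _ (by omega)⟩
    · exact ⟨h2 _ (by omega), ⟨h2 _ (by omega), h1 _ (by omega)⟩, h1 _ (by omega)⟩
  · exact ⟨h1 _ (by omega), h2 _ (by omega), h1 _ (by omega), trivial⟩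
  · rw [LProg.avoids_seqs]
    intro p hp
    obtain ⟨j, -, rfl⟩ := List.mem_map.1 hp
    exact ⟨h1 _ (by omega), h2 _ (by omega), h1 _ (by omega), h1 _ (by omega)⟩

/-- What `copies` computes: block `4` holds the roots of the copies in strong components, and for
each root `b` the cells `b` of the blocks `100`, `101`, … hold the vertices of such a copy. -/
structure IsCopySearch (F : Finset FinDigraph) (adj : ℕ → ℕ → Prop) (n : ℕ) (G : Finset ℕ)
    (s : State) : Prop where
  roots : mask n s 4 = roots adj (copyPatterns F adj n) G
  copy : ∀ b ∈ mask n s 4, ∃ H ∈ F, ∃ f, IsCopy adj n H f ∧ f (rootOf H) = b ∧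
    Bad adj G (b, (Finset.range H.1).image f) ∧ ∀ j < H.1, s.arr (100 + j) b = f j

/-- The tests succeed exactly for the copies in strong components. -/
theorem eval_copyTests {adj : ℕ → ℕ → Prop} {n k : ℕ} {G : Finset ℕ} {s : State}
    (hs : Base adj n k s) (hG : mask n s 8 = G)
    (hR : ∀ u < n, ∀ v < n, s.arr 3 (u * n + v) ≠ 0 ↔ Conn adj G v u) {H : FinDigraph}
    (hH : IsRooted H.2) :
    (Expr.all (copyTests H)).eval s ≠ 0 ↔ IsCopy adj n H (fun j => s.var (100 + j)) ∧
      Bad adj G (s.var (100 + rootOf H), (Finset.range H.1).image fun j => s.var (100 + j)) := by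
  obtain ⟨r, hr, -⟩ := rootOf_spec hH
  have hrlt : rootOf H < H.1 := hr ▸ r.2
  have hrow : (∀ j < H.1, s.var (100 + j) < n) →
      ∀ j < H.1, s.arr 1 (s.var (100 + j)) = s.var (100 + j) * n :=
    fun hv j hj => hs.row _ (hv j hj)
  rw [Expr.eval_all_ne_zero]
  simp only [copyTests, List.mem_append, List.mem_map, List.mem_range, List.mem_filter,
    Finset.mem_toList, Finset.mem_product, Finset.mem_range, Finset.mem_univ, true_and,
    decide_eq_true_eq]
  constructor
  · intro h
    have hv : ∀ j < H.1, s.var (100 + j) < n ∧ s.arr 8 (s.var (100 + j)) ≠ 0 := by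
      intro j hj
      have := h _ (.inl (.inl (.inl ⟨j, hj, rfl⟩)))
      rw [ne_eq, Expr.eval_and_eq_zero, not_not, ne_eq, Expr.eval_lt_eq_zero, not_not] at this
      simpa only [Expr.eval, hs.var_zero] using this
    have hlive := fun j hj => (hv j hj).2
    replace hv := fun j hj => (hv j hj).1
    have hrow := hrow hv
    refine ⟨⟨hv, fun i hi j hj hij => ?_, fun i j hij => ?_⟩, fun u hu => ?_, fun u hu => ?_⟩
    · have := h _ (.inl (.inr ⟨(i, j), ⟨⟨hi, hj⟩, hij⟩, rfl⟩))
      simpa [Expr.eval] using this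
    · have := h _ (.inr ⟨(i, j), hij, rfl⟩)
      simp only [Expr.eval, hrow i i.2] at this
      exact (hs.adj_iff _ (hv i i.2) _ (hv j j.2)).1 this
    · obtain ⟨j, hj, rfl⟩ := Finset.mem_image.1 hu
      rw [Finset.mem_range] at hj
      rw [← hG, mem_mask]
      exact ⟨hv j hj, hlive j hj⟩
    · obtain ⟨j, hj, rfl⟩ := Finset.mem_image.1 hu
      rw [Finset.mem_range] at hj
      have := h _ (.inl (.inl (.inr ⟨j, hj, rfl⟩)))
      simp only [Expr.eval, hrow _ hrlt] at this
      exact (hR _ (hv _ hrlt) _ (hv j hj)).1 this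
  · rintro ⟨hc, hB⟩
    have hv := hc.lt
    have hrow := hrow hv
    rintro e (((⟨j, hj, rfl⟩ | ⟨j, hj, rfl⟩) | ⟨p, ⟨⟨hi, hj⟩, hij⟩, rfl⟩) | ⟨p, hp, rfl⟩)
    · have := hB.1 (Finset.mem_image_of_mem _ (Finset.mem_range.2 hj))
      rw [← hG, mem_mask] at this
      rw [ne_eq, Expr.eval_and_eq_zero, not_not, ne_eq, Expr.eval_lt_eq_zero, not_not]
      simpa only [Expr.eval, hs.var_zero] using this
    · have := hB.2 _ (Finset.mem_image_of_mem _ (Finset.mem_range.2 hj))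
      simp only [Expr.eval, hrow _ hrlt]
      exact (hR _ (hv _ hrlt) _ (hv j hj)).2 this
    · simpa [Expr.eval] using hc.inj _ hi _ hj hij
    · simp only [Expr.eval, hrow p.1 p.1.2]
      exact (hs.adj_iff _ (hv p.1 p.1.2) _ (hv p.2 p.2.2)).2 (hc.arc _ _ hp)

/-- As the root of a copy reaches the whole copy, the tests in `copyTests`, which ask only that the
vertices of the copy reach the root, find exactly the copies in strong components. -/
theorem copies_spec {adj : ℕ → ℕ → Prop} {n k : ℕ} {F : Finset FinDigraph}
    (hF : ∀ H ∈ F, IsRooted H.2) {G : Finset ℕ} {s : State} (hs : Base adj n k s)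
    (hG : mask n s 8 = G)
    (hR : ∀ u < n, ∀ v < n, s.arr 3 (u * n + v) ≠ 0 ↔ Conn adj G v u) :
    IsCopySearch F adj n G ((copies F).den s) := by
  rw [copies, LProg.den_seq]
  set s₁ := (LProg.loop 20 0 (.store 4 (.var 20) (.const 0))).den s with hs₁
  have hb₁ : Base adj n k s₁ := hs.den (by simp [LProg.WF, LProg.WritesVar])
    (by simp [LProg.WritesArr]; omega)
  have h8₁ : s₁.arr 8 = s.arr 8 := LProg.den_arr (by simp [LProg.WritesArr]) s
  have h3₁ : s₁.arr 3 = s.arr 3 := LProg.den_arr (by simp [LProg.WritesArr]) s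
  have h4₁ : ∀ b < n, s₁.arr 4 b = 0 := by
    have := LProg.den_fill (x := 20) (b := 0) (a := 4) (q := .store 4 (.var 20) (.const 0))
      (s := s) (fun _ => 0) hs.var_zero (by simp [LProg.WritesVar]) (by simp [LProg.WritesArr])
      fun i hi s' h1 h2 _ => by
        rw [LProg.den_store_arr]
        · simp [Expr.eval, h1]
        · rw [h2 9 (by decide) (by simp [LProg.WritesVar])]
          simp only [Expr.eval, h1]
          exact hs.lt_nine (by omega)
    intro b hb
    rw [hs₁, this]
    simp [hb]
  clear_value s₁
  set Wit : State → Prop := fun s' => ∀ b < n, s'.arr 4 b ≠ 0 → ∃ H ∈ F, ∃ f, IsCopy adj n H f ∧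
    f (rootOf H) = b ∧ Bad adj G (b, (Finset.range H.1).image f) ∧
      ∀ j < H.1, s'.arr (100 + j) b = f j with hWit
  set I : State → Prop := fun s' =>
    Base adj n k s' ∧ s'.arr 8 = s.arr 8 ∧ s'.arr 3 = s.arr 3 ∧ Wit s' with hI
  have hI₁ : I s₁ := ⟨hb₁, h8₁, h3₁, fun b hb h => absurd (h4₁ b hb) h⟩
  have hIset : ∀ s', ∀ x ≥ 100, ∀ v, I s' → I (s'.setVar x v) := by
    rintro s' x hx v ⟨h1, h2, h3, h4⟩
    exact ⟨h1.congr (fun y hy => by rw [State.setVar_var, if_neg (by omega)]) fun _ _ => rfl,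
      h2, h3, h4⟩
  have htest : ∀ H ∈ F, ∀ s', I s' → ((Expr.all (copyTests H)).eval s' ≠ 0 ↔
      IsCopy adj n H (fun j => s'.var (100 + j)) ∧
      Bad adj G (s'.var (100 + rootOf H), (Finset.range H.1).image fun j => s'.var (100 + j))) := by
    rintro H hH s' ⟨h1, h2, h3, -⟩
    exact eval_copyTests h1 ((mask_congr fun v _ => by rw [h2]).trans hG)
      (fun u hu v hv => by rw [h3]; exact hR u hu v hv) (hF H hH)
  have hrt : ∀ H ∈ F, rootOf H < H.1 := fun H hH => by
    obtain ⟨r, hr, -⟩ := rootOf_spec (hF H hH)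
    exact hr ▸ r.2
  have hbody : ∀ H ∈ F, ∀ s', I s' →
      I ((LProg.ite (.all (copyTests H)) (recordCopy H) .skip).den s') := by
    intro H hH s' hIs
    rw [LProg.den_ite]
    split_ifs with ht
    · obtain ⟨hc, hB⟩ := (htest H hH s' hIs).1 ht
      obtain ⟨h1, h2, h3, h4⟩ := hIs
      have hbn := hc.lt _ (hrt H hH)
      have harr := recordCopy_arr (H := H) (s := s') (h1.lt_nine (x := s'.var (100 + rootOf H))
        (by omega))
      refine ⟨h1.den (by simp [recordCopy, LProg.WF, LProg.wf_seqs]) (fun a ha h => ?_), ?_, ?_, ?_⟩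
      · have := recordCopy_writesArr.1 h
        omega
      · rw [LProg.den_arr (by rw [recordCopy_writesArr]; omega), h2]
      · rw [LProg.den_arr (by rw [recordCopy_writesArr]; omega), h3]
      · intro b hb h
        rw [harr] at h
        by_cases hb' : b = s'.var (100 + rootOf H)
        · refine ⟨H, hH, fun j => s'.var (100 + j), hc, hb'.symm, by rw [hb']; exact hB, ?_⟩
          intro j hj
          rw [harr, if_pos hb', if_neg (by omega), if_pos (by omega)]
        · rw [if_neg hb'] at h
          obtain ⟨H', hH', f, h5, h6, h7, h8⟩ := h4 b hb h
          refine ⟨H', hH', f, h5, h6, h7, fun j hj => ?_⟩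
          rw [harr, if_neg hb', h8 j hj]
    · rwa [LProg.den_skip]
  have hprog : ∀ p ∈ F.toList.map copiesOf, ∀ s', I s' → I (p.den s') := by
    intro p hp s' hIs
    obtain ⟨H, hH, rfl⟩ := List.mem_map.1 hp
    exact LProg.den_nest_of_forall I (fun s x hx v => hIset s x (mem_copyRegs.1 hx).1 v)
      (hbody H (Finset.mem_toList.1 hH)) hIs
  have hfin := LProg.den_seqs_of_forall I hprog hI₁
  refine ⟨?_, fun b hb => hfin.2.2.2 b (mem_mask.1 hb).1 (mem_mask.1 hb).2⟩
  ext b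
  rw [mem_roots]
  constructor
  · intro hb
    rw [mem_mask] at hb
    obtain ⟨H, hH, f, h5, h6, h7, -⟩ := hfin.2.2.2 b hb.1 hb.2
    refine ⟨h7.1 ?_, _, ⟨H, hH, f, h5, by rw [h6]⟩, h7⟩
    rw [← h6]
    exact Finset.mem_image_of_mem _ (Finset.mem_range.2 (hrt H hH))
  · rintro ⟨-, U, ⟨H, hH, f, hc, hbU⟩, hB⟩
    obtain ⟨rfl, rfl⟩ := Prod.mk.inj hbU
    have hbn := hc.lt _ (hrt H hH)
    rw [mem_mask]
    refine ⟨hbn, ?_⟩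
    set Q : State → Prop := fun s' => s'.arr 4 (f (rootOf H)) ≠ 0 with hQ
    have hQbody : ∀ H' ∈ F, ∀ s', I s' → Q s' →
        Q ((LProg.ite (.all (copyTests H')) (recordCopy H') .skip).den s') := by
      intro H' hH' s' hIs hQs
      rw [LProg.den_ite]
      split_ifs with ht
      · have hc' := ((htest H' hH' s' hIs).1 ht).1
        have := hc'.lt _ (hrt H' hH')
        simp only [hQ]
        rw [recordCopy_arr (hIs.1.lt_nine (by omega))]
        split_ifs
        · exact one_ne_zero
        · omega
        · exact hQs
        · exact hQs
      · rwa [LProg.den_skip]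
    refine LProg.den_seqs_of_mem I Q hprog ?_
      (List.mem_map_of_mem (Finset.mem_toList.2 hH)) ?_ hI₁
    · intro p hp s' hIs hQs
      obtain ⟨H', hH', rfl⟩ := List.mem_map.1 hp
      rw [Finset.mem_toList] at hH'
      exact (LProg.den_nest_of_forall (fun s => I s ∧ Q s)
        (fun s x hx v h => ⟨hIset s x (mem_copyRegs.1 hx).1 v h.1, h.2⟩)
        (fun s h => ⟨hbody H' hH' s h.1, hQbody H' hH' s h.1 h.2⟩) ⟨hIs, hQs⟩).2
    · intro s' hIs
      refine LProg.den_nest_of_eq I Q (copyRegs H.1) (fun x => f (x - 100))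
        (fun s x hx v => hIset s x (mem_copyRegs.1 hx).1 v) (hbody H hH) (fun _ _ _ _ h => h)
        (hQbody H hH) (fun s h => h.1.var_zero) (fun x hx => ?_) (copyRegs_nodup _)
        (fun x => by simp [LProg.WritesVar, recordCopy_writesVar]) ?_ hIs fun x hx => .inl hx
      · have := mem_copyRegs.1 hx
        exact hc.lt _ (by omega)
      · intro s'' hIs'' heq
        have hvar : ∀ j < H.1, s''.var (100 + j) = f j := fun j hj => by
          rw [heq _ (mem_copyRegs.2 ⟨by omega, by omega⟩)]
          congr 1
          omega
        rw [LProg.den_ite, if_pos]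
        · have hr := hvar _ (hrt H hH)
          simp only [hQ]
          rw [recordCopy_arr (by rw [hr]; exact hIs''.1.lt_nine (by omega)), if_pos hr.symm,
            if_pos rfl]
          exact one_ne_zero
        · rw [htest H hH s'' hIs'', hvar _ (hrt H hH)]
          refine ⟨⟨fun i hi => ?_, fun i hi j hj => ?_, fun i j => ?_⟩, ?_⟩
          · rw [hvar i hi]
            exact hc.lt i hi
          · rw [hvar i hi, hvar j hj]
            exact hc.inj i hi j hj
          · rw [hvar i i.2, hvar j j.2]
            exact hc.arc i j
          · rwa [Finset.image_congr (g := f) fun j hj => hvar j (Finset.mem_range.1 hj)]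

end RAM

namespace SCCDeletion

section

variable {N t val c : ℕ} {cap res res' : ℕ → ℕ → ℕ} {src : ℕ → Prop}

theorem IsFlowAt.congr (h : IsFlowAt N cap src t res val c) (ht : t < N)
    (hres : ∀ x < N, ∀ y < N, res' x y = res x y) : IsFlowAt N cap src t res' val c := by
  have hsum : ∀ x < N, ∑ y ∈ Finset.range N, ((cap x y : ℤ) - res' x y) =
      ∑ y ∈ Finset.range N, ((cap x y : ℤ) - res x y) := fun x hx =>
    Finset.sum_congr rfl fun y hy => by rw [hres x hx y (Finset.mem_range.1 hy)]
  refine ⟨fun x hx y hy => ?_, fun x hx h1 h2 => ?_, ?_⟩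
  · rw [hres x hx y hy, hres y hy x hx, h.skew x hx y hy]
  · rw [hsum x hx, h.conserve x hx h1 h2]
  · rw [hsum t ht, h.value]

theorem IsFlow.congr (h : IsFlow N cap src t res val) (ht : t < N)
    (hres : ∀ x < N, ∀ y < N, res' x y = res x y) : IsFlow N cap src t res' val := by
  have hsum : ∀ x < N, ∑ y ∈ Finset.range N, ((cap x y : ℤ) - res' x y) =
      ∑ y ∈ Finset.range N, ((cap x y : ℤ) - res x y) := fun x hx =>
    Finset.sum_congr rfl fun y hy => by rw [hres x hx y (Finset.mem_range.1 hy)]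
  refine ⟨fun x hx y hy => ?_, fun x hx h1 h2 => ?_, ?_⟩
  · rw [hres x hx y hy, hres y hy x hx, h.skew x hx y hy]
  · rw [hsum x hx, h.conserve x hx h1 h2]
  · rw [hsum t ht, h.value]

end

end SCCDeletion

namespace RAM

open SCCDeletion Relation

theorem mul_add_inj {N x y x' y' : ℕ} (hy : y < N) (hy' : y' < N)
    (h : x * N + y = x' * N + y') : x = x' ∧ y = y' := by
  have hx : x = x' := by
    have := congrArg (· / N) h
    simpa [Nat.add_comm (_ * N), Nat.add_mul_div_right _ _ (show 0 < N by omega),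
      Nat.div_eq_of_lt hy, Nat.div_eq_of_lt hy'] using this
  subst hx
  exact ⟨rfl, by omega⟩

/-- The expression that is nonzero if one of `e` and `e'` is nonzero. -/
abbrev Expr.or (e e' : Expr) : Expr := .add e e'

/-! ### Augmenting a flow -/

/-- Sends one unit of flow from the node in register `31` to the node `2 * n`, along the pointers
in block `7`. -/
def walk : LProg := .loop 32 2 (.ite (.not (.eq (.var 31) (.sub (.var 2) (.const 1))))
  (.seqs [.assign 34 (.ld 7 31),
    .store 5 (.add (.ld 2 31) (.var 34)) (.sub (.ld2 5 2 31 34) (.const 1)),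
    .store 5 (.add (.ld 2 34) (.var 31)) (.add (.ld2 5 2 34 31) (.const 1)),
    .assign 31 (.var 34)]) .skip)

/-- Sends one unit of flow from some source to the sink, if the sink can be reached. -/
def augment : LProg := .seqs [
  .assign 23 (.sub (.var 2) (.const 1)), mark, .assign 31 (.var 2),
  .loop 33 0 (.ite (.and (.ld 9 33) (.load 6 (.add (.var 0) (.var 33))))
    (.assign 31 (.add (.var 0) (.var 33))) .skip),
  .ite (.lt (.var 31) (.var 2)) walk .skip]

theorem walk_wf : walk.WF 10 := by
  simp [walk, LProg.seqs, LProg.WF, LProg.WritesVar]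

theorem walk_writesVar {y : ℕ} : walk.WritesVar y ↔ y = 31 ∨ y = 32 ∨ y = 34 := by
  simp [walk, LProg.seqs, LProg.WritesVar]
  tauto

theorem walk_writesArr {a : ℕ} : walk.WritesArr a ↔ a = 5 := by
  simp [walk, LProg.seqs, LProg.WritesArr]

theorem augment_wf : augment.WF 10 := by
  simp [augment, LProg.seqs, LProg.WF, LProg.WritesVar, mark_wf, walk_wf]

theorem augment_writesVar {y : ℕ} (h : augment.WritesVar y) : 20 ≤ y ∧ y ≤ 34 ∧ y ≠ 27 ∧
    y ≠ 28 ∧ y ≠ 29 := by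
  simp [augment, LProg.seqs, LProg.WritesVar, mark_writesVar, walk_writesVar] at h
  omega

theorem augment_writesArr {a : ℕ} : augment.WritesArr a ↔ a = 5 ∨ a = 6 ∨ a = 7 := by
  simp [augment, LProg.seqs, LProg.WritesArr, mark_writesArr, walk_writesArr]
  tauto

/-- The matrix of width `2 * n + 1` in block `5`. -/
def resOf (n : ℕ) (s : State) (x y : ℕ) : ℕ := s.arr 5 (x * (2 * n + 1) + y)

section

variable {adj : ℕ → ℕ → Prop} {n k val : ℕ} {s : State} {cap : ℕ → ℕ → ℕ} {src : ℕ → Prop}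

/-- One step of the walk changes the two residual capacities between a node and its successor. -/
theorem push_spec (hs : Base adj n k s) (hc : s.var 31 < 2 * n + 1)
    (hy : s.arr 7 (s.var 31) < 2 * n + 1) (hcy : s.var 31 ≠ s.arr 7 (s.var 31)) :
    let s' := (LProg.seqs [.assign 34 (.ld 7 31),
      .store 5 (.add (.ld 2 31) (.var 34)) (.sub (.ld2 5 2 31 34) (.const 1)),
      .store 5 (.add (.ld 2 34) (.var 31)) (.add (.ld2 5 2 34 31) (.const 1)),
      .assign 31 (.var 34)]).den s
    s'.var 31 = s.arr 7 (s.var 31) ∧ ∀ x < 2 * n + 1, ∀ y < 2 * n + 1,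
      resOf n s' x y = pushRes (resOf n s) (s.var 31) (s.arr 7 (s.var 31)) x y := by
  set c := s.var 31 with hcdef
  set y := s.arr 7 c with hydef
  have h9 := hs.var_nine
  have h1 := (lt_mul_of_lt hc hy).trans_le h9
  have h2 := (lt_mul_of_lt hy hc).trans_le h9
  simp only [LProg.den_seqs_cons, LProg.den_seqs_nil]
  rw [LProg.den_assign (x := 34)]
  rw [LProg.den_store (a := 5) (i := .add (.ld 2 31) (.var 34))]
  rw [LProg.den_store (a := 5) (i := .add (.ld 2 34) (.var 31))]
  rw [LProg.den_assign]
  · simp only [Expr.eval, State.setVar_var, State.setArr_var, State.setVar_arr, State.setArr_arr,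
      if_true, if_neg (show ¬ (31 : ℕ) = 34 by decide), ← hcdef, ← hydef]
    refine ⟨trivial, fun a ha b hb => ?_⟩
    simp [resOf, pushRes, State.setArr_arr, hs.row' c hc, hs.row' y hy]
    by_cases hab : a = c ∧ b = y
    · obtain ⟨rfl, rfl⟩ := hab
      rw [if_neg, if_pos rfl]
      · simp
      · intro h
        exact hcy (mul_add_inj hb ha h).1
    · by_cases hab' : a = y ∧ b = c
      · obtain ⟨rfl, rfl⟩ := hab'
        rw [if_pos rfl, if_neg]
        · simp [hab]
        · intro h
          exact hab (mul_add_inj hb ha h)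
      · rw [if_neg (fun h => hab' (mul_add_inj hb hc h)),
        if_neg (fun h => hab (mul_add_inj hb hy h)),
          if_neg hab, if_neg hab']
  · simp [Expr.eval, State.setArr_arr, ← hcdef, ← hydef, hs.row' y hy]
    exact h2
  · simp [Expr.eval, ← hcdef, ← hydef, hs.row' c hc]
    exact h1

/-- The walk follows the pointers, along which the labels decrease, and so arrives at the sink.
During the walk the matrix is a flow with one additional unit of excess at the current node. -/
theorem walk_spec (hs : Base adj n k s)
    (hmark : IsMarking (2 * n + 1) (resOf n s) (2 * n) (s.arr 6) (s.arr 7))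
    (hc : s.var 31 < 2 * n + 1) (hlev : s.arr 6 (s.var 31) ≠ 0)
    (hflow : IsFlowAt (2 * n + 1) cap src (2 * n) (resOf n s) val (s.var 31)) :
    IsFlow (2 * n + 1) cap src (2 * n) (resOf n (walk.den s)) (val + 1) := by
  set lev := s.arr 6 with hlevdef
  have := LProg.den_loop (x := 32) (b := 2) (s := s)
    (p := .ite (.not (.eq (.var 31) (.sub (.var 2) (.const 1))))
      (.seqs [.assign 34 (.ld 7 31),
        .store 5 (.add (.ld 2 31) (.var 34)) (.sub (.ld2 5 2 31 34) (.const 1)),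
        .store 5 (.add (.ld 2 34) (.var 31)) (.add (.ld2 5 2 34 31) (.const 1)),
        .assign 31 (.var 34)]) .skip)
    (fun i s' => s'.var 31 < 2 * n + 1 ∧ lev (s'.var 31) ≠ 0 ∧
      (s'.var 31 = 2 * n ∨ lev (s'.var 31) + i ≤ 2 * n + 2) ∧
      IsFlowAt (2 * n + 1) cap src (2 * n) (resOf n s') val (s'.var 31) ∧
      ∀ x < 2 * n + 1, ∀ y < 2 * n + 1, lev x ≤ lev (s'.var 31) → lev y ≤ lev (s'.var 31) →
        resOf n s' x y = resOf n s x y) hs.var_two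
    (by simp [LProg.seqs, LProg.WritesVar])
    ⟨hc, hlev, .inr (by have := hmark.le _ hc; simpa using this), hflow, fun _ _ _ _ _ _ => rfl⟩ ?_
  · obtain ⟨h1, h2, h3, h4, -⟩ := this
    have hct : (walk.den s).var 31 = 2 * n := by
      refine h3.elim id fun h3 => by_contra fun hne => ?_
      obtain ⟨-, -, h5, h6⟩ := hmark.next _ h1 h2 hne
      omega
    rw [← walk] at h4
    rw [hct] at h4
    exact h4.isFlow
  · intro i hi s' hx hF ⟨h1, h2, h3, h4, h5⟩
    have hb' : Base adj n k s' := hs.frame hF (by omega)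
      (by simp [LProg.seqs, LProg.WF]) (by simp [LProg.seqs, LProg.WritesArr]; omega)
    have h7 : s'.arr 7 = s.arr 7 := hF.arr 7 (by simp [LProg.seqs, LProg.WritesArr])
    simp only [State.setVar_var, if_neg (show ¬ (31 : ℕ) = 32 by decide), LProg.den_ite, ne_eq,
      Expr.eval_not_eq_zero, Expr.eval_eq_eq_zero, not_not]
    simp only [Expr.eval, hb'.var_two, Nat.add_sub_cancel]
    split_ifs with hct
    · rw [LProg.den_skip]
      exact ⟨h1, h2, .inl hct, h4, h5⟩
    · obtain ⟨h8, h9, h10, h11⟩ := hmark.next _ h1 h2 hct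
      rw [← h7] at h8 h9 h10 h11
      have hcy : s'.var 31 ≠ s'.arr 7 (s'.var 31) := fun h => by
        rw [← h] at h11
        exact lt_irrefl _ h11
      obtain ⟨h12, h13⟩ := push_spec hb' h1 h8 hcy
      generalize (LProg.seqs _).den s' = s'' at h12 h13
      have hres : resOf n (s''.setVar 32 (i + 1)) = resOf n s'' := rfl
      rw [h12, hres]
      refine ⟨h8, h10, .inr ?_, ?_, ?_⟩
      · have := h3.resolve_left hct
        omega
      · refine (h4.push h1 h8 hcy hct ?_).congr (by omega) h13
        rw [h5 _ h1 _ h8 le_rfl h11.le]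
        exact h9
      · intro x hx y hy hxl hyl
        rw [h13 x hx y hy, pushRes, if_neg, if_neg,
        h5 x hx y hy (hxl.trans h11.le) (hyl.trans h11.le)]
        · rintro ⟨-, rfl⟩
          exact absurd h11 (not_lt.2 hyl)
        · rintro ⟨rfl, -⟩
          exact absurd h11 (not_lt.2 hxl)

/-- One round of the flow algorithm. -/
theorem augment_spec (hs : Base adj n k s)
    (hflow : IsFlow (2 * n + 1) cap (fun x => ∃ a ∈ mask n s 9, x = n + a) (2 * n)
      (resOf n s) val) :
    ((∀ a ∈ mask n s 9, ¬ ReflTransGen (fun x y => x < 2 * n + 1 ∧ y < 2 * n + 1 ∧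
      resOf n s x y ≠ 0) (n + a) (2 * n)) ∧ (augment.den s).arr 5 = s.arr 5) ∨
    ((∃ a ∈ mask n s 9, ReflTransGen (fun x y => x < 2 * n + 1 ∧ y < 2 * n + 1 ∧
      resOf n s x y ≠ 0) (n + a) (2 * n)) ∧
    IsFlow (2 * n + 1) cap (fun x => ∃ a ∈ mask n s 9, x = n + a) (2 * n)
      (resOf n (augment.den s)) (val + 1)) := by
  simp only [augment, LProg.den_seqs_cons, LProg.den_seqs_nil]
  rw [LProg.den_assign (x := 23)]
  simp only [Expr.eval, hs.var_two, Nat.add_sub_cancel]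
  set s₁ := s.setVar 23 (2 * n) with hs₁
  have hb₁ : Base adj n k s₁ := hs.congr (fun y hy => by
    rw [hs₁, State.setVar_var, if_neg (by omega)]) fun _ _ => rfl
  have hmark := mark_spec hb₁ rfl (show s₁.var 23 < 2 * n + 1 by simp [hs₁])
  rw [show s₁.var 23 = 2 * n by simp [hs₁]] at hmark
  change IsMarking (2 * n + 1) (resOf n s) _ _ _ at hmark
  set s₂ := mark.den s₁ with hs₂
  have hb₂ : Base adj n k s₂ := hb₁.den mark_wf (by simp [mark_writesArr]; omega)
  have h5₂ : s₂.arr 5 = s.arr 5 := LProg.den_arr (by simp [mark_writesArr]) s₁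
  have h9₂ : s₂.arr 9 = s.arr 9 := LProg.den_arr (by simp [mark_writesArr]) s₁
  rw [LProg.den_assign]
  simp only [Expr.eval, hb₂.var_two]
  clear_value s₂
  set q : LProg := .loop 33 0 (.ite (.and (.ld 9 33) (.load 6 (.add (.var 0) (.var 33))))
    (.assign 31 (.add (.var 0) (.var 33))) .skip) with hq
  set s₃ := q.den (s₂.setVar 31 (2 * n + 1)) with hs₃
  have hb₂' : Base adj n k (s₂.setVar 31 (2 * n + 1)) := hb₂.congr (fun y hy => by
    rw [State.setVar_var, if_neg (by omega)]) fun _ _ => rfl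
  have hb₃ : Base adj n k s₃ := hb₂'.den (by simp [hq, LProg.WF, LProg.WritesVar])
    (by simp [hq, LProg.WritesArr])
  have harr₃ : ∀ a, s₃.arr a = s₂.arr a := fun a =>
    LProg.den_arr (by simp [hq, LProg.WritesArr]) _
  have hcur : (s₃.var 31 = 2 * n + 1 ∧ ∀ a ∈ mask n s 9, s₂.arr 6 (n + a) = 0) ∨
      ∃ a ∈ mask n s 9, s₃.var 31 = n + a ∧ s₂.arr 6 (n + a) ≠ 0 := by
    have := LProg.den_loop (x := 33) (b := 0) (s := s₂.setVar 31 (2 * n + 1))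
      (p := .ite (.and (.ld 9 33) (.load 6 (.add (.var 0) (.var 33))))
        (.assign 31 (.add (.var 0) (.var 33))) .skip)
      (fun i s' => (s'.var 31 = 2 * n + 1 ∧ ∀ a ∈ mask n s 9, a < i → s₂.arr 6 (n + a) = 0) ∨
        ∃ a ∈ mask n s 9, s'.var 31 = n + a ∧ s₂.arr 6 (n + a) ≠ 0) hb₂'.var_zero
      (by simp [LProg.WritesVar]) (.inl ⟨by simp, by simp⟩) ?_
    · refine this.imp (fun h => ⟨h.1, fun a ha => h.2 a ha (mem_mask.1 ha).1⟩) id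
    · intro i hi s' hx hF hP
      have h0 : s'.var 0 = n := by
        rw [hF.var 0 (by decide) (by simp [LProg.WritesVar]), hb₂'.var_zero]
      have h9 : s'.arr 9 = s.arr 9 := by
        rw [hF.arr 9 (by simp [LProg.WritesArr]), State.setVar_arr, h9₂]
      have h6 : s'.arr 6 = s₂.arr 6 := by
        rw [hF.arr 6 (by simp [LProg.WritesArr]), State.setVar_arr]
      simp only [State.setVar_var, if_neg (show ¬ (31 : ℕ) = 33 by decide), LProg.den_ite, ne_eq,
        Expr.eval_and_eq_zero, not_not]
      simp only [Expr.eval, h0, hx, h9, h6]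
      split_ifs with h
      · right
        rw [LProg.den_assign]
        exact ⟨i, mem_mask.2 ⟨hi, h.1⟩, by simp [Expr.eval, h0, hx], h.2⟩
      · rw [LProg.den_skip]
        refine hP.imp (fun hP => ⟨hP.1, fun a ha hai => ?_⟩) id
        rcases Nat.lt_succ_iff_lt_or_eq.1 hai with h' | rfl
        · exact hP.2 a ha h'
        · by_contra h'
          exact h ⟨(mem_mask.1 ha).2, h'⟩
  clear_value s₃
  rw [LProg.den_ite]
  simp only [ne_eq, Expr.eval_lt_eq_zero, not_not]
  simp only [Expr.eval, hb₃.var_two]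
  have hres₃ : resOf n s₃ = resOf n s := by
    funext x y
    rw [resOf, harr₃, h5₂, resOf]
  rcases hcur with ⟨h1, h2⟩ | ⟨a, ha, h1, h2⟩
  · left
    rw [if_neg (by omega), LProg.den_skip, harr₃, h5₂]
    refine ⟨fun a ha h => ?_, rfl⟩
    have han := (mem_mask.1 ha).1
    exact (hmark.lev_ne_zero_iff (show n + a < 2 * n + 1 by omega)).2 h (h2 a ha)
  · right
    have han := (mem_mask.1 ha).1
    rw [if_pos (by omega)]
    refine ⟨⟨a, ha, (hmark.lev_ne_zero_iff (show n + a < 2 * n + 1 by omega)).1 h2⟩, ?_⟩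
    refine walk_spec hb₃ ?_ (by omega) ?_ ?_
    · rw [hres₃, harr₃, harr₃]
      exact hmark
    · rw [harr₃, h1]
      exact h2
    · rw [hres₃, h1]
      exact hflow.isFlowAt ⟨a, ha, rfl⟩ (by omega)

end

end RAM

namespace RAM

open SCCDeletion Relation

/-! ### The flow computation -/

/-- Writes the entry of the capacity matrix of the split digraph in the row of register `27` and
the column of register `28`. -/
def setCap : LProg :=
  .ite (.and (.lt (.var 27) (.var 0)) (.and (.eq (.var 28) (.add (.var 0) (.var 27)))
      (.and (.ld 10 27) (.not (.ld 9 27)))))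
    (.store 5 (.add (.ld 2 27) (.var 28)) (.const 1))
    (.ite (.and (.not (.lt (.var 27) (.var 0)))
        (.and (.lt (.var 27) (.sub (.var 2) (.const 1)))
        (.and (.load 10 (.sub (.var 27) (.var 0)))
        (.or
          (.and (.lt (.var 28) (.var 0)) (.and (.ld 10 28)
          (.and (.load 8 (.sub (.var 27) (.var 0))) (.and (.ld 8 28)
          (.and (.load 0 (.add (.load 1 (.sub (.var 27) (.var 0))) (.var 28)))
            (.load 3 (.add (.load 1 (.sub (.var 27) (.var 0))) (.var 28))))))))
          (.and (.eq (.var 28) (.sub (.var 2) (.const 1)))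
            (.load 11 (.sub (.var 27) (.var 0))))))))
      (.store 5 (.add (.ld 2 27) (.var 28)) (.var 3))
      (.store 5 (.add (.ld 2 27) (.var 28)) (.const 0)))

/-- Computes the flow from the set in block `9` to the set in block `11` through the set in block
`10`.  Afterwards block `12` holds the cut. -/
def flow : LProg := .seqs [
  .loop 27 2 (.loop 28 2 setCap),
  .loop 29 3 augment,
  .assign 23 (.sub (.var 2) (.const 1)), mark,
  .loop 27 0 (.store 12 (.var 27) (.and (.ld 10 27)
    (.and (.not (.ld 6 27)) (.load 6 (.add (.var 0) (.var 27))))))]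

theorem setCap_writesVar (y : ℕ) : ¬ setCap.WritesVar y := by
  simp [setCap, LProg.WritesVar]

theorem setCap_writesArr {a : ℕ} : setCap.WritesArr a ↔ a = 5 := by
  simp [setCap, LProg.WritesArr]

theorem setCap_wf : setCap.WF 10 := by
  simp [setCap, LProg.WF]

theorem flow_wf : flow.WF 10 := by
  simp only [flow, LProg.seqs, LProg.WF, LProg.WritesVar, mark_wf, augment_wf, setCap_wf,
    setCap_writesVar]
  have : ¬ augment.WritesVar 29 := fun h => (augment_writesVar h).2.2.2.2 rfl
  simp [this]

theorem flow_writesVar {y : ℕ} (h : flow.WritesVar y) : 20 ≤ y ∧ y ≤ 34 := by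
  simp only [flow, LProg.seqs, LProg.WritesVar, mark_writesVar, setCap_writesVar] at h
  have := @augment_writesVar y
  by_cases h' : augment.WritesVar y
  · have := this h'
    omega
  · simp [h'] at h
    omega

theorem flow_writesArr {a : ℕ} (h : flow.WritesArr a) : a = 5 ∨ a = 6 ∨ a = 7 ∨ a = 12 := by
  simp [flow, LProg.seqs, LProg.WritesArr, mark_writesArr, setCap_writesArr,
    augment_writesArr] at h
  omega

section

variable {adj : ℕ → ℕ → Prop} {n k : ℕ} {s : State}

open Classical in
/-- One entry of the capacity matrix of the split digraph: vertex `v` becomes the in-node `v` and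
the out-node `n + v`, and `2 * n` is the sink. -/
theorem setCap_spec (hs : Base adj n k s)
    (hR : ∀ u < n, ∀ v < n, s.arr 3 (u * n + v) ≠ 0 ↔ Conn adj (mask n s 8) v u) {x y : ℕ}
    (hx : x < 2 * n + 1) (hy : y < 2 * n + 1) (hvx : s.var 27 = x) (hvy : s.var 28 = y) :
    (setCap.den s).arr 5 = Function.update (s.arr 5) (x * (2 * n + 1) + y)
      (splitCap n (SccArc adj (mask n s 8)) (mask n s 10) (mask n s 9) (mask n s 11) (k + 1)
        x y) := by
  have haddr := (lt_mul_of_lt hx hy).trans_le hs.var_nine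
  have hi : (Expr.add (.ld 2 27) (.var 28)).eval s = x * (2 * n + 1) + y := by
    simp only [Expr.eval, hvx, hvy, hs.row' x hx]
  have hst : ∀ e : Expr, ((LProg.store 5 (.add (.ld 2 27) (.var 28)) e).den s).arr 5 =
      Function.update (s.arr 5) (x * (2 * n + 1) + y) (e.eval s) := fun e => by
    rw [LProg.den_store_arr (by rw [hi]; exact haddr), hi]
  simp only [setCap, LProg.den_ite, ne_eq, Expr.eval_and_eq_zero, Expr.eval_eq_eq_zero,
    Expr.eval_lt_eq_zero, Expr.eval_not_eq_zero, not_not]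
  rw [apply_ite State.arr, apply_ite State.arr, ite_apply, ite_apply, hst, hst, hst]
  simp only [Expr.eval, hvx, hvy, hs.var_zero, hs.var_two, hs.var_three, Nat.add_sub_cancel]
  rw [← apply_ite (Function.update (s.arr 5) (x * (2 * n + 1) + y)),
    ← apply_ite (Function.update (s.arr 5) (x * (2 * n + 1) + y))]
  congr 1
  rw [splitCap]
  by_cases hxn : x < n
  · simp only [hxn, true_and, not_true_eq_false, false_and, if_false, if_true, mem_mask, ne_eq,
      not_not]
  · by_cases hx2 : x < 2 * n
    · have hxn' : x - n < n := by omega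
      have hrow := hs.row _ hxn'
      simp only [hxn, hx2, false_and, true_and, if_false, if_true, mem_mask, ne_eq,
        not_false_eq_true, hxn', Nat.add_eq_zero_iff, Expr.eval_and_eq_zero, not_and_or,
        not_not]
      by_cases hyn : y < n
      · have h1 : y ≠ 2 * n := by omega
        have h2 := hs.adj_iff _ hxn' y hyn
        have h3 := hR _ hxn' y hyn
        simp only [Expr.eval_eq_eq_zero, Expr.eval_lt_eq_zero]
        simp only [Expr.eval, hvx, hvy, hs.var_zero, hs.var_two, Nat.add_sub_cancel, hrow, hyn, h1,
          true_and, if_true, SccArc, mem_mask, hxn', ← h2, ← h3]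
        congr 1
        simp [h1]
        tauto
      · simp only [Expr.eval_eq_eq_zero, Expr.eval_lt_eq_zero]
        simp only [Expr.eval, hvx, hvy, hs.var_zero, hs.var_two, Nat.add_sub_cancel, hyn, if_false]
        by_cases h1 : y = 2 * n
        · simp [h1]
        · simp [h1]
    · simp [hxn, hx2]

/-- The program `flow` computes a maximum flow, cut off at the value `k + 1`. By the labels of a
last search from the sink, the maximal source side of a minimum cut consists of the vertices whose
out-node does not reach the sink in the residual digraph, and the cut itself of those whose out-node
reaches it while the in-node does not. The ends of the flow are read off the residual arcs that
leave the sink. -/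
theorem flow_spec (hs : Base adj n k s)
    (hR : ∀ u < n, ∀ v < n, s.arr 3 (u * n + v) ≠ 0 ↔ Conn adj (mask n s 8) v u) :
    mask n (flow.den s) 12 = ((mask n s 10).filter fun v =>
      (flow.den s).arr 6 v = 0 ∧ (flow.den s).arr 6 (n + v) ≠ 0) ∧
    (mask n s 9 ⊆ mask n s 10 → ∃ val,
      IsFlowOutput (SccArc adj (mask n s 8)) (mask n s 10) (mask n s 9) (mask n s 11) k
      (mask n (flow.den s) 12)
      ((mask n s 10).filter fun v => (flow.den s).arr 6 (n + v) = 0)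
      ((Finset.range n).filter fun v => resOf n (flow.den s) (2 * n) (n + v) ≠ 0) val) := by
  set A := mask n s 9 with hA
  set cap := splitCap n (SccArc adj (mask n s 8)) (mask n s 10) (mask n s 9) (mask n s 11) (k + 1)
    with hcap
  set src : ℕ → Prop := fun x => ∃ a ∈ A, x = n + a with hsrc
  have hden := LProg.den_seqs_cons (s := s) (p := .loop 27 2 (.loop 28 2 setCap)) (l := [
    .loop 29 3 augment, .assign 23 (.sub (.var 2) (.const 1)), mark,
    .loop 27 0 (.store 12 (.var 27) (.and (.ld 10 27)
      (.and (.not (.ld 6 27)) (.load 6 (.add (.var 0) (.var 27))))))])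
  rw [← flow] at hden
  simp only [LProg.den_seqs_cons, LProg.den_seqs_nil] at hden
  set p₁ : LProg := .loop 27 2 (.loop 28 2 setCap) with hp₁
  have hpv : ∀ y, p₁.WritesVar y ↔ y = 27 ∨ y = 28 := by
    simp [hp₁, LProg.WritesVar, setCap_writesVar]
  have hpa : ∀ a, p₁.WritesArr a ↔ a = 5 := by
    simp [hp₁, LProg.WritesArr, setCap_writesArr]
  set s₁ := p₁.den s with hs₁
  have hb₁ : Base adj n k s₁ := hs.den
    (by simp [hp₁, LProg.WF, setCap_wf, LProg.WritesVar, setCap_writesVar])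
    (by simp [hpa]; omega)
  have harr₁ : ∀ a, a ≠ 5 → s₁.arr a = s.arr a := fun a ha => LProg.den_arr (by rwa [hpa]) s
  have h5₁ : ∀ x < 2 * n + 1, ∀ y < 2 * n + 1, resOf n s₁ x y = cap x y := by
    refine LProg.den_fill₂ cap hs.var_two (setCap_writesVar _) (setCap_writesVar _) (by decide)
      (by decide) (by decide) (setCap_writesVar _) (fun c => setCap_writesArr.1) le_rfl ?_
    intro x hx y hy s' h1 h2 h3 h4
    have hb' : Base adj n k s' := hs.congr
      (fun z hz => h3 z (by omega) (by omega) (setCap_writesVar z)) fun a ha => h4 a (by omega)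
    have hmask : ∀ a, a ≠ 5 → mask n s' a = mask n s a := fun a ha =>
      mask_congr fun v _ => by rw [h4 a ha]
    rw [setCap_spec hb' (by rw [h4 3 (by decide), hmask 8 (by decide)]; exact hR) hx hy h1 h2,
      hmask 8 (by decide), hmask 9 (by decide), hmask 10 (by decide), hmask 11 (by decide)]
  clear_value s₁
  set s₂ := (LProg.loop 29 3 augment).den s₁ with hs₂
  have hb₂ : Base adj n k s₂ := hb₁.den
    ⟨by decide, by decide, fun h => (augment_writesVar h).2.2.2.2 rfl, augment_wf⟩
    (by simp [LProg.WritesArr, augment_writesArr]; omega)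
  have harr₂ : ∀ a, a ≠ 5 → a ≠ 6 → a ≠ 7 → s₂.arr a = s.arr a := fun a h5 h6 h7 => by
    rw [← harr₁ a h5]
    exact LProg.den_arr (by simp [LProg.WritesArr, augment_writesArr]; omega) s₁
  obtain ⟨val, hflow, hvk, hmax⟩ : ∃ val, IsFlow (2 * n + 1) cap src (2 * n) (resOf n s₂) val ∧
      val ≤ k + 1 ∧ (val = k + 1 ∨ ∀ a ∈ A, ¬ ReflTransGen (fun x y => x < 2 * n + 1 ∧
        y < 2 * n + 1 ∧ resOf n s₂ x y ≠ 0) (n + a) (2 * n)) := by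
    refine LProg.den_loop (fun i s' => ∃ val, IsFlow (2 * n + 1) cap src (2 * n) (resOf n s') val ∧
      val ≤ i ∧ (val = i ∨ ∀ a ∈ A, ¬ ReflTransGen (fun x y => x < 2 * n + 1 ∧
        y < 2 * n + 1 ∧ resOf n s' x y ≠ 0) (n + a) (2 * n))) hb₁.var_three
      (fun h => (augment_writesVar h).2.2.2.2 rfl)
      ⟨0, (IsFlow.init _).congr (by omega) h5₁, le_rfl, .inl rfl⟩ ?_
    rintro i hi s' hx hF ⟨val, h1, h2, h3⟩
    have hb' : Base adj n k s' := hb₁.frame hF (by omega) augment_wf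
      (by simp [augment_writesArr]; omega)
    have hA' : mask n s' 9 = A := mask_congr fun v _ => by
      rw [hF.arr 9 (by simp [augment_writesArr]), harr₁ 9 (by decide)]
    have hres : ∀ v, resOf n ((augment.den s').setVar 29 v) = resOf n (augment.den s') :=
      fun _ => rfl
    rw [hres]
    have := augment_spec (cap := cap) (val := val) hb' (by rw [hA']; exact h1)
    rw [hA'] at this
    rcases this with ⟨h4, h5⟩ | ⟨⟨a, ha, hpath⟩, h4⟩
    · have h6 : resOf n (augment.den s') = resOf n s' := by
        funext x y
        rw [resOf, h5, resOf]
      rw [h6]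
      exact ⟨val, h1, by omega, .inr h4⟩
    · rcases h3 with rfl | h3
      · exact ⟨_, h4, le_rfl, .inl rfl⟩
      · exact absurd hpath (h3 a ha)
  clear_value s₂
  rw [LProg.den_assign (x := 23)] at hden
  simp only [Expr.eval, hb₂.var_two, Nat.add_sub_cancel] at hden
  set s₃ := s₂.setVar 23 (2 * n) with hs₃
  have hb₃ : Base adj n k s₃ := hb₂.congr (fun y hy => by
    rw [hs₃, State.setVar_var, if_neg (by omega)]) fun _ _ => rfl
  have hmark := mark_spec hb₃ rfl (show s₃.var 23 < 2 * n + 1 by simp [hs₃])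
  rw [show s₃.var 23 = 2 * n by simp [hs₃]] at hmark
  change IsMarking (2 * n + 1) (resOf n s₂) _ _ _ at hmark
  set s₄ := mark.den s₃ with hs₄
  have hb₄ : Base adj n k s₄ := hb₃.den mark_wf (by simp [mark_writesArr]; omega)
  have h5₄ : s₄.arr 5 = s₂.arr 5 := LProg.den_arr (by simp [mark_writesArr]) s₃
  have harr₄ : ∀ a, a ≠ 5 → a ≠ 6 → a ≠ 7 → s₄.arr a = s.arr a := fun a h5 h6 h7 => by
    rw [← harr₂ a h5 h6 h7, hs₄, LProg.den_arr (by simp [mark_writesArr]; omega) s₃]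
    rfl
  clear_value s₄
  set q : LProg := .store 12 (.var 27) (.and (.ld 10 27)
    (.and (.not (.ld 6 27)) (.load 6 (.add (.var 0) (.var 27))))) with hq
  have h12 := LProg.den_fill (x := 27) (b := 0) (a := 12) (m := n) (q := q)
    (s := s₄) (fun v => (Expr.and (.ld 10 27)
      (.and (.not (.ld 6 27)) (.load 6 (.add (.var 0) (.var 27))))).eval (s₄.setVar 27 v))
    hb₄.var_zero (by simp [hq, LProg.WritesVar]) (by simp [hq, LProg.WritesArr])
    fun i hi s' h1 h2 h3 => by
      rw [hq, LProg.den_store_arr]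
      · simp only [Expr.and, Expr.not, Expr.eval, h1, h3 10 (by decide), h3 6 (by decide),
          h2 0 (by decide) (by simp [hq, LProg.WritesVar]), State.setVar_var, State.setVar_arr]
        simp
      · rw [h2 9 (by decide) (by simp [hq, LProg.WritesVar])]
        simp only [Expr.eval, h1]
        exact hb₄.lt_nine (by omega)
  have h5₅ : ((LProg.loop 27 0 q).den s₄).arr 5 = s₂.arr 5 := by
    rw [LProg.den_arr (by simp [hq, LProg.WritesArr]), h5₄]
  have h6₅ : ((LProg.loop 27 0 q).den s₄).arr 6 = s₄.arr 6 :=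
    LProg.den_arr (by simp [hq, LProg.WritesArr]) _
  have hC : mask n ((LProg.loop 27 0 q).den s₄) 12 =
      (mask n s 10).filter fun v => s₄.arr 6 v = 0 ∧ s₄.arr 6 (n + v) ≠ 0 := by
    ext v
    simp only [mem_mask, Finset.mem_filter, h12]
    by_cases hv : v < n
    · simp only [hv, true_and, if_true, ne_eq, Expr.eval_and_eq_zero, Expr.eval_not_eq_zero,
        not_not]
      simp [Expr.eval, hb₄.var_zero, harr₄ 10 (by decide) (by decide) (by decide)]
    · simp [hv]
  have hres : resOf n ((LProg.loop 27 0 q).den s₄) = resOf n s₂ := by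
    funext x y
    rw [resOf, h5₅, resOf]
  rw [hden, hC, h6₅, hres]
  refine ⟨rfl, fun hAX => ⟨val, ?_⟩⟩
  refine isFlowOutput_of_isFlow (Finset.filter_subset _ _) hAX hflow hmark hvk fun hv a ha => ?_
  by_contra hne
  have han := (mem_mask.1 ha).1
  exact hmax.resolve_left (by omega) a ha
    ((hmark.lev_ne_zero_iff (show n + a < 2 * n + 1 by omega)).1 hne)

end

end RAM

namespace RAM

open SCCDeletion

theorem Expr.Avoids.eval_congr {Ia : Finset ℕ} {e : Expr} {s s' : State} (h : e.Avoids ∅ Ia)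
    (hv : ∀ x, s'.var x = s.var x) (ha : ∀ a, a ∉ Ia → s'.arr a = s.arr a) :
    e.eval s' = e.eval s := by
  induction e with
  | const m => rfl
  | var x => exact hv x
  | load a i ih => simp only [eval]; rw [ih h.2, ha a h.1]
  | add e₁ e₂ ih₁ ih₂ => simp only [eval]; rw [ih₁ h.1, ih₂ h.2]
  | sub e₁ e₂ ih₁ ih₂ => simp only [eval]; rw [ih₁ h.1, ih₂ h.2]

/-- A loop that computes the cells of block `a` below `n` by an expression that does not depend
on that block. -/
theorem mask_fill {n x b a : ℕ} {e : Expr} {s : State} (he : e.Avoids ∅ {a}) (hb : s.var b = n)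
    (hn : n ≤ s.var 9) (hx : x ≠ 9) :
    mask n ((LProg.loop x b (.store a (.var x) e)).den s) a =
      (Finset.range n).filter fun i => e.eval (s.setVar x i) ≠ 0 := by
  have := LProg.den_fill (x := x) (b := b) (a := a) (q := .store a (.var x) e) (s := s)
    (fun i => e.eval (s.setVar x i)) hb (by simp [LProg.WritesVar]) (by simp [LProg.WritesArr])
    fun i hi s' h1 h2 h3 => by
      rw [LProg.den_store_arr]
      · simp only [Expr.eval, h1]
        rw [he.eval_congr (s' := s') (s := s.setVar x i) (fun z => ?_) fun c hc => ?_]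
        · rw [State.setVar_var]
          split_ifs with h
          · rw [h, h1]
          · exact h2 z h (by simp [LProg.WritesVar])
        · exact h3 c (by simpa using hc)
      · simp only [Expr.eval, h1]
        rw [h2 9 hx.symm (by simp [LProg.WritesVar])]
        omega
  ext v
  simp only [mem_mask, this, Finset.mem_filter, Finset.mem_range]
  refine and_congr_right fun hv => ?_
  rw [if_pos hv]

/-! ### Choosing a vertex -/

/-- The number of elements of `M` below `v`. -/
def rank (M : Finset ℕ) (v : ℕ) : ℕ := (M.filter (· < v)).card

theorem rank_lt {M : Finset ℕ} {v : ℕ} (hv : v ∈ M) : rank M v < M.card :=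
  Finset.card_lt_card ⟨Finset.filter_subset _ _, fun h =>
    lt_irrefl v (Finset.mem_filter.1 (h hv)).2⟩

theorem rank_succ {M : Finset ℕ} {v : ℕ} :
    rank M (v + 1) = rank M v + if v ∈ M then 1 else 0 := by
  have : M.filter (· < v + 1) = M.filter (· < v) ∪ if v ∈ M then {v} else ∅ := by
    ext z
    split_ifs with h
    · simp only [Finset.mem_filter, Finset.mem_union, Finset.mem_singleton,
        Nat.lt_succ_iff_lt_or_eq]
      constructor
      · tauto
      · rintro (h' | rfl) <;> tauto
    · simp only [Finset.mem_filter, Finset.union_empty, Nat.lt_succ_iff_lt_or_eq]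
      constructor
      · rintro ⟨h1, h2 | rfl⟩ <;> tauto
      · tauto
  rw [rank, this, rank]
  split_ifs with h
  · rw [Finset.card_union_of_disjoint (by simp), Finset.card_singleton]
  · simp

theorem rank_lt_rank {M : Finset ℕ} {u v : ℕ} (hu : u ∈ M) (huv : u < v) :
    rank M u < rank M v := by
  refine Finset.card_lt_card ⟨fun z hz => ?_, fun h => ?_⟩
  · simp only [Finset.mem_filter] at hz ⊢
    exact ⟨hz.1, by omega⟩
  · exact lt_irrefl u (Finset.mem_filter.1 (h (Finset.mem_filter.2 ⟨hu, huv⟩))).2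

theorem rank_inj {M : Finset ℕ} {u v : ℕ} (hu : u ∈ M) (hv : v ∈ M) (h : rank M u = rank M v) :
    u = v := by
  rcases lt_trichotomy u v with h' | h' | h'
  · have := rank_lt_rank hu h'
    omega
  · exact h'
  · have := rank_lt_rank hv h'
    omega

/-- The number in cell `i` of the current command. -/
abbrev Expr.cmd (i : ℕ) : Expr := .load 18 (.const i)

/-- The vertex in register `38` lies in the set that the current command refers to: the vertices
of block `14` that are alive, the cut, or the ends of the flow. -/
def inSelection : Expr :=
  .or (.and (.eq (.cmd 0) (.const 0)) (.and (.ld 14 38) (.ld 8 38)))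
    (.or (.and (.eq (.cmd 0) (.const 1)) (.ld 12 38))
      (.and (.eq (.cmd 0) (.const 2)) (.load 5 (.add (.load 2 (.sub (.var 2) (.const 1)))
        (.add (.var 0) (.var 38))))))

/-- Puts into register `36` the element of the selected set whose rank is given by the current
command. -/
def pick : LProg := .seqs [
  .assign 36 (.var 0), .assign 37 (.const 0),
  .loop 38 0 (.ite inSelection
    (.seq (.ite (.eq (.var 37) (.cmd 2)) (.assign 36 (.var 38)) .skip)
      (.assign 37 (.add (.var 37) (.const 1)))) .skip)]

/-- If the ends of the flow are selected, replaces the chosen root by a vertex of its copy. -/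
def pickFromCopy (h : ℕ) : LProg := .seqs ((List.range h).map fun j =>
  .ite (.and (.eq (.cmd 0) (.const 2)) (.eq (.cmd 3) (.const j)))
    (.assign 36 (.ld (100 + j) 36)) .skip)

theorem pick_wf : pick.WF 10 := by
  simp [pick, LProg.seqs, LProg.WF, LProg.WritesVar]

theorem pick_writesVar {y : ℕ} : pick.WritesVar y ↔ y = 36 ∨ y = 37 ∨ y = 38 := by
  simp [pick, LProg.seqs, LProg.WritesVar]
  tauto

theorem pick_writesArr {a : ℕ} : ¬ pick.WritesArr a := by
  simp [pick, LProg.seqs, LProg.WritesArr]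

theorem pickFromCopy_wf {h : ℕ} : (pickFromCopy h).WF 10 := by
  simp [pickFromCopy, LProg.wf_seqs, LProg.WF]

theorem pickFromCopy_writesVar {h y : ℕ} (hy : (pickFromCopy h).WritesVar y) : y = 36 := by
  simp [pickFromCopy, LProg.writesVar_seqs, LProg.WritesVar] at hy
  exact hy.2

theorem pickFromCopy_writesArr {h a : ℕ} : ¬ (pickFromCopy h).WritesArr a := by
  simp [pickFromCopy, LProg.writesArr_seqs, LProg.WritesArr]

section

variable {adj : ℕ → ℕ → Prop} {n k : ℕ} {s : State}

theorem eval_inSelection (hs : Base adj n k s) : inSelection.eval s ≠ 0 ↔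
    (s.arr 18 0 = 0 ∧ s.arr 14 (s.var 38) ≠ 0 ∧ s.arr 8 (s.var 38) ≠ 0) ∨
    (s.arr 18 0 = 1 ∧ s.arr 12 (s.var 38) ≠ 0) ∨
    (s.arr 18 0 = 2 ∧ resOf n s (2 * n) (n + s.var 38) ≠ 0) := by
  have hor : ∀ e e' : Expr, (Expr.or e e').eval s ≠ 0 ↔ e.eval s ≠ 0 ∨ e'.eval s ≠ 0 := by
    intro e e'
    simp only [Expr.eval]
    omega
  rw [inSelection, hor, hor]
  simp only [ne_eq, Expr.eval_and_eq_zero, Expr.eval_eq_eq_zero, not_not]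
  simp only [Expr.eval, hs.var_two, hs.var_zero, Nat.add_sub_cancel,
    hs.row' (2 * n) (by omega), resOf]

theorem pick_spec (hs : Base adj n k s) {M : Finset ℕ} (hM : M ⊆ Finset.range n)
    (hsel : ∀ u < n, u ∈ M ↔ (s.arr 18 0 = 0 ∧ s.arr 14 u ≠ 0 ∧ s.arr 8 u ≠ 0) ∨
      (s.arr 18 0 = 1 ∧ s.arr 12 u ≠ 0) ∨ (s.arr 18 0 = 2 ∧ resOf n s (2 * n) (n + u) ≠ 0))
    {v : ℕ} (hv : v ∈ M) (hr : s.arr 18 2 = rank M v) : (pick.den s).var 36 = v := by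
  rw [pick]
  simp only [LProg.den_seqs_cons, LProg.den_seqs_nil]
  rw [LProg.den_assign (x := 36), LProg.den_assign (x := 37)]
  simp only [Expr.eval]
  set s₁ := (s.setVar 36 (s.var 0)).setVar 37 0 with hs₁
  have hb₁ : Base adj n k s₁ := hs.congr (fun y hy => by
    simp only [hs₁, State.setVar_var]
    rw [if_neg (by omega), if_neg (by omega)]) fun _ _ => rfl
  have := LProg.den_loop (x := 38) (b := 0) (s := s₁) (p := .ite inSelection
    (.seq (.ite (.eq (.var 37) (.cmd 2)) (.assign 36 (.var 38)) .skip)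
      (.assign 37 (.add (.var 37) (.const 1)))) .skip)
    (fun i s' => s'.var 37 = rank M i ∧ (v < i → s'.var 36 = v)) hb₁.var_zero
    (by simp [LProg.WritesVar]) ⟨by simp [hs₁, rank], by simp⟩ ?_
  · exact this.2 (Finset.mem_range.1 (hM hv))
  · intro i hi s' hx hF ⟨h1, h2⟩
    have hb' : Base adj n k s' := hb₁.frame hF (by omega) (by simp [LProg.WF])
      (by simp [LProg.WritesArr])
    have harr : ∀ a, s'.arr a = s.arr a := fun a => hF.arr a (by simp [LProg.WritesArr])
    have hres : resOf n s' = resOf n s := by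
      funext x y
      rw [resOf, harr, resOf]
    rw [LProg.den_ite]
    have hin := eval_inSelection hb'
    rw [harr, harr, harr, harr, hres, hx, ← hsel i hi] at hin
    simp only [hin]
    by_cases hiM : i ∈ M
    · rw [if_pos hiM, LProg.den_seq, LProg.den_ite]
      simp only [ne_eq, Expr.eval_eq_eq_zero, not_not]
      simp only [Expr.eval, harr, h1, hr]
      by_cases hiv : i = v
      · subst hiv
        rw [if_pos rfl, LProg.den_assign, LProg.den_assign]
        simp [Expr.eval, hx, h1, rank_succ, hiM]
      · rw [if_neg (fun h => hiv (rank_inj hiM hv h)), LProg.den_skip, LProg.den_assign]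
        simp only [Expr.eval, State.setVar_var]
        exact ⟨by simp [h1, rank_succ, hiM], fun h => by simpa using h2 (by omega)⟩
    · rw [if_neg hiM, LProg.den_skip]
      simp only [State.setVar_var]
      refine ⟨by simp [h1, rank_succ, hiM], fun h => ?_⟩
      have : i ≠ v := fun h => hiM (h ▸ hv)
      simpa using h2 (by omega)

theorem pickFromCopy_of_ne {h : ℕ} (hsel : s.arr 18 0 ≠ 2) :
    ((pickFromCopy h).den s).var 36 = s.var 36 := by
  refine (LProg.den_seqs_of_forall (fun s' => s'.arr 18 = s.arr 18 ∧ s'.var 36 = s.var 36) ?_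
    ⟨rfl, rfl⟩).2
  rintro p hp s' ⟨h1, h2⟩
  obtain ⟨j, -, rfl⟩ := List.mem_map.1 hp
  rw [LProg.den_ite, if_neg, LProg.den_skip]
  · exact ⟨h1, h2⟩
  · simp only [ne_eq, Expr.eval_and_eq_zero, Expr.eval_eq_eq_zero, not_not]
    simp only [Expr.eval, h1]
    tauto

theorem pickFromCopy_of_eq {h j : ℕ} (hsel : s.arr 18 0 = 2) (hj : s.arr 18 3 = j) (hjh : j < h) :
    ((pickFromCopy h).den s).var 36 = s.arr (100 + j) (s.var 36) := by
  have key : ∀ l : List ℕ, l.Nodup → ∀ s : State, s.arr 18 0 = 2 → s.arr 18 3 = j →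
      ((LProg.seqs (l.map fun j =>
        .ite (.and (.eq (.cmd 0) (.const 2)) (.eq (.cmd 3) (.const j)))
          (.assign 36 (.ld (100 + j) 36)) .skip)).den s).var 36 =
        if j ∈ l then s.arr (100 + j) (s.var 36) else s.var 36 := by
    intro l
    induction l with
    | nil => intro _ s _ _; simp [LProg.den_seqs_nil]
    | cons i l ih =>
      intro hnd s h1 h2
      rw [List.nodup_cons] at hnd
      rw [List.map_cons, LProg.den_seqs_cons, LProg.den_ite]
      simp only [ne_eq, Expr.eval_and_eq_zero, Expr.eval_eq_eq_zero, not_not]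
      simp only [Expr.eval, h1, h2, true_and]
      by_cases hji : j = i
      · subst hji
        rw [if_pos rfl, LProg.den_assign, ih hnd.2 _ (by simpa using h1) (by simpa using h2),
          if_neg hnd.1]
        simp [Expr.eval]
      · rw [if_neg hji, LProg.den_skip, ih hnd.2 _ h1 h2]
        simp [hji]
  rw [pickFromCopy, key _ List.nodup_range s hsel hj, if_pos (List.mem_range.2 hjh)]

end

/-! ### Moves -/

/-- Deletes the vertex in register `36`. -/
def deleteMove : LProg :=
  .ite (.eq (.cmd 1) (.const 0)) (.store 8 (.var 36) (.const 0)) .skip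

/-- Makes the vertex in register `36` the only source; the targets become the set in block `4` or
the one in block `14`. -/
def startMove : LProg :=
  .ite (.or (.eq (.cmd 1) (.const 1)) (.eq (.cmd 1) (.const 2))) (.seqs [
    .loop 38 0 (.store 9 (.var 38) (.eq (.var 38) (.var 36))),
    .loop 38 0 (.store 10 (.var 38) (.ld 8 38)),
    .loop 38 0 (.store 11 (.var 38) (.or (.and (.eq (.cmd 1) (.const 1)) (.ld 4 38))
      (.and (.eq (.cmd 1) (.const 2)) (.ld 14 38))))]) .skip

/-- Advances the sources to the part of the cut that the command indicates. -/
def shrinkMove : LProg :=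
  .ite (.eq (.cmd 1) (.const 3)) (.seq
    (.assign 37 (.const 0))
    (.loop 38 0 (.ite (.ld 12 38)
      (.seqs [.store 9 (.var 38) (.load 18 (.add (.const 4) (.var 37))),
        .store 10 (.var 38) (.load 18 (.add (.const 4) (.var 37))),
        .assign 37 (.add (.var 37) (.const 1))])
      (.seqs [.store 9 (.var 38) (.const 0),
        .store 10 (.var 38) (.and (.ld 10 38) (.load 6 (.add (.var 0) (.var 38))))])))) .skip

/-- Carries out the current command. -/
def act : LProg := .seq deleteMove (.seq startMove shrinkMove)

theorem act_wf : act.WF 10 := by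
  simp [act, deleteMove, startMove, shrinkMove, LProg.seqs, LProg.WF, LProg.WritesVar]

theorem act_writesVar {y : ℕ} : act.WritesVar y ↔ y = 37 ∨ y = 38 := by
  simp [act, deleteMove, startMove, shrinkMove, LProg.seqs, LProg.WritesVar]
  tauto

theorem act_writesArr {a : ℕ} (h : act.WritesArr a) : a = 8 ∨ a = 9 ∨ a = 10 ∨ a = 11 := by
  simp [act, deleteMove, startMove, shrinkMove, LProg.seqs, LProg.WritesArr] at h
  omega

section

variable {adj : ℕ → ℕ → Prop} {n k : ℕ} {s : State}

theorem deleteMove_of_ne (h : s.arr 18 1 ≠ 0) : deleteMove.den s = s := by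
  rw [deleteMove, LProg.den_ite, if_neg, LProg.den_skip]
  simpa [Expr.eval] using h

theorem startMove_of_ne (h1 : s.arr 18 1 ≠ 1) (h2 : s.arr 18 1 ≠ 2) : startMove.den s = s := by
  rw [startMove, LProg.den_ite, if_neg, LProg.den_skip]
  simp only [Expr.eval, Expr.eq, Expr.not]
  omega

theorem shrinkMove_of_ne (h : s.arr 18 1 ≠ 3) : shrinkMove.den s = s := by
  rw [shrinkMove, LProg.den_ite, if_neg, LProg.den_skip]
  simpa [Expr.eval] using h

theorem act_delete (hs : Base adj n k s) (hc : s.arr 18 1 = 0) (hv : s.var 36 < n) :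
    mask n (act.den s) 8 = (mask n s 8).erase (s.var 36) := by
  have h18 : ∀ i, ((s.setArr 8 (s.var 36) 0).arr 18) i = s.arr 18 i := fun i => by
    rw [State.setArr_arr, if_neg (by omega)]
  rw [act, LProg.den_seq, LProg.den_seq, deleteMove, LProg.den_ite, if_pos, LProg.den_store]
  · simp only [Expr.eval]
    rw [startMove_of_ne (by rw [h18]; omega) (by rw [h18]; omega),
      shrinkMove_of_ne (by rw [h18]; omega)]
    ext v
    simp only [mem_mask, State.setArr_arr, Finset.mem_erase]
    by_cases h : v = s.var 36 <;> simp [h]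
  · exact hs.lt_nine (x := s.var 36) (by omega)
  · simpa [Expr.eval] using hc

/-- Commands without meaning do nothing, so that short searches can be padded to full length. -/
theorem act_idle (hc : 4 ≤ s.arr 18 1) : mask n (act.den s) 8 = mask n s 8 := by
  rw [act, LProg.den_seq, LProg.den_seq, deleteMove_of_ne (by omega),
    startMove_of_ne (by omega) (by omega), shrinkMove_of_ne (by omega)]

/-- The sets that describe the state of the search. -/
def cutState (n : ℕ) (s : State) : CutState ℕ :=
  ⟨mask n s 8, mask n s 9, mask n s 10, mask n s 11⟩

theorem act_start (hs : Base adj n k s) (hc : s.arr 18 1 = 1 ∨ s.arr 18 1 = 2)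
    (hv : s.var 36 < n) :
    cutState n (act.den s) = ⟨mask n s 8, {s.var 36}, mask n s 8,
      if s.arr 18 1 = 1 then mask n s 4 else mask n s 14⟩ := by
  rw [act, LProg.den_seq, LProg.den_seq, deleteMove_of_ne (by omega)]
  have hw : ¬ startMove.WritesArr 18 := by simp [startMove, LProg.seqs, LProg.WritesArr]
  rw [shrinkMove_of_ne (by rw [LProg.den_arr hw]; omega), startMove, LProg.den_ite, if_pos]
  swap
  · simp only [Expr.eval, Expr.eq, Expr.not]
    omega
  simp only [LProg.den_seqs_cons, LProg.den_seqs_nil]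
  set p₁ : LProg := .loop 38 0 (.store 9 (.var 38) (.eq (.var 38) (.var 36)))
  set p₂ : LProg := .loop 38 0 (.store 10 (.var 38) (.ld 8 38))
  set p₃ : LProg := .loop 38 0 (.store 11 (.var 38) (.or (.and (.eq (.cmd 1) (.const 1)) (.ld 4 38))
      (.and (.eq (.cmd 1) (.const 2)) (.ld 14 38))))
  have hb₁ : Base adj n k (p₁.den s) := hs.den (by simp [p₁, LProg.WF, LProg.WritesVar])
    (by simp [p₁, LProg.WritesArr]; omega)
  have hb₂ : Base adj n k (p₂.den (p₁.den s)) := hb₁.den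
    (by simp [p₂, LProg.WF, LProg.WritesVar]) (by simp [p₂, LProg.WritesArr]; omega)
  have ha₁ : ∀ a, a ≠ 9 → (p₁.den s).arr a = s.arr a := fun a ha =>
    LProg.den_arr (by simpa [p₁, LProg.WritesArr] using ha) _
  have ha₂ : ∀ a, a ≠ 10 → (p₂.den (p₁.den s)).arr a = (p₁.den s).arr a := fun a ha =>
    LProg.den_arr (by simpa [p₂, LProg.WritesArr] using ha) _
  have ha₃ : ∀ a, a ≠ 11 → (p₃.den (p₂.den (p₁.den s))).arr a = (p₂.den (p₁.den s)).arr a :=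
    fun a ha => LProg.den_arr (by simpa [p₃, LProg.WritesArr] using ha) _
  have hn : ∀ {s : State}, Base adj n k s → n ≤ s.var 9 := fun h => (h.lt_nine (by omega)).le
  have h9 : mask n (p₁.den s) 9 = {s.var 36} := by
    rw [mask_fill (by simp [Expr.avoids_eq, Expr.Avoids]) hs.var_zero (hn hs) (by decide)]
    ext v
    simp only [Finset.mem_filter, Finset.mem_range, ne_eq, Expr.eval_eq_eq_zero, not_not,
      Finset.mem_singleton]
    simp only [Expr.eval, State.setVar_var]
    simp
    omega
  have h10 : mask n (p₂.den (p₁.den s)) 10 = mask n s 8 := by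
    rw [mask_fill (by simp [Expr.Avoids]) hb₁.var_zero (hn hb₁) (by decide)]
    ext v
    simp [mem_mask, Expr.eval, ha₁]
  have h11 : mask n (p₃.den (p₂.den (p₁.den s))) 11 =
      if s.arr 18 1 = 1 then mask n s 4 else mask n s 14 := by
    rw [mask_fill (by simp [Expr.Avoids, Expr.avoids_and, Expr.avoids_eq]) hb₂.var_zero (hn hb₂)
      (by decide)]
    ext v
    have hor : ∀ (e e' : Expr) (s : State),
        (Expr.or e e').eval s ≠ 0 ↔ e.eval s ≠ 0 ∨ e'.eval s ≠ 0 := by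
      intro e e' s
      simp only [Expr.eval]
      omega
    simp only [Finset.mem_filter, Finset.mem_range, hor]
    simp only [ne_eq, Expr.eval_and_eq_zero, Expr.eval_eq_eq_zero, not_not]
    simp only [Expr.eval, State.setVar_var, State.setVar_arr, if_true]
    rw [ha₂ 18 (by decide), ha₂ 4 (by decide), ha₂ 14 (by decide), ha₁ 18 (by decide),
      ha₁ 4 (by decide), ha₁ 14 (by decide)]
    split_ifs with h
    · simp [h, mem_mask]
    · simp [hc.resolve_left h, mem_mask]
  rw [cutState, h11]
  congr 1
  · exact mask_congr fun v _ => by rw [ha₃ 8 (by decide), ha₂ 8 (by decide), ha₁ 8 (by decide)]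
  · rw [← h9]
    exact mask_congr fun v _ => by rw [ha₃ 9 (by decide), ha₂ 9 (by decide)]
  · rw [← h10]
    exact mask_congr fun v _ => by rw [ha₃ 10 (by decide)]

theorem act_shrink (hs : Base adj n k s) (hc : s.arr 18 1 = 3) {C' : Finset ℕ}
    (hC' : C' ⊆ mask n s 12)
    (hbits : ∀ v ∈ mask n s 12, s.arr 18 (4 + rank (mask n s 12) v) ≠ 0 ↔ v ∈ C')
    (hC : ∀ v ∈ mask n s 12, v ∈ mask n s 10 ∧ s.arr 6 (n + v) ≠ 0) :
    cutState n (act.den s) = ⟨mask n s 8, C',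
      (mask n s 10 \ (mask n s 10).filter fun v => s.arr 6 (n + v) = 0) \ (mask n s 12 \ C'),
      mask n s 11⟩ := by
  rw [act, LProg.den_seq, LProg.den_seq, deleteMove_of_ne (by omega),
    startMove_of_ne (by omega) (by omega), shrinkMove, LProg.den_ite, if_pos]
  swap
  · simpa [Expr.eval] using hc
  rw [LProg.den_seq, LProg.den_assign]
  simp only [Expr.eval]
  set s₁ := s.setVar 37 0 with hs₁
  have hb₁ : Base adj n k s₁ := hs.congr (fun y hy => by
    rw [hs₁, State.setVar_var, if_neg (by omega)]) fun _ _ => rfl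
  set C := mask n s 12 with hCdef
  set X' := ((mask n s 10).filter fun v => s.arr 6 (n + v) ≠ 0 ∧ v ∉ C) ∪ C' with hX'
  set q : LProg := .ite (.ld 12 38)
      (.seqs [.store 9 (.var 38) (.load 18 (.add (.const 4) (.var 37))),
        .store 10 (.var 38) (.load 18 (.add (.const 4) (.var 37))),
        .assign 37 (.add (.var 37) (.const 1))])
      (.seqs [.store 9 (.var 38) (.const 0),
        .store 10 (.var 38) (.and (.ld 10 38) (.load 6 (.add (.var 0) (.var 38))))]) with hq
  have hqa : ∀ a, q.WritesArr a → a = 9 ∨ a = 10 := by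
    intro a h
    simp [hq, LProg.seqs, LProg.WritesArr] at h
    omega
  have hqv : ∀ y, q.WritesVar y → y = 37 := by
    intro y h
    simpa [hq, LProg.seqs, LProg.WritesVar] using h
  have hqwf : q.WF 10 := by simp [hq, LProg.seqs, LProg.WF]
  have hfr : ∀ a, a ≠ 9 → a ≠ 10 → ((LProg.loop 38 0 q).den s₁).arr a = s.arr a :=
    fun a h1 h2 => LProg.den_arr (fun h => by have := hqa a h; omega) s₁
  have := LProg.den_loop (x := 38) (b := 0) (s := s₁) (p := q)
    (fun i s' => s'.var 37 = rank C i ∧ (∀ v < i, s'.arr 9 v ≠ 0 ↔ v ∈ C') ∧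
      (∀ v < i, s'.arr 10 v ≠ 0 ↔ v ∈ X') ∧ ∀ v ≥ i, s'.arr 10 v = s.arr 10 v) hb₁.var_zero
    (fun h => by have := hqv _ h; omega)
    ⟨by simp [hs₁, rank], by simp, by simp, fun _ _ => rfl⟩ ?_
  · obtain ⟨-, h1, h2, -⟩ := this
    have h9 : mask n ((LProg.loop 38 0 q).den s₁) 9 = C' := by
      ext v
      rw [mem_mask]
      exact ⟨fun h => (h1 v h.1).1 h.2, fun h => ⟨(mem_mask.1 (hC' h)).1,
        (h1 v (mem_mask.1 (hC' h)).1).2 h⟩⟩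
    have h10 : mask n ((LProg.loop 38 0 q).den s₁) 10 = X' ∩ Finset.range n := by
      ext v
      rw [mem_mask, Finset.mem_inter, Finset.mem_range]
      exact ⟨fun h => ⟨(h2 v h.1).1 h.2, h.1⟩, fun h => ⟨h.2, (h2 v h.2).2 h.1⟩⟩
    rw [cutState, h9, h10]
    congr 1
    · exact mask_congr fun v _ => by rw [hfr 8 (by decide) (by decide)]
    · ext v
      have h1 := hC v
      have h2 : v ∈ mask n s 10 → v < n := fun h => (mem_mask.1 h).1
      have h3 := @hC' v
      simp only [hX', Finset.mem_inter, Finset.mem_union, Finset.mem_filter, Finset.mem_sdiff,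
        Finset.mem_range]
      tauto
    · exact mask_congr fun v _ => by rw [hfr 11 (by decide) (by decide)]
  · intro i hi s' hx hF ⟨h1, h2, h3, h4⟩
    have hb' : Base adj n k s' := hb₁.frame hF (by omega) hqwf
      fun a ha h => by have := hqa a h; omega
    have harr : ∀ a, a ≠ 9 → a ≠ 10 → s'.arr a = s.arr a := fun a h1 h2 =>
      hF.arr a fun h => by have := hqa a h; omega
    have hi9 := hb'.lt_nine (show i < 2 * n + 1 by omega)
    have hiC : i ∈ C ↔ s.arr 12 i ≠ 0 := by
      rw [hCdef, mem_mask]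
      exact and_iff_right hi
    rw [hq, LProg.den_ite]
    simp only [Expr.eval, hx, harr 12 (by decide) (by decide), ← hiC]
    have hlast : ∀ {P : ℕ → Prop}, (∀ v < i, P v) → P i → ∀ v < i + 1, P v := by
      intro P h h' v hv
      rcases Nat.lt_succ_iff_lt_or_eq.1 hv with hv | rfl
      · exact h v hv
      · exact h'
    by_cases hC0 : i ∈ C
    · rw [if_pos hC0]
      simp only [LProg.den_seqs_cons, LProg.den_seqs_nil]
      rw [LProg.den_store (a := 9) (by simpa [Expr.eval, hx] using hi9)]
      rw [LProg.den_store (a := 10) (by simpa [Expr.eval, hx] using hi9)]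
      rw [LProg.den_assign]
      simp only [Expr.eval, hx, h1, State.setVar_var, State.setVar_arr, State.setArr_var,
        State.setArr_arr, harr 18 (by decide) (by decide)]
      have hb := hbits i hC0
      have hX : i ∈ X' ↔ i ∈ C' := by simp [hX', hC0]
      have hlast' : ∀ {P : ℕ → Prop}, (∀ v < i, P v) → P i → ∀ v ≤ i, P v :=
        fun h h' v hv => hlast h h' v (Nat.lt_succ_of_le hv)
      simp
      refine ⟨by simp [rank_succ, hC0], hlast' (fun v hv => ?_) ?_, hlast' (fun v hv => ?_) ?_,
        fun v hv => ?_⟩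
      · simpa [hv.ne] using h2 v hv
      · simpa using hb
      · simpa [hv.ne] using h3 v hv
      · simpa [hX] using hb
      · rw [if_neg (by omega), h4 v (by omega)]
    · rw [if_neg hC0]
      simp only [LProg.den_seqs_cons, LProg.den_seqs_nil]
      rw [LProg.den_store (a := 9) (by simpa [Expr.eval, hx] using hi9)]
      rw [LProg.den_store (a := 10) (by simpa [Expr.eval, hx] using hi9)]
      have hCi' : i ∉ C' := fun h => hC0 (hC' h)
      refine ⟨?_, hlast (fun v hv => ?_) ?_, hlast (fun v hv => ?_) ?_, fun v hv => ?_⟩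
      · simp [rank_succ, hC0, h1]
      · simp [State.setArr_arr, Expr.eval, hx, hv.ne]
        simpa using h2 v hv
      · simp [State.setArr_arr, Expr.eval, hx, hCi']
      · simp [State.setArr_arr, Expr.eval, hx, hv.ne]
        simpa using h3 v hv
      · rw [State.setVar_arr, State.setArr_arr, if_pos ⟨rfl, by simp [Expr.eval, hx]⟩, ne_eq,
          Expr.eval_and_eq_zero, not_not]
        simp [Expr.eval, State.setArr_arr, hx, hb'.var_zero, h4 i le_rfl,
          harr 6 (by decide) (by decide), hX', hCi', hC0, mem_mask, hi]
      · rw [State.setVar_arr, State.setArr_arr, if_neg, State.setArr_arr, if_neg (by simp),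
          h4 v (by omega)]
        simp only [Expr.eval, State.setArr_var, hx]
        omega

end

end RAM

namespace RAM

open SCCDeletion

/-! ### One step of the search -/

/-- Computes the data that the moves refer to: the reachability matrix, the copies, the flow. -/
noncomputable def prepare (F : Finset FinDigraph) : LProg :=
  .seq closure (.seq (copies F) flow)

/-- One step of the search, controlled by the command in block `18`. -/
noncomputable def searchStep (F : Finset FinDigraph) : LProg :=
  .seq (prepare F) (.seq pick (.seq (pickFromCopy (maxOrder F)) act))

/-- The state with the command `c` in the first cells of block `18`. -/
def State.withCmd (s : State) (c : ℕ → ℕ) : State where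
  var x := if x = 39 then s.var 5 else s.var x
  arr a i := if a = 18 ∧ i < s.var 5 then c i else s.arr a i

theorem prepare_wf {F : Finset FinDigraph} : (prepare F).WF 10 :=
  ⟨closure_wf, copies_wf, flow_wf⟩

theorem prepare_writesVar {F : Finset FinDigraph} {y : ℕ} (h : (prepare F).WritesVar y) :
    20 ≤ y ∧ y ≤ 34 ∨ 100 ≤ y ∧ y < 100 + maxOrder F := by
  rcases h with h | h | h
  · have := closure_writesVar h
    omega
  · have := copies_writesVar h
    omega
  · have := flow_writesVar h
    omega

theorem prepare_writesArr {F : Finset FinDigraph} {a : ℕ} (h : (prepare F).WritesArr a) :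
    3 ≤ a ∧ a ≤ 7 ∨ a = 12 ∨ 100 ≤ a ∧ a < 100 + maxOrder F := by
  rcases h with h | h | h
  · have := closure_writesArr.1 h
    omega
  · have := copies_writesArr h
    omega
  · have := flow_writesArr h
    omega

theorem searchStep_wf {F : Finset FinDigraph} : (searchStep F).WF 10 :=
  ⟨prepare_wf, pick_wf, pickFromCopy_wf, act_wf⟩

theorem searchStep_writesVar {F : Finset FinDigraph} {y : ℕ} (h : (searchStep F).WritesVar y) :
    20 ≤ y ∧ y ≤ 38 ∨ 100 ≤ y ∧ y < 100 + maxOrder F := by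
  rcases h with h | h | h | h
  · have := prepare_writesVar h
    omega
  · have := pick_writesVar.1 h
    omega
  · have := pickFromCopy_writesVar h
    omega
  · have := act_writesVar.1 h
    omega

theorem searchStep_writesArr {F : Finset FinDigraph} {a : ℕ} (h : (searchStep F).WritesArr a) :
    3 ≤ a ∧ a ≤ 12 ∨ 100 ≤ a ∧ a < 100 + maxOrder F := by
  rcases h with h | h | h | h
  · have := prepare_writesArr h
    omega
  · exact absurd h pick_writesArr
  · exact absurd h pickFromCopy_writesArr
  · have := act_writesArr h
    omega

section

variable {Iv Ia : Finset ℕ}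

theorem mark_avoids (hIv : ∀ x ∈ Iv, 10 ≤ x ∧ x < 20 ∨ x = 39) (hIa : ∀ a ∈ Ia, 14 < a ∧ a < 20) :
    mark.Avoids Iv Ia := by
  have h1 : ∀ x, x < 10 ∨ 20 ≤ x ∧ x < 39 → x ∉ Iv := fun x hx h => by
    have := hIv x h
    omega
  have h2 : ∀ a, a < 14 → a ∉ Ia := fun a ha h => by
    have := hIa a h
    omega
  simp [mark, LProg.seqs, LProg.Avoids, Expr.Avoids, Expr.avoids_and, Expr.avoids_not,
    Expr.avoids_lt, h1, h2]

theorem prepare_avoids {F : Finset FinDigraph} (hIv : ∀ x ∈ Iv, 10 ≤ x ∧ x < 20 ∨ x = 39)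
    (hIa : ∀ a ∈ Ia, 14 < a ∧ a < 20) : (prepare F).Avoids Iv Ia := by
  have h1 : ∀ x, x < 10 ∨ 20 ≤ x ∧ x < 39 → x ∉ Iv := fun x hx h => by
    have := hIv x h
    omega
  have h2 : ∀ a, a < 14 → a ∉ Ia := fun a ha h => by
    have := hIa a h
    omega
  have hm := mark_avoids hIv hIa
  refine ⟨?_, copies_avoids hIv
    (fun a ha => by have := hIa a ha; omega), ?_⟩
  · simp [closure, LProg.seqs, LProg.Avoids, Expr.Avoids, Expr.avoids_and, h1, h2, hm]
  · simp [flow, augment, walk, setCap, LProg.seqs, LProg.Avoids, Expr.Avoids, Expr.avoids_and,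
      Expr.avoids_not, Expr.avoids_lt, Expr.avoids_eq, h1, h2, hm]

theorem searchStep_avoids {F : Finset FinDigraph} (hIv : ∀ x ∈ Iv, 10 ≤ x ∧ x < 20)
    (hIa : ∀ a ∈ Ia, 14 < a ∧ a < 18) : (searchStep F).Avoids Iv Ia := by
  have h1 : ∀ x, x < 10 ∨ 20 ≤ x → x ∉ Iv := fun x hx h => by
    have := hIv x h
    omega
  have h2 : ∀ a, a < 15 ∨ 18 ≤ a → a ∉ Ia := fun a ha h => by
    have := hIa a h
    omega
  refine ⟨prepare_avoids (fun x hx => .inl (hIv x hx)) (fun a ha => by have := hIa a ha; omega),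
    ?_, ?_, ?_⟩
  · simp [pick, inSelection, LProg.seqs, LProg.Avoids, Expr.Avoids, Expr.avoids_and,
      Expr.avoids_eq, h1, h2]
  · rw [pickFromCopy, LProg.avoids_seqs]
    intro p hp
    obtain ⟨j, -, rfl⟩ := List.mem_map.1 hp
    have h3 := h1 (100 + j) (by omega)
    have h4 := h2 (100 + j) (by omega)
    simp [LProg.Avoids, Expr.Avoids, Expr.avoids_and, Expr.avoids_eq, h1, h2, h4]
  · simp [act, deleteMove, startMove, shrinkMove, LProg.seqs, LProg.Avoids, Expr.Avoids,
      Expr.avoids_and, Expr.avoids_eq, h1, h2]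

end

section

variable {adj : ℕ → ℕ → Prop} {n k : ℕ} {s : State} {F : Finset FinDigraph}

theorem prepare_arr {a : ℕ} (ha : 8 ≤ a ∧ a < 100) (ha' : a ≠ 12) :
    ((prepare F).den s).arr a = s.arr a :=
  LProg.den_arr (fun h => by have := prepare_writesArr h; omega) s

/-- Before each move, the data that `MoveOptions` asks for are available in memory. -/
theorem prepare_spec (hF : ∀ H ∈ F, IsRooted H.2) (hs : Base adj n k s) :
    Base adj n k ((prepare F).den s) ∧
    IsCopySearch F adj n (mask n s 8) ((prepare F).den s) ∧
    mask n ((prepare F).den s) 12 = ((mask n s 10).filter fun v =>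
      ((prepare F).den s).arr 6 v = 0 ∧ ((prepare F).den s).arr 6 (n + v) ≠ 0) ∧
    (mask n s 9 ⊆ mask n s 10 → ∃ val,
      IsFlowOutput (SccArc adj (mask n s 8)) (mask n s 10) (mask n s 9) (mask n s 11) k
      (mask n ((prepare F).den s) 12)
      ((mask n s 10).filter fun v => ((prepare F).den s).arr 6 (n + v) = 0)
      ((Finset.range n).filter fun v => resOf n ((prepare F).den s) (2 * n) (n + v) ≠ 0) val) := by
  have hR := closure_spec hs
  have hw₁ : ∀ a, a < 3 ∨ 8 ≤ a → (closure.den s).arr a = s.arr a := fun a ha =>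
    LProg.den_arr (by rw [closure_writesArr]; omega) s
  have hb₁ : Base adj n k (closure.den s) := hs.den closure_wf
    fun a ha => by rw [closure_writesArr]; omega
  have hden : (prepare F).den s = flow.den ((copies F).den (closure.den s)) := by
    rw [prepare, LProg.den_seq, LProg.den_seq]
  set s₁ := closure.den s
  have hcopies := copies_spec hF hb₁ (G := mask n s 8) (mask_congr fun v _ => by
    rw [hw₁ 8 (by omega)]) hR
  have hw₂ : ∀ a, a < 4 ∨ 8 ≤ a ∧ a < 100 → ((copies F).den s₁).arr a = s₁.arr a := fun a ha =>
    LProg.den_arr (fun h => by have := copies_writesArr h; omega) s₁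
  have hb₂ : Base adj n k ((copies F).den s₁) := hb₁.den copies_wf
    fun a ha h => by have := copies_writesArr h; omega
  set s₂ := (copies F).den s₁
  have hmask : ∀ a, 8 ≤ a ∧ a < 100 → mask n s₂ a = mask n s a := fun a ha =>
    mask_congr fun v _ => by rw [hw₂ a (by omega), hw₁ a (by omega)]
  have hflow := flow_spec hb₂ (by rw [hw₂ 3 (by omega), hmask 8 (by omega)]; exact hR)
  rw [hmask 8 (by omega), hmask 9 (by omega), hmask 10 (by omega), hmask 11 (by omega)] at hflow
  have hw₃ : ∀ a, a < 5 ∨ 100 ≤ a → (flow.den s₂).arr a = s₂.arr a := fun a ha =>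
    LProg.den_arr (fun h => by have := flow_writesArr h; omega) s₂
  have hb₃ : Base adj n k (flow.den s₂) := hb₂.den flow_wf
    fun a ha h => by have := flow_writesArr h; omega
  rw [hden]
  have h4 : mask n (flow.den s₂) 4 = mask n s₂ 4 := mask_congr fun v _ => by rw [hw₃ 4 (by omega)]
  refine ⟨hb₃, ⟨h4.trans hcopies.roots, fun b hb => ?_⟩, hflow⟩
  obtain ⟨H, hH, f, h1, h2, h3, h5⟩ := hcopies.copy b (h4 ▸ hb)
  exact ⟨H, hH, f, h1, h2, h3, fun j hj => by rw [hw₃ _ (by omega), h5 j hj]⟩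

/-- The preparation does not depend on the command. -/
theorem prepare_withCmd (c : ℕ → ℕ) :
    (prepare F).den (s.withCmd c) = ((prepare F).den s).withCmd c := by
  have hav : (prepare F).Avoids {39} {18} := prepare_avoids (by simp) (by simp)
  have her : (s.withCmd c).erase {39} {18} = s.erase {39} {18} := by
    refine State.ext' (fun x => ?_) fun a i => ?_
    · simp only [State.erase, State.withCmd, Finset.mem_singleton]
      split_ifs <;> rfl
    · simp only [State.erase, State.withCmd, Finset.mem_singleton]
      split_ifs with h1 h2
      · rfl
      · exact absurd h2.1 h1
      · rfl
  have h := (hav.den_erase (s.withCmd c)).symm.trans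
    ((congrArg (prepare F).den her).trans (hav.den_erase s))
  have h39 : ∀ s : State, ((prepare F).den s).var 39 = s.var 39 := fun s =>
    LProg.den_var (fun h => by have := prepare_writesVar h; omega) s
  have h5 : ((prepare F).den s).var 5 = s.var 5 :=
    LProg.den_var (fun h => by have := prepare_writesVar h; omega) s
  refine State.ext' (fun x => ?_) fun a i => ?_
  · by_cases hx : x = 39
    · subst hx
      rw [h39]
      simp [State.withCmd, h5]
    · have := congrArg (fun s => s.var x) h
      simpa [State.erase, State.withCmd, hx] using this
  · by_cases ha : a = 18
    · subst ha
      rw [prepare_arr (by omega) (by omega)]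
      simp only [State.withCmd]
      rw [h5, prepare_arr (by omega) (by omega)]
    · have := congrArg (fun s => s.arr a i) h
      simpa [State.erase, State.withCmd, ha] using this

/-- Choosing a vertex: the selected vertex itself or a vertex of its copy. -/
theorem choose_spec (hs : Base adj n k s) {M : Finset ℕ} (hM : M ⊆ Finset.range n)
    (hsel : ∀ u < n, u ∈ M ↔ (s.arr 18 0 = 0 ∧ s.arr 14 u ≠ 0 ∧ s.arr 8 u ≠ 0) ∨
      (s.arr 18 0 = 1 ∧ s.arr 12 u ≠ 0) ∨ (s.arr 18 0 = 2 ∧ resOf n s (2 * n) (n + u) ≠ 0))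
    {v : ℕ} (hv : v ∈ M) (hr : s.arr 18 2 = rank M v) {h : ℕ} :
    Base adj n k ((pickFromCopy h).den (pick.den s)) ∧
    (∀ a, ((pickFromCopy h).den (pick.den s)).arr a = s.arr a) ∧
    (s.arr 18 0 ≠ 2 → ((pickFromCopy h).den (pick.den s)).var 36 = v) ∧
    (s.arr 18 0 = 2 → s.arr 18 3 < h →
      ((pickFromCopy h).den (pick.den s)).var 36 = s.arr (100 + s.arr 18 3) v) := by
  have harr : ∀ a, (pick.den s).arr a = s.arr a := fun a => LProg.den_arr pick_writesArr s
  have hp := pick_spec hs hM hsel hv hr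
  have hb₁ := hs.den pick_wf fun a _ => pick_writesArr
  refine ⟨hb₁.den pickFromCopy_wf fun a _ => pickFromCopy_writesArr, fun a => ?_, fun h => ?_,
    fun h h' => ?_⟩
  · rw [LProg.den_arr pickFromCopy_writesArr, harr]
  · rw [pickFromCopy_of_ne (by rwa [harr]), hp]
  · rw [pickFromCopy_of_eq (by rwa [harr]) (by rw [harr]) h', hp, harr]

end

end RAM

namespace RAM

open SCCDeletion

/-- The states of the machine between two steps of a search with the vertex set `W`. -/
def SearchState (adj : ℕ → ℕ → Prop) (n k : ℕ) (W : Finset ℕ) : Type :=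
  {s : State // Base adj n k s ∧ mask n s 14 = W ∧ s.var 5 = k + 4}

/-- One step of the search, for some command. -/
def SearchRel (F : Finset FinDigraph) {adj : ℕ → ℕ → Prop} {n k : ℕ} {W : Finset ℕ}
    (σ σ' : SearchState adj n k W) : Prop :=
  ∃ c : ℕ → ℕ, (∀ i, c i < k + maxOrder F + 5) ∧ σ'.1 = (searchStep F).den (σ.1.withCmd c)

/-- The command that selects an element, given by its rank `i`, from the set with the number
`sel`, or else the vertex `j` of the copy with that root, and uses it for the move `move`. -/
def command (sel move i j : ℕ) (x : ℕ) : ℕ :=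
  if x = 0 then sel else if x = 1 then move else if x = 2 then i else if x = 3 then j else 0

open Classical in
/-- The command that advances the sources to the part `C'` of the cut `C`. -/
noncomputable def shrinkCommand (C C' : Finset ℕ) (x : ℕ) : ℕ :=
  if x = 1 then 3 else if 4 ≤ x ∧ ∃ v ∈ C', x = 4 + rank C v then 1 else 0

theorem command_lt {sel move i j x q : ℕ} (h1 : sel < q) (h2 : move < q) (h3 : i < q) (h4 : j < q) :
    command sel move i j x < q := by
  simp only [command]
  split_ifs <;> omega

section

variable {adj : ℕ → ℕ → Prop} {n k : ℕ} {s : State} {F : Finset FinDigraph} {W : Finset ℕ}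

theorem Base.withCmd (hs : Base adj n k s) (c : ℕ → ℕ) : Base adj n k (s.withCmd c) :=
  hs.congr (fun y hy => if_neg (by omega)) fun a ha => by
    funext i
    exact if_neg (by omega)

theorem withCmd_arr {c : ℕ → ℕ} {a : ℕ} (ha : a ≠ 18) : (s.withCmd c).arr a = s.arr a := by
  funext i
  exact if_neg (by omega)

/-- A step of the search leads to a state of the search again. -/
theorem searchStep_mem (σ : SearchState adj n k W) (c : ℕ → ℕ) :
    Base adj n k ((searchStep F).den (σ.1.withCmd c)) ∧
    mask n ((searchStep F).den (σ.1.withCmd c)) 14 = W ∧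
    ((searchStep F).den (σ.1.withCmd c)).var 5 = k + 4 := by
  obtain ⟨s, hs, hW, h5⟩ := σ
  refine ⟨(hs.withCmd c).den searchStep_wf fun a ha h => ?_, ?_, ?_⟩
  · have := searchStep_writesArr h
    omega
  · refine (mask_congr fun v _ => ?_).trans hW
    rw [LProg.den_arr (fun h => by have := searchStep_writesArr h; omega), withCmd_arr (by omega)]
  · rw [LProg.den_var (fun h => by have := searchStep_writesVar h; omega)]
    exact h5

theorem searchStep_den (s : State) : (searchStep F).den s =
    act.den ((pickFromCopy (maxOrder F)).den (pick.den ((prepare F).den s))) := by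
  rw [searchStep, LProg.den_seq, LProg.den_seq, LProg.den_seq]

theorem searchRel_of_cmd (σ : SearchState adj n k W) {c : ℕ → ℕ}
    (hc : ∀ i, c i < k + maxOrder F + 5) : ∃ σ', SearchRel F σ σ' ∧
      σ'.1 = act.den ((pickFromCopy (maxOrder F)).den
        (pick.den (((prepare F).den σ.1).withCmd c))) := by
  refine ⟨⟨(searchStep F).den (σ.1.withCmd c), searchStep_mem σ c⟩, ⟨c, hc, rfl⟩, ?_⟩
  exact (searchStep_den _).trans (by rw [prepare_withCmd])

/-- The step for a command that uses the element `v` of a selected set `M`. -/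
theorem exists_choose (hF : ∀ H ∈ F, IsRooted H.2) (σ : SearchState adj n k W) {c : ℕ → ℕ}
    (hc : ∀ i, c i < k + maxOrder F + 5) {M : Finset ℕ} (hM : M ⊆ Finset.range n)
    (hsel : ∀ u < n, u ∈ M ↔ (c 0 = 0 ∧ u ∈ W ∧ u ∈ mask n σ.1 8) ∨
      (c 0 = 1 ∧ u ∈ mask n ((prepare F).den σ.1) 12) ∨
      (c 0 = 2 ∧ resOf n ((prepare F).den σ.1) (2 * n) (n + u) ≠ 0))
    {v : ℕ} (hv : v ∈ M) (hr : c 2 = rank M v) :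
    ∃ s : State, ∃ σ', SearchRel F σ σ' ∧ σ'.1 = act.den s ∧ Base adj n k s ∧
      (∀ a, a ≠ 18 → s.arr a = ((prepare F).den σ.1).arr a) ∧ (∀ i < k + 4, s.arr 18 i = c i) ∧
      (c 0 ≠ 2 → s.var 36 = v) ∧ (c 0 = 2 → c 3 < maxOrder F →
        s.var 36 = ((prepare F).den σ.1).arr (100 + c 3) v) := by
  obtain ⟨σ', h1, h2⟩ := searchRel_of_cmd σ hc
  obtain ⟨hb, -⟩ := prepare_spec hF σ.2.1
  set s₁ := (prepare F).den σ.1 with hs₁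
  have h5 : s₁.var 5 = k + 4 := by
    rw [hs₁, LProg.den_var (fun h => by have := prepare_writesVar h; omega)]
    exact σ.2.2.2
  have h18 : ∀ i < k + 4, (s₁.withCmd c).arr 18 i = c i := fun i hi => by
    simp only [State.withCmd, h5, hi, and_self, if_true]
  have hW : ∀ u < n, u ∈ W ↔ s₁.arr 14 u ≠ 0 := fun u hu => by
    rw [← σ.2.2.1, mem_mask, prepare_arr (by omega) (by omega)]
    exact and_iff_right hu
  have hG : ∀ u < n, u ∈ mask n σ.1 8 ↔ s₁.arr 8 u ≠ 0 := fun u hu => by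
    rw [mem_mask, prepare_arr (by omega) (by omega)]
    exact and_iff_right hu
  have hC : ∀ u < n, u ∈ mask n s₁ 12 ↔ s₁.arr 12 u ≠ 0 := fun u hu => by
    rw [mem_mask]
    exact and_iff_right hu
  obtain ⟨h3, h4, h6, h7⟩ := choose_spec (hb.withCmd c) (h := maxOrder F) hM (fun u hu => by
    rw [hsel u hu, h18 0 (by omega), withCmd_arr (by decide), withCmd_arr (by decide),
      withCmd_arr (by decide), hW u hu, hG u hu, hC u hu, resOf, resOf, withCmd_arr (by decide)])
    hv (by rw [h18 2 (by omega), hr])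
  rw [h18 0 (by omega)] at h6 h7
  rw [h18 3 (by omega)] at h7
  exact ⟨_, σ', h1, h2, h3, fun a ha => by rw [h4, withCmd_arr ha],
    fun i hi => by rw [h4, h18 i hi], h6, fun h h' => by rw [h7 h h', withCmd_arr (by omega)]⟩

/-- Every move of the abstract search is carried out by a suitable command. -/
theorem implements_searchRel (hF : ∀ H ∈ F, IsRooted H.2) (hW : W.card ≤ k + 1)
    (hWn : W ⊆ Finset.range n) :
    Implements adj (copyPatterns F adj n) W k
      (fun σ : SearchState adj n k W => cutState n σ.1) (SearchRel F) := by
  classical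
  intro σ
  obtain ⟨hb, hcopy, hC, hflow⟩ := prepare_spec hF σ.2.1
  set s₁ := (prepare F).den σ.1 with hs₁
  set G := mask n σ.1 8 with hG
  set C := mask n s₁ 12 with hCdef
  set Y := (mask n σ.1 10).filter fun v => s₁.arr 6 (n + v) = 0 with hY
  set P := (Finset.range n).filter fun v => resOf n s₁ (2 * n) (n + v) ≠ 0 with hP
  have harr : ∀ a, 8 ≤ a ∧ a < 100 → a ≠ 12 → s₁.arr a = σ.1.arr a := fun a h h' => prepare_arr h h'
  have hmask : ∀ a, 8 ≤ a ∧ a < 100 → a ≠ 12 → mask n s₁ a = mask n σ.1 a := fun a h h' =>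
    mask_congr fun v _ => by rw [harr a h h']
  have hroots := hcopy.roots
  have hcp : ∀ b, ∃ U, b ∈ roots adj (copyPatterns F adj n) G →
      (b, U) ∈ copyPatterns F adj n ∧ Bad adj G (b, U) ∧
        ∀ u ∈ U, ∃ j < maxOrder F, s₁.arr (100 + j) b = u := by
    intro b
    by_cases hbr : b ∈ roots adj (copyPatterns F adj n) G
    · obtain ⟨H, hH, f, h1, h2, h3, h4⟩ := hcopy.copy b (hroots ▸ hbr)
      refine ⟨_, fun _ => ⟨⟨H, hH, f, h1, by rw [h2]⟩, h3, fun u hu => ?_⟩⟩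
      obtain ⟨j, hj, rfl⟩ := Finset.mem_image.1 hu
      rw [Finset.mem_range] at hj
      exact ⟨j, hj.trans_le (le_maxOrder hH), h4 j hj⟩
    · exact ⟨∅, fun h => absurd h hbr⟩
  choose U hU using hcp
  -- commands that use an element of `W`
  have hchooseW : ∀ w ∈ W, w ∈ G → ∀ move < 2, ∃ s : State, ∃ σ', SearchRel F σ σ' ∧
      σ'.1 = act.den s ∧ Base adj n k s ∧ (∀ a, a ≠ 18 → s.arr a = s₁.arr a) ∧
      s.arr 18 1 = move ∧ s.var 36 = w := by
    intro w hw hwG move hmove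
    have hmem : w ∈ W ∩ G := Finset.mem_inter.2 ⟨hw, hwG⟩
    have hrank := (rank_lt hmem).trans_le
      ((Finset.card_le_card Finset.inter_subset_left).trans hW)
    obtain ⟨s, σ', h1, h2, h3, h4, h5, h6, -⟩ := exists_choose hF σ
      (c := command 0 move (rank (W ∩ G) w) 0)
      (fun i => command_lt (by omega) (by omega) (by omega) (by omega))
      (Finset.inter_subset_left.trans hWn) (fun u _ => by
        rw [Finset.mem_inter, ← hG]
        simp [command]) hmem rfl
    exact ⟨s, σ', h1, h2, h3, h4, by rw [h5 1 (by omega)]; rfl, h6 (by simp [command])⟩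
  -- commands that use a vertex of a copy
  have hchooseP : P.card ≤ k + 1 → ∀ b ∈ P, b ∈ roots adj (copyPatterns F adj n) G → ∀ u ∈ U b,
      ∀ move < 3, ∃ s : State, ∃ σ', SearchRel F σ σ' ∧
      σ'.1 = act.den s ∧ Base adj n k s ∧ (∀ a, a ≠ 18 → s.arr a = s₁.arr a) ∧
      s.arr 18 1 = move ∧ s.var 36 = u := by
    intro hPk b hbP hbr u hu move hmove
    obtain ⟨j, hj, hju⟩ := (hU b hbr).2.2 u hu
    have hrank := (rank_lt hbP).trans_le hPk
    obtain ⟨s, σ', h1, h2, h3, h4, h5, -, h6⟩ := exists_choose hF σ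
      (c := command 2 move (rank P b) j)
      (fun i => command_lt (by omega) (by omega) (by omega) (by omega))
      (Finset.filter_subset _ _) (fun u hu => by simp [command, hu, hs₁]) hbP rfl
    exact ⟨s, σ', h1, h2, h3, h4, by rw [h5 1 (by omega)]; rfl, (h6 rfl hj).trans hju⟩
  have hlt : ∀ {u : ℕ}, u ∈ G → u < n := fun h => (mem_mask.1 h).1
  have hUG : ∀ b, b ∈ roots adj (copyPatterns F adj n) G → ∀ u ∈ U b, u ∈ G := fun b hb u hu =>
    (hU b hb).2.1.1 hu
  refine ⟨C, Y, P, ?_⟩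
  have hopt : ∀ val, ((cutState n σ.1).A ⊆ (cutState n σ.1).X →
      (cutState n σ.1).X ⊆ (cutState n σ.1).G →
      IsFlowOutput (SccArc adj (cutState n σ.1).G) (cutState n σ.1).X (cutState n σ.1).A
        (cutState n σ.1).T k C Y P val) →
      MoveOptions adj (copyPatterns F adj n) W k
        (fun σ : SearchState adj n k W => cutState n σ.1) (SearchRel F) σ C Y P val U := by
    intro val hval
    refine ⟨hval, fun b hb => ⟨(hU b hb).1, (hU b hb).2.1⟩, ?_, ?_, ?_, ?_, ?_, ?_⟩
    · intro w hw hwG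
      obtain ⟨s, σ', h1, h2, h3, h4, h5, h6⟩ := hchooseW w hw hwG 1 (by omega)
      refine ⟨σ', h1, ?_⟩
      have := act_start h3 (.inl h5) (h6 ▸ hlt hwG)
      rw [h2, this, if_pos h5, h6]
      have e8 : mask n s 8 = G := (mask_congr fun v _ => by rw [h4 8 (by decide)]).trans
        (hmask 8 (by omega) (by omega))
      have e4 : mask n s 4 = mask n s₁ 4 := mask_congr fun v _ => by rw [h4 4 (by decide)]
      rw [e8, e4, hroots]
      rfl
    · intro w hw hwG
      obtain ⟨s, σ', h1, h2, h3, h4, h5, h6⟩ := hchooseW w hw hwG 0 (by omega)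
      refine ⟨σ', h1, ?_⟩
      have := act_delete h3 h5 (h6 ▸ hlt hwG)
      have e8 : mask n s 8 = G := (mask_congr fun v _ => by rw [h4 8 (by decide)]).trans
        (hmask 8 (by omega) (by omega))
      rw [h6, e8] at this
      rw [h2]
      exact this
    · intro hCk x hx
      have hrank := (rank_lt hx).trans_le hCk
      obtain ⟨s, σ', h1, h2, h3, h4, h5, h6, -⟩ := exists_choose hF σ
        (c := command 1 0 (rank C x) 0) (M := C)
        (fun i => command_lt (by omega) (by omega) (by omega) (by omega))
        (Finset.filter_subset _ _) (fun u _ => by rw [← hs₁, ← hCdef]; simp [command]) hx rfl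
      refine ⟨σ', h1, ?_⟩
      have h36 : s.var 36 = x := h6 (by simp [command])
      have := act_delete h3 (by rw [h5 1 (by omega)]; rfl) (h36 ▸ (mem_mask.1 hx).1)
      have e8 : mask n s 8 = G := (mask_congr fun v _ => by rw [h4 8 (by decide)]).trans
        (hmask 8 (by omega) (by omega))
      rw [h36, e8] at this
      rw [h2]
      exact this
    · intro hCk C' hC'
      have hC'k : ∀ v ∈ C, rank C v < k := fun v hv => (rank_lt hv).trans_le hCk
      obtain ⟨σ', h1, h2⟩ := searchRel_of_cmd (F := F) σ (c := shrinkCommand C C') fun i => by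
        simp only [shrinkCommand]
        split_ifs <;> omega
      refine ⟨σ', h1, ?_⟩
      rw [← hs₁] at h2
      set s := (pickFromCopy (maxOrder F)).den (pick.den (s₁.withCmd (shrinkCommand C C'))) with hs
      have hbs : Base adj n k s := ((hb.withCmd _).den pick_wf fun a _ => pick_writesArr).den
        pickFromCopy_wf fun a _ => pickFromCopy_writesArr
      have harr' : ∀ a, s.arr a = (s₁.withCmd (shrinkCommand C C')).arr a := fun a => by
        rw [hs, LProg.den_arr pickFromCopy_writesArr, LProg.den_arr pick_writesArr]
      have h5 : s₁.var 5 = k + 4 := by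
        rw [hs₁, LProg.den_var (fun h => by have := prepare_writesVar h; omega)]
        exact σ.2.2.2
      have h18 : ∀ i < k + 4, s.arr 18 i = shrinkCommand C C' i := fun i hi => by
        rw [harr']
        simp only [State.withCmd, h5, hi, and_self, if_true]
      have hne : ∀ a, a ≠ 18 → s.arr a = s₁.arr a := fun a ha => by
        rw [harr', withCmd_arr ha]
      have hm : ∀ a, a ≠ 18 → mask n s a = mask n s₁ a := fun a ha =>
        mask_congr fun v _ => by rw [hne a ha]
      have := act_shrink hbs (C' := C') (by rw [h18 1 (by omega)]; rfl)
        (by rw [hm 12 (by decide)]; exact hC') (fun v hv => ?_) fun v hv => ?_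
      · rw [h2, this, hm 8 (by decide), hm 10 (by decide), hm 11 (by decide), hm 12 (by decide),
          hmask 8 (by omega) (by omega), hmask 10 (by omega) (by omega),
          hmask 11 (by omega) (by omega), hne 6 (by decide)]
        rfl
      · rw [hm 12 (by decide), ← hCdef] at hv ⊢
        have hr := hC'k v hv
        rw [h18 _ (by omega), shrinkCommand, if_neg (by omega)]
        constructor
        · intro h
          split_ifs at h with h'
          · obtain ⟨-, v', hv', h3⟩ := h'
            rwa [rank_inj hv (hC' hv') (by omega)]
          · exact absurd rfl h
        · intro h
          rw [if_pos ⟨by omega, v, h, rfl⟩]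
          exact one_ne_zero
      · rw [hm 12 (by decide), ← hCdef, hC, Finset.mem_filter] at hv
        rw [hm 10 (by decide), hmask 10 (by omega) (by omega), hne 6 (by decide)]
        exact ⟨hv.1, hv.2.2⟩
    · intro hPk b hbP hbr u hu
      obtain ⟨s, σ', h1, h2, h3, h4, h5, h6⟩ := hchooseP hPk b hbP hbr u hu 0 (by omega)
      refine ⟨σ', h1, ?_⟩
      have := act_delete h3 h5 (h6 ▸ hlt (hUG b hbr u hu))
      have e8 : mask n s 8 = G := (mask_congr fun v _ => by rw [h4 8 (by decide)]).trans
        (hmask 8 (by omega) (by omega))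
      rw [h6, e8] at this
      rw [h2]
      exact this
    · intro hPk b hbP hbr u hu
      obtain ⟨s, σ', h1, h2, h3, h4, h5, h6⟩ := hchooseP hPk b hbP hbr u hu 2 (by omega)
      refine ⟨σ', h1, ?_⟩
      have := act_start h3 (.inr h5) (h6 ▸ hlt (hUG b hbr u hu))
      rw [h2, this, if_neg (by omega), h6]
      have e8 : mask n s 8 = G := (mask_congr fun v _ => by rw [h4 8 (by decide)]).trans
        (hmask 8 (by omega) (by omega))
      have e14 : mask n s 14 = W := (mask_congr fun v _ => by rw [h4 14 (by decide)]).trans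
        ((hmask 14 (by omega) (by omega)).trans σ.2.2.1)
      rw [e8, e14]
      rfl
  by_cases hAX : mask n σ.1 9 ⊆ mask n σ.1 10
  · obtain ⟨val, hval⟩ := hflow hAX
    exact ⟨val, U, hopt val fun _ _ => hval⟩
  · exact ⟨0, U, hopt 0 fun h => absurd h hAX⟩

end

end RAM

namespace RAM

open SCCDeletion

/-! ### Running the search along a tape -/

/-- The state after `m` steps of the search with the commands `c 0`, `c 1`, … -/
noncomputable def searchIter (F : Finset FinDigraph) (c : ℕ → ℕ → ℕ) (s : State) : ℕ → State
  | 0 => s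
  | m + 1 => (searchStep F).den ((searchIter F c s m).withCmd (c m))

/-- Copies the next command from the tape in block `15` to block `18`. -/
def loadCmd : LProg :=
  .loop 39 5 (.store 18 (.var 39) (.load 15 (.add (.var 14) (.var 39))))

/-- The search controlled by the tape in block `15`. -/
noncomputable def run (F : Finset FinDigraph) : LProg :=
  .loop 15 6 (.seq loadCmd (.seq (searchStep F) (.assign 14 (.add (.var 14) (.var 5)))))

section

variable {adj : ℕ → ℕ → Prop} {n k : ℕ} {s : State} {F : Finset FinDigraph} {W : Finset ℕ}

theorem searchIter_succ' (c : ℕ → ℕ → ℕ) (m : ℕ) : searchIter F c s (m + 1) =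
    searchIter F (fun i => c (i + 1)) ((searchStep F).den (s.withCmd (c 0))) m := by
  induction m with
  | zero => rfl
  | succ m ih => rw [searchIter, ih, searchIter]

theorem searchIter_congr {c c' : ℕ → ℕ → ℕ} {m : ℕ}
    (h : ∀ i < m, ∀ j < s.var 5, c i j = c' i j) :
    searchIter F c s m = searchIter F c' s m ∧ (searchIter F c s m).var 5 = s.var 5 := by
  induction m with
  | zero => exact ⟨rfl, rfl⟩
  | succ m ih =>
    obtain ⟨h1, h2⟩ := ih fun i hi => h i (by omega)
    have h3 : (searchIter F c s m).withCmd (c m) = (searchIter F c' s m).withCmd (c' m) := by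
      rw [← h1]
      refine State.ext' (fun _ => rfl) fun a i => ?_
      simp only [State.withCmd, h2]
      split_ifs with hi
      · exact h m (by omega) i hi.2
      · rfl
    refine ⟨by rw [searchIter, searchIter, h3], ?_⟩
    rw [searchIter, LProg.den_var (fun h => by have := searchStep_writesVar h; omega)]
    exact h2

/-- A command that changes nothing in the state of the search. -/
theorem searchStep_idle (F : Finset FinDigraph) (σ : SearchState adj n k W) :
    ∃ σ' : SearchState adj n k W, σ'.1 = (searchStep F).den (σ.1.withCmd fun _ => 4) ∧
      mask n σ'.1 8 = mask n σ.1 8 := by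
  refine ⟨⟨(searchStep F).den (σ.1.withCmd fun _ => 4), searchStep_mem σ _⟩, rfl, ?_⟩
  have h5 : ((prepare F).den σ.1).var 5 = k + 4 := by
    rw [LProg.den_var (fun h => by have := prepare_writesVar h; omega)]
    exact σ.2.2.2
  have harr : ∀ a, ((pickFromCopy (maxOrder F)).den (pick.den
      (((prepare F).den σ.1).withCmd fun _ => 4))).arr a =
      (((prepare F).den σ.1).withCmd fun _ => 4).arr a := fun a => by
    rw [LProg.den_arr pickFromCopy_writesArr, LProg.den_arr pick_writesArr]
  refine Eq.trans (congrArg (fun s => mask n s 8) (searchStep_den _)) ?_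
  rw [prepare_withCmd, act_idle]
  · refine mask_congr fun v _ => ?_
    rw [harr, withCmd_arr (by decide), prepare_arr (by omega) (by omega)]
  · rw [harr]
    simp [State.withCmd, h5]

/-- If a set is found within `m` steps, it is found for some sequence of `m` commands. -/
theorem exists_searchIter {Q : Finset ℕ → Prop} {m : ℕ}
    (σ : SearchState adj n k W) (h : Within (SearchRel F) m σ fun σ' => Q (mask n σ'.1 8)) :
    ∃ c : ℕ → ℕ → ℕ, (∀ i j, c i j < k + maxOrder F + 5) ∧
      Q (mask n (searchIter F c σ.1 m) 8) := by
  have idle : ∀ m, ∀ σ : SearchState adj n k W, Q (mask n σ.1 8) →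
      Q (mask n (searchIter F (fun _ _ => 4) σ.1 m) 8) := by
    intro m
    induction m with
    | zero => exact fun σ h => h
    | succ m ih =>
      intro σ h
      obtain ⟨σ', h1, h2⟩ := searchStep_idle F σ
      rw [searchIter_succ', ← h1]
      exact ih σ' (h2 ▸ h)
  induction m generalizing σ with
  | zero => exact ⟨fun _ _ => 4, fun _ _ => by dsimp only; omega, h⟩
  | succ m ih =>
    rcases h with h | ⟨σ', ⟨c, hc, hσ'⟩, h⟩
    · exact ⟨fun _ _ => 4, fun _ _ => by dsimp only; omega, idle _ σ h⟩
    · obtain ⟨c', hc', h'⟩ := ih σ' h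
      refine ⟨fun i => if i = 0 then c else c' (i - 1), fun i j => ?_, ?_⟩
      · dsimp only
        split_ifs
        · exact hc j
        · exact hc' _ j
      · rw [searchIter_succ']
        simpa [← hσ'] using h'

/-- The registers whose contents do not influence the search: the counter of the tapes, the
success flag, the position on the tape and the number of steps. -/
abbrev hiddenVars : Finset ℕ := {11, 12, 14, 15}

/-- The blocks whose contents do not influence the search: the tape and the solution found
before. -/
abbrev hiddenArrs : Finset ℕ := {15, 17}

/-- The state without the parts that do not influence the search. -/
abbrev State.visible (s : State) : State := s.erase hiddenVars hiddenArrs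

/-- Loading a command from the tape amounts to `State.withCmd`. -/
theorem loadCmd_den (h9 : s.var 5 ≤ s.var 9) :
    loadCmd.den s = s.withCmd fun i => s.arr 15 (s.var 14 + i) := by
  set q : LProg := .store 18 (.var 39) (.load 15 (.add (.var 14) (.var 39))) with hq
  have hqv : ∀ y, ¬ q.WritesVar y := by simp [hq, LProg.WritesVar]
  have hqa : ∀ a, q.WritesArr a → a = 18 := by simp [hq, LProg.WritesArr]
  have h18 : (loadCmd.den s).arr 18 = fun p => if p < s.var 5 then s.arr 15 (s.var 14 + p)
      else s.arr 18 p := by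
    refine LProg.den_fill (q := q) (fun i => s.arr 15 (s.var 14 + i)) rfl (hqv _) hqa ?_
    intro i hi s' h1 h2 h3
    rw [hq, LProg.den_store_arr]
    · simp only [Expr.eval, h1, h3 15 (by decide), h2 14 (by decide) (hqv _)]
    · simp only [Expr.eval, h1, h2 9 (by decide) (hqv _)]
      omega
  have h39 : (loadCmd.den s).var 39 = s.var 5 := by
    refine LProg.den_loop (fun i s' => s'.var 39 = i) rfl (hqv _) (by simp) ?_
    intros
    simp
  refine State.ext' (fun x => ?_) fun a i => ?_
  · by_cases hx : x = 39
    · subst hx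
      rw [h39]
      rfl
    · rw [LProg.den_var (by simpa [loadCmd, LProg.WritesVar] using hx)]
      exact (if_neg hx).symm
  · by_cases ha : a = 18
    · subst ha
      rw [h18]
      simp [State.withCmd]
    · rw [LProg.den_arr (by simpa [loadCmd, LProg.WritesArr] using ha), withCmd_arr ha]

theorem withCmd_visible (c : ℕ → ℕ) : (s.withCmd c).visible = s.visible.withCmd c := by
  refine State.ext' (fun x => ?_) fun a i => ?_
  · by_cases hx : x = 39
    · subst hx
      simp [State.erase, State.withCmd]
    · simp [State.erase, State.withCmd, hx]
  · by_cases ha : a = 18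
    · subst ha
      simp [State.erase, State.withCmd]
    · simp [State.erase, State.withCmd, ha]

/-- Running the search along the tape in block `15` iterates `searchStep` with the commands on the
tape; the position on the tape is invisible to the search. -/
theorem run_spec (h9 : s.var 5 ≤ s.var 9) (h14 : s.var 14 = 0) : ((run F).den s).visible =
    searchIter F (fun i j => s.arr 15 (i * s.var 5 + j)) s.visible (s.var 6) := by
  set p : LProg := .seq loadCmd (.seq (searchStep F) (.assign 14 (.add (.var 14) (.var 5))))
    with hp
  have hpv : ∀ y, p.WritesVar y → y = 14 ∨ 20 ≤ y := by
    rintro y (h | h | h)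
    · simp [loadCmd, LProg.WritesVar] at h
      omega
    · have := searchStep_writesVar h
      omega
    · exact .inl h
  have hpa : ∀ a, p.WritesArr a → a ≠ 15 := by
    rintro a (h | h | h)
    · simp [loadCmd, LProg.WritesArr] at h
      omega
    · have := searchStep_writesArr h
      omega
    · exact h.elim
  have hav : (searchStep F).Avoids hiddenVars hiddenArrs := searchStep_avoids (by simp) (by simp)
  refine (LProg.den_loop (b := 6) (p := p) (fun i s' => s'.visible =
    searchIter F (fun i j => s.arr 15 (i * s.var 5 + j)) s.visible i ∧ s'.var 14 = i * s.var 5)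
    rfl (fun h => by have := hpv _ h; omega) ⟨?_, ?_⟩ ?_).1
  · refine State.ext' (fun x => ?_) fun _ _ => rfl
    by_cases hx : x = 15
    · simp [searchIter, State.erase, hx]
    · simp [searchIter, State.erase, hx]
  · simpa using h14
  · intro i hi s' hx hF ⟨h1, h2⟩
    have hv : ∀ y, y ≠ 14 → y < 15 → s'.var y = s.var y := fun y hy hy' =>
      hF.var y (by omega) fun h => by have := hpv y h; omega
    have h15 : s'.arr 15 = s.arr 15 := hF.arr 15 fun h => hpa _ h rfl
    have h9' : s'.var 5 ≤ s'.var 9 := by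
      rwa [hv 5 (by omega) (by omega), hv 9 (by omega) (by omega)]
    rw [hp, LProg.den_seq, LProg.den_seq, loadCmd_den h9', LProg.den_assign]
    set s'' := (searchStep F).den (s'.withCmd fun i => s'.arr 15 (s'.var 14 + i)) with hs''
    have hvar : ∀ y, y = 14 ∨ y = 5 → s''.var y = s'.var y := fun y hy => by
      rw [hs'', LProg.den_var (fun h => by have := searchStep_writesVar h; omega)]
      exact if_neg (by omega)
    constructor
    · have h3 : ((s''.setVar 14 ((Expr.add (.var 14) (.var 5)).eval s'')).setVar 15
          (i + 1)).visible = s''.visible := by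
        refine State.ext' (fun x => ?_) fun _ _ => rfl
        by_cases hx : x = 15
        · simp [State.erase, hx]
        · by_cases hx : x = 14
          · simp [State.erase, hx]
          · simp [State.erase, *]
      rw [h3, hs'', State.visible, ← hav.den_erase, searchIter]
      congr 1
      refine (withCmd_visible _).trans ?_
      rw [h1, h2, h15]
    · simp [Expr.eval, hvar, h2, hv 5 (by omega) (by omega), Nat.succ_mul]

end

/-! ### Resetting the scratch memory -/

/-- The memory blocks that the search uses. -/
def scratchArrs (h : ℕ) : List ℕ := List.range' 3 10 ++ [18] ++ List.range' 100 h

/-- The registers that the search uses. -/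
def scratchVars (h : ℕ) : List ℕ := List.range' 14 (86 + h)

theorem mem_scratchArrs {h a : ℕ} :
    a ∈ scratchArrs h ↔ 3 ≤ a ∧ a ≤ 12 ∨ a = 18 ∨ 100 ≤ a ∧ a < 100 + h := by
  simp only [scratchArrs, List.mem_append, List.mem_range'_1, List.mem_singleton]
  omega

theorem mem_scratchVars {h x : ℕ} : x ∈ scratchVars h ↔ 14 ≤ x ∧ x < 100 + h := by
  simp only [scratchVars, List.mem_range'_1]
  omega

/-- Clears the registers and the memory blocks that the search uses. -/
def reset (h : ℕ) : LProg :=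
  .seq (.loop 20 9 (.seqs ((scratchArrs h).map fun a => .store a (.var 20) (.const 0))))
    (.seqs ((scratchVars h).map fun x => .assign x (.const 0)))

section

variable {s : State} {h : ℕ}

theorem reset_writesVar {y : ℕ} (hy : (reset h).WritesVar y) : 14 ≤ y ∧ y < 100 + h := by
  rcases hy with (rfl | hy) | hy
  · omega
  · obtain ⟨p, hp, hy⟩ := LProg.writesVar_seqs.1 hy
    obtain ⟨a, -, rfl⟩ := List.mem_map.1 hp
    exact hy.elim
  · obtain ⟨p, hp, hy⟩ := LProg.writesVar_seqs.1 hy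
    obtain ⟨x, hx, rfl⟩ := List.mem_map.1 hp
    rw [show y = x from hy]
    exact mem_scratchVars.1 hx

theorem reset_writesArr {a : ℕ} (ha : (reset h).WritesArr a) : a ∈ scratchArrs h := by
  rcases ha with ha | ha
  · obtain ⟨p, hp, ha⟩ := LProg.writesArr_seqs.1 ha
    obtain ⟨b, hb, rfl⟩ := List.mem_map.1 hp
    rwa [show a = b from ha]
  · obtain ⟨p, hp, ha⟩ := LProg.writesArr_seqs.1 ha
    obtain ⟨x, -, rfl⟩ := List.mem_map.1 hp
    exact ha.elim

theorem reset_var {x : ℕ} (hx : 14 ≤ x ∧ x < 100 + h) : ((reset h).den s).var x = 0 := by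
  rw [reset, LProg.den_seq]
  refine LProg.den_seqs_of_mem (fun _ => True) (fun s => s.var x = 0) (fun _ _ _ _ => trivial) ?_
    (List.mem_map_of_mem (mem_scratchVars.2 hx)) (fun s _ => ?_) trivial
  · rintro p hp s - hs
    obtain ⟨y, -, rfl⟩ := List.mem_map.1 hp
    rw [LProg.den_assign, State.setVar_var]
    split_ifs
    · rfl
    · exact hs
  · simp [LProg.den_assign, Expr.eval]

theorem reset_arr {a i : ℕ} (ha : a ∈ scratchArrs h) (hi : i < s.var 9) :
    ((reset h).den s).arr a i = 0 := by
  rw [reset, LProg.den_seq, LProg.den_arr]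
  swap
  · rw [LProg.writesArr_seqs]
    rintro ⟨p, hp, h⟩
    obtain ⟨x, -, rfl⟩ := List.mem_map.1 hp
    exact h
  have hv : ∀ y, ¬ (LProg.seqs ((scratchArrs h).map fun a =>
      .store a (.var 20) (.const 0))).WritesVar y := by
    intro y hy
    obtain ⟨p, hp, hy⟩ := LProg.writesVar_seqs.1 hy
    obtain ⟨a, -, rfl⟩ := List.mem_map.1 hp
    exact hy
  refine LProg.den_loop (fun j s' => ∀ i < j, s'.arr a i = 0) rfl (hv _) (by simp) ?_ i hi
  intro j hj s' hx hF hP i hij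
  rw [State.setVar_arr]
  have h9 : s'.var 9 = s.var 9 := hF.var 9 (by decide) (hv _)
  have hstep : ∀ p ∈ (scratchArrs h).map (fun a => LProg.store a (.var 20) (.const 0)), ∀ s'',
      (s''.var 20 = j ∧ s''.var 9 = s.var 9) → ((p.den s'').var 20 = j ∧
        (p.den s'').var 9 = s.var 9) := by
    rintro p hp s'' ⟨h1, h2⟩
    obtain ⟨b, -, rfl⟩ := List.mem_map.1 hp
    have hv : ∀ y, ¬ (LProg.store b (.var 20) (.const 0)).WritesVar y := fun _ h => h
    exact ⟨(LProg.den_var (hv _) _).trans h1, (LProg.den_var (hv _) _).trans h2⟩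
  have hkeep : ∀ i', ∀ p ∈ (scratchArrs h).map (fun a => LProg.store a (.var 20) (.const 0)),
      ∀ s'', (s''.var 20 = j ∧ s''.var 9 = s.var 9) → s''.arr a i' = 0 →
        (p.den s'').arr a i' = 0 := by
    rintro i' p hp s'' ⟨h1, h2⟩ h3
    obtain ⟨b, -, rfl⟩ := List.mem_map.1 hp
    rw [LProg.den_store (by simp only [Expr.eval, h1, h2]; exact hj), State.setArr_arr]
    split_ifs
    · rfl
    · exact h3
  rcases Nat.lt_succ_iff_lt_or_eq.1 hij with hij | rfl
  · exact (LProg.den_seqs_of_forall (fun s'' => (s''.var 20 = j ∧ s''.var 9 = s.var 9) ∧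
      s''.arr a i = 0) (fun p hp s'' hs => ⟨hstep p hp s'' hs.1, hkeep i p hp s'' hs.1 hs.2⟩)
      ⟨⟨hx, h9⟩, hP i hij⟩).2
  · refine LProg.den_seqs_of_mem (fun s'' => s''.var 20 = i ∧ s''.var 9 = s.var 9)
      (fun s'' => s''.arr a i = 0) hstep (hkeep i) (List.mem_map_of_mem ha) ?_ ⟨hx, h9⟩
    rintro s'' ⟨h1, h2⟩
    rw [LProg.den_store (by simp only [Expr.eval, h1, h2]; exact hj), State.setArr_arr]
    simp [Expr.eval, h1]

theorem reset_wf : (reset h).WF 10 := by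
  refine ⟨⟨by omega, by omega, fun h => ?_, LProg.wf_seqs.2 fun p hp => ?_⟩,
    LProg.wf_seqs.2 fun p hp => ?_⟩
  · obtain ⟨p, hp, h⟩ := LProg.writesVar_seqs.1 h
    obtain ⟨a, -, rfl⟩ := List.mem_map.1 hp
    exact h
  · obtain ⟨a, -, rfl⟩ := List.mem_map.1 hp
    trivial
  · obtain ⟨x, hx, rfl⟩ := List.mem_map.1 hp
    have := mem_scratchVars.1 hx
    change 10 ≤ x
    omega

end

end RAM

namespace RAM

open SCCDeletion

/-! ### Enumerating the tapes -/

/-- The numbers that depend only on `n`, `k` and the maximal order `h` of the family: register `4`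
holds the number of digits, registers `5`, `6` and `7` the length of a command, the number of
commands and the length of the tape, register `8` the number of tapes. -/
structure Params (adj : ℕ → ℕ → Prop) (n k h : ℕ) (s : State) : Prop extends Base adj n k s where
  var_four : s.var 4 = k + h + 5
  var_five : s.var 5 = k + 4
  var_six : s.var 6 = (k + 1) * (2 * k + 6)
  var_seven : s.var 7 = (k + 1) * (2 * k + 6) * (k + 4)
  var_eight : s.var 8 = (k + h + 5) ^ ((k + 1) * (2 * k + 6) * (k + 4))
  seven_le : s.var 7 ≤ s.var 9

theorem Params.congr {adj : ℕ → ℕ → Prop} {n k h : ℕ} {s s' : State} (hs : Params adj n k h s)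
    (hv : ∀ y < 10, s'.var y = s.var y) (ha : ∀ a < 3, s'.arr a = s.arr a) :
    Params adj n k h s' where
  toBase := hs.toBase.congr hv ha
  var_four := by rw [hv 4 (by omega), hs.var_four]
  var_five := by rw [hv 5 (by omega), hs.var_five]
  var_six := by rw [hv 6 (by omega), hs.var_six]
  var_seven := by rw [hv 7 (by omega), hs.var_seven]
  var_eight := by rw [hv 8 (by omega), hs.var_eight]
  seven_le := by rw [hv 7 (by omega), hv 9 (by omega)]; exact hs.seven_le

/-- Replaces the number on the tape in block `15`, whose digits in base `q` start with the least
significant one, by its successor. -/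
def increment : LProg := .seq (.assign 20 (.const 1))
  (.loop 21 7 (.ite (.var 20)
    (.ite (.lt (.add (.ld 15 21) (.const 1)) (.var 4))
      (.seq (.store 15 (.var 21) (.add (.ld 15 21) (.const 1))) (.assign 20 (.const 0)))
      (.store 15 (.var 21) (.const 0))) .skip))

theorem increment_wf : increment.WF 10 := by
  simp [increment, LProg.WF, LProg.WritesVar]

theorem increment_writesVar {y : ℕ} : increment.WritesVar y ↔ y = 20 ∨ y = 21 := by
  simp [increment, LProg.WritesVar]
  tauto

theorem increment_writesArr {a : ℕ} : increment.WritesArr a ↔ a = 15 := by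
  simp [increment, LProg.WritesArr]

/-- Incrementing the tape turns the digits of `t` into those of `t + 1`. -/
theorem increment_spec {s : State} {q L t : ℕ} (hq : s.var 4 = q) (hL : s.var 7 = L)
    (hL9 : L ≤ s.var 9) (hq0 : 0 < q) (ht : ∀ i < L, s.arr 15 i = t / q ^ i % q) :
    ∀ i < L, (increment.den s).arr 15 i = (t + 1) / q ^ i % q := by
  rw [increment, LProg.den_seq, LProg.den_assign]
  simp only [Expr.eval]
  set p : LProg := .ite (.var 20)
    (.ite (.lt (.add (.ld 15 21) (.const 1)) (.var 4))
      (.seq (.store 15 (.var 21) (.add (.ld 15 21) (.const 1))) (.assign 20 (.const 0)))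
      (.store 15 (.var 21) (.const 0))) .skip with hp
  have hpv : ∀ y, p.WritesVar y → y = 20 := by simp [hp, LProg.WritesVar]
  have := LProg.den_loop (x := 21) (b := 7) (p := p) (s := s.setVar 20 1) (m := L)
    (fun i s' => (∀ j < i, s'.arr 15 j = (t + 1) / q ^ j % q) ∧
      (∀ j, i ≤ j → j < L → s'.arr 15 j = t / q ^ j % q) ∧
      (s'.var 20 = 0 ∧ ¬ q ^ i ∣ t + 1 ∨ s'.var 20 = 1 ∧ q ^ i ∣ t + 1)) (by simpa using hL)
    (fun h => by have := hpv _ h; omega) ⟨by simp, fun j _ hj => ht j hj, by simp⟩ ?_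
  · exact this.1
  · intro i hi s' hx hF ⟨h1, h2, h3⟩
    have h4 : s'.var 4 = q := by
      rw [hF.var 4 (by decide) (fun h => by have := hpv _ h; omega)]
      simpa using hq
    have h9 : s'.var 9 = s.var 9 := by
      rw [hF.var 9 (by decide) (fun h => by have := hpv _ h; omega)]
      simp
    have hst : ∀ e : Expr, (LProg.store 15 (.var 21) e).den s' = s'.setArr 15 i (e.eval s') := by
      intro e
      rw [LProg.den_store (by simp only [Expr.eval, hx, h9]; omega)]
      simp only [Expr.eval, hx]
    have hlast : ∀ {P : ℕ → Prop}, (∀ v < i, P v) → P i → ∀ v < i + 1, P v := by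
      intro P h h' v hv
      rcases Nat.lt_succ_iff_lt_or_eq.1 hv with hv | rfl
      · exact h v hv
      · exact h'
    have hdiv : ∀ j, (t + 1) / q ^ j = t / q ^ j + if q ^ j ∣ t + 1 then 1 else 0 :=
      fun j => Nat.succ_div
    have hpow : q ^ (i + 1) ∣ t + 1 ↔ q ^ i ∣ t + 1 ∧ q ∣ (t + 1) / q ^ i := by
      rw [pow_succ]
      constructor
      · intro h
        exact ⟨(Dvd.intro _ rfl).trans h, Nat.dvd_div_of_mul_dvd h⟩
      · rintro ⟨h, h'⟩
        exact Nat.mul_dvd_of_dvd_div h h'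
    have hti := h2 i le_rfl hi
    have hmod : t / q ^ i % q < q := Nat.mod_lt _ hq0
    rw [hp, LProg.den_ite]
    have he : (Expr.var 20).eval s' = s'.var 20 := rfl
    rcases h3 with ⟨h0, hnd⟩ | ⟨h0, hd⟩
    · rw [if_neg (show ¬ (Expr.var 20).eval s' ≠ 0 by omega), LProg.den_skip]
      refine ⟨hlast h1 ?_, fun j hj hjL => h2 j (by omega) hjL, .inl ⟨by simpa using h0, ?_⟩⟩
      · rw [State.setVar_arr, hti, hdiv, if_neg hnd, add_zero]
      · rw [hpow]
        tauto
    · rw [if_pos (show (Expr.var 20).eval s' ≠ 0 by omega), LProg.den_ite]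
      simp only [ne_eq, Expr.eval_lt_eq_zero, not_not]
      simp only [Expr.eval, hx, h4, hti]
      have hsucc : (t + 1) / q ^ i = t / q ^ i + 1 := by rw [hdiv, if_pos hd]
      split_ifs with hlt
      · rw [LProg.den_seq, hst, LProg.den_assign]
        simp only [Expr.eval, hx, hti]
        refine ⟨hlast (fun j hj => ?_) ?_, fun j hj hjL => ?_, .inl ⟨by simp, ?_⟩⟩
        · simpa [State.setArr_arr, hj.ne] using h1 j hj
        · simp only [State.setVar_arr, State.setArr_arr, and_self, if_true]
          rw [hsucc, Nat.add_mod, Nat.mod_eq_of_lt (a := 1) (by omega), Nat.mod_eq_of_lt hlt]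
        · simp only [State.setVar_arr, State.setArr_arr]
          rw [if_neg (by omega), h2 j (by omega) hjL]
        · rw [hpow, hsucc]
          rintro ⟨-, h⟩
          have h := Nat.mod_eq_zero_of_dvd h
          rw [Nat.add_mod, Nat.mod_eq_of_lt (a := 1) (by omega), Nat.mod_eq_of_lt hlt] at h
          omega
      · have hmax : t / q ^ i % q + 1 = q := by omega
        have hdvd : q ∣ (t + 1) / q ^ i := by
          rw [hsucc]
          refine ⟨t / q ^ i / q + 1, ?_⟩
          have := Nat.div_add_mod (t / q ^ i) q
          rw [Nat.mul_add]
          omega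
        rw [hst]
        simp only [Expr.eval]
        refine ⟨hlast (fun j hj => ?_) ?_, fun j hj hjL => ?_, .inr ⟨by simpa using h0, ?_⟩⟩
        · simpa [State.setArr_arr, hj.ne] using h1 j hj
        · simp only [State.setVar_arr, State.setArr_arr, and_self, if_true]
          exact (Nat.mod_eq_zero_of_dvd hdvd).symm
        · simp only [State.setVar_arr, State.setArr_arr]
          rw [if_neg (by omega), h2 j (by omega) hjL]
        · rw [hpow]
          exact ⟨hd, hdvd⟩

/-- Every tape occurs in the enumeration. -/
theorem exists_digits {q : ℕ} (τ : ℕ → ℕ) (hτ : ∀ x, τ x < q) (L : ℕ) :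
    ∃ t < q ^ L, ∀ x < L, t / q ^ x % q = τ x := by
  induction L generalizing τ with
  | zero => exact ⟨0, by simp, by simp⟩
  | succ L ih =>
    obtain ⟨t, ht, h⟩ := ih (fun x => τ (x + 1)) fun x => hτ _
    have h0 := hτ 0
    refine ⟨τ 0 + q * t, ?_, fun x hx => ?_⟩
    · calc τ 0 + q * t < q * (t + 1) := by rw [Nat.mul_succ]; omega
        _ ≤ q * q ^ L := Nat.mul_le_mul_left _ ht
        _ = q ^ (L + 1) := by rw [pow_succ']
    · rcases x with - | x
      · simp [Nat.mod_eq_of_lt h0]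
      · rw [pow_succ', ← Nat.div_div_eq_div_mul, Nat.add_mul_div_left _ _ (by omega),
          Nat.div_eq_of_lt h0, zero_add]
        exact h x (by omega)

/-! ### Verifying the outcome of a run -/

/-- The vertex in register `20` belongs to the current prefix of the vertices and is deleted. -/
def isDeleted : Expr := .and (.not (.ld 8 20)) (.lt (.var 20) (.add (.var 10) (.const 1)))

/-- If the digraph induced by the set in block `8` has no copies in strong components and at most
`k` vertices are missing from the current prefix, then these are recorded in block `17` and
register `12` is set. -/
noncomputable def check (F : Finset FinDigraph) : LProg := .seqs [
  closure, copies F, .assign 21 (.const 0), .assign 22 (.const 0),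
  .loop 20 0 (.ite (.ld 4 20) (.assign 22 (.const 1)) .skip),
  .loop 20 0 (.ite isDeleted (.assign 21 (.add (.var 21) (.const 1))) .skip),
  .ite (.and (.not (.var 22)) (.lt (.var 21) (.var 3)))
    (.seq (.loop 20 0 (.store 17 (.var 20) isDeleted)) (.assign 12 (.const 1))) .skip]

theorem check_wf {F : Finset FinDigraph} : (check F).WF 10 := by
  simp [check, LProg.seqs, LProg.WF, LProg.WritesVar, closure_wf, copies_wf]

theorem check_writesVar {F : Finset FinDigraph} {y : ℕ} (h : (check F).WritesVar y) :
    y = 12 ∨ 20 ≤ y ∧ y < 100 + maxOrder F := by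
  simp only [check, LProg.seqs, LProg.WritesVar] at h
  have h1 := @closure_writesVar y
  have h2 := @copies_writesVar F y
  by_cases h3 : closure.WritesVar y
  · have := h1 h3
    omega
  · by_cases h4 : (copies F).WritesVar y
    · have := h2 h4
      omega
    · simp [h3, h4] at h
      omega

theorem check_writesArr {F : Finset FinDigraph} {a : ℕ} (h : (check F).WritesArr a) :
    3 ≤ a ∧ a ≤ 7 ∨ a = 17 ∨ 100 ≤ a ∧ a < 100 + maxOrder F := by
  simp only [check, LProg.seqs, LProg.WritesArr, closure_writesArr] at h
  have h2 := @copies_writesArr F a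
  by_cases h4 : (copies F).WritesArr a
  · have := h2 h4
    omega
  · simp [h4] at h
    omega

section

variable {adj : ℕ → ℕ → Prop} {n k : ℕ} {s : State} {F : Finset FinDigraph}

theorem eval_isDeleted {i : ℕ} (h10 : s.var 10 = i) :
    isDeleted.eval s ≠ 0 ↔ s.arr 8 (s.var 20) = 0 ∧ s.var 20 < i + 1 := by
  rw [isDeleted, ne_eq, Expr.eval_and_eq_zero, not_not, ne_eq, Expr.eval_not_eq_zero, not_not,
    ne_eq, Expr.eval_lt_eq_zero, not_not]
  simp only [Expr.eval, h10]

open Classical in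
/-- The verification accepts exactly the outcomes that are solutions, and records them. This is the
only fact about a run on which the soundness of the algorithm depends. -/
theorem check_spec (hF : ∀ H ∈ F, IsRooted H.2) (hs : Base adj n k s) {i : ℕ} (hi : i < n)
    (h10 : s.var 10 = i) :
    if Good adj (copyPatterns F adj n) (mask n s 8) ∧
        (Finset.range (i + 1) \ mask n s 8).card ≤ k then
      ((check F).den s).var 12 = 1 ∧
        mask n ((check F).den s) 17 = Finset.range (i + 1) \ mask n s 8
    else ((check F).den s).var 12 = s.var 12 ∧ ((check F).den s).arr 17 = s.arr 17 := by
  set G := mask n s 8 with hG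
  set R := Finset.range (i + 1) \ G with hR
  have hmemR : ∀ v < n, v ∈ R ↔ s.arr 8 v = 0 ∧ v < i + 1 := fun v hv => by
    simp only [hR, Finset.mem_sdiff, Finset.mem_range, hG, mem_mask, hv, true_and, ne_eq, not_not]
    exact and_comm
  have hden : (check F).den s = (check F).den s := rfl
  conv_rhs at hden => rw [check, LProg.den_seqs_cons, LProg.den_seqs_cons]
  have hreach := closure_spec hs
  have hb₁ : Base adj n k (closure.den s) := hs.den closure_wf
    fun a ha => by rw [closure_writesArr]; omega
  have hv₁ : ∀ y, y < 20 → (closure.den s).var y = s.var y := fun y hy =>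
    LProg.den_var (fun h => by have := closure_writesVar h; omega) s
  have hw₁ : ∀ a, a = 8 ∨ a = 17 → (closure.den s).arr a = s.arr a := fun a ha =>
    LProg.den_arr (by rw [closure_writesArr]; omega) s
  set s₁ := closure.den s
  have hcopies := (copies_spec hF hb₁ (G := G) (mask_congr fun v _ => by
    rw [hw₁ 8 (by omega)]) hreach).roots
  have hb₂ : Base adj n k ((copies F).den s₁) := hb₁.den copies_wf
    fun a ha h => by have := copies_writesArr h; omega
  have hv₂ : ∀ y, y < 20 → ((copies F).den s₁).var y = s.var y := fun y hy => by
    rw [LProg.den_var (fun h => by have := copies_writesVar h; omega) s₁, hv₁ y hy]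
  have hw₂ : ∀ a, a = 8 ∨ a = 17 → ((copies F).den s₁).arr a = s.arr a := fun a ha => by
    rw [LProg.den_arr (fun h => by have := copies_writesArr h; omega) s₁, hw₁ a ha]
  set s₂ := (copies F).den s₁
  have hgood := good_iff_roots_eq_empty (rootedPatterns_copyPatterns hF adj n) G
  rw [← hcopies] at hgood
  clear_value s₂
  simp only [LProg.den_seqs_cons, LProg.den_seqs_nil] at hden
  rw [LProg.den_assign (x := 21), LProg.den_assign (x := 22)] at hden
  simp only [Expr.eval] at hden
  set s₃ := (s₂.setVar 21 0).setVar 22 0 with hs₃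
  have hv₃ : ∀ y, y < 20 → s₃.var y = s₂.var y := fun y hy => by
    simp only [hs₃, State.setVar_var]
    rw [if_neg (by omega), if_neg (by omega)]
  have hb₃ : Base adj n k s₃ := hb₂.congr (fun y hy => hv₃ y (by omega)) fun _ _ => rfl
  -- searching for marked roots
  set p₄ : LProg := .ite (.ld 4 20) (.assign 22 (.const 1)) .skip with hp₄
  set s₄ := (LProg.loop 20 0 p₄).den s₃ with hs₄
  have hp₄v : ∀ y, p₄.WritesVar y → y = 22 := by simp [hp₄, LProg.WritesVar]
  have hv₄ : ∀ y, y < 20 ∨ y = 21 → s₄.var y = s₃.var y := fun y hy => LProg.den_var (by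
    rintro (h | h)
    · omega
    · have := hp₄v y h
      omega) s₃
  have ha₄ : s₄.arr = s₂.arr := funext fun a => LProg.den_arr (by simp [hp₄, LProg.WritesArr]) s₃
  have h22 : s₄.var 22 = 0 ↔ Good adj (copyPatterns F adj n) G := by
    rw [hgood]
    have := LProg.den_loop (x := 20) (b := 0) (p := p₄) (s := s₃)
      (fun i s' => s'.var 22 = 0 ↔ ∀ v < i, s₂.arr 4 v = 0) hb₃.var_zero
      (fun h => by have := hp₄v _ h; omega) (by simp [hs₃]) ?_
    · rw [hs₄, this]
      constructor
      · intro h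
        ext v
        simp only [mem_mask, Finset.notMem_empty, iff_false]
        exact fun h' => h'.2 (h v h'.1)
      · intro h v hv
        by_contra h'
        have : v ∈ mask n s₂ 4 := mem_mask.2 ⟨hv, h'⟩
        rw [h] at this
        simp at this
    · intro j hj s' hx hF' hP
      have h4 : s'.arr 4 = s₂.arr 4 := hF'.arr 4 (by simp [hp₄, LProg.WritesArr])
      rw [hp₄, LProg.den_ite]
      simp only [Expr.eval, hx, h4]
      split_ifs with h
      · rw [LProg.den_assign]
        simp only [Expr.eval, State.setVar_var]
        simp
        exact ⟨j, le_rfl, h⟩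
      · rw [LProg.den_skip]
        simp only [State.setVar_var, if_neg (show ¬ (22 : ℕ) = 20 by decide), hP]
        rw [not_not] at h
        constructor
        · intro h' v hv
          rcases Nat.lt_succ_iff_lt_or_eq.1 hv with hv | rfl
          · exact h' v hv
          · exact h
        · exact fun h' v hv => h' v (by omega)
  -- counting the deleted vertices
  have hb₄ : Base adj n k s₄ := hb₃.congr (fun y hy => hv₄ y (by omega))
    fun a _ => by rw [ha₄]; rfl
  set p₅ : LProg := .ite isDeleted (.assign 21 (.add (.var 21) (.const 1))) .skip with hp₅
  set s₅ := (LProg.loop 20 0 p₅).den s₄ with hs₅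
  have hp₅v : ∀ y, p₅.WritesVar y → y = 21 := by simp [hp₅, LProg.WritesVar]
  have hv₅ : ∀ y, y < 20 ∨ y = 22 → s₅.var y = s₄.var y := fun y hy => LProg.den_var (by
    rintro (h | h)
    · omega
    · have := hp₅v y h
      omega) s₄
  have ha₅ : s₅.arr = s₂.arr := by
    rw [← ha₄]
    exact funext fun a => LProg.den_arr (by simp [hp₅, LProg.WritesArr]) s₄
  have h10₄ : s₄.var 10 = i := by rw [hv₄ 10 (by omega), hv₃ 10 (by omega), hv₂ 10 (by omega), h10]
  have h21 : s₅.var 21 = R.card := by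
    have := LProg.den_loop (x := 20) (b := 0) (p := p₅) (s := s₄)
      (fun i s' => s'.var 21 = rank R i) hb₄.var_zero
      (fun h => by have := hp₅v _ h; omega) ?_ ?_
    · rw [hs₅, this, rank, Finset.filter_true_of_mem]
      intro v hv
      have := Finset.mem_range.1 (Finset.mem_sdiff.1 hv).1
      omega
    · simp only [State.setVar_var]
      rw [if_neg (by decide), hv₄ 21 (by omega)]
      simp [hs₃, rank]
    · intro j hj s' hx hF' hP
      have h10' : s'.var 10 = i := by
        rw [hF'.var 10 (by decide) (fun h => by have := hp₅v _ h; omega), h10₄]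
      have h8 : s'.arr 8 = s.arr 8 := by
        rw [hF'.arr 8 (by simp [hp₅, LProg.WritesArr]), ha₄, hw₂ 8 (by omega)]
      have hdel := eval_isDeleted h10'
      rw [hx, h8, ← hmemR j hj] at hdel
      rw [hp₅, LProg.den_ite]
      simp only [hdel]
      rw [rank_succ]
      split_ifs with h
      · rw [LProg.den_assign]
        simp [Expr.eval, hP]
      · rw [LProg.den_skip]
        simpa using hP
  have hb₅ : Base adj n k s₅ := hb₄.congr (fun y hy => hv₅ y (by omega))
    fun a _ => by rw [ha₅, ← ha₄]
  rw [LProg.den_ite] at hden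
  simp only [ne_eq, Expr.eval_and_eq_zero, Expr.eval_not_eq_zero, Expr.eval_lt_eq_zero,
    not_not] at hden
  simp only [Expr.eval, hv₅ 22 (by omega), h22, h21, hb₅.var_three, Nat.lt_succ_iff] at hden
  rw [hden]
  split_ifs with h
  · rw [LProg.den_seq, LProg.den_assign]
    refine ⟨by simp [Expr.eval], ?_⟩
    have : ∀ s' : State, mask n (s'.setVar 12 1) 17 = mask n s' 17 := fun _ => rfl
    simp only [Expr.eval]
    rw [this, mask_fill (by simp [isDeleted, Expr.Avoids, Expr.avoids_and, Expr.avoids_not,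
      Expr.avoids_lt]) hb₅.var_zero (hb₅.lt_nine (by omega)).le (by decide)]
    ext v
    rw [Finset.mem_filter, Finset.mem_range]
    have h10₅ : (s₅.setVar 20 v).var 10 = i := by
      rw [State.setVar_var, if_neg (by decide), hv₅ 10 (by omega), h10₄]
    rw [eval_isDeleted h10₅]
    simp only [State.setVar_var, if_true, State.setVar_arr, ha₅, hw₂ 8 (by omega)]
    constructor
    · exact fun h => (hmemR v h.1).2 h.2
    · intro h
      have hvn : v < n := by
        have := Finset.mem_range.1 (Finset.mem_sdiff.1 h).1
        omega
      exact ⟨hvn, (hmemR v hvn).1 h⟩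
  · rw [LProg.den_skip, ha₅, hw₂ 17 (by omega), hv₅ 12 (by omega), hv₄ 12 (by omega),
      hv₃ 12 (by omega), hv₂ 12 (by omega)]
    exact ⟨rfl, rfl⟩

end

end RAM

namespace RAM

open SCCDeletion

/-! ### Running the search along all tapes -/

/-- At most `k` vertices whose deletion leaves no copy in a strong component of the digraph
induced by the numbers below `i`. -/
structure IsSolution (F : Finset FinDigraph) (adj : ℕ → ℕ → Prop) (n k i : ℕ) (S : Finset ℕ) :
    Prop where
  subset : S ⊆ Finset.range i
  card_le : S.card ≤ k
  good : Good adj (copyPatterns F adj n) (Finset.range i \ S)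

/-- Writes the vertices up to the one in register `10` to block `8`. -/
def initPrefix : LProg :=
  .loop 20 0 (.store 8 (.var 20) (.lt (.var 20) (.add (.var 10) (.const 1))))

/-- The state in which the search starts. -/
noncomputable def searchStart (h : ℕ) (s : State) : State :=
  (initPrefix.den ((reset h).den s)).visible

/-- The two states agree on everything that the search reads, apart from the tape. -/
structure SameInput (h : ℕ) (s s' : State) : Prop where
  var : ∀ x, x ≠ 11 → x ≠ 12 → ¬ (14 ≤ x ∧ x < 100 + h) → s'.var x = s.var x
  arr : ∀ a, a ∉ scratchArrs h → a ≠ 15 → a ≠ 17 → s'.arr a = s.arr a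
  arr_of_le : ∀ a i, s.var 9 ≤ i → s'.arr a i = s.arr a i

/-- The set that the search reaches on the tape `τ` from the state `s`. -/
noncomputable def searchResult (F : Finset FinDigraph) (n k : ℕ) (s : State) (τ : ℕ → ℕ) :
    Finset ℕ :=
  mask n (searchIter F (fun i j => τ (i * (k + 4) + j)) (searchStart (maxOrder F) s)
    ((k + 1) * (2 * k + 6))) 8

/-- Runs the search along the tape, verifies the outcome, and passes to the next tape. -/
noncomputable def tapeBody (F : Finset FinDigraph) : LProg :=
  .seqs [reset (maxOrder F), initPrefix, run F, check F, increment]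

theorem run_wf {F : Finset FinDigraph} : (run F).WF 10 := by
  have h : ∀ y, y < 20 → ¬ (searchStep F).WritesVar y := fun y hy h => by
    have := searchStep_writesVar h
    omega
  simp [run, loadCmd, LProg.WF, LProg.WritesVar, searchStep_wf, h]

theorem run_writesVar {F : Finset FinDigraph} {y : ℕ} (h : (run F).WritesVar y) :
    14 ≤ y ∧ y < 100 + maxOrder F := by
  rcases h with h | (h | h) | h | h
  · omega
  · change y = 39 at h
    omega
  · exact h.elim
  · have := searchStep_writesVar h
    omega
  · change y = 14 at h
    omega

theorem run_writesArr {F : Finset FinDigraph} {a : ℕ} (h : (run F).WritesArr a) :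
    a ∈ scratchArrs (maxOrder F) := by
  rw [mem_scratchArrs]
  rcases h with h | h | h
  · change a = 18 at h
    omega
  · have := searchStep_writesArr h
    omega
  · exact h.elim

theorem initPrefix_wf : initPrefix.WF 10 := by
  simp [initPrefix, LProg.WF, LProg.WritesVar]

theorem initPrefix_writesVar {y : ℕ} (h : initPrefix.WritesVar y) : y = 20 := by
  rcases h with h | h
  · exact h
  · exact h.elim

theorem initPrefix_writesArr {a : ℕ} (h : initPrefix.WritesArr a) : a = 8 := h

theorem tapeBody_wf {F : Finset FinDigraph} : (tapeBody F).WF 10 :=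
  ⟨reset_wf, initPrefix_wf, run_wf, check_wf, increment_wf, trivial⟩

theorem tapeBody_writesVar {F : Finset FinDigraph} {y : ℕ} (h : (tapeBody F).WritesVar y) :
    y = 12 ∨ 14 ≤ y ∧ y < 100 + maxOrder F := by
  rcases h with h | h | h | h | h | h
  · exact .inr (reset_writesVar h)
  · have := initPrefix_writesVar h
    omega
  · exact .inr (run_writesVar h)
  · have := check_writesVar h
    omega
  · have := increment_writesVar.1 h
    omega
  · exact h.elim

theorem tapeBody_writesArr {F : Finset FinDigraph} {a : ℕ} (h : (tapeBody F).WritesArr a) :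
    a ∈ scratchArrs (maxOrder F) ∨ a = 15 ∨ a = 17 := by
  rcases h with h | h | h | h | h | h
  · exact .inl (reset_writesArr h)
  · have := initPrefix_writesArr h
    rw [mem_scratchArrs]
    omega
  · exact .inl (run_writesArr h)
  · have := check_writesArr h
    rw [mem_scratchArrs]
    omega
  · have := increment_writesArr.1 h
    omega
  · exact h.elim

theorem SameInput.trans {h : ℕ} {s s' s'' : State} (h1 : SameInput h s s')
    (h2 : SameInput h s' s'') : SameInput h s s'' where
  var x hx hx' hx'' := (h2.var x hx hx' hx'').trans (h1.var x hx hx' hx'')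
  arr a ha ha' ha'' := (h2.arr a ha ha' ha'').trans (h1.arr a ha ha' ha'')
  arr_of_le a i hi := (h2.arr_of_le a i (by
    rwa [h1.var 9 (by decide) (by decide) (by omega)])).trans (h1.arr_of_le a i hi)

theorem SameInput.setVar (h : ℕ) (s : State) (v : ℕ) : SameInput h s (s.setVar 11 v) :=
  ⟨fun x hx _ _ => by rw [State.setVar_var, if_neg hx], fun _ _ _ _ => rfl, fun _ _ _ => rfl⟩

theorem sameInput_tapeBody (F : Finset FinDigraph) (s : State) :
    SameInput (maxOrder F) s ((tapeBody F).den s) where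
  var x _ hx hx' := LProg.den_var (fun h => by have := tapeBody_writesVar h; omega) s
  arr a ha ha' ha'' := LProg.den_arr (fun h => by have := tapeBody_writesArr h; tauto) s
  arr_of_le a i hi := LProg.den_arr_of_le (fun h => by have := tapeBody_writesVar h; omega) s a hi

/-- Clearing the scratch memory makes the start of the search independent of all earlier runs. -/
theorem SameInput.searchStart_eq {h : ℕ} {s s' : State} (hs : SameInput h s s') :
    searchStart h s' = searchStart h s := by
  have hav : initPrefix.Avoids hiddenVars hiddenArrs := by
    simp [initPrefix, LProg.Avoids, Expr.Avoids, Expr.lt]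
  have : ((reset h).den s').visible = ((reset h).den s).visible := by
    refine State.ext' (fun x => ?_) fun a i => ?_
    · simp only [State.erase]
      split_ifs with hx
      · rfl
      · by_cases hx' : 14 ≤ x ∧ x < 100 + h
        · rw [reset_var hx', reset_var hx']
        · rw [LProg.den_var (fun h => hx' (reset_writesVar h)),
            LProg.den_var (fun h => hx' (reset_writesVar h))]
          simp only [Finset.mem_insert, not_or] at hx
          exact hs.var x hx.1 hx.2.1 hx'
    · simp only [State.erase]
      split_ifs with ha
      · rfl
      · simp only [Finset.mem_insert, Finset.mem_singleton, not_or] at ha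
        by_cases ha' : a ∈ scratchArrs h
        · have h9 : s'.var 9 = s.var 9 := hs.var 9 (by decide) (by decide) (by omega)
          have hr9 : ¬ (reset h).WritesVar 9 := fun h => by have := reset_writesVar h; omega
          rcases lt_or_ge i (s.var 9) with hi | hi
          · rw [reset_arr ha' hi, reset_arr ha' (h9 ▸ hi)]
          · rw [LProg.den_arr_of_le hr9 _ _ hi, LProg.den_arr_of_le hr9 _ _ (h9 ▸ hi),
              hs.arr_of_le a i hi]
        · rw [LProg.den_arr (fun h => ha' (reset_writesArr h)),
            LProg.den_arr (fun h => ha' (reset_writesArr h)), hs.arr a ha' ha.1 ha.2]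
  rw [searchStart, searchStart, State.visible, State.visible, ← hav.den_erase, ← hav.den_erase]
  exact congrArg initPrefix.den this

section

variable {adj : ℕ → ℕ → Prop} {n k i : ℕ} {s s' : State} {F : Finset FinDigraph} {W : Finset ℕ}

theorem searchStart_var {h x : ℕ} (hx : x < 11) : (searchStart h s).var x = s.var x := by
  refine (if_neg (by simp; omega)).trans ?_
  rw [LProg.den_var (fun h => by have := initPrefix_writesVar h; omega),
    LProg.den_var (fun h => by have := reset_writesVar h; omega)]

theorem searchStart_arr {h a : ℕ} (ha : a ∉ scratchArrs h) (ha' : a ≠ 15) (ha'' : a ≠ 17) :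
    (searchStart h s).arr a = s.arr a := by
  funext j
  refine (if_neg (by simp [*])).trans ?_
  rw [LProg.den_arr (fun h' => ha (by rw [initPrefix_writesArr h', mem_scratchArrs]; omega)),
    LProg.den_arr (fun h => ha (reset_writesArr h))]

/-- The outcome of a search depends only on the cells of the tape within its length. -/
theorem searchResult_congr {τ τ' : ℕ → ℕ} (h5 : s.var 5 = k + 4)
    (h : ∀ x < (k + 1) * (2 * k + 6) * (k + 4), τ x = τ' x) :
    searchResult F n k s τ = searchResult F n k s τ' := by
  rw [searchResult, searchResult]
  congr 1
  refine (searchIter_congr fun i hi j hj => h _ ?_).1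
  rw [searchStart_var (by omega), h5] at hj
  calc i * (k + 4) + j < (i + 1) * (k + 4) := by rw [Nat.succ_mul]; omega
    _ ≤ _ := Nat.mul_le_mul_right _ hi

open Classical in
/-- One round of the enumeration: the search is run on the current tape and its outcome verified,
and the tape is replaced by the next one. -/
theorem tapeBody_spec (hF : ∀ H ∈ F, IsRooted H.2) (hs : Params adj n k (maxOrder F) s)
    (hi : i < n) (h10 : s.var 10 = i) {t : ℕ}
    (ht : ∀ x < (k + 1) * (2 * k + 6) * (k + 4), s.arr 15 x =
      t / (k + maxOrder F + 5) ^ x % (k + maxOrder F + 5)) :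
    (∀ x < (k + 1) * (2 * k + 6) * (k + 4), ((tapeBody F).den s).arr 15 x =
      (t + 1) / (k + maxOrder F + 5) ^ x % (k + maxOrder F + 5)) ∧
    if Good adj (copyPatterns F adj n) (searchResult F n k s (s.arr 15)) ∧
        (Finset.range (i + 1) \ searchResult F n k s (s.arr 15)).card ≤ k then
      ((tapeBody F).den s).var 12 = 1 ∧ mask n ((tapeBody F).den s) 17 =
        Finset.range (i + 1) \ searchResult F n k s (s.arr 15)
    else ((tapeBody F).den s).var 12 = s.var 12 ∧ ((tapeBody F).den s).arr 17 = s.arr 17 := by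
  have hden : (tapeBody F).den s = increment.den ((check F).den ((run F).den
      (initPrefix.den ((reset (maxOrder F)).den s)))) := by
    rw [tapeBody, LProg.den_seqs_cons, LProg.den_seqs_cons, LProg.den_seqs_cons,
      LProg.den_seqs_cons, LProg.den_seqs_cons, LProg.den_seqs_nil]
  set s₁ := initPrefix.den ((reset (maxOrder F)).den s) with hs₁
  set s₂ := (run F).den s₁ with hs₂
  have hv₁ : ∀ x, x < 14 → s₁.var x = s.var x := fun x hx => by
    rw [hs₁, LProg.den_var (fun h => by have := initPrefix_writesVar h; omega),
      LProg.den_var (fun h => by have := reset_writesVar h; omega)]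
  have hv₂ : ∀ x, x < 14 → s₂.var x = s.var x := fun x hx => by
    rw [hs₂, LProg.den_var (fun h => by have := run_writesVar h; omega), hv₁ x hx]
  have ha₁ : ∀ a, a ∉ scratchArrs (maxOrder F) → s₁.arr a = s.arr a := fun a ha => by
    rw [hs₁, LProg.den_arr (fun h => ha (by
      rw [initPrefix_writesArr h, mem_scratchArrs]; omega)),
      LProg.den_arr (fun h => ha (reset_writesArr h))]
  have ha₂ : ∀ a, a ∉ scratchArrs (maxOrder F) → s₂.arr a = s.arr a := fun a ha => by
    rw [hs₂, LProg.den_arr (fun h => ha (run_writesArr h)), ha₁ a ha]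
  have hmem : ∀ a, a < 3 ∨ a = 15 ∨ a = 17 → a ∉ scratchArrs (maxOrder F) := fun a ha => by
    rw [mem_scratchArrs]
    omega
  have hp₂ : Params adj n k (maxOrder F) s₂ :=
    hs.congr (fun y hy => hv₂ y (by omega)) fun a ha => ha₂ a (hmem a (by omega))
  have h14 : s₁.var 14 = 0 := by
    rw [hs₁, LProg.den_var (fun h => by have := initPrefix_writesVar h; omega),
      reset_var (by omega)]
  have h59 : s₁.var 5 ≤ s₁.var 9 := by
    rw [hv₁ 5 (by omega), hv₁ 9 (by omega), hs.var_five]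
    refine le_trans ?_ hs.seven_le
    rw [hs.var_seven]
    exact Nat.le_mul_of_pos_left _ (by positivity)
  have hresult : mask n s₂ 8 = searchResult F n k s (s.arr 15) := by
    have h1 := run_spec (F := F) h59 h14
    have h2 : mask n s₂ 8 = mask n s₂.visible 8 := mask_congr fun _ _ => by simp [State.erase]
    rw [h2, hs₂, h1, hv₁ 5 (by omega), hv₁ 6 (by omega), hs.var_five, hs.var_six,
      ha₁ 15 (hmem 15 (by omega))]
    rfl
  have hcheck := check_spec hF hp₂.toBase hi ((hv₂ 10 (by omega)).trans h10)
  rw [hresult, hv₂ 12 (by omega), ha₂ 17 (hmem 17 (by omega))] at hcheck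
  set s₃ := (check F).den s₂ with hs₃
  have hv₃ : ∀ x, x < 12 → s₃.var x = s.var x := fun x hx => by
    rw [hs₃, LProg.den_var (fun h => by have := check_writesVar h; omega), hv₂ x (by omega)]
  have h15 : s₃.arr 15 = s.arr 15 := by
    rw [hs₃, LProg.den_arr (fun h => by have := check_writesArr h; omega),
      ha₂ 15 (hmem 15 (by omega))]
  have h12 : (increment.den s₃).var 12 = s₃.var 12 := LProg.den_var (by
    rw [increment_writesVar]; omega) _
  have h17 : (increment.den s₃).arr 17 = s₃.arr 17 := LProg.den_arr (by
    rw [increment_writesArr]; omega) _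
  rw [hden]
  refine ⟨increment_spec ((hv₃ 4 (by omega)).trans hs.var_four)
    ((hv₃ 7 (by omega)).trans hs.var_seven) ?_ (by omega) (by rwa [h15]), ?_⟩
  · rw [hv₃ 9 (by omega), ← hs.var_seven]
    exact hs.seven_le
  · rw [h12, h17, mask_congr (a := 17) (a' := 17) (s' := s₃) fun v _ => by rw [h17]]
    exact hcheck

/-- The tape with the number `t`. -/
def tape (q t x : ℕ) : ℕ := t / q ^ x % q

/-- After all tapes, either a solution has been recorded or no tape leads to one. -/
theorem tapes_spec (hF : ∀ H ∈ F, IsRooted H.2) (hs : Params adj n k (maxOrder F) s)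
    (hi : i < n) (h10 : s.var 10 = i) (h12 : s.var 12 = 0)
    (h15 : ∀ x < (k + 1) * (2 * k + 6) * (k + 4), s.arr 15 x = 0)
    (hs' : s' = (LProg.loop 11 8 (tapeBody F)).den s) :
    (s'.var 12 ≠ 0 → IsSolution F adj n k (i + 1) (mask n s' 17)) ∧
    (s'.var 12 = 0 → ∀ t < (k + maxOrder F + 5) ^ ((k + 1) * (2 * k + 6) * (k + 4)),
      ¬ (Good adj (copyPatterns F adj n)
          (searchResult F n k s (tape (k + maxOrder F + 5) t)) ∧
        (Finset.range (i + 1) \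
          searchResult F n k s (tape (k + maxOrder F + 5) t)).card ≤ k)) := by
  set q := k + maxOrder F + 5 with hq
  set L := (k + 1) * (2 * k + 6) * (k + 4) with hL
  suffices h : SameInput (maxOrder F) s s' ∧ (∀ x < L, s'.arr 15 x = tape q (q ^ L) x) ∧
      (s'.var 12 ≠ 0 → IsSolution F adj n k (i + 1) (mask n s' 17)) ∧
      (s'.var 12 = 0 → ∀ t < q ^ L, ¬ (Good adj (copyPatterns F adj n)
        (searchResult F n k s (tape q t)) ∧
        (Finset.range (i + 1) \ searchResult F n k s (tape q t)).card ≤ k)) from h.2.2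
  rw [hs']
  refine LProg.den_loop (fun t s' => SameInput (maxOrder F) s s' ∧
      (∀ x < L, s'.arr 15 x = tape q t x) ∧
      (s'.var 12 ≠ 0 → IsSolution F adj n k (i + 1) (mask n s' 17)) ∧
      (s'.var 12 = 0 → ∀ t' < t, ¬ (Good adj (copyPatterns F adj n)
        (searchResult F n k s (tape q t')) ∧
        (Finset.range (i + 1) \ searchResult F n k s (tape q t')).card ≤ k)))
    hs.var_eight (fun h => by have := tapeBody_writesVar h; omega)
    ⟨.setVar _ _ _, fun x hx => by simp [tape, h15 x hx], fun h => absurd h12 h, by simp⟩ ?_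
  intro t ht s₁ _ _ ⟨h1, h2, h3, h4⟩
  have hp₁ : Params adj n k (maxOrder F) s₁ := hs.congr
    (fun y hy => h1.var y (by omega) (by omega) (by omega))
    fun a ha => h1.arr a (by rw [mem_scratchArrs]; omega) (by omega) (by omega)
  obtain ⟨h5, h6⟩ := tapeBody_spec hF hp₁ hi ((h1.var 10 (by decide) (by decide) (by omega)).trans
    h10) h2
  have hres : searchResult F n k s₁ (s₁.arr 15) = searchResult F n k s (tape q t) := by
    rw [searchResult_congr hp₁.var_five h2, searchResult, searchResult, h1.searchStart_eq]
  rw [hres] at h6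
  refine ⟨h1.trans ((sameInput_tapeBody F s₁).trans (.setVar _ _ _)), h5, ?_⟩
  simp only [State.setVar_var, if_neg (show ¬ (12 : ℕ) = 11 by decide)]
  have hmask : mask n (((tapeBody F).den s₁).setVar 11 (t + 1)) 17 =
    mask n ((tapeBody F).den s₁) 17 := rfl
  rw [hmask]
  split_ifs at h6 with hok
  · refine ⟨fun _ => ?_, fun h => by omega⟩
    rw [h6.2]
    refine ⟨Finset.sdiff_subset, hok.2, hok.1.mono fun v hv => ?_⟩
    simp only [Finset.mem_sdiff] at hv
    tauto
  · rw [h6.1, mask_congr (a := 17) (a' := 17) (s' := s₁) fun v _ => by rw [h6.2]]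
    refine ⟨h3, fun h t' ht' => ?_⟩
    rcases Nat.lt_succ_iff_lt_or_eq.1 ht' with ht' | rfl
    · exact h4 h t' ht'
    · exact hok

/-- If the graph on the first `i + 1` vertices has a solution, some tape leads to one. -/
theorem exists_tape (hF : ∀ H ∈ F, IsRooted H.2) (hs : Params adj n k (maxOrder F) s)
    (hi : i < n) (h10 : s.var 10 = i) (hW : mask n s 14 = W) (hWk : W.card ≤ k + 1)
    (hWgood : Good adj (copyPatterns F adj n) (Finset.range (i + 1) \ W)) {S : Finset ℕ}
    (hS : IsSolution F adj n k (i + 1) S) :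
    ∃ t < (k + maxOrder F + 5) ^ ((k + 1) * (2 * k + 6) * (k + 4)),
      Good adj (copyPatterns F adj n) (searchResult F n k s (tape (k + maxOrder F + 5) t)) ∧
      (Finset.range (i + 1) \
        searchResult F n k s (tape (k + maxOrder F + 5) t)).card ≤ k := by
  set σ := searchStart (maxOrder F) s with hσ
  have hscratch : ∀ a, a < 3 ∨ a = 14 → a ∉ scratchArrs (maxOrder F) := fun a ha => by
    rw [mem_scratchArrs]
    omega
  have hb : Base adj n k σ := hs.toBase.congr (fun y hy => searchStart_var (by omega))
    fun a ha => searchStart_arr (hscratch a (by omega)) (by omega) (by omega)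
  have h14 : mask n σ 14 = W := by
    rw [← hW]
    exact mask_congr fun v _ => by
      rw [hσ, searchStart_arr (hscratch 14 (by omega)) (by omega) (by omega)]
  have h8 : mask n σ 8 = Finset.range (i + 1) := by
    have h0 : ((reset (maxOrder F)).den s).var 0 = n := by
      rw [LProg.den_var (fun h => by have := reset_writesVar h; omega), hs.var_zero]
    have h9 : ((reset (maxOrder F)).den s).var 9 = s.var 9 :=
      LProg.den_var (fun h => by have := reset_writesVar h; omega) s
    have h10' : ((reset (maxOrder F)).den s).var 10 = i := by
      rw [LProg.den_var (fun h => by have := reset_writesVar h; omega), h10]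
    have h1 : mask n σ 8 = mask n (initPrefix.den ((reset (maxOrder F)).den s)) 8 :=
      mask_congr fun _ _ => by simp [hσ, searchStart, State.erase]
    rw [h1, initPrefix, mask_fill (by simp [Expr.Avoids, Expr.lt]) h0
      (by rw [h9]; exact (hs.toBase.lt_nine (by omega)).le) (by decide)]
    ext v
    rw [Finset.mem_filter, Finset.mem_range, Finset.mem_range, ne_eq, Expr.eval_lt_eq_zero,
      not_not]
    simp only [Expr.eval, State.setVar_var, if_true, if_neg (show ¬ (10 : ℕ) = 20 by decide), h10']
    omega
  let σ' : SearchState adj n k W := ⟨σ, hb, h14, (searchStart_var (by omega)).trans hs.var_five⟩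
  have hG : (cutState n σ'.1).G = Finset.range (i + 1) := h8
  have hsearch := (implements_searchRel (adj := adj) hF hWk (by
    rw [← hW]; exact Finset.filter_subset _ _)).exists_good (rootedPatterns_copyPatterns hF adj n)
    k le_rfl σ' S (by rw [hG]; exact hS.subset) hS.card_le (by rw [hG]; exact hS.good)
    (by rw [hG]; exact hWgood)
  rw [hG, Finset.card_range] at hsearch
  obtain ⟨c, hc, hQ⟩ := exists_searchIter (Q := fun G => Good adj (copyPatterns F adj n) G ∧
    G ⊆ Finset.range (i + 1) ∧ i + 1 ≤ G.card + k) σ'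
    (hsearch.mono (m' := (k + 1) * (2 * k + 6)) (by nlinarith))
  obtain ⟨t, ht, hdig⟩ := exists_digits (fun x => c (x / (k + 4)) (x % (k + 4)))
    (fun x => hc _ _) ((k + 1) * (2 * k + 6) * (k + 4))
  have hres : searchResult F n k s (tape (k + maxOrder F + 5) t) =
      mask n (searchIter F c σ ((k + 1) * (2 * k + 6))) 8 := by
    rw [searchResult_congr (τ := tape _ t) hs.var_five hdig, searchResult]
    congr 1
    refine (searchIter_congr fun x _ j hj => ?_).1
    rw [searchStart_var (by omega), hs.var_five] at hj
    rw [Nat.mul_comm x, Nat.mul_add_div (by omega), Nat.div_eq_of_lt hj, Nat.mul_add_mod,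
      Nat.mod_eq_of_lt hj, add_zero]
  refine ⟨t, ht, ?_⟩
  rw [hres]
  refine ⟨hQ.1, ?_⟩
  rw [Finset.card_sdiff_of_subset hQ.2.1, Finset.card_range]
  have := hQ.2.2
  omega

end

end RAM

namespace RAM

open SCCDeletion

/-! ### Adding the vertices one by one -/

/-- The round for the vertex in register `10`: from a solution for the preceding vertices in
block `16`, either computes a solution that takes the new vertex into account, or reports in
register `13` that there is none.  The old solution together with the new vertex is put into
block `14`. -/
noncomputable def prefixBody (F : Finset FinDigraph) : LProg := .seqs [
  .loop 20 0 (.store 14 (.var 20) (.add (.ld 16 20) (.eq (.var 20) (.var 10)))),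
  .loop 20 7 (.store 15 (.var 20) (.const 0)),
  .assign 12 (.const 0),
  .loop 11 8 (tapeBody F),
  .ite (.var 12) (.loop 20 0 (.store 16 (.var 20) (.ld 17 20))) (.assign 13 (.const 1))]

theorem prefixBody_wf {F : Finset FinDigraph} : (prefixBody F).WF 10 := by
  have h : ¬ (tapeBody F).WritesVar 11 := fun h => by
    have := tapeBody_writesVar h
    omega
  simp [prefixBody, LProg.seqs, LProg.WF, LProg.WritesVar, tapeBody_wf, h]

theorem prefixBody_writesVar {F : Finset FinDigraph} {y : ℕ} (h : (prefixBody F).WritesVar y) :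
    11 ≤ y := by
  simp only [prefixBody, LProg.seqs, LProg.WritesVar] at h
  by_cases h' : (tapeBody F).WritesVar y
  · have := tapeBody_writesVar h'
    omega
  · simp [h'] at h
    omega

theorem prefixBody_writesArr {F : Finset FinDigraph} {a : ℕ} (h : (prefixBody F).WritesArr a) :
    3 ≤ a := by
  simp only [prefixBody, LProg.seqs, LProg.WritesArr] at h
  by_cases h' : (tapeBody F).WritesArr a
  · have := tapeBody_writesArr h'
    rw [mem_scratchArrs] at this
    omega
  · simp [h'] at h
    omega

section

variable {adj : ℕ → ℕ → Prop} {n k i : ℕ} {s s' : State} {F : Finset FinDigraph}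

/-- Deleting from a solution the vertices outside a prefix leaves a solution for the prefix. -/
theorem IsSolution.inter_range {S : Finset ℕ} (h : IsSolution F adj n k n S) (hi : i ≤ n) :
    IsSolution F adj n k i (S ∩ Finset.range i) where
  subset := Finset.inter_subset_right
  card_le := (Finset.card_le_card Finset.inter_subset_left).trans h.card_le
  good := h.good.mono fun v hv => by
    simp only [Finset.mem_sdiff, Finset.mem_inter, Finset.mem_range] at *
    exact ⟨by omega, fun h => hv.2 ⟨h, hv.1⟩⟩

/-- The invariant of the compression: block `16` holds a solution for the current prefix, or else
register `13` reports that the whole digraph has none. -/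
theorem prefixBody_spec (hF : ∀ H ∈ F, IsRooted H.2) (hs : Params adj n k (maxOrder F) s)
    (hi : i < n) (h10 : s.var 10 = i) (h16 : s.var 13 = 0 → IsSolution F adj n k i (mask n s 16))
    (h13 : s.var 13 ≠ 0 → ¬ ∃ S, IsSolution F adj n k n S)
    (hs' : s' = (prefixBody F).den s) :
    (s'.var 13 = 0 → IsSolution F adj n k (i + 1) (mask n s' 16)) ∧
    (s'.var 13 ≠ 0 → ¬ ∃ S, IsSolution F adj n k n S) := by
  set L := (k + 1) * (2 * k + 6) * (k + 4) with hL
  rw [prefixBody, LProg.den_seqs_cons, LProg.den_seqs_cons, LProg.den_seqs_cons,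
    LProg.den_seqs_cons, LProg.den_seqs_cons, LProg.den_seqs_nil, LProg.den_assign] at hs'
  have h9 := hs.toBase.lt_nine (x := n) (by omega)
  -- the set that is to be improved
  have h14 := mask_fill (n := n) (x := 20) (b := 0) (a := 14)
    (e := .add (.ld 16 20) (.eq (.var 20) (.var 10))) (s := s)
    (by simp [Expr.Avoids, Expr.eq, Expr.not]) hs.var_zero h9.le (by decide)
  set s₁ := (LProg.loop 20 0 (.store 14 (.var 20)
    (.add (.ld 16 20) (.eq (.var 20) (.var 10))))).den s with hs₁
  have hv₁ : ∀ y, y < 20 → s₁.var y = s.var y := fun y hy =>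
    LProg.den_var (by simp [LProg.WritesVar]; omega) s
  have ha₁ : ∀ a, a ≠ 14 → s₁.arr a = s.arr a := fun a ha =>
    LProg.den_arr (by simpa [LProg.WritesArr] using ha) s
  have hp₁ : Params adj n k (maxOrder F) s₁ :=
    hs.congr (fun y hy => hv₁ y (by omega)) fun a ha => ha₁ a (by omega)
  have hmem : ∀ v, v ∈ mask n s₁ 14 ↔ v < n ∧ (v ∈ mask n s 16 ∨ v = i) := by
    intro v
    rw [h14, Finset.mem_filter, Finset.mem_range, mem_mask]
    refine and_congr_right fun hv => ?_
    simp only [Expr.eval, Expr.eq, Expr.not, State.setVar_var, if_true, State.setVar_arr,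
      if_neg (show ¬ (10 : ℕ) = 20 by decide), h10, hv, true_and]
    omega
  -- the empty tape
  have h15 := LProg.den_fill (x := 20) (b := 7) (a := 15) (q := .store 15 (.var 20) (.const 0))
    (s := s₁) (fun _ => 0) hp₁.var_seven (by simp [LProg.WritesVar]) (by simp [LProg.WritesArr])
    fun j hj s'' h1 h2 _ => by
      rw [LProg.den_store_arr]
      · simp only [Expr.eval, h1]
      · have := hp₁.seven_le
        rw [hp₁.var_seven] at this
        simp only [Expr.eval, h1, h2 9 (by decide) (by simp [LProg.WritesVar])]
        omega
  set s₂ := (LProg.loop 20 7 (.store 15 (.var 20) (.const 0))).den s₁ with hs₂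
  have hv₂ : ∀ y, y < 20 → s₂.var y = s.var y := fun y hy => by
    rw [hs₂, LProg.den_var (by simp [LProg.WritesVar]; omega), hv₁ y hy]
  have ha₂ : ∀ a, a ≠ 15 → s₂.arr a = s₁.arr a := fun a ha =>
    LProg.den_arr (by simpa [LProg.WritesArr] using ha) s₁
  simp only [Expr.eval] at hs'
  set s₃ := s₂.setVar 12 0 with hs₃
  have hv₃ : ∀ y, y < 12 ∨ y = 13 → s₃.var y = s.var y := fun y hy => by
    rw [hs₃, State.setVar_var, if_neg (by omega), hv₂ y (by omega)]
  have hp₃ : Params adj n k (maxOrder F) s₃ := hs.congr (fun y hy => hv₃ y (by omega))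
    fun a ha => by rw [hs₃, State.setVar_arr, ha₂ a (by omega), ha₁ a (by omega)]
  have h12 : s₃.var 12 = 0 := by simp [hs₃]
  have h15' : ∀ x < L, s₃.arr 15 x = 0 := fun x hx => by
    rw [hs₃, State.setVar_arr, h15]
    exact if_pos hx
  obtain ⟨hfound, hnot⟩ := tapes_spec hF hp₃ hi ((hv₃ 10 (by omega)).trans h10) h12 h15' rfl
  set s₄ := (LProg.loop 11 8 (tapeBody F)).den s₃ with hs₄
  have hv₄ : ∀ y, y < 11 ∨ y = 13 → s₄.var y = s.var y := fun y hy => by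
    rw [hs₄, LProg.den_var, hv₃ y (by omega)]
    rintro (h | h)
    · omega
    · have := tapeBody_writesVar h
      omega
  have ha₄ : s₄.arr 16 = s.arr 16 := by
    rw [hs₄, LProg.den_arr, hs₃, State.setVar_arr, ha₂ 16 (by omega), ha₁ 16 (by omega)]
    intro h
    have := tapeBody_writesArr h
    rw [mem_scratchArrs] at this
    omega
  rw [LProg.den_ite] at hs'
  by_cases hf : s₄.var 12 = 0
  · rw [if_neg (show ¬ (Expr.var 12).eval s₄ ≠ 0 from not_not.2 hf), LProg.den_assign] at hs'
    simp only [Expr.eval] at hs'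
    rw [hs']
    simp only [State.setVar_var, if_true]
    refine ⟨fun h => by omega, fun _ ⟨S, hS⟩ => ?_⟩
    have h0 : s.var 13 = 0 := by
      by_contra h
      exact h13 h ⟨S, hS⟩
    have hsol := h16 h0
    have hcard : (mask n s₁ 14).card ≤ k + 1 := by
      have : mask n s₁ 14 ⊆ insert i (mask n s 16) := fun v hv => by
        have := ((hmem v).1 hv).2
        rw [Finset.mem_insert]
        tauto
      exact (Finset.card_le_card this).trans ((Finset.card_insert_le _ _).trans
        (by have := hsol.card_le; omega))
    have hgood : Good adj (copyPatterns F adj n) (Finset.range (i + 1) \ mask n s₁ 14) := by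
      refine hsol.good.mono fun v hv => ?_
      rw [Finset.mem_sdiff, hmem, Finset.mem_range] at hv
      rw [Finset.mem_sdiff, Finset.mem_range]
      have : v < n := by omega
      have h' : ¬ (v ∈ mask n s 16 ∨ v = i) := fun h => hv.2 ⟨this, h⟩
      rw [not_or] at h'
      exact ⟨by omega, h'.1⟩
    have hmask : mask n s₃ 14 = mask n s₁ 14 := mask_congr fun v _ => by
      rw [hs₃, State.setVar_arr, ha₂ 14 (by omega)]
    obtain ⟨t, ht, hok⟩ := exists_tape hF hp₃ hi ((hv₃ 10 (by omega)).trans h10) hmask hcard hgood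
      (hS.inter_range (i := i + 1) hi)
    exact hnot hf t ht hok
  · rw [if_pos (show (Expr.var 12).eval s₄ ≠ 0 from hf)] at hs'
    have h16' := mask_fill (n := n) (x := 20) (b := 0) (a := 16) (e := .ld 17 20) (s := s₄)
      (by simp [Expr.Avoids]) (by rw [hv₄ 0 (by omega), hs.var_zero])
      (by rw [hv₄ 9 (by omega)]; exact h9.le) (by decide)
    rw [← hs'] at h16'
    have h13' : s'.var 13 = s.var 13 := by
      rw [hs', LProg.den_var (by simp [LProg.WritesVar]), hv₄ 13 (by omega)]
    rw [h13']
    refine ⟨fun _ => ?_, h13⟩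
    have : mask n s' 16 = mask n s₄ 17 := by
      rw [h16']
      ext v
      rw [mem_mask, Finset.mem_filter, Finset.mem_range]
      simp [Expr.eval]
    rw [this]
    exact hfound hf

/-- After the last round, register `13` tells whether there is a solution. -/
theorem prefixLoop_spec (hF : ∀ H ∈ F, IsRooted H.2) (hs : Params adj n k (maxOrder F) s)
    (h13 : s.var 13 = 0) (h16 : s.arr 16 = fun _ => 0) :
    ((LProg.loop 10 0 (prefixBody F)).den s).var 13 = 0 ↔ ∃ S, IsSolution F adj n k n S := by
  have := LProg.den_loop (x := 10) (b := 0) (p := prefixBody F) (s := s) (m := n)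
    (fun i s' => (s'.var 13 = 0 → IsSolution F adj n k i (mask n s' 16)) ∧
      (s'.var 13 ≠ 0 → ¬ ∃ S, IsSolution F adj n k n S)) hs.var_zero
    (fun h => by have := prefixBody_writesVar h; omega) ⟨fun _ => ?_, fun h => ?_⟩ ?_
  · constructor
    · exact fun h => ⟨_, this.1 h⟩
    · intro h
      by_contra h'
      exact this.2 h' h
  · have hempty : mask n (s.setVar 10 0) 16 = ∅ := by simp [mask, h16]
    rw [hempty]
    refine ⟨by simp, by simp, ?_⟩
    rw [Finset.range_zero, Finset.empty_sdiff]
    refine (good_iff_roots_eq_empty (rootedPatterns_copyPatterns hF adj n) ∅).2 ?_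
    exact Finset.eq_empty_of_forall_notMem fun b hb => by simpa using (mem_roots.1 hb).1
  · exact absurd (by simpa using h13) h
  · intro i hi s' hx hFr ⟨h1, h2⟩
    have hp : Params adj n k (maxOrder F) s' := hs.congr
      (fun y hy => hFr.var y (by omega) fun h => by have := prefixBody_writesVar h; omega)
      fun a ha => hFr.arr a fun h => by have := prefixBody_writesArr h; omega
    have hm : mask n (((prefixBody F).den s').setVar 10 (i + 1)) 16 =
      mask n ((prefixBody F).den s') 16 := rfl
    rw [hm]
    simp only [State.setVar_var, if_neg (show ¬ (13 : ℕ) = 10 by decide)]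
    exact prefixBody_spec hF hp hi hx h1 h2 rfl

end

end RAM

namespace RAM

open SCCDeletion

/-! ### Preparing the parameters -/

theorem LProg.WF.lt_of_isBound {θ b : ℕ} {p : LProg} (h : p.WF θ) (hb : p.IsBound b) : b < θ := by
  induction p with
  | skip => exact hb.elim
  | assign x e => exact hb.elim
  | store a i e => exact hb.elim
  | seq p q ihp ihq =>
    rcases hb with hb | hb
    · exact ihp h.1 hb
    · exact ihq h.2 hb
  | ite e p q ihp ihq =>
    rcases hb with hb | hb
    · exact ihp h.1 hb
    · exact ihq h.2 hb
  | loop x c p ih =>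
    rcases hb with rfl | hb
    · exact h.2.1
    · exact ih h.2.2.2 hb

/-- The form of `LProg.WF.exec` used for the short programs that compute the parameters. -/
theorem LProg.WF.exec_le {θ m : ℕ} {p : LProg} (h : p.WF θ) (hm : 1 ≤ m) (s : State)
    (hs : ∀ b, p.IsBound b → s.var b ≤ m) :
    ∃ t ≤ p.size * m ^ p.depth, Exec p.compile s (p.den s) t := by
  obtain ⟨t, ht, hex⟩ := h.exec s (β := s.var) fun _ _ => le_rfl
  exact ⟨t, ht.trans (LProg.timeBound_le hm hs), hex⟩

/-- Adds to register `y` the product of the registers `b` and `z`. -/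
def addMul (y b z : ℕ) : LProg := .loop 20 b (.assign y (.add (.var y) (.var z)))

theorem addMul_writesVar {x y b z : ℕ} : (addMul y b z).WritesVar x ↔ x = 20 ∨ x = y := Iff.rfl

theorem addMul_writesArr {a y b z : ℕ} : ¬ (addMul y b z).WritesArr a := id

theorem addMul_spec {y b z : ℕ} {s : State} (hy : y ≠ 20) (hz : z ≠ 20) (hzy : z ≠ y) :
    ((addMul y b z).den s).var y = s.var y + s.var b * s.var z := by
  refine LProg.den_loop (fun i s' => s'.var y = s.var y + i * s.var z) rfl ?_ (by simp [hy]) ?_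
  · exact fun h => hy h.symm
  · intro i _ s' _ hF hP
    rw [LProg.den_assign]
    simp only [Expr.eval, State.setVar_var, if_true, if_neg hy, hP]
    rw [hF.var z hz (by simpa [LProg.WritesVar] using hzy), Nat.succ_mul, add_assoc]

/-- Computes the registers `2` to `5`, and `2 * k + 6` in register `23`. -/
def setupLinear (h : ℕ) : LProg := .seqs [
  .assign 2 (.add (.add (.var 0) (.var 0)) (.const 1)),
  .assign 3 (.add (.var 1) (.const 1)),
  .assign 4 (.add (.var 1) (.const (h + 5))),
  .assign 5 (.add (.var 1) (.const 4)),
  .assign 23 (.add (.add (.var 1) (.var 1)) (.const 6))]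

/-- Computes the number of tapes in register `8`. -/
def setupPower : LProg := .seq (.assign 8 (.const 1))
  (.loop 21 7 (.seqs [.assign 22 (.const 0), addMul 22 4 8, .assign 8 (.var 22)]))

/-- Writes the multiples of register `b` to block `a`. -/
def setupRows (a b : ℕ) : LProg := .seq (.assign 22 (.const 0))
  (.loop 20 b (.seq (.store a (.var 20) (.var 22)) (.assign 22 (.add (.var 22) (.var b)))))

theorem setupPower_spec {s : State} : (setupPower.den s).var 8 = s.var 4 ^ s.var 7 := by
  set p : LProg := .seqs [.assign 22 (.const 0), addMul 22 4 8, .assign 8 (.var 22)] with hp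
  have hpv : ∀ y, p.WritesVar y → y = 8 ∨ y = 20 ∨ y = 22 := by
    simp [hp, LProg.seqs, LProg.WritesVar, addMul_writesVar]
    tauto
  rw [setupPower, LProg.den_seq, LProg.den_assign]
  refine LProg.den_loop (fun i s' => s'.var 8 = s.var 4 ^ i) (by simp) ?_ (by simp [Expr.eval]) ?_
  · intro h
    have := hpv _ h
    omega
  · intro i _ s' _ hF hP
    have h4 : s'.var 4 = s.var 4 := by
      rw [hF.var 4 (by decide) (fun h => by have := hpv _ h; omega)]
      simp
    rw [LProg.den_seqs_cons, LProg.den_seqs_cons, LProg.den_seqs_cons, LProg.den_seqs_nil,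
      LProg.den_assign (x := 8), LProg.den_assign (x := 22)]
    simp only [Expr.eval]
    rw [addMul_spec (by decide) (by decide) (by decide)]
    simp [hP, h4, pow_succ']

theorem setupRows_spec {s : State} {a b m : ℕ} (hb : b < 10) (hm : s.var b = m)
    (h9 : m ≤ s.var 9) : ∀ i < m, ((setupRows a b).den s).arr a i = i * m := by
  set p : LProg := .seq (.store a (.var 20) (.var 22)) (.assign 22 (.add (.var 22) (.var b)))
    with hp
  have hpv : ∀ y, p.WritesVar y → y = 22 := by simp [hp, LProg.WritesVar]
  rw [setupRows, LProg.den_seq, LProg.den_assign]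
  refine (LProg.den_loop (p := p) (fun i s' => s'.var 22 = i * m ∧ ∀ j < i, s'.arr a j = j * m)
    ?_ ?_ ⟨by simp [Expr.eval], by simp⟩ ?_).2
  · rw [State.setVar_var, if_neg (by omega), hm]
  · intro h
    have := hpv _ h
    omega
  · intro i hi s' hx hF ⟨h1, h2⟩
    have hv : ∀ y, y < 10 → s'.var y = s.var y := fun y hy => by
      rw [hF.var y (by omega) (fun h => by have := hpv _ h; omega), State.setVar_var,
        if_neg (by omega)]
    rw [hp, LProg.den_seq, LProg.den_assign, LProg.den_store (by
      simp only [Expr.eval, hx, hv 9 (by omega)]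
      omega)]
    simp only [Expr.eval, State.setVar_var, State.setArr_var, State.setVar_arr, State.setArr_arr,
      if_true, if_neg (show ¬ (22 : ℕ) = 20 by decide), h1, hx, hv b hb, hm, true_and]
    refine ⟨by rw [Nat.succ_mul], fun j hj => ?_⟩
    split_ifs with h
    · rw [h]
    · exact h2 j (by omega)

/-- Computes the registers `2` to `9` and the blocks `1` and `2`. -/
def setup (h : ℕ) : Prog := .seq (setupLinear h).compile (.seq (LProg.compile (addMul 6 3 23))
  (.seq (LProg.compile (addMul 7 5 6)) (.seq setupPower.compile
  (.seq (LProg.compile (.seq (.assign 9 (.var 7)) (addMul 9 2 2)))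
  (LProg.compile (.seq (setupRows 1 0) (setupRows 2 2)))))))

/-- The number of steps is bounded by a multiple of `m ^ 2`. The number of tapes, which may be
huge, is obtained by repeated multiplication with the base `k + h + 5`, each time by a loop of
`k + h + 5` additions. -/
theorem setup_exec {adj : ℕ → ℕ → Prop} {n k h : ℕ} {s : State} (h0 : s.var 0 = n)
    (h1 : s.var 1 = k) (h6 : s.var 6 = 0) (h7 : s.var 7 = 0)
    (hadj : ∀ u < n, ∀ v < n, s.arr 0 (u * n + v) ≠ 0 ↔ adj u v) {m : ℕ}
    (hm : (2 * n + 1) * (2 * n + 1) + (k + 1) * (2 * k + 6) * (k + 4) + h ≤ m) :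
    ∃ s' : State, ∃ t ≤ ((setupLinear h).size + 1000) * m ^ 2, Exec (setup h) s s' t ∧
      Params adj n k h s' ∧
      s'.var 9 = (2 * n + 1) * (2 * n + 1) + (k + 1) * (2 * k + 6) * (k + 4) ∧
      s'.var 13 = s.var 13 ∧ s'.arr 16 = s.arr 16 := by
  set M := (k + 1) * (2 * k + 6) with hM
  set L := M * (k + 4) with hL
  have hM6 : 6 * (k + 1) ≤ M := by
    rw [hM, Nat.mul_comm]
    exact Nat.mul_le_mul_left _ (by omega)
  have hLM : 4 * M ≤ L := by
    rw [hL, Nat.mul_comm]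
    exact Nat.mul_le_mul_left _ (by omega)
  have hm1 : 1 ≤ m := by omega
  have hnm : 2 * n + 1 ≤ (2 * n + 1) * (2 * n + 1) := Nat.le_mul_of_pos_left _ (by omega)
  -- registers 2 to 5
  have wf₁ : (setupLinear h).WF 2 := by simp [setupLinear, LProg.seqs, LProg.WF]
  obtain ⟨t₁, ht₁, ex₁⟩ := wf₁.exec_le hm1 s
    (by simp [setupLinear, LProg.seqs, LProg.IsBound])
  set s₁ := (setupLinear h).den s with hs₁
  have v₁ : s₁.var 0 = n ∧ s₁.var 1 = k ∧ s₁.var 2 = 2 * n + 1 ∧ s₁.var 3 = k + 1 ∧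
      s₁.var 4 = k + h + 5 ∧ s₁.var 5 = k + 4 ∧ s₁.var 23 = 2 * k + 6 ∧ s₁.var 6 = 0 ∧
      s₁.var 7 = 0 ∧ s₁.var 13 = s.var 13 := by
    rw [hs₁, setupLinear, LProg.den_seqs_cons, LProg.den_seqs_cons, LProg.den_seqs_cons,
      LProg.den_seqs_cons, LProg.den_seqs_cons, LProg.den_seqs_nil, LProg.den_assign (x := 23),
      LProg.den_assign (x := 5), LProg.den_assign (x := 4), LProg.den_assign (x := 3),
      LProg.den_assign (x := 2)]
    simp [Expr.eval, h0, h1, h6, h7]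
    omega
  have a₁ : s₁.arr = s.arr := funext fun a =>
    LProg.den_arr (by simp [setupLinear, LProg.seqs, LProg.WritesArr]) s
  clear_value s₁
  obtain ⟨w0, w1, w2, w3, w4, w5, w23, w6, w7, w13⟩ := v₁
  -- register 6
  have wf₂ : (addMul 6 3 23).WF 6 := by simp [addMul, LProg.WF, LProg.WritesVar]
  obtain ⟨t₂, ht₂, ex₂⟩ := wf₂.exec_le hm1 s₁ (by
    intro b hb
    rw [show b = 3 by simpa [addMul, LProg.IsBound] using hb, w3]
    omega)
  have v₂ : ∀ y, y ≠ 20 → y ≠ 6 → ((addMul 6 3 23).den s₁).var y = s₁.var y := fun y hy hy' =>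
    LProg.den_var (by rw [addMul_writesVar]; omega) s₁
  have v₂' : ((addMul 6 3 23).den s₁).var 6 = M := by
    rw [addMul_spec (by decide) (by decide) (by decide), w6, w3, w23, zero_add]
  have a₂ : ((addMul 6 3 23).den s₁).arr = s.arr := (funext fun a =>
    LProg.den_arr addMul_writesArr s₁).trans a₁
  set s₂ := (addMul 6 3 23).den s₁
  clear_value s₂
  -- register 7
  have wf₃ : (addMul 7 5 6).WF 7 := by simp [addMul, LProg.WF, LProg.WritesVar]
  obtain ⟨t₃, ht₃, ex₃⟩ := wf₃.exec_le hm1 s₂ (by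
    intro b hb
    rw [show b = 5 by simpa [addMul, LProg.IsBound] using hb, v₂ 5 (by decide) (by decide), w5]
    omega)
  have v₃ : ∀ y, y ≠ 20 → y ≠ 6 → y ≠ 7 → ((addMul 7 5 6).den s₂).var y = s₁.var y :=
    fun y hy hy' hy'' => by
      rw [LProg.den_var (by rw [addMul_writesVar]; omega), v₂ y hy hy']
  have v₃' : ((addMul 7 5 6).den s₂).var 6 = M := by
    rw [LProg.den_var (by rw [addMul_writesVar]; omega), v₂']
  have v₃'' : ((addMul 7 5 6).den s₂).var 7 = L := by
    rw [addMul_spec (by decide) (by decide) (by decide), v₂', v₂ 7 (by decide) (by decide),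
      v₂ 5 (by decide) (by decide), w7, w5, zero_add, Nat.mul_comm]
  have a₃ : ((addMul 7 5 6).den s₂).arr = s.arr := (funext fun a =>
    LProg.den_arr addMul_writesArr s₂).trans a₂
  set s₃ := (addMul 7 5 6).den s₂
  clear_value s₃
  -- register 8
  have wf₄ : setupPower.WF 8 := by
    simp [setupPower, addMul, LProg.seqs, LProg.WF, LProg.WritesVar]
  obtain ⟨t₄, ht₄, ex₄⟩ := wf₄.exec_le hm1 s₃ (by
    intro b hb
    have : b = 7 ∨ b = 4 := by
      simpa [setupPower, addMul, LProg.seqs, LProg.IsBound] using hb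
    rcases this with rfl | rfl
    · rw [v₃'']
      omega
    · rw [v₃ 4 (by decide) (by decide) (by decide), w4]
      omega)
  have hw₄ : ∀ y, setupPower.WritesVar y → y = 8 ∨ y = 20 ∨ y = 21 ∨ y = 22 := by
    simp [setupPower, addMul, LProg.seqs, LProg.WritesVar]
    tauto
  have v₄ : ∀ y, y < 8 ∨ y = 13 → (setupPower.den s₃).var y = s₃.var y := fun y hy =>
    LProg.den_var (fun h => by have := hw₄ y h; omega) s₃
  have v₄' : (setupPower.den s₃).var 8 = (k + h + 5) ^ L := by
    rw [setupPower_spec, v₃'', v₃ 4 (by decide) (by decide) (by decide), w4]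
  have a₄ : (setupPower.den s₃).arr = s.arr := (funext fun a => LProg.den_arr (by
    simp [setupPower, addMul, LProg.seqs, LProg.WritesArr]) s₃).trans a₃
  set s₄ := setupPower.den s₃
  clear_value s₄
  -- register 9
  set p₅ : LProg := .seq (.assign 9 (.var 7)) (addMul 9 2 2) with hp₅
  have wf₅ : p₅.WF 9 := by simp [hp₅, addMul, LProg.WF, LProg.WritesVar]
  obtain ⟨t₅, ht₅, ex₅⟩ := wf₅.exec_le hm1 s₄ (by
    intro b hb
    rw [show b = 2 by simpa [hp₅, addMul, LProg.IsBound] using hb, v₄ 2 (by omega),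
      v₃ 2 (by decide) (by decide) (by decide), w2]
    omega)
  have v₅ : ∀ y, y < 9 ∨ y = 13 → (p₅.den s₄).var y = s₄.var y := fun y hy => LProg.den_var (by
    simp [hp₅, addMul, LProg.WritesVar]
    omega) s₄
  have v₅' : (p₅.den s₄).var 9 = (2 * n + 1) * (2 * n + 1) + L := by
    rw [hp₅, LProg.den_seq, LProg.den_assign, addMul_spec (by decide) (by decide) (by decide)]
    simp only [Expr.eval, State.setVar_var, if_true, if_neg (show ¬ (2 : ℕ) = 9 by decide)]
    rw [v₄ 2 (by omega), v₃ 2 (by decide) (by decide) (by decide), w2, v₄ 7 (by omega), v₃'',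
      add_comm]
  have a₅ : (p₅.den s₄).arr = s.arr := (funext fun a => LProg.den_arr (by
    simp [hp₅, addMul, LProg.WritesArr]) s₄).trans a₄
  set s₅ := p₅.den s₄
  clear_value s₅
  -- blocks 1 and 2
  have wf₆ : (LProg.seq (setupRows 1 0) (setupRows 2 2)).WF 10 := by
    simp [setupRows, LProg.WF, LProg.WritesVar]
  have x0 : s₅.var 0 = n := by
    rw [v₅ 0 (by omega), v₄ 0 (by omega), v₃ 0 (by decide) (by decide) (by decide), w0]
  have x2 : s₅.var 2 = 2 * n + 1 := by
    rw [v₅ 2 (by omega), v₄ 2 (by omega), v₃ 2 (by decide) (by decide) (by decide), w2]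
  obtain ⟨t₆, ht₆, ex₆⟩ := wf₆.exec_le hm1 s₅ (by
    intro b hb
    have : b = 0 ∨ b = 2 := by
      simpa [setupRows, LProg.IsBound] using hb
    rcases this with rfl | rfl
    · omega
    · omega)
  have r1 : ∀ i < n, ((setupRows 1 0).den s₅).arr 1 i = i * n :=
    setupRows_spec (by decide) x0 (by rw [v₅']; omega)
  have hrv : ∀ a b y, y < 20 → ¬ (setupRows a b).WritesVar y := fun a b y hy => by
    simp [setupRows, LProg.WritesVar]
    omega
  have hra : ∀ a b c, c ≠ a → ¬ (setupRows a b).WritesArr c := fun a b c hc => by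
    simpa [setupRows, LProg.WritesArr] using hc
  have r2 : ∀ i < 2 * n + 1, ((setupRows 2 2).den ((setupRows 1 0).den s₅)).arr 2 i =
      i * (2 * n + 1) := by
    refine setupRows_spec (by decide) ?_ ?_
    · rw [LProg.den_var (hrv _ _ _ (by omega)), x2]
    · rw [LProg.den_var (hrv _ _ _ (by omega)), v₅']
      omega
  rw [LProg.den_seq] at ex₆
  have v₆ : ∀ y, y < 20 → ((setupRows 2 2).den ((setupRows 1 0).den s₅)).var y = s₅.var y :=
    fun y hy => by rw [LProg.den_var (hrv _ _ _ hy), LProg.den_var (hrv _ _ _ hy)]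
  have a₆ : ∀ a, a ≠ 1 → a ≠ 2 → ((setupRows 2 2).den ((setupRows 1 0).den s₅)).arr a =
      s.arr a := fun a ha ha' => by
    rw [LProg.den_arr (hra _ _ _ ha'), LProg.den_arr (hra _ _ _ ha), a₅]
  have r1' : ∀ i < n, ((setupRows 2 2).den ((setupRows 1 0).den s₅)).arr 1 i = i * n :=
    fun i hi => by rw [LProg.den_arr (hra _ _ _ (by decide)), r1 i hi]
  refine ⟨_, _, ?_, .seq ex₁ (.seq ex₂ (.seq ex₃ (.seq ex₄ (.seq ex₅ ex₆)))), ?_⟩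
  · have hd₁ : (setupLinear h).depth = 0 := by simp [setupLinear, LProg.seqs, LProg.depth]
    have hmm : m ≤ m ^ 2 := Nat.le_self_pow (by decide) m
    rw [hd₁, pow_zero] at ht₁
    simp only [addMul, setupPower, setupRows, hp₅, LProg.seqs, LProg.size, LProg.depth,
      Expr.cost] at ht₂ ht₃ ht₄ ht₅ ht₆
    norm_num at ht₂ ht₃ ht₄ ht₅ ht₆
    rw [Nat.add_mul]
    have := Nat.le_mul_of_pos_right (setupLinear h).size (show 0 < m ^ 2 by positivity)
    omega
  · set s₆ := (setupRows 2 2).den ((setupRows 1 0).den s₅)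
    refine ⟨?_, ?_, ?_, a₆ 16 (by decide) (by decide)⟩
    · constructor
      · constructor
        · rw [v₆ 0 (by omega), x0]
        · rw [v₆ 1 (by omega), v₅ 1 (by omega), v₄ 1 (by omega),
            v₃ 1 (by decide) (by decide) (by decide), w1]
        · rw [v₆ 2 (by omega), x2]
        · rw [v₆ 3 (by omega), v₅ 3 (by omega), v₄ 3 (by omega),
            v₃ 3 (by decide) (by decide) (by decide), w3]
        · rw [v₆ 9 (by omega), v₅']
          omega
        · rw [a₆ 0 (by decide) (by decide)]
          exact hadj
        · exact r1'
        · exact r2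
      · rw [v₆ 4 (by omega), v₅ 4 (by omega), v₄ 4 (by omega),
          v₃ 4 (by decide) (by decide) (by decide), w4]
      · rw [v₆ 5 (by omega), v₅ 5 (by omega), v₄ 5 (by omega),
          v₃ 5 (by decide) (by decide) (by decide), w5]
      · rw [v₆ 6 (by omega), v₅ 6 (by omega), v₄ 6 (by omega), v₃']
      · rw [v₆ 7 (by omega), v₅ 7 (by omega), v₄ 7 (by omega), v₃'']
      · rw [v₆ 8 (by omega), v₅ 8 (by omega), v₄']
      · rw [v₆ 7 (by omega), v₅ 7 (by omega), v₄ 7 (by omega), v₃'', v₆ 9 (by omega), v₅']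
        omega
    · rw [v₆ 9 (by omega), v₅']
    · rw [v₆ 13 (by omega), v₅ 13 (by omega), v₄ 13 (by omega),
        v₃ 13 (by decide) (by decide) (by decide), w13]

end RAM

namespace RAM

open SCCDeletion Relation

/-! ### Digraphs on the first natural numbers -/

/-- The digraph `D`, as a relation on the natural numbers. -/
def natAdj {n : ℕ} (D : Digraph (Fin n)) (u v : ℕ) : Prop :=
  ∃ (hu : u < n) (hv : v < n), D.Adj ⟨u, hu⟩ ⟨v, hv⟩

/-- The vertices of a digraph on `Fin n` that are not in `S`, as natural numbers. -/
def remaining {n : ℕ} (S : Finset (Fin n)) : Finset ℕ := Finset.range n \ S.map Fin.valEmbedding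

section

variable {n k : ℕ} {D : Digraph (Fin n)} {S : Finset (Fin n)} {F : Finset FinDigraph}

theorem mem_remaining {v : ℕ} : v ∈ remaining S ↔ ∃ h : v < n, (⟨v, h⟩ : Fin n) ∉ S := by
  simp only [remaining, Finset.mem_sdiff, Finset.mem_range, Finset.mem_map, Fin.valEmbedding_apply,
    not_exists, not_and]
  constructor
  · exact fun h => ⟨h.1, fun h' => h.2 _ h' rfl⟩
  · rintro ⟨h, h'⟩
    exact ⟨h, fun x hx hxv => h' (by subst hxv; exact hx)⟩

theorem val_mem_remaining (x : ((S : Set (Fin n))ᶜ : Set (Fin n))) : (x.1 : ℕ) ∈ remaining S :=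
  mem_remaining.2 ⟨x.1.2, x.2⟩

theorem conn_of_reach {x y : ((S : Set (Fin n))ᶜ : Set (Fin n))}
    (h : Reach (induced D (S : Set (Fin n))ᶜ) x y) :
    Conn (natAdj D) (remaining S) x.1 y.1 :=
  ReflTransGen.lift (fun x : ((S : Set (Fin n))ᶜ : Set (Fin n)) => (x.1 : ℕ))
    (fun x y hxy => ⟨⟨x.1.2, y.1.2, hxy⟩, val_mem_remaining x, val_mem_remaining y⟩) _ _ h

theorem reach_of_conn {x y : ((S : Set (Fin n))ᶜ : Set (Fin n))}
    (h : Conn (natAdj D) (remaining S) x.1 y.1) :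
    Reach (induced D (S : Set (Fin n))ᶜ) x y := by
  have key : ∀ v, Conn (natAdj D) (remaining S) x.1 v →
      ∀ y : ((S : Set (Fin n))ᶜ : Set (Fin n)), (y.1 : ℕ) = v →
        Reach (induced D (S : Set (Fin n))ᶜ) x y := by
    intro v hv
    induction hv with
    | refl =>
      intro y hy
      rw [show y = x from Subtype.ext (Fin.ext hy)]
      exact .refl
    | @tail u v _ huv ih =>
      intro y hy
      obtain ⟨hu, hu'⟩ := mem_remaining.1 huv.2.1
      obtain ⟨_, _, hadj⟩ := huv.1
      refine .tail (ih ⟨⟨u, hu⟩, hu'⟩ rfl) ?_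
      have : y.1 = ⟨v, hy ▸ y.1.2⟩ := Fin.ext hy
      change D.Adj ⟨u, hu⟩ y.1
      rw [this]
      exact hadj
  exact key _ h y rfl

/-- Deletion sets in the sense of strong components and copies correspond to vertex sets that leave
no bad pattern. -/
theorem isDeletionSet_iff (hF : ∀ H ∈ F, IsRooted H.2) :
    IsDeletionSet F D S ↔ Good (natAdj D) (copyPatterns F (natAdj D) n) (remaining S) := by
  constructor
  · rintro h p ⟨H, hH, f, hf, rfl⟩ hbad
    have hpat : (f (rootOf H), (Finset.range H.1).image f) ∈ copyPatterns F (natAdj D) n :=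
      ⟨H, hH, f, hf, rfl⟩
    have hroot := rootedPatterns_copyPatterns hF (natAdj D) n
    have hmem : ∀ j : Fin H.1, f j ∈ (Finset.range H.1).image f := fun j =>
      Finset.mem_image_of_mem f (Finset.mem_range.2 j.2)
    obtain ⟨hr, hr'⟩ := mem_remaining.1 (hbad.1 (hroot _ hpat).1)
    let r : ((S : Set (Fin n))ᶜ : Set (Fin n)) := ⟨⟨f (rootOf H), hr⟩, hr'⟩
    let g : Fin H.1 → ((S : Set (Fin n))ᶜ : Set (Fin n)) := fun j =>
      ⟨⟨f j, hf.lt j j.2⟩, (mem_remaining.1 (hbad.1 (hmem j))).2⟩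
    -- the strong component of the root
    let C : Set ((S : Set (Fin n))ᶜ : Set (Fin n)) :=
      {x | Reach (induced D (S : Set (Fin n))ᶜ) x r ∧ Reach (induced D (S : Set (Fin n))ᶜ) r x}
    have hg : ∀ j, g j ∈ C := fun j =>
      ⟨reach_of_conn (hbad.2 _ (hmem j)), reach_of_conn (hbad.conn_root hroot hpat (hmem j))⟩
    refine h C ⟨fun u hu v hv => ⟨hu.1.trans hv.2, hv.1.trans hu.2⟩, fun C' hC' hCC' x hx => ?_⟩
      H hH ⟨fun j => ⟨g j, hg j⟩, fun i j hij => ?_, fun i j hij => ?_⟩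
    · have := hC' x hx r (hCC' (show r ∈ C from ⟨.refl, .refl⟩))
      exact this
    · by_contra hne
      refine hf.inj i i.2 j j.2 (fun h => hne (Fin.ext h)) ?_
      exact congrArg (fun x => (x.1.1 : ℕ)) hij
    · exact (hf.arc i j hij).choose_spec.choose_spec
  · rintro h C hC H hH ⟨g, hg, hgarc⟩
    let f : ℕ → ℕ := fun i => if hi : i < H.1 then ((g ⟨i, hi⟩).1.1 : ℕ) else 0
    have hfg : ∀ j : Fin H.1, f j = ((g j).1.1 : ℕ) := fun j => dif_pos j.2
    have hf : IsCopy (natAdj D) n H f := by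
      refine ⟨fun i hi => ?_, fun i hi j hj hij h => ?_, fun i j hij => ?_⟩
      · rw [hfg ⟨i, hi⟩]
        exact (g ⟨i, hi⟩).1.1.2
      · rw [hfg ⟨i, hi⟩, hfg ⟨j, hj⟩] at h
        exact hij (congrArg Fin.val (hg (Subtype.ext (Subtype.ext (Fin.ext h)))))
      · rw [hfg, hfg]
        exact ⟨(g i).1.1.2, (g j).1.1.2, hgarc i j hij⟩
    obtain ⟨r, hr, -⟩ := rootOf_spec (hF H hH)
    refine h _ ⟨H, hH, f, hf, rfl⟩ ⟨fun u hu => ?_, fun u hu => ?_⟩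
    · obtain ⟨i, hi, rfl⟩ := Finset.mem_image.1 hu
      rw [hfg ⟨i, Finset.mem_range.1 hi⟩]
      exact val_mem_remaining _
    · obtain ⟨i, hi, rfl⟩ := Finset.mem_image.1 hu
      rw [hfg ⟨i, Finset.mem_range.1 hi⟩, hr]
      rw [hfg r]
      exact conn_of_reach (hC.1 _ (g ⟨i, _⟩).2 _ (g r).2).1

theorem isYes_iff (hF : ∀ H ∈ F, IsRooted H.2) :
    IsYes F D k ↔ ∃ S, IsSolution F (natAdj D) n k n S := by
  constructor
  · rintro ⟨S, hS, h⟩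
    refine ⟨S.map Fin.valEmbedding, fun v hv => ?_, by rwa [Finset.card_map],
      (isDeletionSet_iff hF).1 h⟩
    obtain ⟨x, -, rfl⟩ := Finset.mem_map.1 hv
    exact Finset.mem_range.2 x.2
  · rintro ⟨T, hT⟩
    have hTS : (Finset.univ.filter fun v : Fin n => (v : ℕ) ∈ T).map Fin.valEmbedding = T := by
      ext v
      simp only [Finset.mem_map, Finset.mem_filter, Finset.mem_univ, true_and,
        Fin.valEmbedding_apply]
      constructor
      · rintro ⟨x, hx, rfl⟩
        exact hx
      · exact fun hv => ⟨⟨v, Finset.mem_range.1 (hT.subset hv)⟩, hv, rfl⟩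
    refine ⟨Finset.univ.filter fun v : Fin n => (v : ℕ) ∈ T, ?_, (isDeletionSet_iff hF).2 ?_⟩
    · rw [← Finset.card_map Fin.valEmbedding, hTS]
      exact hT.card_le
    · rw [remaining, hTS]
      exact hT.good

/-- With at least `n` deletions, or for the empty family, every instance is a yes-instance. -/
theorem isYes_of_le (hF : ∀ H ∈ F, IsRooted H.2) (h : n ≤ k ∨ F = ∅) : IsYes F D k := by
  rcases h with h | rfl
  · refine (isYes_iff hF).2 ⟨Finset.range n, le_rfl, by simpa using h, ?_⟩
    rw [sdiff_self, Finset.bot_eq_empty]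
    refine (good_iff_roots_eq_empty (rootedPatterns_copyPatterns hF _ n) ∅).2 ?_
    exact Finset.eq_empty_of_forall_notMem fun b hb => by simpa using (mem_roots.1 hb).1
  · exact ⟨∅, by simp, fun _ _ H hH => by simp at hH⟩

theorem input_adj {u v : ℕ} (hu : u < n) (hv : v < n) :
    (input D k).arr 0 (u * n + v) ≠ 0 ↔ natAdj D u v := by
  have : (input D k).arr 0 (u * n + v) ≠ 0 ↔
      ∃ x y : Fin n, u * n + v = (x : ℕ) * n + y ∧ D.Adj x y := by
    simp [input]
  rw [this]
  constructor
  · rintro ⟨x, y, h, hadj⟩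
    obtain ⟨h1, h2⟩ := mul_add_inj hv y.2 h
    exact ⟨hu, hv, by convert hadj⟩
  · rintro ⟨_, _, h⟩
    exact ⟨⟨u, hu⟩, ⟨v, hv⟩, rfl, h⟩

end

end RAM

namespace RAM

open SCCDeletion

/-! ### The running time -/

theorem mark_depth : mark.depth = 3 := by simp [mark, LProg.seqs, LProg.depth]

theorem closure_depth : closure.depth = 4 := by
  simp [closure, LProg.seqs, LProg.depth, mark_depth]

theorem flow_depth : flow.depth = 4 := by
  simp [flow, augment, walk, setCap, LProg.seqs, LProg.depth, mark_depth]

theorem searchStep_depth {F : Finset FinDigraph} : (searchStep F).depth ≤ maxOrder F + 4 := by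
  have h1 := copies_depth (F := F)
  have h2 : pick.depth = 1 := by simp [pick, LProg.seqs, LProg.depth]
  have h3 : (pickFromCopy (maxOrder F)).depth ≤ 0 :=
    LProg.depth_seqs_le.2 (by simp [LProg.depth])
  have h4 : act.depth = 1 := by
    simp [act, deleteMove, startMove, shrinkMove, LProg.seqs, LProg.depth]
  simp only [searchStep, prepare, LProg.depth, closure_depth, flow_depth, h2, h4]
  omega

theorem tapeBody_depth {F : Finset FinDigraph} : (tapeBody F).depth ≤ maxOrder F + 5 := by
  have h1 := copies_depth (F := F)
  have h2 := searchStep_depth (F := F)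
  have h3 : (reset (maxOrder F)).depth ≤ 1 :=
    max_le (Nat.succ_le_succ (LProg.depth_seqs_le.2 (by simp [LProg.depth])))
      (LProg.depth_seqs_le.2 (by simp [LProg.depth]))
  have h4 : increment.depth = 1 := by simp [increment, LProg.depth]
  simp only [tapeBody, run, check, loadCmd, initPrefix, LProg.seqs, LProg.depth, closure_depth, h4]
  omega

/-- Register `8` holds the number of tapes, the only loop bound that is not polynomial in `n` and
`k`. It does not bound any loop within the treatment of a single tape. -/
theorem tapeBody_isBound {F : Finset FinDigraph} : ¬ (tapeBody F).IsBound 8 := by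
  have h1 : ¬ mark.IsBound 8 := by simp [mark, LProg.seqs, LProg.IsBound]
  have h2 : ¬ closure.IsBound 8 := by simp [closure, LProg.seqs, LProg.IsBound, h1]
  have h3 : ¬ (copies F).IsBound 8 := fun h => by simpa using copies_isBound h
  have h4 : ¬ flow.IsBound 8 := by
    simp [flow, augment, walk, setCap, LProg.seqs, LProg.IsBound, h1]
  have h5 : ¬ (searchStep F).IsBound 8 := by
    simp [searchStep, prepare, pick, pickFromCopy, act, deleteMove, startMove, shrinkMove,
      LProg.isBound_seqs, LProg.IsBound, h2, h3, h4]
  have h6 : ¬ (reset (maxOrder F)).IsBound 8 := by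
    simp [reset, LProg.isBound_seqs, LProg.IsBound]
  simp [tapeBody, run, check, loadCmd, initPrefix, increment, LProg.seqs, LProg.IsBound, h2, h3,
    h5, h6]

/-- The main loop takes `O(g * m ^ (h + 6))` steps if there are at most `g` tapes and the other loop
bounds are at most `m`. -/
theorem prefixLoop_exec {F : Finset FinDigraph} {s : State} {m g : ℕ} (hm : 1 ≤ m)
    (hs : ∀ b < 10, b ≠ 8 → s.var b ≤ m) (hg : s.var 8 ≤ g) (hg1 : 1 ≤ g) :
    ∃ t ≤ ((tapeBody F).size + 200) * (g * m ^ (maxOrder F + 6)),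
      Exec (LProg.compile (.loop 10 0 (prefixBody F))) s
        ((LProg.loop 10 0 (prefixBody F)).den s) t := by
  have hwf : (LProg.loop 10 0 (prefixBody F)).WF 10 :=
    ⟨le_rfl, by decide, fun h => by have := prefixBody_writesVar h; omega, prefixBody_wf⟩
  obtain ⟨t, ht, hex⟩ := hwf.exec s (β := s.var) fun _ _ => le_rfl
  refine ⟨t, ht.trans ?_, hex⟩
  set d := maxOrder F + 5 with hd
  have hpow : 1 ≤ m ^ d := Nat.pow_pos hm
  have hbody : (tapeBody F).timeBound s.var ≤ (tapeBody F).size * m ^ d :=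
    (LProg.timeBound_le hm fun b hb => hs b (tapeBody_wf.lt_of_isBound hb)
      fun h => tapeBody_isBound (h ▸ hb)).trans
      (Nat.mul_le_mul_left _ (Nat.pow_le_pow_right hm tapeBody_depth))
  have h0 := hs 0 (by decide) (by decide)
  have h7 := hs 7 (by decide) (by decide)
  have hmd : m ≤ m ^ d := by
    calc m = m ^ 1 := (pow_one m).symm
      _ ≤ m ^ d := Nat.pow_le_pow_right hm (by omega)
  have hE : m ^ d ≤ g * m ^ d := Nat.le_mul_of_pos_left _ hg1
  have htapes : s.var 8 * ((tapeBody F).timeBound s.var + 8) ≤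
      ((tapeBody F).size + 8) * (g * m ^ d) := by
    calc s.var 8 * ((tapeBody F).timeBound s.var + 8)
        ≤ g * ((tapeBody F).size * m ^ d + 8 * m ^ d) := Nat.mul_le_mul hg (by omega)
      _ = ((tapeBody F).size + 8) * (g * m ^ d) := by ring
  have hprefix : (prefixBody F).timeBound s.var ≤ ((tapeBody F).size + 180) * (g * m ^ d) := by
    simp only [prefixBody, LProg.seqs, LProg.timeBound, Expr.cost, Expr.eq, Expr.not]
    rw [Nat.add_mul] at htapes ⊢
    omega
  simp only [LProg.timeBound]
  calc s.var 0 * ((prefixBody F).timeBound s.var + 8) + 6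
      ≤ m * (((tapeBody F).size + 180) * (g * m ^ d) + 8 * (g * m ^ d)) +
          6 * (m * (g * m ^ d)) := by
        refine Nat.add_le_add (Nat.mul_le_mul h0 (by omega)) ?_
        have := Nat.mul_le_mul hm (hpow.trans hE)
        omega
    _ = ((tapeBody F).size + 194) * (g * (m ^ d * m)) := by ring
    _ ≤ ((tapeBody F).size + 200) * (g * m ^ (maxOrder F + 6)) := by
        rw [← pow_succ]
        exact Nat.mul_le_mul_right _ (by omega)

/-- The number of tapes is at most a constant times `k ^ (69 * k ^ 3)`. -/
theorem tapes_le (h k : ℕ) : (k + h + 5) ^ ((k + 1) * (2 * k + 6) * (k + 4)) ≤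
    (2 * h + 6) ^ ((h + 2) * (2 * h + 8) * (h + 5)) * k ^ (69 * k ^ 3) := by
  have h1 : 1 ≤ k ^ (69 * k ^ 3) := by
    rcases Nat.eq_zero_or_pos k with rfl | hk
    · simp
    · exact Nat.pow_pos hk
  by_cases hk : k ≤ h + 1
  · calc (k + h + 5) ^ ((k + 1) * (2 * k + 6) * (k + 4))
        ≤ (2 * h + 6) ^ ((h + 2) * (2 * h + 8) * (h + 5)) := by
          refine (Nat.pow_le_pow_left (by omega) _).trans (Nat.pow_le_pow_right (by omega) ?_)
          exact Nat.mul_le_mul (Nat.mul_le_mul (by omega) (by omega)) (by omega)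
      _ ≤ _ := Nat.le_mul_of_pos_right _ h1
  · have hk2 : 2 ≤ k := by omega
    have hbase : k + h + 5 ≤ k ^ 3 := by
      have : 4 * k ≤ k ^ 3 := by
        rw [pow_succ]
        exact Nat.mul_le_mul_right _ (by nlinarith)
      omega
    -- the constant `69` is `3 * 23`, from these two bounds
    have hexp : (k + 1) * (2 * k + 6) * (k + 4) ≤ 23 * k ^ 3 := by
      obtain ⟨j, rfl⟩ := Nat.exists_eq_add_of_le hk2
      ring_nf
      nlinarith [Nat.zero_le j]
    calc (k + h + 5) ^ ((k + 1) * (2 * k + 6) * (k + 4))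
        ≤ (k ^ 3) ^ (23 * k ^ 3) :=
          (Nat.pow_le_pow_left hbase _).trans (Nat.pow_le_pow_right (by positivity) hexp)
      _ = k ^ (69 * k ^ 3) := by
          rw [← pow_mul]
          congr 1
          ring
      _ ≤ _ := Nat.le_mul_of_pos_left _ (by positivity)

/-- For `k < n`, all loop bounds other than the number of tapes are polynomial in `n`; the constant
`33` is `9 + 24`, from `(2 * n + 1) ^ 2 ≤ 9 * n ^ 3` and `(k + 1) * (2 * k + 6) * (k + 4) ≤ 24 * n ^
3`. -/
theorem guard_le {n k h : ℕ} (hk : k + 1 ≤ n) :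
    (2 * n + 1) * (2 * n + 1) + (k + 1) * (2 * k + 6) * (k + 4) + h ≤ (h + 33) * n ^ 3 := by
  have e1 : (2 * n + 1) * (2 * n + 1) ≤ 9 * n ^ 3 := by
    calc (2 * n + 1) * (2 * n + 1) ≤ (3 * n) * (3 * n) := by gcongr <;> omega
      _ = 9 * n ^ 2 := by ring
      _ ≤ 9 * n ^ 3 := Nat.mul_le_mul_left _ (Nat.pow_le_pow_right (by omega) (by omega))
  have e2 : (k + 1) * (2 * k + 6) * (k + 4) ≤ 24 * n ^ 3 := by
    calc (k + 1) * (2 * k + 6) * (k + 4) ≤ n * (6 * n) * (4 * n) := by gcongr <;> omega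
      _ = 24 * n ^ 3 := by ring
  have e3 : h ≤ h * n ^ 3 := Nat.le_mul_of_pos_right _ (Nat.pow_pos (by omega))
  calc _ ≤ 9 * n ^ 3 + 24 * n ^ 3 + h * n ^ 3 := add_le_add (add_le_add e1 e2) e3
    _ = _ := by ring

/-- The sum of the steps of all parts of the program. The exponent of `n` is `3 * (h + 6) ≤ 69 * h`,
with room to spare, so that the constant `69` of `tapes_le` serves both factors. -/
theorem steps_le {A C g g₀ κ n h t₁ t₂ : ℕ} (hh : 1 ≤ h) (hn : 1 ≤ n)
    (hg1 : 1 ≤ g) (ht₁ : t₁ ≤ C * ((h + 33) * n ^ 3) ^ 2)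
    (ht₂ : t₂ ≤ A * (g * ((h + 33) * n ^ 3) ^ (h + 6)))
    (hg : g ≤ g₀ * κ) : 3 + 1 + (t₁ + (t₂ + (3 + 1))) ≤
      (A + C + 10) * g₀ * (h + 33) ^ (h + 6) * κ * max n 1 ^ (69 * h) := by
  have hm1 : 1 ≤ (h + 33) * n ^ 3 := Nat.mul_pos (by omega) (Nat.pow_pos hn)
  have hmn : ((h + 33) * n ^ 3) ^ (h + 6) ≤ (h + 33) ^ (h + 6) * max n 1 ^ (69 * h) := by
    rw [mul_pow, ← pow_mul, max_eq_left hn]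
    exact Nat.mul_le_mul_left _ (Nat.pow_le_pow_right hn (by omega))
  generalize (h + 33) * n ^ 3 = m at *
  have hX : m ^ 2 ≤ g * m ^ (h + 6) := (Nat.pow_le_pow_right hm1 (by omega)).trans
    (Nat.le_mul_of_pos_left _ hg1)
  have hX1 : 1 ≤ g * m ^ (h + 6) := Nat.mul_pos hg1 (Nat.pow_pos hm1)
  calc _ ≤ A * (g * m ^ (h + 6)) + C * (g * m ^ (h + 6)) + 10 * (g * m ^ (h + 6)) := by
        have := ht₁.trans (Nat.mul_le_mul_left C hX)
        linarith
    _ = (A + C + 10) * (g * m ^ (h + 6)) := by ring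
    _ ≤ (A + C + 10) * ((g₀ * κ) * ((h + 33) ^ (h + 6) * max n 1 ^ (69 * h))) := by gcongr
    _ = _ := by ring

/-! ### The algorithm -/

/-- Decides the problem for a nonempty family. -/
noncomputable def decisionProg (F : Finset FinDigraph) : Prog :=
  .ite (.sub (.var 0) (.var 1)) (.seq (setup (maxOrder F))
    (.seq (LProg.compile (.loop 10 0 (prefixBody F)))
      (.assign 0 (.sub (.const 1) (.var 13))))) (.assign 0 (.const 1))

theorem one_le_maxOrder {F : Finset FinDigraph} (hF : ∀ H ∈ F, IsRooted H.2) (hne : F ≠ ∅) :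
    1 ≤ maxOrder F := by
  obtain ⟨H, hH⟩ := Finset.nonempty_iff_ne_empty.2 hne
  obtain ⟨r, -, -⟩ := rootOf_spec (hF H hH)
  exact (Nat.one_le_iff_ne_zero.2 fun h => by have := r.2; omega).trans (le_maxOrder hH)

/-- If the family is empty, or if `n ≤ k`, the answer is yes and is given at once. -/
theorem exists_prog (F : Finset FinDigraph) (hF : ∀ H ∈ F, IsRooted H.2) :
    ∃ (P : Prog) (B : ℕ), ∀ (n : ℕ) (D : Digraph (Fin n)) (k : ℕ), ∃ (s : State) (t : ℕ),
      Exec P (input D k) s t ∧ (IsYes F D k → s.var 0 = 1) ∧ (¬ IsYes F D k → s.var 0 = 0) ∧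
      t ≤ B * k ^ (69 * k ^ 3) * max n 1 ^ (69 * maxOrder F) := by
  have hone : ∀ n k : ℕ, 1 ≤ k ^ (69 * k ^ 3) * max n 1 ^ (69 * maxOrder F) := fun n k => by
    refine Nat.mul_pos ?_ (Nat.pow_pos (by omega))
    rcases Nat.eq_zero_or_pos k with rfl | hk
    · simp
    · exact Nat.pow_pos hk
  have hpos : ∀ B n k : ℕ, B ≤ B * k ^ (69 * k ^ 3) * max n 1 ^ (69 * maxOrder F) :=
    fun B n k => by
      rw [mul_assoc]
      exact Nat.le_mul_of_pos_right _ (hone n k)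
  by_cases hne : F = ∅
  · refine ⟨.assign 0 (.const 1), 2, fun n D k => ⟨_, _, .assign _ _ _, fun _ => ?_, fun h => ?_,
      hpos 2 n k⟩⟩
    · simp [Expr.eval]
    · exact absurd (isYes_of_le hF (.inr hne)) h
  have hh := one_le_maxOrder hF hne
  set h := maxOrder F with hdef
  set C := (setupLinear h).size + 1000 with hC
  set A := (tapeBody F).size + 200 with hA
  set g₀ := (2 * h + 6) ^ ((h + 2) * (2 * h + 8) * (h + 5)) with hg₀
  refine ⟨decisionProg F, (A + C + 10) * g₀ * (h + 33) ^ (h + 6), fun n D k => ?_⟩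
  have hB : 6 ≤ (A + C + 10) * g₀ * (h + 33) ^ (h + 6) := by
    have : 1 ≤ g₀ * (h + 33) ^ (h + 6) := Nat.mul_pos (Nat.pow_pos (by omega))
      (Nat.pow_pos (by omega))
    rw [mul_assoc]
    exact le_trans (by omega) (Nat.mul_le_mul (Nat.le_refl _) this)
  have h0 : (input D k).var 0 = n := rfl
  have h1 : (input D k).var 1 = k := rfl
  by_cases hnk : n ≤ k
  · refine ⟨_, _, .iteFalse ?_ (.assign _ _ _), fun _ => ?_, fun h => ?_,
      le_trans ?_ (hB.trans (hpos _ n k))⟩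
    · simp only [Expr.eval, h0, h1]
      omega
    · simp [Expr.eval]
    · exact absurd (isYes_of_le hF (.inl hnk)) h
    · simp [Expr.cost]
  set m := (h + 33) * n ^ 3 with hm
  have hn : 1 ≤ n := by omega
  have hnk' : k + 1 ≤ n := by omega
  have hmL := guard_le (h := h) hnk'
  rw [← hm] at hmL
  have hm1 : 1 ≤ m := by
    rw [hm]
    exact Nat.mul_pos (by omega) (by positivity)
  obtain ⟨s, t₁, ht₁, ex₁, hs, h9, h13, h16⟩ := setup_exec (h := h) h0 h1 (by simp [input])
    (by simp [input]) (fun u hu v hv => input_adj hu hv) hmL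
  set g := (k + h + 5) ^ ((k + 1) * (2 * k + 6) * (k + 4)) with hg
  have hL4 : k + h + 5 ≤ m := by
    have : 6 * (k + 4) ≤ (k + 1) * (2 * k + 6) * (k + 4) :=
      Nat.mul_le_mul_right _ (by nlinarith)
    omega
  have h79 := hs.seven_le
  obtain ⟨t₂, ht₂, ex₂⟩ := prefixLoop_exec (F := F) (g := g) hm1 (s := s) (by
    have h90 := Nat.le_mul_of_pos_left (2 * n + 1) (show 0 < 2 * n + 1 by omega)
    have hM : (k + 1) * (2 * k + 6) ≤ (k + 1) * (2 * k + 6) * (k + 4) :=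
      Nat.le_mul_of_pos_right _ (by omega)
    intro b hb hb8
    have : b = 0 ∨ b = 1 ∨ b = 2 ∨ b = 3 ∨ b = 4 ∨ b = 5 ∨ b = 6 ∨ b = 7 ∨ b = 9 := by omega
    rcases this with rfl | rfl | rfl | rfl | rfl | rfl | rfl | rfl | rfl
    · rw [hs.var_zero]; omega
    · rw [hs.var_one]; omega
    · rw [hs.var_two]; omega
    · rw [hs.var_three]; omega
    · rw [hs.var_four]; omega
    · rw [hs.var_five]; omega
    · rw [hs.var_six]; omega
    · omega
    · omega) hs.var_eight.le (Nat.pow_pos (by omega))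
  rw [← hdef] at ht₂
  have hspec := prefixLoop_spec hF hs (h13.trans (by simp [input])) (by
    rw [h16]
    funext i
    simp [input])
  rw [← isYes_iff hF] at hspec
  refine ⟨_, _, .iteTrue ?_ (.seq ex₁ (.seq ex₂ (.assign _ _ _))), fun hyes => ?_,
    fun hno => ?_, ?_⟩
  · simp only [Expr.eval, h0, h1]
    omega
  · simp [Expr.eval, hspec.2 hyes]
  · have : ¬ ((LProg.loop 10 0 (prefixBody F)).den s).var 13 = 0 := fun h => hno (hspec.1 h)
    simp only [Expr.eval, State.setVar_var, if_true]
    omega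
  · exact steps_le hh hn (Nat.pow_pos (by omega)) ht₁ ht₂ (tapes_le h k)

/-- For `k = 0` the logarithm is `0` by convention, and both sides are `1`. -/
theorem rpow_mul_logb (c k : ℕ) :
    (2 : ℝ) ^ ((c : ℝ) * (k : ℝ) ^ 3 * Real.logb 2 (k : ℝ)) = (k : ℝ) ^ (c * k ^ 3) := by
  rcases Nat.eq_zero_or_pos k with rfl | hk
  · simp
  · have hk' : (0 : ℝ) < k := by exact_mod_cast hk
    have hc : (c : ℝ) * (k : ℝ) ^ 3 = ((c * k ^ 3 : ℕ) : ℝ) := by push_cast; rfl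
    rw [mul_comm, Real.rpow_mul (by norm_num), Real.rpow_logb (by norm_num) (by norm_num) hk', hc,
      Real.rpow_natCast]

end RAM

theorem theorem1 :
    ∃ c : ℕ, ∀ F : Finset SCCDeletion.FinDigraph, (∀ H ∈ F, SCCDeletion.IsRooted H.2) →
      ∃ (P : RAM.Prog) (B : ℕ), ∀ (n : ℕ) (D : Digraph (Fin n)) (k : ℕ),
        ∃ (s : RAM.State) (t : ℕ), RAM.Exec P (SCCDeletion.input D k) s t ∧
          (SCCDeletion.IsYes F D k → s.var 0 = 1) ∧
          (¬ SCCDeletion.IsYes F D k → s.var 0 = 0) ∧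
          (t : ℝ) ≤ (B : ℝ) * (2 : ℝ) ^ ((c : ℝ) * (k : ℝ) ^ 3 * Real.logb 2 (k : ℝ)) *
            ((max n 1 : ℕ) : ℝ) ^ (c * SCCDeletion.maxOrder F) := by
  refine ⟨69, fun F hF => ?_⟩
  obtain ⟨P, B, h⟩ := RAM.exists_prog F hF
  refine ⟨P, B, fun n D k => ?_⟩
  obtain ⟨s, t, h1, h2, h3, h4⟩ := h n D k
  refine ⟨s, t, h1, h2, h3, ?_⟩
  rw [RAM.rpow_mul_logb]
  exact_mod_cast h4
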